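/- **Proposition (extended $A_\infty$ categories, $A_\infty$ categories and dg categories).** Let $\mathbb K$ be a field of characteristic zero and $\Lambda$ a set. Complexes are $\mathbb Z$-graded complexes of $\mathbb K$-vector spaces with differential of degree $-1$ (no boundedness or finite-dimensionality is assumed). *The category $\mathscr D^+=\mathscr D^+_{open,\Lambda}$.* Its objects are finite sequences $\alpha=((s_0,t_0),\dots,(s_{O-1},t_{O-1}))$ of pairs of elements of $\Lambda$ (open boundaries), with tensor product $\alpha\amalg\beta$ given by concatenation. The complex $\mathscr D^+(\alpha,\beta)$ is the complex of cellular chains, over $\mathbb K$, on the moduli space of disjoint unions of discs, possibly with nodes on the boundary, with marked points on the boundary labelled bijectively by the incoming boundaries $\alpha$ and the outgoing boundaries $\beta$, with exactly one outgoing point on each connected component, and with the free boundaries labelled by $\Lambda$ compatibly with $\alpha$ and $\beta$. Cells correspond to the topological types, i.e. to planar forests: each component is either a disc with at most one incoming point (whose moduli space is a point) or a tree of irreducible discs each of which has $k\ge 2$ incoming special points and contributes dimension $k-2$. The differential is the sum of all degenerations acquiring one more node, with signs. Composition is gluing of outgoing to incoming points: the disc with one incoming and one outgoing point is the identity, and gluing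 on a disc with no incoming point forgets a marked point (the result is $0$ if the irreducible disc containing that point has at least three incoming points). With disjoint union, $\mathscr D^+$ is a dg symmetric monoidal category. *Three categories.* 1. A *unital extended $A_\infty$ category* with set of objects $\Lambda$ is a dg symmetric lax monoidal functor $\Phi$ from $\mathscr D^+$ to complexes, with structure maps $\Phi(\alpha)\otimes\Phi(\beta)\to\Phi(\alpha\amalg\beta)$ and $\mathbb K\to\Phi(\emptyset)$, that is *h-split*: all these structure maps are quasi-isomorphisms. Morphisms are monoidal natural transformations (closed, of degree $0$, and compatible with the unit maps). 2. A *unital $A_\infty$ category* with set of objects $\Lambda$ consists of complexes $\mathrm{Hom}(\lambda,\lambda')$ and operations $m_n:\mathrm{Hom}(\lambda_0,\lambda_1)\otimes\cdots\otimes\mathrm{Hom}(\lambda_{n-1},\lambda_n)\to\mathrm{Hom}(\lambda_0,\lambda_n)$ of degree $n-2$ for $n\ge1$, with $m_1$ the differential and $\sum_{r+s+t=n,\ s\ge1}(-1)^{r+st}m_{r+1+t}(1^{\otimes r}\otimes m_s\otimes1^{\otimes t})=0$ for all $n\ge 1$, and closed elements $1_\lambda\in\mathrm{Hom}_0(\lambda,\lambda)$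 which are two-sided units for $m_2$ and such that $m_n$, $n\ge3$, vanishes whenever one of its arguments is a unit. Morphisms are degree $0$ chain maps $\mathrm{Hom}_A(\lambda,\lambda')\to\mathrm{Hom}_B(\lambda,\lambda')$ commuting strictly with all $m_n$ and preserving units. 3. A *unital dg category* with set of objects $\Lambda$; morphisms are unital dg functors that are the identity on objects. In each case a *quasi-isomorphism* is a morphism all of whose components are quasi-isomorphisms of complexes. A functor is *exact* if it preserves quasi-isomorphisms; two exact functors are *quasi-isomorphic* ($\simeq$) if they are connected by a chain of natural transformations, in either direction, between exact functors, with all components quasi-isomorphisms. A *quasi-equivalence* between $C$ and $D$ is a pair of exact functors $F:C\to D$, $G:D\to C$ with $F\circ G\simeq\mathrm{Id}_D$ and $G\circ F\simeq\mathrm{Id}_C$. *Statement.* The three categories are pairwise quasi-equivalent. Moreover, the functor $I$ that regards a dg category as an $A_\infty$ category with $m_n=0$ for $n\ge3$ is half of a quasi-equivalence: there is an exact functor $R$ from unital $A_\infty$ categories to unital dg categories with $I\circ R\simeq\mathrm{Id}$ and $R\circ I\simeq\mathrm{Id}$. In particular every unital $A_\infty$ category is functorially quasi-isomorphic to a unital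 dg category. -/

import Mathlib

open CategoryTheory TensorProduct

universe u v w

/-! ## Complexes -/

/-- A complex of `K`-vector spaces, homologically graded by `ℤ` (no boundedness or finiteness is
imposed), given by its total space, the splitting of that space into homogeneous parts, and a
square-zero differential of degree `-1`. -/
structure Cx (K : Type u) [Field K] where
  X : Type w
  [addCommGroup : AddCommGroup X]
  [module : Module K X]
  grade : ℤ → Submodule K X
  internal : DirectSum.IsInternal grade
  d : X →ₗ[K] X
  d_mem : ∀ {n : ℤ} {x : X}, x ∈ grade n → d x ∈ grade (n - 1)
  d_d : ∀ x : X, d (d x) = 0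

attribute [instance] Cx.addCommGroup Cx.module

/-- For linear endomorphisms `dM`, `dN` of square zero and a linear map `f` commuting with them:
`f` induces a bijection `ker dM / im dM → ker dN / im dN`. -/
def HomologyBijective {K : Type u} [Field K] {M N : Type*} [AddCommGroup M] [Module K M]
    [AddCommGroup N] [Module K N] (dM : M →ₗ[K] M) (dN : N →ₗ[K] N) (f : M →ₗ[K] N) : Prop :=
  (∀ x, dM x = 0 → (∃ y, dN y = f x) → ∃ z, dM z = x) ∧
    (∀ y, dN y = 0 → ∃ x, dM x = 0 ∧ ∃ z, y = f x + dN z)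

namespace Cx

variable {K : Type u} [Field K]

/-- The total space as a direct sum of its homogeneous parts. -/
noncomputable def decomp (V : Cx.{u, w} K) : (DirectSum ℤ fun n => V.grade n) ≃ₗ[K] V.X :=
  LinearEquiv.ofBijective (DirectSum.coeLinearMap V.grade) V.internal

/-- The parity involution `x ↦ (-1)^|x| x`. -/
noncomputable def sgn (V : Cx.{u, w} K) : V.X →ₗ[K] V.X :=
  (DirectSum.toModule K ℤ V.X fun n => ((n.negOnePow : ℤ) : K) • (V.grade n).subtype) ∘ₗ
    V.decomp.symm.toLinearMap

theorem sgn_of_mem (V : Cx.{u, w} K) {n : ℤ} {x : V.X} (hx : x ∈ V.grade n) :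
    V.sgn x = ((n.negOnePow : ℤ) : K) • x := by
  have h : V.decomp.symm x = DirectSum.lof K ℤ (fun i => V.grade i) n ⟨x, hx⟩ := by
    rw [LinearEquiv.symm_apply_eq]
    exact (DirectSum.coeLinearMap_lof V.grade n ⟨x, hx⟩).symm
  simp [sgn, h]

theorem sgn_sgn (V : Cx.{u, w} K) (x : V.X) : V.sgn (V.sgn x) = x := by
  have hx : x ∈ ⨆ n, V.grade n := by
    rw [V.internal.submodule_iSup_eq_top]; trivial
  induction hx using Submodule.iSup_induction' with
  | mem n x hx =>
    rw [sgn_of_mem V hx, map_smul, sgn_of_mem V hx, smul_smul, ← Int.cast_mul]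
    rcases Int.even_or_odd n with h | h
    · simp [Int.negOnePow_even n h]
    · simp [Int.negOnePow_odd n h]
  | zero => simp
  | add x y _ _ hx hy => simp [hx, hy]

/-- The differential `d ⊗ 1 + (-1)^{|x|} x ⊗ d` of the tensor product of two complexes. -/
noncomputable def tensorD (V W : Cx.{u, w} K) : V.X ⊗[K] W.X →ₗ[K] V.X ⊗[K] W.X :=
  TensorProduct.map V.d LinearMap.id + TensorProduct.map V.sgn W.d

/-- Chain maps of degree `0`. -/
@[ext]
structure Hom (V W : Cx.{u, w} K) where
  f : V.X →ₗ[K] W.X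
  map_mem : ∀ {n : ℤ} {x : V.X}, x ∈ V.grade n → f x ∈ W.grade n
  map_d : ∀ x : V.X, f (V.d x) = W.d (f x)

def Hom.id (V : Cx.{u, w} K) : Hom V V := ⟨LinearMap.id, fun h => h, fun _ => rfl⟩

def Hom.comp {U V W : Cx.{u, w} K} (g : Hom V W) (f : Hom U V) : Hom U W :=
  ⟨g.f ∘ₗ f.f, fun h => g.map_mem (f.map_mem h), fun x => by simp [f.map_d, g.map_d]⟩

/-- Quasi-isomorphisms of complexes. -/
def Hom.IsQuasiIso {V W : Cx.{u, w} K} (f : Hom V W) : Prop := HomologyBijective V.d W.d f.f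

theorem Hom.map_sgn {V W : Cx.{u, w} K} (f : Hom V W) (x : V.X) :
    f.f (V.sgn x) = W.sgn (f.f x) := by
  have hx : x ∈ ⨆ n, V.grade n := by
    rw [V.internal.submodule_iSup_eq_top]; trivial
  induction hx using Submodule.iSup_induction' with
  | mem n x hx => rw [sgn_of_mem V hx, sgn_of_mem W (f.map_mem hx), map_smul]
  | zero => simp
  | add x y _ _ hx hy => simp [hx, hy]

end Cx

/-! ## Unital dg categories with object set `Λ` -/

/-- A unital dg category with set of objects `Λ`; `mul x y` is the composite of
`x : a ⟶ b` and `y : b ⟶ c`. -/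
structure DGCat (K : Type u) [Field K] (Λ : Type v) where
  Hom : Λ → Λ → Cx.{u, w} K
  mul : ∀ {a b c : Λ}, (Hom a b).X →ₗ[K] (Hom b c).X →ₗ[K] (Hom a c).X
  mul_mem : ∀ {a b c : Λ} {p q : ℤ} {x : (Hom a b).X} {y : (Hom b c).X},
    x ∈ (Hom a b).grade p → y ∈ (Hom b c).grade q → mul x y ∈ (Hom a c).grade (p + q)
  d_mul : ∀ {a b c : Λ} (x : (Hom a b).X) (y : (Hom b c).X),
    (Hom a c).d (mul x y) = mul ((Hom a b).d x) y + mul ((Hom a b).sgn x) ((Hom b c).d y)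
  mul_assoc : ∀ {a b c e : Λ} (x : (Hom a b).X) (y : (Hom b c).X) (z : (Hom c e).X),
    mul (mul x y) z = mul x (mul y z)
  one : ∀ a : Λ, (Hom a a).X
  one_mem : ∀ a : Λ, one a ∈ (Hom a a).grade 0
  d_one : ∀ a : Λ, (Hom a a).d (one a) = 0
  one_mul : ∀ {a b : Λ} (x : (Hom a b).X), mul (one a) x = x
  mul_one : ∀ {a b : Λ} (x : (Hom a b).X), mul x (one b) = x

namespace DGCat

variable {K : Type u} [Field K] {Λ : Type v}

/-- Unital dg functors that are the identity on objects. -/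
@[ext]
structure Mor (A B : DGCat.{u, v, w} K Λ) where
  φ : ∀ a b : Λ, Cx.Hom (A.Hom a b) (B.Hom a b)
  map_mul : ∀ {a b c : Λ} (x : (A.Hom a b).X) (y : (A.Hom b c).X),
    (φ a c).f (A.mul x y) = B.mul ((φ a b).f x) ((φ b c).f y)
  map_one : ∀ a : Λ, (φ a a).f (A.one a) = B.one a

instance : Category (DGCat.{u, v, w} K Λ) where
  Hom := Mor
  id A := ⟨fun a b => Cx.Hom.id (A.Hom a b), fun _ _ => rfl, fun _ => rfl⟩
  comp F G := ⟨fun a b => (G.φ a b).comp (F.φ a b),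
    fun x y => by simp [Cx.Hom.comp, F.map_mul, G.map_mul],
    fun a => by simp [Cx.Hom.comp, F.map_one, G.map_one]⟩

/-- Morphisms that are quasi-isomorphisms on all morphism complexes. -/
def quasiIso (K : Type u) [Field K] (Λ : Type v) : MorphismProperty (DGCat.{u, v, w} K Λ) :=
  fun _ _ (F : Mor _ _) => ∀ a b, (F.φ a b).IsQuasiIso

end DGCat

/-! ## Unital A-infinity categories with object set `Λ` -/

/-- Finite composable sequences `x₁, …, xₙ` with `xᵢ ∈ H(aᵢ₋₁, aᵢ)`, from `a₀` to `aₙ`. -/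
inductive Chain {Λ : Type v} (H : Λ → Λ → Type w) : Λ → Λ → Type (max v w)
  | nil (a : Λ) : Chain H a a
  | cons {a b c : Λ} (x : H a b) (l : Chain H b c) : Chain H a c

namespace Chain

variable {Λ : Type v} {H H' : Λ → Λ → Type w}

def length {a b : Λ} : Chain H a b → ℕ
  | nil _ => 0
  | cons _ l => l.length + 1

def append {a b c : Λ} : Chain H a b → Chain H b c → Chain H a c
  | nil _, m => m
  | cons x l, m => cons x (l.append m)

def map (f : ∀ a b, H a b → H' a b) {a b : Λ} : Chain H a b → Chain H' a b
  | nil a => nil a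
  | cons x l => cons (f _ _ x) (l.map f)

/-- All ways of writing a sequence as a concatenation of two (possibly empty) sequences. -/
def splits {a b : Λ} : Chain H a b → List (Σ e : Λ, Chain H a e × Chain H e b)
  | nil a => [⟨a, nil a, nil a⟩]
  | @cons _ _ a _ _ x l =>
      ⟨a, nil a, cons x l⟩ :: l.splits.map fun s => ⟨s.1, cons x s.2.1, s.2.2⟩

theorem length_append {a b c : Λ} (l : Chain H a b) (m : Chain H b c) :
    (l.append m).length = l.length + m.length := by
  induction l with
  | nil => simp [append, length]
  | cons x l ih => simp [append, length, ih]; omega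

theorem length_map (f : ∀ a b, H a b → H' a b) {a b : Λ} (l : Chain H a b) :
    (l.map f).length = l.length := by
  induction l with
  | nil => rfl
  | cons x l ih => simp [map, length, ih]

theorem length_of_mem_splits {a b : Λ} (l : Chain H a b) :
    ∀ s ∈ l.splits, s.2.1.length + s.2.2.length = l.length := by
  induction l with
  | nil => simp [splits, length]
  | cons x l ih =>
    intro s hs
    simp only [splits, List.mem_cons, List.mem_map] at hs
    rcases hs with rfl | ⟨t, ht, rfl⟩
    · simp [length]
    · have := ih t ht
      simp [length]; omega

/-- All entries are homogeneous, and their degrees add up to `n`. -/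
def Homogeneous {K : Type u} [Field K] {M : Λ → Λ → Cx.{u, w} K} {a b : Λ} :
    Chain (fun a b => (M a b).X) a b → ℤ → Prop
  | nil _, n => n = 0
  | @cons _ _ a b _ x l, n => ∃ p q : ℤ, x ∈ (M a b).grade p ∧ l.Homogeneous q ∧ n = p + q

end Chain

/-- The left hand side of the `n`-th A-infinity relation on `c = (x₁, …, xₙ)`:
`∑ (-1)^{r+st} m_{r+1+t} (1^{⊗r} ⊗ m_s ⊗ 1^{⊗t})`, the sum over all `r + s + t = n` with `s ≥ 1`.
By the Koszul rule the summand takes `c = p ++ q ++ t` (of lengths `r`, `s`, `t`) to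
`(-1)^{r+st} (-1)^{s (|x₁| + ⋯ + |x_r|)} m (p, m q, t)`. -/
noncomputable def stasheffSum {K : Type u} [Field K] {Λ : Type v} (M : Λ → Λ → Cx.{u, w} K)
    (m : ∀ {a b : Λ}, Chain (fun a b => (M a b).X) a b → (M a b).X)
    {a b : Λ} (c : Chain (fun a b => (M a b).X) a b) : (M a b).X :=
  (c.splits.map fun s => (s.2.2.splits.map fun s' =>
    if s'.2.1.length = 0 then 0 else
      (-1 : K) ^ (s.2.1.length + s'.2.1.length * s'.2.2.length) •
        m ((s.2.1.map fun a b x => ((M a b).sgn ^ s'.2.1.length) x).append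
          (.cons (m s'.2.1) s'.2.2))).sum).sum

/-- A unital A-infinity category with set of objects `Λ`. The operation `mₙ` is `m` on sequences
of length `n`; it is multilinear of degree `n - 2`, and `m₁` is the differential. -/
structure AInfCat (K : Type u) [Field K] (Λ : Type v) where
  Hom : Λ → Λ → Cx.{u, w} K
  m : ∀ {a b : Λ}, Chain (fun a b => (Hom a b).X) a b → (Hom a b).X
  m_nil : ∀ a : Λ, m (.nil a) = 0
  m_single : ∀ {a b : Λ} (x : (Hom a b).X), m (.cons x (.nil b)) = (Hom a b).d x
  m_add : ∀ {a b c e : Λ} (l : Chain (fun a b => (Hom a b).X) a b) (x y : (Hom b c).X)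
    (l' : Chain (fun a b => (Hom a b).X) c e),
    m (l.append (.cons (x + y) l')) = m (l.append (.cons x l')) + m (l.append (.cons y l'))
  m_smul : ∀ {a b c e : Λ} (l : Chain (fun a b => (Hom a b).X) a b) (k : K) (x : (Hom b c).X)
    (l' : Chain (fun a b => (Hom a b).X) c e),
    m (l.append (.cons (k • x) l')) = k • m (l.append (.cons x l'))
  m_mem : ∀ {a b : Λ} (l : Chain (fun a b => (Hom a b).X) a b) (n : ℤ),
    l.Homogeneous n → m l ∈ (Hom a b).grade (n + l.length - 2)
  stasheff : ∀ {a b : Λ} (l : Chain (fun a b => (Hom a b).X) a b), stasheffSum Hom m l = 0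
  one : ∀ a : Λ, (Hom a a).X
  one_mem : ∀ a : Λ, one a ∈ (Hom a a).grade 0
  d_one : ∀ a : Λ, (Hom a a).d (one a) = 0
  one_mul : ∀ {a b : Λ} (x : (Hom a b).X), m (.cons (one a) (.cons x (.nil b))) = x
  mul_one : ∀ {a b : Λ} (x : (Hom a b).X), m (.cons x (.cons (one b) (.nil b))) = x
  m_one : ∀ {a b c : Λ} (l : Chain (fun a b => (Hom a b).X) a b)
    (l' : Chain (fun a b => (Hom a b).X) b c),
    3 ≤ (l.append (.cons (one b) l')).length → m (l.append (.cons (one b) l')) = 0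

namespace AInfCat

variable {K : Type u} [Field K] {Λ : Type v}

/-- Morphisms of A-infinity categories with object set `Λ`: maps of morphism complexes that
commute strictly with all operations and preserve units. -/
@[ext]
structure Mor (A B : AInfCat.{u, v, w} K Λ) where
  φ : ∀ a b : Λ, Cx.Hom (A.Hom a b) (B.Hom a b)
  map_m : ∀ {a b : Λ} (l : Chain (fun a b => (A.Hom a b).X) a b),
    (φ a b).f (A.m l) = B.m (l.map fun a b => (φ a b).f)
  map_one : ∀ a : Λ, (φ a a).f (A.one a) = B.one a

theorem chain_map_id {H : Λ → Λ → Type w} {a b : Λ} (l : Chain H a b) :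
    l.map (fun _ _ x => x) = l := by
  induction l with
  | nil => rfl
  | cons x l ih => simp [Chain.map, ih]

theorem chain_map_map {H H' H'' : Λ → Λ → Type w} (f : ∀ a b, H a b → H' a b)
    (g : ∀ a b, H' a b → H'' a b) {a b : Λ} (l : Chain H a b) :
    (l.map f).map g = l.map (fun a b x => g a b (f a b x)) := by
  induction l with
  | nil => rfl
  | cons x l ih => simp [Chain.map, ih]

instance : Category (AInfCat.{u, v, w} K Λ) where
  Hom := Mor
  id A := ⟨fun a b => Cx.Hom.id (A.Hom a b), fun l => (congrArg A.m (chain_map_id l)).symm,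
    fun _ => rfl⟩
  comp F G := ⟨fun a b => (G.φ a b).comp (F.φ a b),
    fun l => (congrArg _ (F.map_m l)).trans ((G.map_m _).trans (congrArg _ (chain_map_map _ _ l))),
    fun a => by simp [Cx.Hom.comp, F.map_one, G.map_one]⟩

/-- Morphisms that are quasi-isomorphisms on all morphism complexes. -/
def quasiIso (K : Type u) [Field K] (Λ : Type v) : MorphismProperty (AInfCat.{u, v, w} K Λ) :=
  fun _ _ (F : Mor _ _) => ∀ a b, (F.φ a b).IsQuasiIso

end AInfCat

/-! ## dg categories as A-infinity categories -/

namespace DGCat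

variable {K : Type u} [Field K] {Λ : Type v}

/-- `m₁ = d`, `m₂` is the composition, and `mₙ = 0` for `n ≥ 3`. -/
def op (A : DGCat.{u, v, w} K Λ) {a b : Λ} :
    Chain (fun a b => (A.Hom a b).X) a b → (A.Hom a b).X
  | .nil _ => 0
  | .cons x (.nil _) => (A.Hom _ _).d x
  | .cons x (.cons y (.nil _)) => A.mul x y
  | .cons _ (.cons _ (.cons _ _)) => 0

theorem op_long (A : DGCat.{u, v, w} K Λ) {a b : Λ}
    (l : Chain (fun a b => (A.Hom a b).X) a b) (h : 3 ≤ l.length) : A.op l = 0 := by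
  match l, h with
  | .cons _ (.cons _ (.cons _ _)), _ => rfl
  | .nil _, h => simp [Chain.length] at h
  | .cons _ (.nil _), h => simp [Chain.length] at h
  | .cons _ (.cons _ (.nil _)), h => simp [Chain.length] at h

theorem op_add (A : DGCat.{u, v, w} K Λ) {a b c e : Λ}
    (l : Chain (fun a b => (A.Hom a b).X) a b) (x y : (A.Hom b c).X)
    (l' : Chain (fun a b => (A.Hom a b).X) c e) :
    A.op (l.append (.cons (x + y) l')) =
      A.op (l.append (.cons x l')) + A.op (l.append (.cons y l')) := by
  cases l with
  | nil =>
    cases l' with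
    | nil => simp [Chain.append, op]
    | cons y l' => cases l' <;> simp [Chain.append, op]
  | cons z l =>
    cases l with
    | nil => cases l' <;> simp [Chain.append, op]
    | cons t l =>
      rw [op_long, op_long, op_long, add_zero] <;>
        simp [Chain.append, Chain.length, Chain.length_append] <;> omega

theorem op_smul (A : DGCat.{u, v, w} K Λ) {a b c e : Λ}
    (l : Chain (fun a b => (A.Hom a b).X) a b) (k : K) (x : (A.Hom b c).X)
    (l' : Chain (fun a b => (A.Hom a b).X) c e) :
    A.op (l.append (.cons (k • x) l')) = k • A.op (l.append (.cons x l')) := by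
  cases l with
  | nil =>
    cases l' with
    | nil => simp [Chain.append, op]
    | cons y l' => cases l' <;> simp [Chain.append, op]
  | cons z l =>
    cases l with
    | nil => cases l' <;> simp [Chain.append, op]
    | cons t l =>
      rw [op_long, op_long, smul_zero] <;>
        simp [Chain.append, Chain.length, Chain.length_append] <;> omega

theorem op_zero (A : DGCat.{u, v, w} K Λ) {a b c e : Λ}
    (l : Chain (fun a b => (A.Hom a b).X) a b)
    (l' : Chain (fun a b => (A.Hom a b).X) c e) :
    A.op (l.append (.cons (0 : (A.Hom b c).X) l')) = 0 := by
  have := A.op_smul l (0 : K) (0 : (A.Hom b c).X) l'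
  simpa using this

theorem op_mem (A : DGCat.{u, v, w} K Λ) {a b : Λ}
    (l : Chain (fun a b => (A.Hom a b).X) a b) (n : ℤ) (h : l.Homogeneous n) :
    A.op l ∈ (A.Hom a b).grade (n + l.length - 2) := by
  match l, h with
  | .nil _, _ => exact Submodule.zero_mem _
  | .cons x (.nil _), h =>
    obtain ⟨p, q, hx, hq, rfl⟩ := h
    have hq : q = 0 := hq
    subst hq
    have := (A.Hom _ _).d_mem hx
    have e : p + 0 + ((Chain.cons x (Chain.nil _) :
      Chain (fun a b => (A.Hom a b).X) _ _).length : ℤ) - 2 = p - 1 := by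
      simp [Chain.length]; ring
    rw [e]; exact this
  | .cons x (.cons y (.nil _)), h =>
    obtain ⟨p, q, hx, ⟨p', q', hy, hq, rfl⟩, rfl⟩ := h
    have hq : q' = 0 := hq
    subst hq
    have := A.mul_mem hx hy
    have e : p + (p' + 0) + ((Chain.cons x (Chain.cons y (Chain.nil _)) :
      Chain (fun a b => (A.Hom a b).X) _ _).length : ℤ) - 2 = p + p' := by
      simp [Chain.length]
    rw [e]; exact this
  | .cons _ (.cons _ (.cons _ _)), _ => exact Submodule.zero_mem _

theorem op_stasheff (A : DGCat.{u, v, w} K Λ) {a b : Λ}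
    (l : Chain (fun a b => (A.Hom a b).X) a b) : stasheffSum A.Hom A.op l = 0 := by
  unfold stasheffSum
  by_cases hl : 4 ≤ l.length
  · apply List.sum_eq_zero
    intro y hy
    obtain ⟨s, hs, rfl⟩ := List.mem_map.1 hy
    apply List.sum_eq_zero
    intro y hy
    obtain ⟨s', hs', rfl⟩ := List.mem_map.1 hy
    have h1 := Chain.length_of_mem_splits _ s hs
    have h2 := Chain.length_of_mem_splits _ s' hs'
    dsimp only
    split_ifs with h0
    · rfl
    · by_cases h3 : 3 ≤ s'.2.1.length
      · rw [A.op_long s'.2.1 h3, op_zero, smul_zero]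
      · rw [A.op_long (Chain.append _ _), smul_zero]
        simp only [Chain.length_append, Chain.length, Chain.length_map]
        omega
  · match l, hl with
    | .nil _, _ => simp [Chain.splits, Chain.length]
    | .cons x (.nil _), _ =>
      simp [Chain.splits, Chain.length, Chain.append, Chain.map, op, Cx.d_d]
    | .cons x (.cons y (.nil _)), _ =>
      simp [Chain.splits, Chain.length, Chain.append, Chain.map, op, A.d_mul]
    | .cons x (.cons y (.cons z (.nil _))), _ =>
      simp [Chain.splits, Chain.length, Chain.append, Chain.map, op, A.mul_assoc,
        pow_two, Cx.sgn_sgn]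
    | .cons x (.cons y (.cons z (.cons t l))), hl =>
      exact absurd (by simp [Chain.length]) hl

/-- A dg category, regarded as an A-infinity category. -/
def toAInfCat (A : DGCat.{u, v, w} K Λ) : AInfCat.{u, v, w} K Λ where
  Hom := A.Hom
  m := A.op
  m_nil _ := rfl
  m_single _ := rfl
  m_add := A.op_add
  m_smul := A.op_smul
  m_mem := A.op_mem
  stasheff := A.op_stasheff
  one := A.one
  one_mem := A.one_mem
  d_one := A.d_one
  one_mul := A.one_mul
  mul_one := A.mul_one
  m_one _ _ h := A.op_long _ h

theorem map_op {A B : DGCat.{u, v, w} K Λ} (F : Mor A B) {a b : Λ}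
    (l : Chain (fun a b => (A.Hom a b).X) a b) :
    (F.φ a b).f (A.op l) = B.op (l.map fun a b => (F.φ a b).f) := by
  match l with
  | .nil _ => simp [op, Chain.map]
  | .cons x (.nil _) => exact (F.φ _ _).map_d x
  | .cons x (.cons y (.nil _)) => exact F.map_mul x y
  | .cons _ (.cons _ (.cons _ _)) => simp [op, Chain.map]

/-- The inclusion of dg categories into A-infinity categories. -/
def inclusion (K : Type u) [Field K] (Λ : Type v) :
    DGCat.{u, v, w} K Λ ⥤ AInfCat.{u, v, w} K Λ where
  obj A := A.toAInfCat
  map F := (⟨F.φ, map_op F, F.map_one⟩ : AInfCat.Mor _ _)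

end DGCat

/-! ## Nodal discs with marked points, and the cells of their moduli

A (possibly nodal) disc with `k` incoming marked points and one outgoing marked point on its
boundary is described by the planar rooted tree of its components; a disjoint union of such discs,
ordered by their outgoing points, by a planar forest. -/

/-- Planar forests with labelled leaves. `leaf i r` is the forest whose first tree is the single
leaf `i`, followed by `r`; `node c r` is the forest whose first tree is a root vertex carrying the
forest `c` of its branches, followed by `r`.

A vertex is an irreducible disc: its branches are its incoming special points, in the cyclic order
that starts behind the outgoing one. Leaves are incoming marked points, and edges between two
vertices are nodes. A tree that is a single leaf is the disc with one incoming and one outgoing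
point (the identity), and the vertex without branches is the disc whose only marked point is
outgoing. -/
inductive Forest : Type
  | nil : Forest
  | leaf (i : ℕ) (r : Forest) : Forest
  | node (c r : Forest) : Forest

namespace Forest

/-- Juxtaposition. -/
def append : Forest → Forest → Forest
  | nil, G => G
  | leaf i r, G => leaf i (r.append G)
  | node c r, G => node c (r.append G)

/-- The number of trees. -/
def width : Forest → ℕ
  | nil => 0
  | leaf _ r => r.width + 1
  | node _ r => r.width + 1

/-- The labels of the leaves, from left to right. -/
def leaves : Forest → List ℕ
  | nil => []
  | leaf i r => i :: r.leaves
  | node c r => c.leaves ++ r.leaves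

/-- The list of trees of a forest. -/
def roots : Forest → List Forest
  | nil => []
  | leaf i r => leaf i nil :: r.roots
  | node c r => node c nil :: r.roots

/-- For each tree the labels of its leaves, from left to right. -/
def legs (F : Forest) : List (List ℕ) := F.roots.map leaves

/-- The `j`-th tree. -/
def tree (F : Forest) (j : ℕ) : Forest := F.roots.getD j nil

/-- The dimension of the cell: the moduli space of irreducible discs with `k ≥ 2` incoming points
and one outgoing point is an open cell of dimension `k - 2`; for `k ≤ 1` it is a point. -/
def deg : Forest → ℕ
  | nil => 0
  | leaf _ r => r.deg
  | node c r => (c.width - 2) + c.deg + r.deg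

def relabel (f : ℕ → ℕ) : Forest → Forest
  | nil => nil
  | leaf i r => leaf (f i) (r.relabel f)
  | node c r => node (c.relabel f) (r.relabel f)

/-- A forest of single leaves. -/
def ofLabels : List ℕ → Forest
  | [] => nil
  | i :: l => leaf i (ofLabels l)

/-- All vertices are stable: they have at least two branches. -/
def Reduced : Forest → Prop
  | nil => True
  | leaf _ r => r.Reduced
  | node c r => 2 ≤ c.width ∧ c.Reduced ∧ r.Reduced

/-- Each tree is either the vertex without branches, or has only stable vertices. -/
def Stable : Forest → Prop
  | nil => True
  | leaf _ r => r.Stable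
  | node c r => (c = nil ∨ (2 ≤ c.width ∧ c.Reduced)) ∧ r.Stable

/-! ### The boundary -/

/-- All ways of writing a forest as a juxtaposition of two (possibly empty) forests. -/
def splits : Forest → List (Forest × Forest)
  | nil => [(nil, nil)]
  | leaf i r => (nil, leaf i r) :: r.splits.map fun s => (leaf i s.1, s.2)
  | node c r => (nil, node c r) :: r.splits.map fun s => (node c s.1, s.2)

/-- The degenerations of an irreducible disc with branches `c` into two discs that meet in a node:
for each decomposition `c = p ++ q ++ t` into `r + s + t` trees with `2 ≤ s < width c`, the branches
`q` move to a new disc. The sign exponent is that of `- (-1)^{r+st} m_{r+1+t} (1^r ⊗ m_s ⊗ 1^t)`,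
followed by moving `m_s` past the branches `p`. -/
def expand (c : Forest) : List (ℕ × Forest) :=
  c.splits.flatMap fun x => x.2.splits.filterMap fun y =>
    if 2 ≤ y.1.width ∧ y.1.width < c.width then
      some (1 + x.1.width + y.1.width * y.2.width + y.1.width * x.1.deg,
        x.1.append (node y.1 y.2))
    else none

/-- The cellular boundary: all ways of degenerating one of the vertices, with sign exponents; the
cells are oriented by the order of their vertices in which each vertex precedes its branches and
branches are traversed from left to right. -/
def bdry : Forest → List (ℕ × Forest)
  | nil => []
  | leaf i r => r.bdry.map fun t => (t.1, leaf i t.2)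
  | node c r =>
      c.expand.map (fun t => (t.1, node t.2 r)) ++
      c.bdry.map (fun t => (c.width + t.1, node t.2 r)) ++
      r.bdry.map (fun t => (c.width + c.deg + t.1, node c t.2))

/-! ### Gluing -/

/-- Some tree is the vertex without branches. -/
def HasUnit : Forest → Prop
  | nil => False
  | leaf _ r => r.HasUnit
  | node c r => c = nil ∨ r.HasUnit

open Classical in
/-- A new vertex with branches `c`. If discs without incoming points are glued to it, then the
points at which they are glued are forgotten: a disc with two incoming points becomes an identity,
and a disc with at least three incoming points has an image of smaller dimension, so that the
resulting chain vanishes (`none`). -/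
noncomputable def join (c : Forest) : Option Forest :=
  if c.HasUnit then
    match c with
    | node nil (leaf i nil) => some (leaf i nil)
    | node nil (node e nil) => some (node e nil)
    | leaf i (node nil nil) => some (leaf i nil)
    | node e (node nil nil) => some (node e nil)
    | _ => none
  else some (node c nil)

/-- Glue the tree `S j` at the leaf `j`, for all leaves. -/
noncomputable def subst (S : ℕ → Forest) : Forest → Option Forest
  | nil => some nil
  | leaf j r => (r.subst S).map (S j).append
  | node c r => (c.subst S).bind fun c' => c'.join.bind fun n => (r.subst S).map n.append

/-- The sign exponent for moving, for each leaf `j`, an element of degree `δ j` from behind all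
vertices to its position `j`. -/
def shuffle (δ : ℕ → ℕ) : Forest → ℕ
  | nil => 0
  | leaf j r => δ j * r.deg + r.shuffle δ
  | node c r => (c.leaves.map δ).sum * r.deg + c.shuffle δ + r.shuffle δ

/-- The sign exponent for moving elements of degree `δ j` from their natural order into the order
given by a list. -/
def invSign (δ : ℕ → ℕ) : List ℕ → ℕ
  | [] => 0
  | j :: l => δ j * ((l.filter (· < j)).map δ).sum + invSign δ l

/-- The Koszul sign exponent for gluing the trees of `F` to the leaves of `G`: the vertices of `G`,
followed by those of `F`, are brought into the order of the vertices of the result. -/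
def gluingSign (G F : Forest) : ℕ :=
  G.shuffle (fun j => (F.tree j).deg) + invSign (fun j => (F.tree j).deg) G.leaves

/-! ### Bookkeeping -/

@[simp] theorem legs_nil : nil.legs = [] := rfl

@[simp] theorem legs_leaf (i : ℕ) (r : Forest) : (leaf i r).legs = [i] :: r.legs := by
  simp [legs, roots, leaves]

@[simp] theorem legs_node (c r : Forest) : (node c r).legs = c.leaves :: r.legs := by
  simp [legs, roots, leaves]

theorem flatten_legs (F : Forest) : F.legs.flatten = F.leaves := by
  induction F with
  | nil => rfl
  | leaf i r ih => simp [ih, leaves]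
  | node c r _ ih => simp [ih, leaves]

theorem length_legs (F : Forest) : F.legs.length = F.width := by
  induction F with
  | nil => rfl
  | leaf i r ih => simp [ih, width]
  | node c r _ ih => simp [ih, width]

theorem legs_append (F G : Forest) : (F.append G).legs = F.legs ++ G.legs := by
  induction F with
  | nil => rfl
  | leaf i r ih => simp [append, ih]
  | node c r _ ih => simp [append, ih]

theorem leaves_append (F G : Forest) : (F.append G).leaves = F.leaves ++ G.leaves := by
  rw [← flatten_legs, legs_append, List.flatten_append, flatten_legs, flatten_legs]

theorem width_append (F G : Forest) : (F.append G).width = F.width + G.width := by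
  rw [← length_legs, legs_append, List.length_append, length_legs, length_legs]

theorem leaves_relabel (f : ℕ → ℕ) (F : Forest) : (F.relabel f).leaves = F.leaves.map f := by
  induction F with
  | nil => rfl
  | leaf i r ih => simp [relabel, leaves, ih]
  | node c r ih1 ih2 => simp [relabel, leaves, ih1, ih2]

theorem legs_relabel (f : ℕ → ℕ) (F : Forest) :
    (F.relabel f).legs = F.legs.map (List.map f) := by
  induction F with
  | nil => rfl
  | leaf i r ih => simp [relabel, ih]
  | node c r _ ih => simp [relabel, ih, leaves_relabel]

theorem legs_ofLabels (l : List ℕ) : (ofLabels l).legs = l.map fun i => [i] := by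
  induction l with
  | nil => rfl
  | cons i l ih => simp [ofLabels, ih]

theorem leaves_ofLabels (l : List ℕ) : (ofLabels l).leaves = l := by
  induction l with
  | nil => rfl
  | cons i l ih => simp [ofLabels, leaves, ih]

theorem stable_ofLabels (l : List ℕ) : (ofLabels l).Stable := by
  induction l with
  | nil => trivial
  | cons i l ih => exact ih

theorem Stable.append {F G : Forest} (hF : F.Stable) (hG : G.Stable) : (F.append G).Stable := by
  induction F with
  | nil => exact hG
  | leaf i r ih => exact ih hF
  | node c r _ ih => exact ⟨hF.1, ih hF.2⟩

theorem Reduced.append {F G : Forest} (hF : F.Reduced) (hG : G.Reduced) :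
    (F.append G).Reduced := by
  induction F with
  | nil => exact hG
  | leaf i r ih => exact ih hF
  | node c r _ ih => exact ⟨hF.1, hF.2.1, ih hF.2.2⟩

theorem width_relabel (f : ℕ → ℕ) (F : Forest) : (F.relabel f).width = F.width := by
  rw [← length_legs, legs_relabel, List.length_map, length_legs]

theorem Reduced.relabel {F : Forest} (f : ℕ → ℕ) (h : F.Reduced) : (F.relabel f).Reduced := by
  induction F with
  | nil => trivial
  | leaf i r ih => exact ih h
  | node c r ih1 ih2 => exact ⟨by rw [width_relabel]; exact h.1, ih1 h.2.1, ih2 h.2.2⟩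

theorem Stable.relabel {F : Forest} (f : ℕ → ℕ) (h : F.Stable) : (F.relabel f).Stable := by
  induction F with
  | nil => trivial
  | leaf i r ih => exact ih h
  | node c r _ ih =>
    refine ⟨?_, ih h.2⟩
    rcases h.1 with rfl | ⟨h1, h2⟩
    · exact Or.inl rfl
    · exact Or.inr ⟨by rw [width_relabel]; exact h1, h2.relabel f⟩

theorem splits_spec (F : Forest) : ∀ s ∈ F.splits, s.1.append s.2 = F := by
  induction F with
  | nil => simp [splits, append]
  | leaf i r ih =>
    intro s hs
    simp only [splits, List.mem_cons, List.mem_map] at hs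
    rcases hs with rfl | ⟨t, ht, rfl⟩
    · rfl
    · simp [append, ih t ht]
  | node c r _ ih =>
    intro s hs
    simp only [splits, List.mem_cons, List.mem_map] at hs
    rcases hs with rfl | ⟨t, ht, rfl⟩
    · rfl
    · simp [append, ih t ht]

theorem reduced_append_iff (F G : Forest) : (F.append G).Reduced ↔ F.Reduced ∧ G.Reduced := by
  induction F with
  | nil => simp [append, Reduced]
  | leaf i r ih => simpa [append, Reduced] using ih
  | node c r _ ih => simp [append, Reduced, ih, and_assoc]

theorem expand_spec (c : Forest) (t : ℕ × Forest) (ht : t ∈ c.expand) :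
    t.2.leaves = c.leaves ∧ 2 ≤ t.2.width ∧ (c.Reduced → t.2.Reduced) := by
  simp only [expand, List.mem_flatMap, List.mem_filterMap] at ht
  obtain ⟨x, hx, y, hy, h⟩ := ht
  split_ifs at h with hw
  obtain rfl := Option.some.inj h
  have h1 := splits_spec _ x hx
  have h2 := splits_spec _ y hy
  have hc : c = x.1.append (y.1.append y.2) := by rw [h2, h1]
  have hwid : c.width = x.1.width + (y.1.width + y.2.width) := by
    rw [hc, width_append, width_append]
  refine ⟨?_, ?_, ?_⟩
  · rw [hc]; simp [leaves_append, leaves]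
  · simp only [width_append, width]; omega
  · intro hr
    rw [hc, reduced_append_iff, reduced_append_iff] at hr
    exact hr.1.append ⟨hw.1, hr.2.1, hr.2.2⟩

theorem bdry_spec (F : Forest) : ∀ t ∈ F.bdry, t.2.legs = F.legs ∧
    (F.Reduced → t.2.Reduced) ∧ (F.Stable → t.2.Stable) := by
  induction F with
  | nil => simp [bdry]
  | leaf i r ih =>
    intro t ht
    simp only [bdry, List.mem_map] at ht
    obtain ⟨s, hs, rfl⟩ := ht
    obtain ⟨h1, h2, h3⟩ := ih s hs
    exact ⟨by simp [h1], h2, h3⟩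
  | node c r ihc ih =>
    intro t ht
    simp only [bdry, List.mem_append, List.mem_map] at ht
    rcases ht with (⟨s, hs, rfl⟩ | ⟨s, hs, rfl⟩) | ⟨s, hs, rfl⟩
    · obtain ⟨h1, h2, h3⟩ := expand_spec c s hs
      refine ⟨by simp [h1], fun h => ⟨h2, h3 h.2.1, h.2.2⟩, fun h => ⟨Or.inr ⟨h2, ?_⟩, h.2⟩⟩
      rcases h.1 with rfl | h'
      · simp [expand, splits, width] at hs
      · exact h3 h'.2
    · obtain ⟨h1, h2, h3⟩ := ihc s hs
      have hw : s.2.width = c.width := by rw [← length_legs, h1, length_legs]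
      have hl : s.2.leaves = c.leaves := by rw [← flatten_legs, h1, flatten_legs]
      refine ⟨by simp [hl], fun h => ⟨hw ▸ h.1, h2 h.2.1, h.2.2⟩, fun h => ⟨?_, h.2⟩⟩
      rcases h.1 with rfl | h'
      · simp [bdry] at hs
      · exact Or.inr ⟨hw ▸ h'.1, h2 h'.2⟩
    · obtain ⟨h1, h2, h3⟩ := ih s hs
      exact ⟨by simp [h1], fun h => ⟨h.1, h.2.1, h2 h.2.2⟩, fun h => ⟨h.1, h3 h.2⟩⟩

theorem Reduced.stable {F : Forest} (h : F.Reduced) : F.Stable := by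
  induction F with
  | nil => trivial
  | leaf i r ih => exact ih h
  | node c r _ ih => exact ⟨Or.inr ⟨h.1, h.2.1⟩, ih h.2.2⟩

theorem Stable.reduced {F : Forest} (h : F.Stable) (hu : ¬ F.HasUnit) : F.Reduced := by
  induction F with
  | nil => trivial
  | leaf i r ih => exact ih h hu
  | node c r _ ih =>
    simp only [HasUnit, not_or] at hu
    rcases h.1 with h' | h'
    · exact absurd h' hu.1
    · exact ⟨h'.1, h'.2, ih h.2 hu.2⟩

theorem join_spec (c n : Forest) (h : c.join = some n) :
    n.legs = [c.leaves] ∧ (c.Stable → (c = nil ∨ 2 ≤ c.width) → n.Stable) := by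
  unfold join at h
  split_ifs at h with hu
  · split at h
    · obtain rfl := Option.some.inj h
      exact ⟨by simp [leaves], fun _ _ => trivial⟩
    · obtain rfl := Option.some.inj h
      exact ⟨by simp [leaves], fun hs _ => hs.2⟩
    · obtain rfl := Option.some.inj h
      exact ⟨by simp [leaves], fun _ _ => trivial⟩
    · obtain rfl := Option.some.inj h
      exact ⟨by simp [leaves], fun hs _ => ⟨hs.1, trivial⟩⟩
    · cases h
  · obtain rfl := Option.some.inj h
    refine ⟨by simp, fun hs hw => ⟨?_, trivial⟩⟩
    exact hw.imp id fun hw => ⟨hw, hs.reduced hu⟩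

theorem subst_spec (S : ℕ → Forest) (G : Forest) :
    ∀ H, G.subst S = some H → (∀ j ∈ G.leaves, (S j).width = 1 ∧ (S j).Stable) →
      H.legs = G.legs.map (fun l => l.flatMap fun j => (S j).leaves) ∧ (G.Stable → H.Stable) := by
  induction G with
  | nil =>
    intro H h _
    obtain rfl := Option.some.inj h
    exact ⟨rfl, id⟩
  | leaf j r ih =>
    intro H h hS
    simp only [subst, Option.map_eq_some_iff] at h
    obtain ⟨r', hr, rfl⟩ := h
    simp only [leaves, List.mem_cons, forall_eq_or_imp] at hS
    obtain ⟨h1, h2⟩ := ih r' hr hS.2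
    refine ⟨?_, fun h => hS.1.2.append (h2 h)⟩
    obtain ⟨l, hl⟩ : ∃ l, (S j).legs = [l] := List.length_eq_one_iff.1 (by
      rw [length_legs]; exact hS.1.1)
    have : (S j).leaves = l := by rw [← flatten_legs, hl]; simp
    simp [legs_append, h1, hl, this]
  | node c r ihc ihr =>
    intro H h hS
    simp only [subst, Option.bind_eq_some_iff, Option.map_eq_some_iff] at h
    obtain ⟨c', hc, n, hn, r', hr, rfl⟩ := h
    simp only [leaves, List.mem_append] at hS
    obtain ⟨hc1, hc2⟩ := ihc c' hc fun j hj => hS j (Or.inl hj)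
    obtain ⟨hr1, hr2⟩ := ihr r' hr fun j hj => hS j (Or.inr hj)
    obtain ⟨hn1, hn2⟩ := join_spec c' n hn
    have hl : c'.leaves = c.leaves.flatMap fun j => (S j).leaves := by
      rw [← flatten_legs, hc1, ← flatten_legs, ← List.flatMap_def]
      simp [List.flatMap_def, List.flatten_flatten, List.map_flatten, Function.comp_def]
    refine ⟨by simp [legs_append, hn1, hr1, hl], fun h => Stable.append ?_ (hr2 h.2)⟩
    rcases h.1 with rfl | ⟨hw, hred⟩
    · obtain rfl := Option.some.inj hc
      exact hn2 trivial (Or.inl rfl)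
    · refine hn2 (hc2 hred.stable) (Or.inr ?_)
      rw [← length_legs, hc1, List.length_map, length_legs]
      exact hw

theorem tree_spec (F : Forest) (hF : F.Stable) (j : ℕ) (hj : j < F.width) :
    (F.tree j).width = 1 ∧ (F.tree j).Stable := by
  induction F generalizing j with
  | nil => simp [width] at hj
  | leaf i r ih =>
    cases j with
    | zero => exact ⟨rfl, trivial⟩
    | succ j => exact ih hF j (by simpa [width] using hj)
  | node c r _ ih =>
    cases j with
    | zero => exact ⟨rfl, hF.1, trivial⟩
    | succ j => exact ih hF.2 j (by simpa [width] using hj)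

theorem leaves_tree (F : Forest) (j : ℕ) : (F.tree j).leaves = F.legs.getD j [] := by
  simp only [tree, legs, List.getD_eq_getElem?_getD, List.getElem?_map]
  cases F.roots[j]? <;> rfl

end Forest

/-! ## The dg symmetric monoidal category of chains on moduli of discs -/

namespace DPlus

variable {Λ : Type v}

/-- An object is a finite sequence of open boundaries, each with the pair of D-branes at which it
starts and ends. -/
abbrev Obj (Λ : Type v) : Type v := List (Λ × Λ)

/-- The open boundaries of `α` with indices `l`, in this order, fit together to a path from the
D-brane `a` to the D-brane `b`: the free boundaries between consecutive marked points carry a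
single D-brane. -/
def IsPath (α : Obj Λ) : List ℕ → Λ → Λ → Prop
  | [], a, b => a = b
  | i :: l, a, b => ∃ c, α[i]? = some (a, c) ∧ IsPath α l c b

/-- The forest describes a disjoint union of discs with incoming boundaries `α`, each of which is
used exactly once, and outgoing boundaries `β`, one on each component. -/
def IsCell (α β : Obj Λ) (F : Forest) : Prop :=
  F.leaves.Perm (List.range α.length) ∧
    List.Forall₂ (fun l p => IsPath α l p.1 p.2) F.legs β ∧ F.Stable

/-- The cells of the moduli space of disjoint unions of discs from `α` to `β`. -/
def Cell (α β : Obj Λ) : Type := {F : Forest // IsCell α β F}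

def Cell.deg {α β : Obj Λ} (x : Cell α β) : ℕ := x.1.deg

theorem IsPath.append {α : Obj Λ} {l l' : List ℕ} {a b c : Λ} (h : IsPath α l a b)
    (h' : IsPath α l' b c) : IsPath α (l ++ l') a c := by
  induction l generalizing a with
  | nil => obtain rfl : a = b := h; exact h'
  | cons i l ih => obtain ⟨e, h1, h2⟩ := h; exact ⟨e, h1, ih h2⟩

theorem IsPath.flatMap {α β : Obj Λ} {L : ℕ → List ℕ}
    (hL : ∀ j a b, β[j]? = some (a, b) → IsPath α (L j) a b) {l : List ℕ} {a b : Λ}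
    (h : IsPath β l a b) : IsPath α (l.flatMap L) a b := by
  induction l generalizing a with
  | nil => exact h
  | cons i l ih => obtain ⟨e, h1, h2⟩ := h; exact (hL i a e h1).append (ih h2)

theorem IsPath.left {α : Obj Λ} (α' : Obj Λ) {l : List ℕ} {a b : Λ} (h : IsPath α l a b) :
    IsPath (α ++ α') l a b := by
  induction l generalizing a with
  | nil => exact h
  | cons i l ih =>
    obtain ⟨e, h1, h2⟩ := h
    refine ⟨e, ?_, ih h2⟩
    rw [List.getElem?_append_left (List.getElem?_eq_some_iff.1 h1).1, h1]

theorem IsPath.right (α : Obj Λ) {α' : Obj Λ} {l : List ℕ} {a b : Λ} (h : IsPath α' l a b) :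
    IsPath (α ++ α') (l.map (α.length + ·)) a b := by
  induction l generalizing a with
  | nil => exact h
  | cons i l ih =>
    obtain ⟨e, h1, h2⟩ := h
    refine ⟨e, ?_, ih h2⟩
    rw [List.getElem?_append_right (Nat.le_add_right _ _)]
    simpa using h1

theorem isCell_bdry {α β : Obj Λ} {F : Forest} (hF : IsCell α β F) (t : ℕ × Forest)
    (ht : t ∈ F.bdry) : IsCell α β t.2 := by
  obtain ⟨h1, -, h3⟩ := F.bdry_spec t ht
  refine ⟨?_, by rw [h1]; exact hF.2.1, h3 hF.2.2⟩
  rw [← Forest.flatten_legs, h1, Forest.flatten_legs]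
  exact hF.1

theorem isCell_subst {α β γ : Obj Λ} {G F H : Forest} (hG : IsCell β γ G) (hF : IsCell α β F)
    (h : G.subst F.tree = some H) : IsCell α γ H := by
  have hw : F.width = β.length := by rw [← Forest.length_legs, hF.2.1.length_eq]
  have hlt : ∀ j ∈ G.leaves, j < F.width := fun j hj => by
    rw [hw]; exact List.mem_range.1 (hG.1.subset hj)
  obtain ⟨h1, h2⟩ := Forest.subst_spec F.tree G H h
    fun j hj => F.tree_spec hF.2.2 j (hlt j hj)
  refine ⟨?_, ?_, h2 hG.2.2⟩
  · have e : H.leaves = G.leaves.flatMap fun j => (F.tree j).leaves := by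
      rw [← Forest.flatten_legs, h1, ← Forest.flatten_legs]
      simp [List.flatMap_def, List.flatten_flatten, List.map_flatten, Function.comp_def]
    rw [e]
    refine (hG.1.flatMap_right _).trans ?_
    have e' : ((List.range β.length).flatMap fun j => (F.tree j).leaves) = F.leaves := by
      rw [← Forest.flatten_legs F, List.flatMap_def]
      congr 1
      apply List.ext_getElem
      · simp [hF.2.1.length_eq]
      · intro i hi hi'
        simp [Forest.leaves_tree, List.getD_eq_getElem?_getD, List.getElem?_eq_getElem hi']
    rw [e']
    exact hF.1
  · rw [h1, List.forall₂_map_left_iff]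
    refine hG.2.1.imp fun l p hp => IsPath.flatMap ?_ hp
    intro j a b hj
    obtain ⟨hj1, hj2⟩ := List.getElem?_eq_some_iff.1 hj
    have hj' : j < F.legs.length := by rw [hF.2.1.length_eq]; exact hj1
    have := (List.forall₂_iff_get.1 hF.2.1).2 j hj' hj1
    simp only [List.get_eq_getElem, hj2] at this
    rw [Forest.leaves_tree, List.getD_eq_getElem?_getD, List.getElem?_eq_getElem hj']
    exact this

theorem isCell_append {α α' β β' : Obj Λ} {F F' : Forest} (hF : IsCell α β F)
    (hF' : IsCell α' β' F') :
    IsCell (α ++ α') (β ++ β') (F.append (F'.relabel (α.length + ·))) := by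
  refine ⟨?_, ?_, hF.2.2.append (hF'.2.2.relabel _)⟩
  · rw [Forest.leaves_append, Forest.leaves_relabel, List.length_append, List.range_add]
    exact hF.1.append (hF'.1.map _)
  · rw [Forest.legs_append, Forest.legs_relabel]
    refine List.rel_append (hF.2.1.imp fun l p h => h.left α') ?_
    rw [List.forall₂_map_left_iff]
    exact hF'.2.1.imp fun l p h => h.right α

theorem isCell_id (α : Obj Λ) : IsCell α α (Forest.ofLabels (List.range α.length)) := by
  refine ⟨by rw [Forest.leaves_ofLabels], ?_, Forest.stable_ofLabels _⟩
  rw [Forest.legs_ofLabels, List.forall₂_iff_get]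
  refine ⟨by simp, fun i h1 h2 => ?_⟩
  simp only [List.get_eq_getElem, List.getElem_map, List.getElem_range]
  exact ⟨_, by rw [List.getElem?_eq_getElem h2], rfl⟩

theorem isCell_symm (α β : Obj Λ) : IsCell (α ++ β) (β ++ α)
    (Forest.ofLabels ((List.range β.length).map (α.length + ·) ++ List.range α.length)) := by
  refine ⟨?_, ?_, Forest.stable_ofLabels _⟩
  · rw [Forest.leaves_ofLabels, List.length_append, List.range_add]
    exact List.perm_append_comm
  · have h := fun γ : Obj Λ => (isCell_id γ).2.1
    simp only [Forest.legs_ofLabels] at h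
    rw [Forest.legs_ofLabels, List.map_append]
    refine List.rel_append ?_ ((h α).imp fun l p hp => hp.left β)
    have := h β
    rw [List.forall₂_map_left_iff] at this
    rw [List.map_map, List.forall₂_map_left_iff]
    exact this.imp fun l p hp => hp.right α

section Operations

variable (K : Type u) [Field K]

/-- The morphism complex from `α` to `β`: cellular chains, with a cell `x` in degree `x.deg`. -/
abbrev Hom (α β : Obj Λ) : Type u := Cell α β →₀ K

/-- The chain of a single cell. -/
noncomputable def of {α β : Obj Λ} (x : Cell α β) : Hom K α β := Finsupp.single x 1

/-- The differential. -/
noncomputable def d {α β : Obj Λ} : Hom K α β →ₗ[K] Hom K α β :=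
  Finsupp.linearCombination K fun x : Cell α β =>
    (x.1.bdry.attach.map fun t =>
      (-1 : K) ^ t.1.1 • of K (⟨t.1.2, isCell_bdry x.2 t.1 t.2⟩ : Cell α β)).sum

/-- The composition of cells. -/
noncomputable def compCell {α β γ : Obj Λ} (y : Cell β γ) (x : Cell α β) : Hom K α γ :=
  match h : y.1.subst x.1.tree with
  | none => 0
  | some z => (-1 : K) ^ y.1.gluingSign x.1 • of K (⟨z, isCell_subst y.2 x.2 h⟩ : Cell α γ)

/-- The composition `comp g f = g ∘ f`, given by gluing the outgoing boundaries of `f` to the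
incoming boundaries of `g`. -/
noncomputable def comp {α β γ : Obj Λ} : Hom K β γ →ₗ[K] Hom K α β →ₗ[K] Hom K α γ :=
  Finsupp.linearCombination K fun y => Finsupp.linearCombination K fun x => compCell K y x

/-- The identity. -/
noncomputable def id (α : Obj Λ) : Hom K α α := of K ⟨_, isCell_id α⟩

/-- The tensor product of morphisms, given by disjoint union. -/
noncomputable def tensor {α α' β β' : Obj Λ} :
    Hom K α β →ₗ[K] Hom K α' β' →ₗ[K] Hom K (α ++ α') (β ++ β') :=
  Finsupp.linearCombination K fun x => Finsupp.linearCombination K fun x' =>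
    of K ⟨_, isCell_append x.2 x'.2⟩

/-- The symmetry isomorphism. -/
noncomputable def symm (α β : Obj Λ) : Hom K (α ++ β) (β ++ α) := of K ⟨_, isCell_symm α β⟩

end Operations

end DPlus

/-! ## Unital extended A-infinity categories -/

/-- A unital extended A-infinity category with set of objects `Λ`: a dg symmetric monoidal functor
from the category of chains on moduli of discs to complexes (lax monoidal, with structure maps `mul`
and `unit`) which is h-split, that is, whose monoidal structure maps are quasi-isomorphisms. -/
structure ExtAInfCat (K : Type u) [Field K] (Λ : Type v) where
  obj : DPlus.Obj Λ → Cx.{u, w} K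
  /-- The functor on morphisms; a dg functor. -/
  act : ∀ {α β : DPlus.Obj Λ}, DPlus.Hom K α β →ₗ[K] (obj α).X →ₗ[K] (obj β).X
  act_mem : ∀ {α β : DPlus.Obj Λ} (x : DPlus.Cell α β) {n : ℤ} {v : (obj α).X},
    v ∈ (obj α).grade n → act (DPlus.of K x) v ∈ (obj β).grade (x.deg + n)
  act_d : ∀ {α β : DPlus.Obj Λ} (x : DPlus.Cell α β) (v : (obj α).X),
    act (DPlus.d K (DPlus.of K x)) v =
      (obj β).d (act (DPlus.of K x) v) - (-1 : K) ^ x.deg • act (DPlus.of K x) ((obj α).d v)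
  act_id : ∀ (α : DPlus.Obj Λ) (v : (obj α).X), act (DPlus.id K α) v = v
  act_comp : ∀ {α β γ : DPlus.Obj Λ} (g : DPlus.Hom K β γ) (f : DPlus.Hom K α β)
    (v : (obj α).X), act (DPlus.comp K g f) v = act g (act f v)
  /-- The chain maps `obj α ⊗ obj β → obj (α ⊔ β)`. -/
  mul : ∀ {α β : DPlus.Obj Λ}, (obj α).X →ₗ[K] (obj β).X →ₗ[K] (obj (α ++ β)).X
  mul_mem : ∀ {α β : DPlus.Obj Λ} {p q : ℤ} {v : (obj α).X} {w : (obj β).X},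
    v ∈ (obj α).grade p → w ∈ (obj β).grade q → mul v w ∈ (obj (α ++ β)).grade (p + q)
  d_mul : ∀ {α β : DPlus.Obj Λ} (v : (obj α).X) (w : (obj β).X),
    (obj (α ++ β)).d (mul v w) = mul ((obj α).d v) w + mul ((obj α).sgn v) ((obj β).d w)
  /-- Naturality: `(f ⊗ g) (v w) = (-1)^{|g| |v|} f(v) g(w)`. -/
  act_tensor : ∀ {α α' β β' : DPlus.Obj Λ} (x : DPlus.Cell α β) (y : DPlus.Cell α' β')
    (v : (obj α).X) (w : (obj α').X),
    act (DPlus.tensor K (DPlus.of K x) (DPlus.of K y)) (mul v w) =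
      mul (act (DPlus.of K x) (((obj α).sgn ^ y.deg) v)) (act (DPlus.of K y) w)
  mul_assoc : ∀ {α β γ : DPlus.Obj Λ} (v : (obj α).X) (w : (obj β).X) (z : (obj γ).X),
    HEq (mul (mul v w) z) (mul v (mul w z))
  mul_symm : ∀ {α β : DPlus.Obj Λ} {p q : ℤ} {v : (obj α).X} {w : (obj β).X},
    v ∈ (obj α).grade p → w ∈ (obj β).grade q →
      act (DPlus.symm K α β) (mul v w) = (((p * q).negOnePow : ℤ) : K) • mul w v
  /-- The image of `1` under the chain map `K → obj ∅`. -/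
  unit : (obj []).X
  unit_mem : unit ∈ (obj []).grade 0
  d_unit : (obj []).d unit = 0
  unit_mul : ∀ {α : DPlus.Obj Λ} (v : (obj α).X), mul unit v = v
  mul_unit : ∀ {α : DPlus.Obj Λ} (v : (obj α).X), HEq (mul v unit) v
  hsplit_mul : ∀ α β : DPlus.Obj Λ,
    HomologyBijective (Cx.tensorD (obj α) (obj β)) (obj (α ++ β)).d (TensorProduct.lift mul)
  hsplit_unit : HomologyBijective (0 : K →ₗ[K] K) (obj []).d (LinearMap.toSpanSingleton K _ unit)

namespace ExtAInfCat

variable {K : Type u} [Field K] {Λ : Type v}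

/-- Monoidal natural transformations. -/
@[ext]
structure Mor (A B : ExtAInfCat.{u, v, w} K Λ) where
  φ : ∀ α : DPlus.Obj Λ, Cx.Hom (A.obj α) (B.obj α)
  map_act : ∀ {α β : DPlus.Obj Λ} (f : DPlus.Hom K α β) (v : (A.obj α).X),
    (φ β).f (A.act f v) = B.act f ((φ α).f v)
  map_mul : ∀ {α β : DPlus.Obj Λ} (v : (A.obj α).X) (w : (A.obj β).X),
    (φ (α ++ β)).f (A.mul v w) = B.mul ((φ α).f v) ((φ β).f w)
  map_unit : (φ []).f A.unit = B.unit

instance : Category (ExtAInfCat.{u, v, w} K Λ) where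
  Hom := Mor
  id A := ⟨fun α => Cx.Hom.id (A.obj α), fun _ _ => rfl, fun _ _ => rfl, rfl⟩
  comp F G := ⟨fun α => (G.φ α).comp (F.φ α),
    fun f v => by simp [Cx.Hom.comp, F.map_act, G.map_act],
    fun v w => by simp [Cx.Hom.comp, F.map_mul, G.map_mul],
    by simp [Cx.Hom.comp, F.map_unit, G.map_unit]⟩

/-- Morphisms all of whose components are quasi-isomorphisms of complexes. -/
def quasiIso (K : Type u) [Field K] (Λ : Type v) : MorphismProperty (ExtAInfCat.{u, v, w} K Λ) :=
  fun _ _ (F : Mor _ _) => ∀ α, (F.φ α).IsQuasiIso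

end ExtAInfCat

/-! ## Quasi-equivalences of categories with quasi-isomorphisms -/

section QuasiEquivalence

universe v₁ v₂ u₁ u₂

variable {C : Type u₁} [Category.{v₁} C] {D : Type u₂} [Category.{v₂} D]

/-- A functor is exact if it takes quasi-isomorphisms to quasi-isomorphisms. -/
def IsExact (WC : MorphismProperty C) (WD : MorphismProperty D) (F : C ⥤ D) : Prop :=
  ∀ ⦃X Y : C⦄ (f : X ⟶ Y), WC f → WD (F.map f)

/-- Two exact functors are quasi-isomorphic if they are connected by a chain of natural
transformations between exact functors, in either direction, all of whose components are
quasi-isomorphisms. -/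
def QuasiIsomorphic (WC : MorphismProperty C) (WD : MorphismProperty D) (F G : C ⥤ D) : Prop :=
  Relation.EqvGen (fun F G : C ⥤ D => IsExact WC WD F ∧ IsExact WC WD G ∧
    ∃ τ : F ⟶ G, ∀ X, WD (τ.app X)) F G

/-- The exact functors `F` and `G` form a quasi-equivalence. -/
def IsQuasiEquivalence (WC : MorphismProperty C) (WD : MorphismProperty D)
    (F : C ⥤ D) (G : D ⥤ C) : Prop :=
  IsExact WC WD F ∧ IsExact WD WC G ∧
    QuasiIsomorphic WD WD (G ⋙ F) (𝟭 D) ∧ QuasiIsomorphic WC WC (F ⋙ G) (𝟭 C)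

/-- The categories `C` and `D` are quasi-equivalent. -/
def QuasiEquivalent (WC : MorphismProperty C) (WD : MorphismProperty D) : Prop :=
  ∃ (F : C ⥤ D) (G : D ⥤ C), IsQuasiEquivalence WC WD F G

end QuasiEquivalence

noncomputable section

variable {K : Type u} [Field K] {Λ : Type v} {a b c e : Λ}

namespace HomologyBijective

variable {L M N : Type*} [AddCommGroup L] [Module K L]
  [AddCommGroup M] [Module K M] [AddCommGroup N] [Module K N]
  {dL : L →ₗ[K] L} {dM : M →ₗ[K] M} {dN : N →ₗ[K] N}

lemma comp {g : M →ₗ[K] N} {f : L →ₗ[K] M} (hg : HomologyBijective dM dN g)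
    (hf : HomologyBijective dL dM f) (h : ∀ x, f (dL x) = dM (f x))
    (h' : ∀ x, g (dM x) = dN (g x)) : HomologyBijective dL dN (g ∘ₗ f) := by
  refine ⟨fun x hx hy => hf.1 x hx (hg.1 _ (by rw [← h, hx, map_zero]) hy), fun y hy => ?_⟩
  obtain ⟨x, hx, z, rfl⟩ := hg.2 y hy
  obtain ⟨x', hx', z', rfl⟩ := hf.2 x hx
  exact ⟨x', hx', g z' + z, by simp [h', add_assoc]⟩

lemma of_comp {g : M →ₗ[K] N} {f : L →ₗ[K] M} (hgf : HomologyBijective dL dN (g ∘ₗ f))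
    (hf : HomologyBijective dL dM f) (h : ∀ x, f (dL x) = dM (f x))
    (h' : ∀ x, g (dM x) = dN (g x)) : HomologyBijective dM dN g := by
  refine ⟨fun x hx hy => ?_, fun y hy => ?_⟩
  · obtain ⟨x', hx', z, rfl⟩ := hf.2 x hx
    obtain ⟨y, hy⟩ := hy
    obtain ⟨z', rfl⟩ := hgf.1 x' hx' ⟨y - g z, by rw [map_sub, hy, ← h']; simp⟩
    exact ⟨f z' + z, by simp [h]⟩
  · obtain ⟨x, hx, z, rfl⟩ := hgf.2 y hy
    exact ⟨f x, by rw [← h, hx, map_zero], z, rfl⟩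

lemma of_bijective {f : M →ₗ[K] N} (h : ∀ x, f (dM x) = dN (f x)) (hf : Function.Bijective f) :
    HomologyBijective dM dN f := by
  refine ⟨fun x _ ⟨y, hy⟩ => ?_, fun y hy => ?_⟩
  · obtain ⟨z, rfl⟩ := hf.2 y
    exact ⟨z, hf.1 (by rw [h, hy])⟩
  · obtain ⟨x, rfl⟩ := hf.2 y
    exact ⟨x, hf.1 (by rw [h, hy, map_zero]), 0, by simp⟩

lemma of_homotopyInverse {f : M →ₗ[K] N} {g : N →ₗ[K] M}
    {h : M →ₗ[K] M} {k : N →ₗ[K] N} (hg : ∀ y, g (dN y) = dM (g y))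
    (hh : ∀ x, g (f x) = x + dM (h x) + h (dM x)) (hk : ∀ y, f (g y) = y + dN (k y) + k (dN y)) :
    HomologyBijective dM dN f := by
  refine ⟨fun x hx ⟨y, hy⟩ => ⟨g y - h x, ?_⟩, fun y hy => ⟨g y, ?_, -k y, ?_⟩⟩
  · rw [map_sub, ← hg, hy, hh, hx]; simp
  · rw [← hg, hy, map_zero]
  · rw [hk, hy]; simp

lemma exists_homotopyInverse {f : M →ₗ[K] N} (hf : ∀ x, f (dM x) = dN (f x))
    (dd : ∀ x, dM (dM x) = 0) (dd' : ∀ x, dN (dN x) = 0) (H : HomologyBijective dM dN f) :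
    ∃ (g : N →ₗ[K] M) (h : M →ₗ[K] M) (k : N →ₗ[K] N), (∀ y, g (dN y) = dM (g y)) ∧
      (∀ x, g (f x) = x + dM (h x) + h (dM x)) ∧ ∀ y, f (g y) = y + dN (k y) + k (dN y) := by
  let D : M × N →ₗ[K] M × N :=
    (-(dM ∘ₗ LinearMap.fst K M N)).prod (f ∘ₗ LinearMap.fst K M N + dN ∘ₗ LinearMap.snd K M N)
  have hD : ∀ x y, D (x, y) = (-dM x, f x + dN y) := fun x y => rfl
  obtain ⟨p, hp⟩ : ∃ p : M × N →ₗ[K] M × N, ∀ z, D (p (D z)) = D z := by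
    obtain ⟨g, hg⟩ := D.rangeRestrict.exists_rightInverse_of_surjective
      (LinearMap.range_rangeRestrict D)
    obtain ⟨p, hp⟩ := LinearMap.exists_extend g
    refine ⟨p, fun z => ?_⟩
    have h1 : p (D z) = g ⟨D z, z, rfl⟩ := LinearMap.congr_fun hp ⟨D z, z, rfl⟩
    have h2 := congrArg Subtype.val (LinearMap.congr_fun hg ⟨D z, z, rfl⟩)
    rw [h1]; exact h2
  have hDD : ∀ z, D (D z) = 0 := by
    rintro ⟨x, y⟩
    simp [hD, dd, dd', hf]
  have hex : ∀ z, D z = 0 → ∃ z', D z' = z := by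
    rintro ⟨x, y⟩ hz
    simp only [hD, Prod.mk_eq_zero, neg_eq_zero] at hz
    obtain ⟨x', rfl⟩ := H.1 x hz.1 ⟨-y, by rw [map_neg, eq_comm]; exact eq_neg_of_add_eq_zero_left hz.2⟩
    obtain ⟨x₁, hx₁, y₁, hy₁⟩ := H.2 (y + f x') (by rw [map_add, ← hf, add_comm]; exact hz.2)
    exact ⟨(x₁ - x', y₁), by
      rw [hD, map_sub, hx₁, map_sub, sub_add_eq_add_sub, ← hy₁]; simp⟩
  let s : M × N →ₗ[K] M × N := p - p ∘ₗ p ∘ₗ D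
  have hs : ∀ z, D (s z) + s (D z) = z := by
    intro z
    obtain ⟨z', hz'⟩ := hex (z - p (D z)) (by rw [map_sub, hp, sub_self])
    have h1 : s z = p (D z') := by simp [s, hz']
    have h2 : s (D z) = p (D z) := by simp [s, hDD]
    rw [h1, hp, hz', h2]; simp
  have e : ∀ x y, -dM (s (x, y)).1 + (s (-dM x, f x + dN y)).1 = x ∧
      f (s (x, y)).1 + dN (s (x, y)).2 + (s (-dM x, f x + dN y)).2 = y := fun x y => by
    simpa [Prod.ext_iff, hD] using hs (x, y)
  have e' : ∀ x y, s (-dM x, f x + dN y) = s (0, f x) + s (0, dN y) - s (dM x, 0) := fun x y => by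
    rw [← map_add, ← map_sub]; simp
  refine ⟨.fst K M N ∘ₗ s ∘ₗ .inr K M N, .fst K M N ∘ₗ s ∘ₗ .inl K M N,
    -(.snd K M N ∘ₗ s ∘ₗ .inr K M N), fun y => ?_, fun x => ?_, fun y => ?_⟩
  · have := (e 0 y).1
    rw [e'] at this
    simp at this
    simpa using (neg_add_eq_zero.1 this).symm
  · have := (e x 0).1
    rw [e', map_zero, show ((0 : M), (0 : N)) = 0 from rfl, map_zero] at this
    simp at this
    simp
    linear_combination (norm := module) this
  · have := (e 0 y).2
    rw [e'] at this
    simp at this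
    simp
    linear_combination (norm := module) this

end HomologyBijective

lemma isInternal_of_eigenspaces [CharZero K] {X : Type*} [AddCommGroup X]
    [Module K X] (g : ℤ → Submodule K X) (L : X →ₗ[K] X)
    (h : ∀ n : ℤ, ∀ x ∈ g n, L x = (2 : K) ^ n • x) (top : ⨆ n, g n = ⊤) :
    DirectSum.IsInternal g := by
  refine DirectSum.isInternal_submodule_of_iSupIndep_of_iSup_eq_top ?_ top
  have inj : Function.Injective fun n : ℤ => (2 : K) ^ n := by
    intro a b hab
    have hab' : (2 : K) ^ a = 2 ^ b := hab
    have : (((2 : ℚ) ^ a : ℚ) : K) = (((2 : ℚ) ^ b : ℚ) : K) := by push_cast; exact hab'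
    exact zpow_right_injective₀ (by norm_num) (by norm_num) (Rat.cast_injective this)
  exact ((Module.End.eigenspaces_iSupIndep L).comp inj).mono
    fun n x hx => Module.End.mem_eigenspace_iff.2 (h n x hx)

namespace Cx

lemma homogeneous_induction (V : Cx.{u,w} K) {p : V.X → Prop}
    (mem : ∀ (n : ℤ) (x : V.X), x ∈ V.grade n → p x) (add : ∀ x y, p x → p y → p (x + y))
    (x : V.X) : p x := by
  have hx : x ∈ ⨆ n, V.grade n := by
    rw [V.internal.submodule_iSup_eq_top]; trivial
  induction hx using Submodule.iSup_induction' with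
  | mem n x hx => exact mem n x hx
  | zero => exact mem 0 0 (Submodule.zero_mem _)
  | add x y _ _ hx hy => exact add x y hx hy

lemma sgn_mem (V : Cx.{u,w} K) {n : ℤ} {x : V.X} (hx : x ∈ V.grade n) : V.sgn x ∈ V.grade n := by
  rw [sgn_of_mem V hx]; exact Submodule.smul_mem _ _ hx

lemma sgn_d (V : Cx.{u,w} K) (x : V.X) : V.sgn (V.d x) = -V.d (V.sgn x) := by
  induction x using V.homogeneous_induction with
  | mem n x hx => rw [sgn_of_mem V hx, sgn_of_mem V (V.d_mem hx)]; simp [Int.negOnePow_sub]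
  | add x y hx hy => simp [hx, hy, add_comm]

/-- Multiplication by `t ^ n` in degree `n`. -/
def scale (V : Cx.{u,w} K) (t : Kˣ) : V.X →ₗ[K] V.X :=
  (DirectSum.toModule K ℤ V.X fun n => ((t ^ n : Kˣ) : K) • (V.grade n).subtype) ∘ₗ
    V.decomp.symm.toLinearMap

lemma scale_of_mem (V : Cx.{u,w} K) (t : Kˣ) {n : ℤ} {x : V.X} (hx : x ∈ V.grade n) :
    V.scale t x = ((t ^ n : Kˣ) : K) • x := by
  have h : V.decomp.symm x = DirectSum.lof K ℤ (fun i => V.grade i) n ⟨x, hx⟩ := by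
    rw [LinearEquiv.symm_apply_eq]
    exact (DirectSum.coeLinearMap_lof V.grade n ⟨x, hx⟩).symm
  simp [scale, h]

lemma scale_neg_one (V : Cx.{u,w} K) : V.scale (-1) = V.sgn := by
  ext x
  induction x using V.homogeneous_induction with
  | mem n x hx =>
    rw [scale_of_mem V _ hx, sgn_of_mem V hx]
    rcases Int.even_or_odd n with h | h
    · simp [Int.negOnePow_even n h, h.neg_one_zpow]
    · simp [Int.negOnePow_odd n h, h.neg_one_zpow]
  | add x y hx hy => simp [hx, hy]

lemma Hom.map_scale {V W : Cx.{u,w} K} (f : Hom V W) (t : Kˣ) (x : V.X) :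
    f.f (V.scale t x) = W.scale t (f.f x) := by
  induction x using V.homogeneous_induction with
  | mem n x hx => rw [scale_of_mem V _ hx, scale_of_mem W _ (f.map_mem hx), map_smul]
  | add x y hx hy => simp [hx, hy]

/-- Homotopy inverses can be chosen compatible with parity. -/
lemma Hom.exists_homotopyInverse [CharZero K] {V W : Cx.{u,w} K} (f : Hom V W)
    (H : f.IsQuasiIso) :
    ∃ (g : W.X →ₗ[K] V.X) (h : V.X →ₗ[K] V.X) (k : W.X →ₗ[K] W.X),
      (∀ y, g (W.d y) = V.d (g y)) ∧ (∀ x, g (f.f x) = x + V.d (h x) + h (V.d x)) ∧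
      (∀ y, f.f (g y) = y + W.d (k y) + k (W.d y)) ∧ (∀ y, g (W.sgn y) = V.sgn (g y)) ∧
      (∀ x, h (V.sgn x) = -V.sgn (h x)) ∧ ∀ y, k (W.sgn y) = -W.sgn (k y) := by
  obtain ⟨g, h, k, h1, h2, h3⟩ := HomologyBijective.exists_homotopyInverse f.map_d V.d_d W.d_d H
  have two : (2⁻¹ : K) + 2⁻¹ = 1 := by norm_num
  have key : ∀ {X : Type w} [AddCommGroup X] [Module K X] (x : X),
      (2⁻¹ : K) • x + (2⁻¹ : K) • x = x := fun x => by rw [← add_smul, two, one_smul]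
  refine ⟨(2⁻¹ : K) • (g + V.sgn ∘ₗ g ∘ₗ W.sgn), (2⁻¹ : K) • (h - V.sgn ∘ₗ h ∘ₗ V.sgn),
    (2⁻¹ : K) • (k - W.sgn ∘ₗ k ∘ₗ W.sgn), fun y => ?_, fun x => ?_, fun y => ?_, fun y => ?_,
    fun x => ?_, fun y => ?_⟩
  · simp [h1, sgn_d]
  · have e : V.sgn (g (W.sgn (f.f x))) =
        x - V.d (V.sgn (h (V.sgn x))) - V.sgn (h (V.sgn (V.d x))) := by
      rw [← f.map_sgn, h2]
      simp [sgn_sgn, sgn_d, sub_eq_add_neg]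
    simp only [LinearMap.smul_apply, LinearMap.add_apply, LinearMap.sub_apply,
      LinearMap.comp_apply, map_smul, map_sub, e, h2]
    linear_combination (norm := module) key x
  · have e : f.f (V.sgn (g (W.sgn y))) =
        y - W.d (W.sgn (k (W.sgn y))) - W.sgn (k (W.sgn (W.d y))) := by
      rw [f.map_sgn, h3]
      simp [sgn_sgn, sgn_d, sub_eq_add_neg]
    simp only [LinearMap.smul_apply, LinearMap.add_apply, LinearMap.sub_apply,
      LinearMap.comp_apply, map_smul, map_sub, map_add, e, h3]
    linear_combination (norm := module) key y
  · simp [sgn_sgn, add_comm]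
  · simp [sgn_sgn, ← smul_neg]
  · simp [sgn_sgn, ← smul_neg]

lemma Hom.IsQuasiIso.comp {U V W : Cx.{u,w} K} {g : Hom V W} {f : Hom U V} (hg : g.IsQuasiIso)
    (hf : f.IsQuasiIso) : (g.comp f).IsQuasiIso :=
  HomologyBijective.comp hg hf f.map_d g.map_d

section Tensor

lemma tensorD_tmul (V W : Cx.{u,w} K) (x : V.X) (y : W.X) :
    tensorD V W (x ⊗ₜ y) = V.d x ⊗ₜ y + V.sgn x ⊗ₜ W.d y := rfl

lemma tensorD_tensorD (V W : Cx.{u,w} K) (z : V.X ⊗[K] W.X) :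
    tensorD V W (tensorD V W z) = 0 := by
  induction z <;> simp_all [tensorD_tmul, d_d, sgn_d, neg_tmul]

def tensorGrade (V W : Cx.{u,w} K) (n : ℤ) : Submodule K (V.X ⊗[K] W.X) :=
  ⨆ i : ℤ, Submodule.map₂ (TensorProduct.mk K V.X W.X) (V.grade i) (W.grade (n - i))

lemma tmul_mem_tensorGrade {V W : Cx.{u,w} K} {i j : ℤ} {x : V.X} {y : W.X}
    (hx : x ∈ V.grade i) (hy : y ∈ W.grade j) : x ⊗ₜ y ∈ tensorGrade V W (i + j) :=
  Submodule.mem_iSup_of_mem i (Submodule.apply_mem_map₂ _ hx (by rwa [add_sub_cancel_left]))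

lemma tensorGrade_le {V W : Cx.{u,w} K} {n : ℤ} {S : Submodule K (V.X ⊗[K] W.X)}
    (h : ∀ i j : ℤ, i + j = n → ∀ x ∈ V.grade i, ∀ y ∈ W.grade j, x ⊗ₜ y ∈ S) :
    tensorGrade V W n ≤ S :=
  iSup_le fun i => Submodule.map₂_le.2 fun x hx y hy => h i (n - i) (by ring) x hx y hy

lemma iSup_tensorGrade (V W : Cx.{u,w} K) : ⨆ n, tensorGrade V W n = ⊤ := by
  rw [eq_top_iff, ← span_tmul_eq_top, Submodule.span_le]
  rintro _ ⟨x, y, rfl⟩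
  rw [SetLike.mem_coe]
  induction x using V.homogeneous_induction with
  | mem i x hx =>
    induction y using W.homogeneous_induction with
    | mem j y hy => exact Submodule.mem_iSup_of_mem _ (tmul_mem_tensorGrade hx hy)
    | add y y' hy hy' => rw [tmul_add]; exact Submodule.add_mem _ hy hy'
  | add x x' hx hx' => rw [add_tmul]; exact Submodule.add_mem _ hx hx'

variable [CharZero K]

def tensor (V W : Cx.{u,w} K) : Cx.{u,w} K where
  X := V.X ⊗[K] W.X
  grade := tensorGrade V W
  internal := by
    let t := Units.mk0 (2 : K) two_ne_zero
    refine isInternal_of_eigenspaces _ (map (V.scale t) (W.scale t)) (fun n x hx => ?_)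
      (iSup_tensorGrade V W)
    exact tensorGrade_le (S := LinearMap.eqLocus (map (V.scale t) (W.scale t))
      ((2 : K) ^ n • LinearMap.id)) (fun i j hij x hx y hy => by
        simp [t, scale_of_mem _ _ hx, scale_of_mem _ _ hy, ← hij, zpow_add₀ (two_ne_zero (α := K)),
          ← smul_tmul', smul_smul, mul_comm]) hx
  d := tensorD V W
  d_mem {n _} hx := tensorGrade_le (S := (tensorGrade V W (n - 1)).comap (tensorD V W))
    (fun i j hij x hx y hy => by
      refine Submodule.add_mem (tensorGrade V W (n - 1)) ?_ ?_
      · rw [show n - 1 = (i - 1) + j by omega]; exact tmul_mem_tensorGrade (V.d_mem hx) hy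
      · rw [show n - 1 = i + (j - 1) by omega]
        exact tmul_mem_tensorGrade (V.sgn_mem hx) (W.d_mem hy)) hx
  d_d := tensorD_tensorD V W

lemma sgn_tensor_tmul (V W : Cx.{u,w} K) (x : V.X) (y : W.X) :
    (tensor V W).sgn (x ⊗ₜ y : V.X ⊗[K] W.X) = (V.sgn x ⊗ₜ W.sgn y : V.X ⊗[K] W.X) := by
  induction x using V.homogeneous_induction with
  | mem i x hx =>
    induction y using W.homogeneous_induction with
    | mem j y hy =>
      rw [sgn_of_mem (tensor V W) (tmul_mem_tensorGrade hx hy), sgn_of_mem V hx, sgn_of_mem W hy,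
        smul_tmul_smul, Int.negOnePow_add]
      push_cast
      rfl
    | add y y' hy hy' =>
      rw [tmul_add, map_add, tmul_add]
      exact (LinearMap.map_add _ _ _).trans (congrArg₂ _ hy hy')
  | add x x' hx hx' =>
      rw [add_tmul, map_add, add_tmul]
      exact (LinearMap.map_add _ _ _).trans (congrArg₂ _ hx hx')

/-- The base field as a complex in degree `0`. -/
def unitCx (K : Type u) [Field K] [CharZero K] : Cx.{u,max u w} K where
  X := ULift.{w} K
  grade n := if n = 0 then ⊤ else ⊥
  internal := by
    refine isInternal_of_eigenspaces _ LinearMap.id (fun n x hx => ?_) ?_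
    · by_cases h : n = 0
      · simp [h]
      · rw [if_neg h, Submodule.mem_bot] at hx; simp [hx]
    · exact eq_top_iff.2 (le_iSup_of_le 0 (by simp))
  d := 0
  d_mem _ := Submodule.zero_mem _
  d_d _ := rfl

def Hom.tensor {V V' W W' : Cx.{u,w} K} (f : Hom V V') (g : Hom W W') :
    Hom (V.tensor W) (V'.tensor W') where
  f := map f.f g.f
  map_mem {n _} hx := tensorGrade_le (S := (tensorGrade V' W' n).comap (map f.f g.f))
    (fun i j hij x hx y hy => by
      rw [Submodule.mem_comap, map_tmul, ← hij]
      exact tmul_mem_tensorGrade (f.map_mem hx) (g.map_mem hy)) hx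
  map_d := LinearMap.congr_fun (f := map f.f g.f ∘ₗ tensorD V W) (g := tensorD V' W' ∘ₗ map f.f g.f)
    (ext' fun x y => by simp [tensorD_tmul, f.map_d, g.map_d, f.map_sgn])

lemma Hom.IsQuasiIso.tensor_id {V V' : Cx.{u,w} K} {f : Hom V V'} (hf : f.IsQuasiIso)
    (W : Cx.{u,w} K) : (f.tensor (Hom.id W)).IsQuasiIso := by
  obtain ⟨g, h, k, h1, h2, h3, h4, h5, h6⟩ := f.exists_homotopyInverse hf
  refine HomologyBijective.of_homotopyInverse (dM := tensorD V W) (dN := tensorD V' W)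
    (f := map f.f LinearMap.id) (g := map g LinearMap.id) (h := map h LinearMap.id)
    (k := map k LinearMap.id) (fun z => ?_) (fun z => ?_) fun z => ?_
  all_goals
    induction z with
    | zero => simp
    | tmul x y => simp [tensorD_tmul, h1, h2, h3, h4, h5, h6, add_tmul, neg_tmul]; try abel
    | add x y hx hy => simp only [map_add, hx, hy]; try abel

lemma Hom.IsQuasiIso.id_tensor {W W' : Cx.{u,w} K} {f : Hom W W'} (hf : f.IsQuasiIso)
    (V : Cx.{u,w} K) : ((Hom.id V).tensor f).IsQuasiIso := by
  obtain ⟨g, h, k, h1, h2, h3, -, -, -⟩ := f.exists_homotopyInverse hf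
  refine HomologyBijective.of_homotopyInverse (dM := tensorD V W) (dN := tensorD V W')
    (f := map LinearMap.id f.f) (g := map LinearMap.id g) (h := map V.sgn h)
    (k := map V.sgn k) (fun z => ?_) (fun z => ?_) fun z => ?_
  all_goals
    induction z with
    | zero => simp
    | tmul x y => simp [tensorD_tmul, h1, h2, h3, sgn_sgn, sgn_d, tmul_add, neg_tmul]; try abel
    | add x y hx hy => simp only [map_add, hx, hy]; try abel

lemma Hom.IsQuasiIso.tensor {V V' W W' : Cx.{u,w} K} {f : Hom V V'} {g : Hom W W'}
    (hf : f.IsQuasiIso) (hg : g.IsQuasiIso) : (f.tensor g).IsQuasiIso := by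
  have e : f.tensor g = ((Hom.id V').tensor g).comp (f.tensor (Hom.id W)) := by
    ext1; exact ext' fun x y => rfl
  exact e ▸ (hg.id_tensor V').comp (hf.tensor_id W)

end Tensor

end Cx

namespace Chain

variable {H H' : Λ → Λ → Type w}

lemma append_nil (l : Chain H a b) : l.append (nil b) = l := by
  induction l <;> grind [append]

lemma append_assoc (l : Chain H a b) (m : Chain H b c) (n : Chain H c e) :
    (l.append m).append n = l.append (m.append n) := by
  induction l <;> grind [append]

lemma map_append (f : ∀ a b, H a b → H' a b) (l : Chain H a b) (m : Chain H b c) :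
    (l.append m).map f = (l.map f).append (m.map f) := by
  induction l <;> grind [append, map]

lemma map_congr {f g : ∀ a b, H a b → H' a b} (h : ∀ a b x, f a b x = g a b x)
    (l : Chain H a b) : l.map f = l.map g := by
  induction l <;> grind [map]

lemma map_id' {f : ∀ a b, H a b → H a b} (h : ∀ a b x, f a b x = x)
    (l : Chain H a b) : l.map f = l :=
  (map_congr h l).trans (AInfCat.chain_map_id l)

/-- The sum of `g p q` over all decompositions of a chain into `p` followed by `q`. -/
def sumSplits {N : Type*} [AddCommMonoid N] : {a b : Λ} → Chain H a b →
    (∀ e, Chain H a e → Chain H e b → N) → N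
  | _, _, nil a, g => g a (nil a) (nil a)
  | a, _, cons x l, g => g a (nil a) (cons x l) + l.sumSplits fun e p q => g e (cons x p) q

section SumSplits

variable {N : Type*} [AddCommMonoid N]

@[simp] lemma sumSplits_nil (g : ∀ e, Chain H a e → Chain H e a → N) :
    (nil a).sumSplits g = g a (nil a) (nil a) := rfl

lemma sumSplits_cons (x : H a b) (l : Chain H b c)
    (g : ∀ e, Chain H a e → Chain H e c → N) :
    (cons x l).sumSplits g =
      g a (nil a) (cons x l) + l.sumSplits fun e p q => g e (cons x p) q := rfl

lemma sum_splits (c : Chain H a b) (g : (Σ e : Λ, Chain H a e × Chain H e b) → N) :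
    (c.splits.map g).sum = c.sumSplits fun e p q => g ⟨e, p, q⟩ := by
  induction c with
  | nil => simp [splits]
  | cons x l ih =>
    simp only [splits, List.map_cons, List.sum_cons, List.map_map, sumSplits_cons]
    rw [← ih fun s => g ⟨s.1, cons x s.2.1, s.2.2⟩]
    rfl

lemma sumSplits_congr (c : Chain H a b) {g g' : ∀ e, Chain H a e → Chain H e b → N}
    (h : ∀ e p q, p.length + q.length = c.length → g e p q = g' e p q) :
    c.sumSplits g = c.sumSplits g' := by
  induction c with
  | nil => exact h _ _ _ rfl
  | cons x l ih =>
    rw [sumSplits_cons, sumSplits_cons, h _ _ _ (by simp [length]), ih]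
    intro e p q hl
    exact h _ _ _ (by simp only [length]; omega)

lemma sumSplits_add (c : Chain H a b) (g g' : ∀ e, Chain H a e → Chain H e b → N) :
    (c.sumSplits fun e p q => g e p q + g' e p q) = c.sumSplits g + c.sumSplits g' := by
  induction c with
  | nil => rfl
  | cons _ _ ih => grind [sumSplits_cons]

lemma sumSplits_zero (c : Chain H a b) :
    (c.sumSplits fun _ _ _ => (0 : N)) = 0 := by
  induction c <;> simp_all [sumSplits_cons, add_zero]

lemma map_sumSplits {N' F : Type*} [AddCommMonoid N'] [FunLike F N N'] [AddMonoidHomClass F N N']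
    (f : F) (c : Chain H a b) (g : ∀ e, Chain H a e → Chain H e b → N) :
    f (c.sumSplits g) = c.sumSplits fun e p q => f (g e p q) := by
  induction c <;> simp_all [sumSplits_cons, map_add]

lemma sumSplits_comm {a b a' b' : Λ} (c : Chain H a b) (c' : Chain H a' b')
    (g : ∀ e e', Chain H a e → Chain H e b → Chain H a' e' → Chain H e' b' → N) :
    (c.sumSplits fun e p q => c'.sumSplits fun e' p' q' => g e e' p q p' q') =
      c'.sumSplits fun e' p' q' => c.sumSplits fun e p q => g e e' p q p' q' := by
  induction c <;> simp_all [sumSplits_cons, sumSplits_add]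

lemma sumSplits_map (f : ∀ a b, H a b → H' a b) (c : Chain H a b)
    (g : ∀ e, Chain H' a e → Chain H' e b → N) :
    (c.map f).sumSplits g = c.sumSplits fun e p q => g e (p.map f) (q.map f) := by
  induction c <;> simp_all [map, sumSplits_cons]

lemma sumSplits_append_cons (l : Chain H a b) (x : H b c) (l' : Chain H c e)
    (g : ∀ f, Chain H a f → Chain H f e → N) :
    (l.append (cons x l')).sumSplits g =
      (l.sumSplits fun f p q => g f p (q.append (cons x l'))) +
        l'.sumSplits fun f p q => g f (l.append (cons x p)) q := by
  induction l <;> simp_all [append, sumSplits_cons, add_assoc]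

lemma sumSplits_assoc (c : Chain H a b)
    (g : ∀ e f, Chain H a e → Chain H e f → Chain H f b → N) :
    (c.sumSplits fun e p w => w.sumSplits fun f q t => g e f p q t) =
      c.sumSplits fun f w t => w.sumSplits fun e p q => g e f p q t := by
  induction c <;> simp_all [sumSplits_cons, sumSplits_add, add_assoc, sumSplits_nil]

lemma smul_sumSplits {K : Type*} [DistribSMul K N] (k : K) (c : Chain H a b)
    (g : ∀ e, Chain H a e → Chain H e b → N) :
    k • c.sumSplits g = c.sumSplits fun e p q => k • g e p q :=
  map_sumSplits (DistribSMul.toAddMonoidHom N k) c g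

lemma neg_sumSplits {N : Type*} [AddCommGroup N] (c : Chain H a b)
    (g : ∀ e, Chain H a e → Chain H e b → N) :
    -c.sumSplits g = c.sumSplits fun e p q => -g e p q :=
  map_sumSplits (negAddMonoidHom (α := N)) c g

end SumSplits

end Chain

/-- Functions of chains that are linear in each entry. -/
structure SlotLinear (K : Type u) [Field K] {H : Λ → Λ → Type w}
    [∀ a b, AddCommGroup (H a b)] [∀ a b, Module K (H a b)] {N : Type*} [AddCommGroup N]
    [Module K N] {a b : Λ} (Ψ : Chain H a b → N) : Prop where
  add : ∀ {c e : Λ} (l : Chain H a c) (x y : H c e) (l' : Chain H e b),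
    Ψ (l.append (.cons (x + y) l')) = Ψ (l.append (.cons x l')) + Ψ (l.append (.cons y l'))
  smul : ∀ {c e : Λ} (l : Chain H a c) (k : K) (x : H c e) (l' : Chain H e b),
    Ψ (l.append (.cons (k • x) l')) = k • Ψ (l.append (.cons x l'))

namespace SlotLinear

variable {H H' : Λ → Λ → Type w}
  [∀ a b, AddCommGroup (H a b)] [∀ a b, Module K (H a b)] [∀ a b, AddCommGroup (H' a b)]
  [∀ a b, Module K (H' a b)] {N N' : Type*} [AddCommGroup N] [Module K N] [AddCommGroup N']
  [Module K N']

lemma zero_slot {Ψ : Chain H a b → N} (h : SlotLinear K Ψ) (l : Chain H a c)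
    (l' : Chain H e b) : Ψ (l.append (.cons 0 l')) = 0 := by
  have := h.smul l (0 : K) 0 l'
  rwa [zero_smul, zero_smul] at this

lemma cons_add {Ψ : Chain H a b → N} (h : SlotLinear K Ψ) (x y : H a e)
    (l : Chain H e b) : Ψ (.cons (x + y) l) = Ψ (.cons x l) + Ψ (.cons y l) :=
  h.add (.nil a) x y l

lemma cons_smul {Ψ : Chain H a b → N} (h : SlotLinear K Ψ) (k : K) (x : H a e)
    (l : Chain H e b) : Ψ (.cons (k • x) l) = k • Ψ (.cons x l) :=
  h.smul (.nil a) k x l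

lemma cons_zero {Ψ : Chain H a b → N} (h : SlotLinear K Ψ) (l : Chain H e b) :
    Ψ (.cons 0 l) = 0 := h.zero_slot (.nil a) l

lemma cons_neg {Ψ : Chain H a b → N} (h : SlotLinear K Ψ) (x : H a e)
    (l : Chain H e b) : Ψ (.cons (-x) l) = -Ψ (.cons x l) := by
  rw [← neg_one_smul K x, h.cons_smul, neg_one_smul]

lemma cons {Ψ : Chain H a b → N} (h : SlotLinear K Ψ) (x : H a e) :
    SlotLinear K fun l : Chain H e b => Ψ (.cons x l) :=
  ⟨fun l y z l' => h.add (.cons x l) y z l', fun l k y l' => h.smul (.cons x l) k y l'⟩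

lemma append_left {Ψ : Chain H a b → N} (h : SlotLinear K Ψ) (p : Chain H a e) :
    SlotLinear K fun l : Chain H e b => Ψ (p.append l) := by
  refine ⟨fun l y z l' => ?_, fun l k y l' => ?_⟩
  · simp only [← Chain.append_assoc]; exact h.add _ y z l'
  · simp only [← Chain.append_assoc]; exact h.smul _ k y l'

lemma append_right {Ψ : Chain H a b → N} (h : SlotLinear K Ψ) (p : Chain H e b) :
    SlotLinear K fun l : Chain H a e => Ψ (l.append p) := by
  refine ⟨fun l y z l' => ?_, fun l k y l' => ?_⟩
  · simp only [Chain.append_assoc]; exact h.add _ y z _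
  · simp only [Chain.append_assoc]; exact h.smul _ k y _

lemma neg_slot {Ψ : Chain H a b → N} (h : SlotLinear K Ψ) (l : Chain H a c)
    (x : H c e) (l' : Chain H e b) :
    Ψ (l.append (.cons (-x) l')) = -Ψ (l.append (.cons x l')) :=
  (h.append_left l).cons_neg x l'

lemma comp {Ψ : Chain H a b → N} (h : SlotLinear K Ψ) (f : N →ₗ[K] N') :
    SlotLinear K fun l => f (Ψ l) :=
  ⟨fun l x y l' => by rw [h.add, map_add], fun l k x l' => by rw [h.smul, map_smul]⟩

lemma const_smul {Ψ : Chain H a b → N} (h : SlotLinear K Ψ) (k : K) :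
    SlotLinear K fun l => k • Ψ l := h.comp (k • LinearMap.id)

lemma zero : SlotLinear K fun _ : Chain H a b => (0 : N) :=
  ⟨fun _ _ _ _ => by simp, fun _ _ _ _ => by simp⟩

lemma map {Ψ : Chain H' a b → N} (h : SlotLinear K Ψ) (f : ∀ a b, H a b →ₗ[K] H' a b) :
    SlotLinear K fun l : Chain H a b => Ψ (l.map fun a b => f a b) := by
  refine ⟨fun l y z l' => ?_, fun l k y l' => ?_⟩
  · simp only [Chain.map_append, Chain.map, map_add]; exact h.add _ _ _ _
  · simp only [Chain.map_append, Chain.map, map_smul]; exact h.smul _ _ _ _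

lemma add_fun {Ψ Ψ' : Chain H a b → N} (h : SlotLinear K Ψ) (h' : SlotLinear K Ψ') :
    SlotLinear K fun l => Ψ l + Ψ' l :=
  ⟨fun l x y l' => by rw [h.add, h'.add]; abel, fun l k x l' => by rw [h.smul, h'.smul, smul_add]⟩

lemma sumSplits {g : ∀ e, Chain H a e → Chain H e b → N}
    (h : ∀ e q, SlotLinear K fun p => g e p q) (h' : ∀ e p, SlotLinear K (g e p)) :
    SlotLinear K fun l : Chain H a b => l.sumSplits g := by
  refine ⟨fun l x y l' => ?_, fun l k x l' => ?_⟩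
  · simp only [Chain.sumSplits_append_cons]
    rw [add_add_add_comm, ← Chain.sumSplits_add, ← Chain.sumSplits_add]
    congr 1
    · congr 1; funext e p q; exact (h' e p).add q x y l'
    · congr 1; funext e p q; exact (h e q).add l x y p
  · simp only [Chain.sumSplits_append_cons]
    rw [smul_add]
    congr 1
    · rw [Chain.smul_sumSplits]
      congr 1; funext e p q; exact (h' e p).smul q k x l'
    · rw [Chain.smul_sumSplits]
      congr 1; funext e p q; exact (h e q).smul l k x p

lemma map_neg {Ψ : Chain H a b → N} (h : SlotLinear K Ψ) (l : Chain H a b) :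
    Ψ (l.map fun _ _ x => -x) = (-1 : K) ^ l.length • Ψ l := by
  induction l with
  | nil => simp [Chain.map, Chain.length]
  | cons x l ih =>
    rw [Chain.map, h.cons_neg, ih (h.cons x), Chain.length, pow_succ, mul_neg_one, neg_smul]

end SlotLinear

lemma SlotLinear.ext_homogeneous {M : Λ → Λ → Cx.{u,w} K}
    {N : Type*} [AddCommGroup N] [Module K N]
    {Ψ Ψ' : Chain (fun a b => (M a b).X) a b → N} (h : SlotLinear K Ψ) (h' : SlotLinear K Ψ')
    (H : ∀ (l : Chain (fun a b => (M a b).X) a b) (n : ℤ), l.Homogeneous n → Ψ l = Ψ' l)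
    (l : Chain (fun a b => (M a b).X) a b) : Ψ l = Ψ' l := by
  induction l with
  | nil a => exact H _ 0 rfl
  | @cons a c b x l ih =>
    induction x using (M a c).homogeneous_induction with
    | mem n x hx =>
      exact ih (h.cons x) (h'.cons x) fun l m hl => H _ (n + m) ⟨n, m, hx, hl, rfl⟩
    | add x y hx hy => rw [h.cons_add, h'.cons_add, hx, hy]

section Bar

variable {H : Λ → Λ → Type w}
  [∀ a b, AddCommGroup (H a b)] [∀ a b, Module K (H a b)] {N N' : Type*} [AddCommGroup N]
  [Module K N] [AddCommGroup N'] [Module K N']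

open Chain

/-- The sum of `Ψ (s p, b q, t)` over all decompositions of a chain into `p`, `q`, `t`. -/
def insertSum (s : ∀ a b, H a b →ₗ[K] H a b) (b : ∀ a b : Λ, Chain H a b → H a b)
    (Ψ : Chain H a e → N) (c : Chain H a e) : N :=
  c.sumSplits fun _ p w => w.sumSplits fun _ q t =>
    Ψ ((p.map fun a b => s a b).append (cons (b _ _ q) t))

variable {s : ∀ a b, H a b →ₗ[K] H a b} {b : ∀ a b : Λ, Chain H a b → H a b}

lemma insertSum_cons {a e f : Λ} (x : H a e) (l : Chain H e f) (Ψ : Chain H a f → N) :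
    insertSum s b Ψ (cons x l) = ((cons x l).sumSplits fun _ q t => Ψ (cons (b _ _ q) t)) +
      insertSum s b (fun l => Ψ (cons (s _ _ x) l)) l := rfl

lemma map_insertSum (f : N →ₗ[K] N') (Ψ : Chain H a e → N) (c : Chain H a e) :
    f (insertSum s b Ψ c) = insertSum s b (fun l => f (Ψ l)) c := by simp [insertSum, map_sumSplits]

lemma slotLinear_insertSum (hb : ∀ a e, SlotLinear K (b a e)) {Ψ : Chain H a e → N}
    (h : SlotLinear K Ψ) : SlotLinear K (insertSum s b Ψ) := by
  refine SlotLinear.sumSplits (fun f w => ?_) (fun f p => ?_)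
  · refine ⟨fun l x y l' => ?_, fun l k x l' => ?_⟩
    · rw [← sumSplits_add]
      congr 1; funext f' q t
      exact ((h.append_right (cons (b _ _ q) t)).map s).add l x y l'
    · rw [smul_sumSplits]
      congr 1; funext f' q t
      exact ((h.append_right (cons (b _ _ q) t)).map s).smul l k x l'
  · refine SlotLinear.sumSplits (fun f' t => ?_) (fun f' q => ?_)
    · exact ⟨fun l x y l' => by rw [(hb _ _).add]; exact h.add _ _ _ _,
        fun l k x l' => by rw [(hb _ _).smul]; exact h.smul _ _ _ _⟩
    · exact (h.append_left _).cons _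

lemma insertSum_sumSplits (c : Chain H a e)
    (g : ∀ f, Chain H a f → Chain H f e → N) :
    insertSum s b (fun l => l.sumSplits g) c =
      c.sumSplits fun f p q => insertSum s b (fun p' => g f p' q) p +
        insertSum s b (g f (p.map fun a b => s a b)) q := by
  rw [sumSplits_add]
  simp only [insertSum, sumSplits_append_cons, sumSplits_map, sumSplits_add]
  rw [add_comm]
  congr 1
  · rw [← sumSplits_assoc c fun f f' p w q => w.sumSplits fun f q' t =>
      g _ ((p.map fun a b => s a b).append (cons (b _ _ q') t)) q]
    congr 1; funext f p w
    rw [sumSplits_assoc w fun f f' q u v =>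
      g f' ((p.map fun a b => s a b).append (cons (b _ _ q) u)) v]
  · simp only [fun (f : Λ) (p : Chain H a f) (q : Chain H f e) => sumSplits_comm q p fun _ f' q' t u v =>
      g f' (u.map fun a b => s a b) ((v.map fun a b => s a b).append (cons (b _ _ q') t))]
    rw [← sumSplits_assoc c fun f f' p w q => q.sumSplits fun f q' t =>
      g _ (p.map fun a b => s a b) ((w.map fun a b => s a b).append (cons (b _ _ q') t))]
    rfl

lemma insertSum_insertSum (hss : ∀ a b x, s a b (s a b x) = x)
    (hbs : ∀ {a e : Λ} (c : Chain H a e), b _ _ (c.map fun a b => s a b) = -s _ _ (b _ _ c))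
    (hbb : ∀ {a e : Λ} (c : Chain H a e), insertSum s b (b _ _) c = 0)
    {Ψ : Chain H a e → N} (h : SlotLinear K Ψ) (c : Chain H a e) :
    insertSum s b (insertSum s b Ψ) c = 0 := by
  have hm : ∀ {a e : Λ} (c : Chain H a e), (c.map fun a b => s a b).map (fun a b => s a b) = c :=
    fun c => by
      rw [AInfCat.chain_map_map]
      exact map_id' hss c
  have e1 : insertSum s b (insertSum s b Ψ) c = c.sumSplits fun f p w =>
      insertSum s b (fun p' => w.sumSplits fun _ q t =>
        Ψ ((p'.map fun a b => s a b).append (cons (b _ _ q) t))) p +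
      insertSum s b (fun w' => w'.sumSplits fun _ q t => Ψ (p.append (cons (b _ _ q) t))) w := by
    rw [show insertSum s b Ψ = fun c => c.sumSplits fun _ p w => w.sumSplits fun _ q t =>
      Ψ ((p.map fun a b => s a b).append (cons (b _ _ q) t)) from rfl, insertSum_sumSplits]
    simp only [hm]
  have e2 : ∀ (f : Λ) (p : Chain H a f) (w : Chain H f e),
      insertSum s b (fun w' => w'.sumSplits fun _ q t => Ψ (p.append (cons (b _ _ q) t))) w =
        -w.sumSplits fun _ q t =>
          insertSum s b (fun t' => Ψ (p.append (cons (s _ _ (b _ _ q)) t'))) t := by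
    intro f p w
    rw [insertSum_sumSplits, neg_sumSplits]
    congr 1; funext f' q t
    let L : H f f' →ₗ[K] N :=
      { toFun := fun z => Ψ (p.append (cons z t))
        map_add' := fun x y => h.add p x y t
        map_smul' := fun k x => h.smul p k x t }
    have h1 : insertSum s b (fun p' => Ψ (p.append (cons (b _ _ p') t))) q = 0 := by
      have := map_insertSum (s := s) (b := b) L (b f f') q
      rw [hbb, map_zero] at this
      exact this.symm
    rw [h1, zero_add, hbs, ← neg_one_smul K (insertSum _ _ _ _)]
    have := map_insertSum (s := s) (b := b) ((-1 : K) • (LinearMap.id : N →ₗ[K] N))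
      (fun t' => Ψ (p.append (cons (s _ _ (b _ _ q)) t'))) t
    refine Eq.trans ?_ this.symm
    congr 1; funext t'
    simp [h.neg_slot]
  have e3 : ∀ (f : Λ) (p : Chain H a f) (w : Chain H f e),
      insertSum s b (fun p' => w.sumSplits fun _ q t =>
        Ψ ((p'.map fun a b => s a b).append (cons (b _ _ q) t))) p =
      p.sumSplits fun _ p1 u => u.sumSplits fun _ p2 p3 => w.sumSplits fun _ q t =>
        Ψ (p1.append (cons (s _ _ (b _ _ p2)) ((p3.map fun a b => s a b).append
          (cons (b _ _ q) t)))) := by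
    intro f p w
    simp only [insertSum, map_append, hm, Chain.map, append_assoc, Chain.append]
  rw [e1]
  simp only [e2, e3, sumSplits_add]
  rw [← neg_sumSplits, add_neg_eq_zero]
  simp only [insertSum]
  rw [← sumSplits_assoc c fun f f' p1 u w => u.sumSplits fun _ p2 p3 => w.sumSplits fun _ q t =>
        Ψ (p1.append (cons (s _ _ (b _ _ p2)) ((p3.map fun a b => s a b).append
          (cons (b _ _ q) t))))]
  congr 1; funext f p w
  rw [← sumSplits_assoc w fun f f' p2 p3 w => w.sumSplits fun _ q t =>
        Ψ (p.append (cons (s _ _ (b _ _ p2)) ((p3.map fun a b => s a b).append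
          (cons (b _ _ q) t))))]

end Bar

/-- Chains of elements of morphism complexes. -/
abbrev ChainOf (M : Λ → Λ → Cx.{u,w} K) (a b : Λ) :=
  Chain (fun a b => (M a b).X) a b

/-- Chains of morphisms of an A-infinity category. -/
notation "χ[" A "]" => ChainOf (AInfCat.Hom A)

namespace Cx

lemma sgn_pow_sgn_pow (V : Cx.{u,w} K) (n : ℕ) (x : V.X) : (V.sgn ^ n) ((V.sgn ^ n) x) = x := by
  rw [← Module.End.mul_apply, ← (Commute.refl V.sgn).mul_pow, show V.sgn * V.sgn = 1 from LinearMap.ext V.sgn_sgn,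
    one_pow, Module.End.one_apply]

lemma sgn_pow_mem (V : Cx.{u,w} K) (n : ℕ) {i : ℤ} {x : V.X} (hx : x ∈ V.grade i) :
    (V.sgn ^ n) x ∈ V.grade i := by
  induction n with
  | zero => simpa using hx
  | succ n ih => rw [pow_succ', Module.End.mul_apply]; exact V.sgn_mem ih

/-- The operator `t ^ (n + 1)` in degree `n`; for `t = -1` the parity involution of the
suspension. -/
def barScale (V : Cx.{u,w} K) (t : Kˣ) : V.X →ₗ[K] V.X := (t : K) • V.scale t

lemma barScale_of_mem (V : Cx.{u,w} K) (t : Kˣ) {n : ℤ} {x : V.X} (hx : x ∈ V.grade n) :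
    V.barScale t x = ((t ^ (n + 1) : Kˣ) : K) • x := by
  rw [barScale, LinearMap.smul_apply, scale_of_mem V t hx, smul_smul, zpow_add_one, mul_comm,
    Units.val_mul]

lemma barScale_neg_one (V : Cx.{u,w} K) : V.barScale (-1) = -V.sgn := by simp [barScale, scale_neg_one]

end Cx

section Twist

variable {M M' : Λ → Λ → Cx.{u,w} K}

namespace Chain

/-- The sign relating operations on complexes and on their suspensions. -/
def twist {a b : Λ} : ChainOf M a b → ChainOf M a b
  | nil a => nil a
  | @cons _ _ a b _ x l => cons (((M a b).sgn ^ l.length) x) l.twist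

@[simp] lemma length_twist (l : ChainOf M a b) : l.twist.length = l.length := by
  induction l <;> simp_all [twist, length]

lemma twist_twist (l : ChainOf M a b) : l.twist.twist = l := by
  induction l <;> simp_all [twist, Cx.sgn_pow_sgn_pow]

lemma twist_append (l : ChainOf M a b) (l' : ChainOf M b c) :
    (l.append l').twist =
      (l.twist.map fun a b => (M a b).sgn ^ l'.length).append l'.twist := by
  induction l with
  | nil => rfl
  | cons x l ih =>
    simp only [append, twist, ih, Chain.map, length_append]
    rw [add_comm, pow_add, Module.End.mul_apply]

lemma twist_map (f : ∀ a b, (M a b).X →ₗ[K] (M' a b).X)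
    (hf : ∀ a b x, f a b ((M a b).sgn x) = (M' a b).sgn (f a b x)) (l : ChainOf M a b) :
    (l.map fun a b => f a b).twist = l.twist.map fun a b => f a b := by
  have hp : ∀ (n : ℕ) (a b : Λ) (x : (M a b).X),
      f a b (((M a b).sgn ^ n) x) = ((M' a b).sgn ^ n) (f a b x) := by
    intro n a b
    induction n with
    | zero => simp
    | succ n ih => intro x; simp only [pow_succ', Module.End.mul_apply, hf, ih]
  induction l with
  | nil => rfl
  | cons x l ih => simp only [Chain.map, twist, ih, hp, length_map]

lemma sumSplits_twist {N : Type*} [AddCommMonoid N] (c : ChainOf M a b)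
    (g : ∀ e, ChainOf M a e → ChainOf M e b → N) :
    c.twist.sumSplits g = c.sumSplits fun e p q =>
      g e (p.twist.map fun a b => (M a b).sgn ^ q.length) q.twist := by
  induction c with
  | nil => rfl
  | cons x l ih =>
    simp only [twist, sumSplits_cons, ih, Chain.map]
    congr 1
    refine sumSplits_congr _ fun e p q h => ?_
    rw [← h, add_comm, pow_add, Module.End.mul_apply]

lemma Homogeneous.twist {l : ChainOf M a b} {n : ℤ} (h : l.Homogeneous n) :
    l.twist.Homogeneous n := by
  induction l generalizing n with
  | nil => exact h
  | cons x l ih =>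
    obtain ⟨p, q, hx, hq, rfl⟩ := h
    exact ⟨p, q, Cx.sgn_pow_mem _ _ hx, ih hq, rfl⟩

end Chain

open Chain

lemma SlotLinear.twist {N : Type*} [AddCommGroup N] [Module K N]
    {Ψ : ChainOf M a b → N} (h : SlotLinear K Ψ) : SlotLinear K fun l : ChainOf M a b => Ψ l.twist := by
  refine ⟨fun l x y l' => ?_, fun l k x l' => ?_⟩
  · simp only [twist_append, Chain.twist, map_add]; exact h.add _ _ _ _
  · simp only [twist_append, Chain.twist, map_smul]; exact h.smul _ _ _ _

lemma SlotLinear.map_barScale {N : Type*} [AddCommGroup N] [Module K N]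
    {Ψ : ChainOf M a b → N} (h : SlotLinear K Ψ) (t : Kˣ) {l : ChainOf M a b} {n : ℤ}
    (hl : l.Homogeneous n) :
    Ψ (l.map fun a b => (M a b).barScale t) = ((t ^ (n + l.length) : Kˣ) : K) • Ψ l := by
  induction l generalizing n with
  | nil a => obtain rfl : n = 0 := hl; simp [Chain.map, length]
  | cons x l ih =>
    obtain ⟨p, q, hx, hq, rfl⟩ := hl
    rw [Chain.map, Cx.barScale_of_mem _ t hx, h.cons_smul, ih (h.cons x) hq, smul_smul,
      ← Units.val_mul, ← zpow_add]
    congr 3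
    simp only [length]; push_cast; ring

lemma SlotLinear.map_sgn {N : Type*} [AddCommGroup N] [Module K N]
    {Ψ : ChainOf M a b → N} (h : SlotLinear K Ψ) (l : ChainOf M a b) :
    Ψ (l.map fun a b => (M a b).sgn) =
      (-1 : K) ^ l.length • Ψ (l.map fun a b => (M a b).barScale (-1)) := by
  have := h.map_neg (l.map fun a b => (M a b).barScale (-1))
  rw [length_map] at this
  rw [← this, AInfCat.chain_map_map]
  exact congrArg Ψ (map_congr (fun a b x => by simp [Cx.barScale_neg_one]) l)

/-- Compatibility with degrees of an operation of degree `n - 2` on chains of length `n`. -/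
lemma barScale_of_mem_grade (m : ∀ a b, ChainOf M a b → (M a b).X)
    (hm : ∀ a b, SlotLinear K (m a b))
    (hmem : ∀ {a b : Λ} (l : ChainOf M a b) (n : ℤ),
      l.Homogeneous n → m a b l ∈ (M a b).grade (n + l.length - 2))
    (t : Kˣ) (l : ChainOf M a b) :
    m a b (l.map fun a b => (M a b).barScale t) = (t : K) • (M a b).barScale t (m a b l) := by
  refine SlotLinear.ext_homogeneous ((hm a b).map _)
    ((hm a b).comp ((t : K) • (M a b).barScale t)) (fun l n hl => ?_) l
  rw [(hm a b).map_barScale t hl, LinearMap.smul_apply,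
    Cx.barScale_of_mem _ _ (hmem l n hl), smul_smul, ← Units.val_mul, ← zpow_one_add]
  congr 3
  ring

lemma stasheffSum_eq (m : ∀ a b, ChainOf M a b → (M a b).X)
    (hm : ∀ a b, SlotLinear K (m a b)) (hnil : ∀ a, m a a (nil a) = 0)
    (hmem : ∀ {a b : Λ} (l : ChainOf M a b) (n : ℤ),
      l.Homogeneous n → m a b l ∈ (M a b).grade (n + l.length - 2))
    (c : ChainOf M a b) :
    stasheffSum M (fun {a b} => m a b) c =
      insertSum (fun a b => (M a b).barScale (-1)) (fun a b l => m a b l.twist)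
        (fun l => m a b l.twist) c.twist := by
  have h1 : ∀ {a b : Λ} (l : ChainOf M a b),
      m a b (l.map fun a b => (M a b).barScale (-1)) = (M a b).sgn (m a b l) := fun l => by
    rw [barScale_of_mem_grade m hm hmem]; simp [Cx.barScale_neg_one]
  have hs : ∀ {a b : Λ} (l : ChainOf M a b) (n : ℕ),
      m a b (l.map fun a b => (M a b).sgn ^ n) =
        (-1 : K) ^ (n * l.length) • ((M a b).sgn ^ n) (m a b l) := by
    intro a b l n
    induction n with
    | zero => simp [map_id']
    | succ n ih =>
      have e : (l.map fun a b => (M a b).sgn ^ (n + 1)) =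
          (l.map fun a b => (M a b).sgn ^ n).map fun a b => (M a b).sgn := by
        rw [AInfCat.chain_map_map]
        exact map_congr (fun a b x => by rw [pow_succ', Module.End.mul_apply]) l
      rw [e, (hm a b).map_sgn, h1, ih, length_map, pow_succ' _ n, Module.End.mul_apply, map_smul,
        smul_smul, ← pow_add]
      congr 2
      ring
  unfold stasheffSum insertSum
  rw [sum_splits, sumSplits_twist]
  refine sumSplits_congr _ fun e p w hpw => ?_
  rw [sum_splits, sumSplits_twist]
  refine sumSplits_congr _ fun f q t hqt => ?_
  dsimp only
  have e1 : (q.twist.map fun a b => (M a b).sgn ^ t.length).twist =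
      q.map fun a b => (M a b).sgn ^ t.length := by
    rw [twist_map (fun a b => (M a b).sgn ^ t.length), twist_twist]
    intro a b x
    rw [← Module.End.mul_apply, ← Module.End.mul_apply, ← pow_succ, ← pow_succ']
  by_cases hq : q.length = 0
  · rw [if_pos hq, e1]
    cases q with
    | cons x q => simp [length] at hq
    | nil =>
      rw [Chain.map, hnil]
      exact ((hm a b).twist.zero_slot _ _).symm
  · have e2 : ((p.twist.map fun a b => (M a b).sgn ^ w.length).map fun a b =>
        (M a b).barScale (-1)).twist =
        (p.map fun a b => (M a b).sgn ^ w.length).map fun a b => (M a b).barScale (-1) := by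
      rw [AInfCat.chain_map_map, AInfCat.chain_map_map]
      refine (twist_map (fun a b => (M a b).barScale (-1) ∘ₗ (M a b).sgn ^ w.length) ?_ _).trans
        (by rw [twist_twist]; rfl)
      intro a b x
      have : ∀ n : ℕ, ((M a b).sgn ^ n) ((M a b).sgn x) = (M a b).sgn (((M a b).sgn ^ n) x) := by
        intro n
        rw [← Module.End.mul_apply, ← Module.End.mul_apply, ← pow_succ, ← pow_succ']
      simp [Cx.barScale_neg_one, this]
    rw [if_neg hq, e1, hs, twist_append, e2, Chain.twist, twist_twist, map_smul,
      (hm a b).smul, AInfCat.chain_map_map, AInfCat.chain_map_map]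
    simp only [length, length_twist, Cx.sgn_pow_sgn_pow]
    have e3 : (p.map fun a b x => ((M a b).sgn ^ (t.length + 1)) ((M a b).barScale (-1)
        (((M a b).sgn ^ w.length) x))) =
        (p.map fun a b => (M a b).sgn ^ q.length).map fun _ _ x => -x := by
      rw [AInfCat.chain_map_map]
      refine map_congr (fun a b x => ?_) p
      rw [Cx.barScale_neg_one, LinearMap.neg_apply, map_neg, ← hqt, add_comm q.length,
        pow_succ, Module.End.mul_apply, Cx.sgn_sgn, pow_add, Module.End.mul_apply,
        Cx.sgn_pow_sgn_pow]
    rw [e3, ((hm a b).append_right _).map_neg, smul_smul, ← pow_add, length_map]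
    congr 2
    ring

end Twist

namespace AInfCat

section

variable (A : AInfCat.{u,v,w} K Λ)

open Chain

lemma slotLinear_m (a b : Λ) : SlotLinear K (A.m (a := a) (b := b)) := ⟨A.m_add, A.m_smul⟩

/-- The operations of an A-infinity category on the suspensions of its morphism complexes. -/
def bar (a b : Λ) (c : χ[A] a b) : (A.Hom a b).X := A.m c.twist

abbrev barSgn (a b : Λ) : (A.Hom a b).X →ₗ[K] (A.Hom a b).X :=
  (A.Hom a b).barScale (-1)

/-- The parity involution on the entries of a sequence. -/
notation "σ[" A "]" => fun a b => (AInfCat.barSgn A a b : _ → _)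

/-- The insertion of one operation of an A-infinity category into a chain. -/
notation "ι[" A "]" => insertSum (AInfCat.barSgn A) (AInfCat.bar A)

lemma slotLinear_bar (a b : Λ) : SlotLinear K (A.bar a b) := (A.slotLinear_m a b).twist

lemma bar_nil (a : Λ) : A.bar a a (.nil a) = 0 := A.m_nil a

lemma bar_single (x : (A.Hom a b).X) :
    A.bar a b (.cons x (.nil b)) = (A.Hom a b).d x := A.m_single x

lemma bar_one_left (x : (A.Hom a b).X) :
    A.bar a b (.cons (A.one a) (.cons x (.nil b))) = x := by
  simp only [bar, twist, length, zero_add, pow_one, pow_zero, Module.End.one_apply,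
    Cx.sgn_of_mem _ (A.one_mem a)]
  simpa using A.one_mul x

lemma bar_one_right (x : (A.Hom a b).X) :
    A.bar a b (.cons x (.cons (A.one b) (.nil b))) = (A.Hom a b).sgn x := by
  simp only [bar, twist, length, zero_add, pow_one, pow_zero, Module.End.one_apply]
  exact A.mul_one _

lemma bar_one (l : χ[A] a b) (l' : χ[A] b c)
    (h : 2 ≤ l.length + l'.length) : A.bar a c (l.append (.cons (A.one b) l')) = 0 := by
  have e : ((A.Hom b b).sgn ^ l'.length) (A.one b) = A.one b := by
    have : (A.Hom b b).sgn (A.one b) = A.one b := by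
      rw [Cx.sgn_of_mem _ (A.one_mem b)]; simp
    rw [Module.End.pow_apply]
    exact Function.iterate_fixed this _
  rw [bar, twist_append, twist, e]
  refine A.m_one _ _ ?_
  simp only [length_append, length, length_map, length_twist]
  omega

lemma bar_mem (l : χ[A] a b) (n : ℤ) (h : l.Homogeneous n) :
    A.bar a b l ∈ (A.Hom a b).grade (n + l.length - 2) := by
  simpa [bar] using A.m_mem _ n h.twist

lemma bar_barScale (t : Kˣ) (l : χ[A] a b) :
    A.bar a b (l.map fun a b => (A.Hom a b).barScale t) =
      (t : K) • (A.Hom a b).barScale t (A.bar a b l) :=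
  barScale_of_mem_grade A.bar A.slotLinear_bar A.bar_mem t l

lemma bar_barSgn (l : χ[A] a b) :
    A.bar a b (l.map σ[A]) = -A.barSgn a b (A.bar a b l) := by
  simpa using A.bar_barScale (-1) l

lemma barSgn_barSgn (a b : Λ) (x : (A.Hom a b).X) : A.barSgn a b (A.barSgn a b x) = x := by
  simp [Cx.barScale_neg_one, Cx.sgn_sgn]

lemma insertSum_bar (l : χ[A] a b) :
    ι[A] (A.bar a b) l = 0 := by
  have := stasheffSum_eq (fun a b => A.m (a := a) (b := b)) A.slotLinear_m A.m_nil A.m_mem l.twist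
  rw [A.stasheff, twist_twist] at this
  exact this.symm

lemma map_bar {A B : AInfCat.{u,v,w} K Λ} (F : Mor A B) (l : χ[A] a b) :
    (F.φ a b).f (A.bar a b l) = B.bar a b (l.map fun a b => (F.φ a b).f) := by
  rw [bar, F.map_m, bar, twist_map _ fun a b x => (F.φ a b).map_sgn x]

end

/-- An A-infinity category given by the operations on suspensions. -/
def ofBar (M : Λ → Λ → Cx.{u,w} K) (b : ∀ a b, ChainOf M a b → (M a b).X)
    (slotLinear : ∀ a e, SlotLinear K (b a e)) (nil : ∀ a, b a a (.nil a) = 0)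
    (single : ∀ {a e : Λ} (x : (M a e).X), b a e (.cons x (.nil e)) = (M a e).d x)
    (mem : ∀ {a e : Λ} (l : ChainOf M a e) (n : ℤ),
      l.Homogeneous n → b a e l ∈ (M a e).grade (n + l.length - 2))
    (insert : ∀ {a e : Λ} (l : ChainOf M a e),
      insertSum (fun a b => (M a b).barScale (-1)) b (b a e) l = 0)
    (one : ∀ a, (M a a).X) (one_mem : ∀ a, one a ∈ (M a a).grade 0)
    (d_one : ∀ a, (M a a).d (one a) = 0)
    (one_left : ∀ {a e : Λ} (x : (M a e).X), b a e (.cons (one a) (.cons x (.nil e))) = x)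
    (one_right : ∀ {a e : Λ} (x : (M a e).X),
      b a e (.cons x (.cons (one e) (.nil e))) = (M a e).sgn x)
    (unit : ∀ {a e f : Λ} (l : ChainOf M a e) (l' : ChainOf M e f), 2 ≤ l.length + l'.length →
      b a f (l.append (.cons (one e) l')) = 0) : AInfCat.{u,v,w} K Λ where
  Hom := M
  m {a e} l := b a e l.twist
  m_nil := nil
  m_single := single
  m_add := (slotLinear _ _).twist.add
  m_smul := (slotLinear _ _).twist.smul
  m_mem l n h := by simpa using mem _ n h.twist
  stasheff l := by
    rw [stasheffSum_eq (fun a e (l : ChainOf M a e) => b a e l.twist)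
      (fun a e => (slotLinear a e).twist) nil fun l n h => by simpa using mem _ n h.twist]
    simp only [Chain.twist_twist]
    exact insert _
  one := one
  one_mem := one_mem
  d_one := d_one
  one_mul {a e} x := by
    have h1 : (M a a).sgn (one a) = one a := by rw [Cx.sgn_of_mem _ (one_mem a)]; simp
    simp only [Chain.twist, Chain.length, zero_add, pow_one, pow_zero, Module.End.one_apply, h1]
    exact one_left x
  mul_one {a e} x := by
    simp only [Chain.twist, Chain.length, zero_add, pow_one, pow_zero, Module.End.one_apply]
    rw [one_right, Cx.sgn_sgn]
  m_one {a e f} l l' h := by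
    have h1 : (M e e).sgn (one e) = one e := by rw [Cx.sgn_of_mem _ (one_mem e)]; simp
    have h2 : ((M e e).sgn ^ l'.length) (one e) = one e := by
      rw [Module.End.pow_apply]
      exact Function.iterate_fixed h1 _
    rw [Chain.twist_append, Chain.twist, h2]
    refine unit _ _ ?_
    simp only [Chain.length_append, Chain.length] at h
    simp only [Chain.length_map, Chain.length_twist]
    omega

end AInfCat

namespace Chain

variable {H : Λ → Λ → Type w} {N : Type*} [AddCommMonoid N]

lemma sumSplits_eq_first (c : Chain H a b) {g : ∀ e, Chain H a e → Chain H e b → N}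
    (h : ∀ e p q, 1 ≤ p.length → g e p q = 0) : c.sumSplits g = g a (nil a) c := by
  cases c with
  | nil => rfl
  | cons x l =>
    rw [sumSplits_cons, sumSplits_congr l (fun e p q _ => h e (cons x p) q (by simp [length])),
      sumSplits_zero, add_zero]

lemma sumSplits_eq_last (c : Chain H a b) {g : ∀ e, Chain H a e → Chain H e b → N}
    (h : ∀ e p q, 1 ≤ q.length → g e p q = 0) : c.sumSplits g = g b c (nil b) := by
  induction c with
  | nil => rfl
  | cons x l ih =>
    rw [sumSplits_cons, ih (fun e p q hq => h e _ q hq), h _ _ _ (by simp [length]), zero_add]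

end Chain

namespace AInfCat

variable (A : AInfCat.{u,v,w} K Λ)

open Chain

lemma barSgn_one (a : Λ) : A.barSgn a a (A.one a) = -A.one a := by
  simp [Cx.barScale_neg_one, Cx.sgn_of_mem _ (A.one_mem a)]

lemma barScale_comm (t s : Kˣ) (x : (A.Hom a b).X) :
    (A.Hom a b).barScale t ((A.Hom a b).barScale s x) =
      (A.Hom a b).barScale s ((A.Hom a b).barScale t x) := by
  induction x using (A.Hom a b).homogeneous_induction with
  | mem n x hx =>
    rw [Cx.barScale_of_mem _ s hx, map_smul, Cx.barScale_of_mem _ t hx, map_smul,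
      Cx.barScale_of_mem _ s hx, smul_comm]
  | add x y hx hy => simp only [map_add, hx, hy]

lemma map_barSgn_barSgn (c : χ[A] a b) :
    (c.map σ[A]).map σ[A] = c := by
  rw [AInfCat.chain_map_map]; exact map_id' A.barSgn_barSgn c

section InsertSum

variable {N : Type*} [AddCommGroup N] [Module K N]

lemma insertSum_map_barScale (t : Kˣ) {Ψ : χ[A] a b → N}
    (h : SlotLinear K Ψ) (c : χ[A] a b) :
    ι[A] Ψ (c.map fun a b => (A.Hom a b).barScale t) =
      (t : K) • ι[A]
        (fun l => Ψ (l.map fun a b => (A.Hom a b).barScale t)) c := by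
  have hc : ∀ a b (x : (A.Hom a b).X), A.barSgn a b ((A.Hom a b).barScale t x) =
      (A.Hom a b).barScale t (A.barSgn a b x) := fun a b x => A.barScale_comm _ _ x
  simp only [insertSum, smul_sumSplits, sumSplits_map]
  congr 1; funext e p w; congr 1; funext f q s
  rw [A.bar_barScale, h.smul, map_append, Chain.map, AInfCat.chain_map_map, AInfCat.chain_map_map,
    map_congr hc]

lemma insertSum_one {a e f : Λ} (l : χ[A] a e) (l' : χ[A] e f)
    {Ψ : χ[A] a f → N} (h : SlotLinear K Ψ)
    (hΨ : ∀ (p : χ[A] a e) (q : χ[A] e f), 1 ≤ p.length + q.length →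
      Ψ (p.append (cons (A.one e) q)) = 0) :
    ι[A] Ψ (l.append (cons (A.one e) l')) =
      (if l'.length = 0 then 0 else Ψ ((l.map σ[A]).append l')) -
        (if l.length = 0 then 0 else Ψ ((l.map σ[A]).append l')) := by
  induction l with
  | nil a =>
    have h1 : ι[A] (fun l => Ψ (cons (A.barSgn a a (A.one a)) l)) l' = 0 := by
      unfold insertSum
      refine (sumSplits_congr _ fun e p w _ => (sumSplits_congr _ fun f q t _ => ?_).trans
        (sumSplits_zero _)).trans (sumSplits_zero _)
      have := hΨ (nil a) ((p.map σ[A]).append (cons (A.bar _ _ q) t))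
        (by simp only [length_append, length]; omega)
      show Ψ (cons (A.barSgn a a (A.one a)) _) = 0
      rw [A.barSgn_one, h.cons_neg]
      exact neg_eq_zero.2 this
    simp only [Chain.append, insertSum_cons, h1, add_zero, Chain.map, length, sumSplits_cons,
      bar_nil, h.cons_zero, zero_add, ↓reduceIte, sub_zero]
    cases l' with
    | nil => simp [bar_single, d_one, h.cons_zero, length]
    | cons x l' =>
      rw [sumSplits_cons, bar_single, d_one, h.cons_zero, zero_add, sumSplits_eq_first,
        bar_one_left]
      · simp [length]
      · intro e p q hp
        have := A.bar_one (nil a) (cons x p) (by simp only [length]; omega)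
        rw [Chain.append] at this
        rw [this, h.cons_zero]
  | @cons a b e x l ih =>
    have h1 : (((cons x l).append (cons (A.one e) l')).sumSplits fun _ q t =>
        Ψ (cons (A.bar _ _ q) t)) =
        if l.length = 0 then -Ψ (((cons x l).map σ[A]).append l') else 0 := by
      rw [sumSplits_append_cons, sumSplits_congr (cons x l) (g' := fun _ _ _ => 0),
        sumSplits_zero, zero_add, sumSplits_eq_first]
      · cases l with
        | nil =>
          simp only [Chain.append, bar_one_right, length, if_true, Chain.map]
          rw [← h.cons_neg]
          simp [Cx.barScale_neg_one]
        | cons y l =>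
          rw [A.bar_one _ _ (by simp only [length]; omega), h.cons_zero]
          simp [length]
      · intro f p q hp
        rw [A.bar_one _ _ (by simp only [length]; omega), h.cons_zero]
      · intro f p q _
        have := hΨ (cons (A.bar _ _ p) q) l' (by simp only [length]; omega)
        rw [Chain.append] at this
        exact this
    rw [show (cons x l).append (cons (A.one e) l') = cons x (l.append (cons (A.one e) l')) from rfl]
      at h1 ⊢
    rw [insertSum_cons, h1, ih l' (h.cons _) fun p q _ => hΨ (cons (A.barSgn _ _ x) p) q (by simp only [length]; omega)]
    by_cases h2 : l.length = 0 <;> by_cases h3 : l'.length = 0 <;>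
      simp [h2, h3, length, Chain.map, Chain.append]

end InsertSum

/-- The relations defining the enveloping algebra of an A-infinity category. -/
structure IsTau {B : Type*} [Ring B] [Algebra K B] (g : ∀ a b, χ[A] a b → B) : Prop where
  slotLinear : ∀ a b, SlotLinear K (g a b)
  nil : ∀ a, g a a (.nil a) = 0
  mul_eq_zero : ∀ {a b a' b' : Λ} (c : χ[A] a b) (c' : χ[A] a' b'), b ≠ a' →
    g a b c * g a' b' c' = 0
  one_mul : ∀ {a b : Λ} (c : χ[A] a b),
    g a a (.cons (A.one a) (.nil a)) * g a b c = g a b c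
  mul_one : ∀ {a b : Λ} (c : χ[A] a b),
    g a b c * g b b (.cons (A.one b) (.nil b)) = g a b c
  unit : ∀ {a b c : Λ} (l : χ[A] a b) (l' : χ[A] b c),
    1 ≤ l.length + l'.length → g a c (l.append (.cons (A.one b) l')) = 0

/-- The free algebra on chains. -/
abbrev FreeEnv := FreeAlgebra K (Σ a b, χ[A] a b)

inductive EnvRel : FreeEnv A → FreeEnv A → Prop
  | add {a b c e : Λ} (l : χ[A] a b) (x y : (A.Hom b c).X) (l' : χ[A] c e) :
    EnvRel (FreeAlgebra.ι K ⟨a, e, l.append (.cons (x + y) l')⟩)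
      (FreeAlgebra.ι K ⟨a, e, l.append (.cons x l')⟩ +
        FreeAlgebra.ι K ⟨a, e, l.append (.cons y l')⟩)
  | smul {a b c e : Λ} (l : χ[A] a b) (k : K) (x : (A.Hom b c).X)
    (l' : χ[A] c e) : EnvRel (FreeAlgebra.ι K ⟨a, e, l.append (.cons (k • x) l')⟩)
      (k • FreeAlgebra.ι K ⟨a, e, l.append (.cons x l')⟩)
  | nil (a : Λ) : EnvRel (FreeAlgebra.ι K ⟨a, a, .nil a⟩) 0
  | mul_eq_zero {a b a' b' : Λ} (c : χ[A] a b) (c' : χ[A] a' b') (h : b ≠ a') :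
    EnvRel (FreeAlgebra.ι K ⟨a, b, c⟩ * FreeAlgebra.ι K ⟨a', b', c'⟩) 0
  | one_mul {a b : Λ} (c : χ[A] a b) :
    EnvRel (FreeAlgebra.ι K ⟨a, a, .cons (A.one a) (.nil a)⟩ * FreeAlgebra.ι K ⟨a, b, c⟩)
      (FreeAlgebra.ι K ⟨a, b, c⟩)
  | mul_one {a b : Λ} (c : χ[A] a b) :
    EnvRel (FreeAlgebra.ι K ⟨a, b, c⟩ * FreeAlgebra.ι K ⟨b, b, .cons (A.one b) (.nil b)⟩)
      (FreeAlgebra.ι K ⟨a, b, c⟩)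
  | unit {a b c : Λ} (l : χ[A] a b) (l' : χ[A] b c)
    (h : 1 ≤ l.length + l'.length) :
    EnvRel (FreeAlgebra.ι K ⟨a, c, l.append (.cons (A.one b) l')⟩) 0

/-- The enveloping algebra: the total algebra of the normalized cobar construction of the bar
construction. -/
def Env : Type max u v w := RingQuot (EnvRel A)

instance : Ring (Env A) := inferInstanceAs (Ring (RingQuot (EnvRel A)))
instance : Algebra K (Env A) := inferInstanceAs (Algebra K (RingQuot (EnvRel A)))

def tau (a b : Λ) (c : χ[A] a b) : Env A :=
  RingQuot.mkAlgHom K (EnvRel A) (FreeAlgebra.ι K ⟨a, b, c⟩)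

lemma isTau_tau : A.IsTau A.tau where
  slotLinear a b :=
    ⟨fun l x y l' => (RingQuot.mkAlgHom_rel K (EnvRel.add l x y l')).trans (map_add _ _ _),
      fun l k x l' => (RingQuot.mkAlgHom_rel K (EnvRel.smul l k x l')).trans (map_smul _ _ _)⟩
  nil a := (RingQuot.mkAlgHom_rel K (EnvRel.nil a)).trans (map_zero _)
  mul_eq_zero c c' h := (map_mul _ _ _).symm.trans
    ((RingQuot.mkAlgHom_rel K (EnvRel.mul_eq_zero c c' h)).trans (map_zero _))
  one_mul c := (map_mul _ _ _).symm.trans (RingQuot.mkAlgHom_rel K (EnvRel.one_mul c))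
  mul_one c := (map_mul _ _ _).symm.trans (RingQuot.mkAlgHom_rel K (EnvRel.mul_one c))
  unit l l' h := (RingQuot.mkAlgHom_rel K (EnvRel.unit l l' h)).trans (map_zero _)

variable {A}

/-- The universal property of the enveloping algebra. -/
def IsTau.lift {B : Type*} [Ring B] [Algebra K B]
    {g : ∀ a b, χ[A] a b → B} (h : A.IsTau g) : Env A →ₐ[K] B :=
  RingQuot.liftAlgHom K ⟨FreeAlgebra.lift K fun s => g s.1 s.2.1 s.2.2, fun x y hxy => by
    induction hxy with
    | add l x y l' => simpa using (h.slotLinear _ _).add l x y l'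
    | smul l k x l' => simpa using (h.slotLinear _ _).smul l k x l'
    | nil a => simpa using h.nil a
    | mul_eq_zero c c' hne => simpa using h.mul_eq_zero c c' hne
    | one_mul c => simpa using h.one_mul c
    | mul_one c => simpa using h.mul_one c
    | unit l l' hl => simpa using h.unit l l' hl⟩

@[simp] lemma IsTau.lift_tau {B : Type*} [Ring B] [Algebra K B]
    {g : ∀ a b, χ[A] a b → B} (h : A.IsTau g) (c : χ[A] a b) :
    h.lift (A.tau a b c) = g a b c :=
  (RingQuot.liftAlgHom_mkAlgHom_apply _ _ _ _).trans (FreeAlgebra.lift_ι_apply _ _)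

lemma Env.induction {p : Env A → Prop} (r : Env A) (scalar : ∀ k : K, p (algebraMap K _ k))
    (tau : ∀ {a b : Λ} (c : χ[A] a b), p (A.tau a b c))
    (mul : ∀ r s, p r → p s → p (r * s)) (add : ∀ r s, p r → p s → p (r + s)) : p r := by
  obtain ⟨x, rfl⟩ := RingQuot.mkAlgHom_surjective K (EnvRel A) r
  induction x using FreeAlgebra.induction with
  | grade0 k => rw [AlgHom.commutes]; exact scalar k
  | grade1 s => exact tau s.2.2
  | mul x y hx hy => rw [map_mul]; exact mul _ _ hx hy
  | add x y hx hy => rw [map_add]; exact add _ _ hx hy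

lemma Env.algHom_ext {B : Type*} [Ring B] [Algebra K B] {f g : Env A →ₐ[K] B}
    (h : ∀ {a b : Λ} (c : χ[A] a b), f (A.tau a b c) = g (A.tau a b c)) (r : Env A) :
    f r = g r := by
  induction r using Env.induction with
  | scalar k => rw [AlgHom.commutes, AlgHom.commutes]
  | tau c => exact h c
  | mul r s hr hs => rw [map_mul, map_mul, hr, hs]
  | add r s hr hs => rw [map_add, map_add, hr, hs]

variable (A)

lemma slotLinear_tau (a b : Λ) : SlotLinear K (A.tau a b) := A.isTau_tau.slotLinear a b

def idem (a : Λ) : Env A := A.tau a a (.cons (A.one a) (.nil a))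

lemma idem_mul_tau (c : χ[A] a b) : A.idem a * A.tau a b c = A.tau a b c :=
  A.isTau_tau.one_mul c

lemma tau_mul_idem (c : χ[A] a b) : A.tau a b c * A.idem b = A.tau a b c :=
  A.isTau_tau.mul_one c

lemma idem_mul_idem (a : Λ) : A.idem a * A.idem a = A.idem a := A.idem_mul_tau _

lemma idem_mul_idem_of_ne (h : a ≠ b) : A.idem a * A.idem b = 0 :=
  A.isTau_tau.mul_eq_zero _ _ h

lemma isTau_scale (t : Kˣ) : A.IsTau fun a b c =>
    ((t⁻¹ : Kˣ) : K) • A.tau a b (c.map fun a b => (A.Hom a b).barScale t) := by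
  have h1 : ∀ a, (A.Hom a a).barScale t (A.one a) = (t : K) • A.one a := fun a => by
    simp [Cx.barScale_of_mem _ t (A.one_mem a)]
  have h2 : ∀ a, ((t⁻¹ : Kˣ) : K) • A.tau a a ((Chain.cons (A.one a) (.nil a)).map
      fun a b => (A.Hom a b).barScale t) = A.idem a := fun a => by
    rw [Chain.map, h1, (A.slotLinear_tau a a).cons_smul, smul_smul, Units.inv_mul, one_smul]; rfl
  refine ⟨fun a b => ((A.slotLinear_tau a b).map _).const_smul _, fun a => ?_,
    fun c c' h => ?_, fun c => ?_, fun c => ?_, fun l l' h => ?_⟩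
  · rw [Chain.map, A.isTau_tau.nil, smul_zero]
  · rw [smul_mul_smul_comm, A.isTau_tau.mul_eq_zero _ _ h, smul_zero]
  · rw [h2, mul_smul_comm, idem_mul_tau]
  · rw [h2, smul_mul_assoc, tau_mul_idem]
  · rw [map_append, Chain.map, h1, (A.slotLinear_tau _ _).smul,
      A.isTau_tau.unit _ _ (by rw [length_map, length_map]; exact h), smul_zero, smul_zero]

/-- Multiplication by `t ^ n` in degree `n`. -/
def envScale (t : Kˣ) : Env A →ₐ[K] Env A := (A.isTau_scale t).lift

lemma envScale_tau (t : Kˣ) (c : χ[A] a b) :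
    A.envScale t (A.tau a b c) =
      ((t⁻¹ : Kˣ) : K) • A.tau a b (c.map fun a b => (A.Hom a b).barScale t) :=
  IsTau.lift_tau _ _

abbrev envSgn : Env A →ₐ[K] Env A := A.envScale (-1)

lemma envSgn_tau (c : χ[A] a b) :
    A.envSgn (A.tau a b c) = -A.tau a b (c.map σ[A]) := by simp [envScale_tau]

lemma envScale_idem (t : Kˣ) (a : Λ) : A.envScale t (A.idem a) = A.idem a := by
  rw [idem, envScale_tau, Chain.map, Cx.barScale_of_mem _ t (A.one_mem a),
    (A.slotLinear_tau a a).cons_smul]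
  simp [Chain.map]

lemma envScale_comm (t s : Kˣ) (r : Env A) :
    A.envScale t (A.envScale s r) = A.envScale s (A.envScale t r) := by
  refine Env.algHom_ext (f := (A.envScale t).comp (A.envScale s))
    (g := (A.envScale s).comp (A.envScale t)) (fun c => ?_) r
  simp only [AlgHom.comp_apply, envScale_tau, map_smul, AInfCat.chain_map_map]
  rw [smul_comm, map_congr fun a b x => A.barScale_comm t s x]

lemma envSgn_envSgn (r : Env A) : A.envSgn (A.envSgn r) = r := by
  refine Env.algHom_ext (f := A.envSgn.comp A.envSgn) (g := AlgHom.id K _) (fun c => ?_) r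
  simp only [AlgHom.comp_apply, envSgn_tau, map_neg, neg_neg, map_barSgn_barSgn, AlgHom.id_apply]

/-- The differential on generators. -/
def delta (a b : Λ) (c : χ[A] a b) : Env A :=
  ι[A] (A.tau a b) c +
    c.sumSplits fun _ p q => A.tau _ _ (p.map σ[A]) * A.tau _ _ q

lemma slotLinear_delta (a b : Λ) : SlotLinear K (A.delta a b) := by
  refine (slotLinear_insertSum A.slotLinear_bar (A.slotLinear_tau a b)).add_fun
    (SlotLinear.sumSplits (fun e q => ?_) fun e p => ?_)
  · exact ((A.slotLinear_tau a e).map _).comp (LinearMap.mulRight K _)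
  · exact (A.slotLinear_tau e b).comp (LinearMap.mulLeft K _)

lemma idem_mul_delta (c : χ[A] a b) :
    A.idem a * A.delta a b c = A.delta a b c := by
  have h1 := map_insertSum (s := A.barSgn) (b := A.bar) (LinearMap.mulLeft K (A.idem a))
    (A.tau a b) c
  have h2 := map_sumSplits (LinearMap.mulLeft K (A.idem a)) c
    fun _ p q => A.tau _ _ (p.map σ[A]) * A.tau _ _ q
  simp only [LinearMap.mulLeft_apply, ← mul_assoc, idem_mul_tau] at h1 h2
  rw [delta, mul_add, h1, h2]

lemma delta_mul_idem (c : χ[A] a b) :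
    A.delta a b c * A.idem b = A.delta a b c := by
  have h1 := map_insertSum (s := A.barSgn) (b := A.bar) (LinearMap.mulRight K (A.idem b))
    (A.tau a b) c
  have h2 := map_sumSplits (LinearMap.mulRight K (A.idem b)) c
    fun _ p q => A.tau _ _ (p.map σ[A]) * A.tau _ _ q
  simp only [LinearMap.mulRight_apply, mul_assoc, tau_mul_idem] at h1 h2
  rw [delta, add_mul, h1, h2]

lemma delta_idem (a : Λ) : A.delta a a (.cons (A.one a) (.nil a)) = 0 := by
  simp [delta, insertSum, sumSplits_cons, bar_nil, bar_single, d_one, (A.slotLinear_tau a a).cons_zero,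
    Chain.map, Chain.append, A.isTau_tau.nil]
  have := (A.slotLinear_tau a a).zero_slot (.cons (A.barSgn a a (A.one a)) (.nil a)) (.nil a)
  simpa only [Chain.append] using this

lemma delta_one (l : χ[A] a b) (l' : χ[A] b c)
    (h : 1 ≤ l.length + l'.length) : A.delta a c (l.append (.cons (A.one b) l')) = 0 := by
  rw [delta, A.insertSum_one l l' (A.slotLinear_tau a c) fun p q h => A.isTau_tau.unit p q h,
    sumSplits_append_cons, sumSplits_eq_last l, sumSplits_eq_first l']
  · have e1 : A.tau _ _ (l.map σ[A]) *
        A.tau _ _ ((Chain.nil b).append (.cons (A.one b) l')) = if l'.length = 0 then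
          A.tau _ _ ((l.map σ[A]).append l') else 0 := by
      cases l' with
      | nil =>
        rw [append_nil]
        exact A.tau_mul_idem _
      | cons y l' =>
        rw [A.isTau_tau.unit _ _ (by simp [length]), mul_zero]; simp [length]
    have e2 : A.tau _ _ ((l.append (.cons (A.one b) (.nil b))).map σ[A]) *
        A.tau _ _ l' = if l.length = 0 then
          -A.tau _ _ ((l.map σ[A]).append l') else 0 := by
      cases l with
      | nil =>
        simp only [Chain.append, Chain.map, barSgn_one, (A.slotLinear_tau _ _).cons_neg, length,
          if_true, neg_mul]
        exact congrArg _ (A.idem_mul_tau l')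
      | cons y l =>
        rw [map_append]
        simp only [Chain.map, barSgn_one]
        rw [(A.slotLinear_tau _ _).neg_slot, A.isTau_tau.unit _ _ (by simp only [length]; omega)]
        simp [length]
    rw [e1, e2]
    by_cases h1 : l.length = 0 <;> by_cases h2 : l'.length = 0 <;> simp [h1, h2]
  · intro e p q hp
    rw [map_append, Chain.map, barSgn_one, (A.slotLinear_tau _ _).neg_slot,
      A.isTau_tau.unit _ _ (by simp only [length_map]; omega), neg_zero, zero_mul]
  · intro e p q hq
    rw [A.isTau_tau.unit _ _ (by omega), mul_zero]

lemma isTau_matrix : A.IsTau fun a b c =>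
    (!![A.envSgn (A.tau a b c), A.delta a b c; 0, A.tau a b c] : Matrix (Fin 2) (Fin 2) (Env A)) := by
  have hs : ∀ {a b} (c : χ[A] a b), A.idem a * A.tau a b (c.map σ[A]) =
      A.tau a b (c.map σ[A]) := fun c => A.idem_mul_tau _
  refine ⟨fun a b => ⟨fun l x y l' => ?_, fun l k x l' => ?_⟩, fun a => ?_, fun {a b a' b'} c c' h => ?_,
    fun c => ?_, fun c => ?_, fun l l' h => ?_⟩
  · rw [(A.slotLinear_tau a b).add, (A.slotLinear_delta a b).add]
    ext i j; fin_cases i <;> fin_cases j <;> simp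
  · rw [(A.slotLinear_tau a b).smul, (A.slotLinear_delta a b).smul]
    ext i j; fin_cases i <;> fin_cases j <;> simp
  · have : A.delta a a (.nil a) = 0 := by
      simp [delta, insertSum, bar_nil, (A.slotLinear_tau a a).cons_zero, Chain.map, Chain.append,
        A.isTau_tau.nil]
    rw [this, A.isTau_tau.nil]
    ext i j; fin_cases i <;> fin_cases j <;> simp
  · have h1 : ∀ x y : Env A, x * A.idem b = x → A.idem a' * y = y → x * y = 0 := by
      intro x y hx hy
      rw [← hx, ← hy, mul_assoc, ← mul_assoc (A.idem b), A.idem_mul_idem_of_ne h, zero_mul, mul_zero]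
    rw [Matrix.mul_fin_two, ← map_mul, A.isTau_tau.mul_eq_zero c c' h,
      h1 _ _ (A.delta_mul_idem c) (A.idem_mul_tau c'), envSgn_tau,
      h1 _ _ (by rw [neg_mul, tau_mul_idem]) (A.idem_mul_delta c')]
    ext i j; fin_cases i <;> fin_cases j <;> simp
  · rw [Matrix.mul_fin_two, ← map_mul, A.isTau_tau.one_mul, delta_idem,
      show A.tau _ _ _ = A.idem _ from rfl, envScale_idem, idem_mul_delta]
    ext i j; fin_cases i <;> fin_cases j <;> simp
  · rw [Matrix.mul_fin_two, ← map_mul, A.isTau_tau.mul_one, delta_idem,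
      show A.tau _ _ (.cons (A.one _) _) = A.idem _ from rfl, delta_mul_idem]
    ext i j; fin_cases i <;> fin_cases j <;> simp
  · rw [A.isTau_tau.unit l l' h, delta_one A l l' h]
    ext i j; fin_cases i <;> fin_cases j <;> simp

/-- The differential of the enveloping algebra, together with the parity involution and the
identity. -/
def envMatrix : Env A →ₐ[K] Matrix (Fin 2) (Fin 2) (Env A) := A.isTau_matrix.lift

lemma envMatrix_tau (c : χ[A] a b) : A.envMatrix (A.tau a b c) =
    !![A.envSgn (A.tau a b c), A.delta a b c; 0, A.tau a b c] := IsTau.lift_tau _ _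

lemma envMatrix_eq (r : Env A) : A.envMatrix r = !![A.envSgn r, A.envMatrix r 0 1; 0, r] := by
  induction r using Env.induction with
  | scalar k =>
    ext i j
    fin_cases i <;> fin_cases j <;> simp [Matrix.algebraMap_matrix_apply]
  | tau c => simp [envMatrix_tau]
  | mul r s hr hs =>
    rw [map_mul, hr, hs, Matrix.mul_fin_two]
    simp
  | add r s hr hs =>
    rw [map_add, hr, hs]
    ext i j
    fin_cases i <;> fin_cases j <;> simp

def envD : Env A →ₗ[K] Env A where
  toFun r := A.envMatrix r 0 1
  map_add' r s := by simp
  map_smul' k r := by simp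

lemma envD_tau (c : χ[A] a b) : A.envD (A.tau a b c) = A.delta a b c := by
  change A.envMatrix _ 0 1 = _
  rw [envMatrix_tau]; rfl

lemma envD_mul (r s : Env A) : A.envD (r * s) = A.envD r * s + A.envSgn r * A.envD s := by
  change A.envMatrix _ 0 1 = _
  have h : A.envMatrix (r * s) 0 1 =
      A.envSgn r * A.envMatrix s 0 1 + A.envMatrix r 0 1 * s := by
    rw [map_mul]
    conv_lhs => rw [envMatrix_eq A r, envMatrix_eq A s, Matrix.mul_fin_two]
    simp
  rw [h, add_comm]
  rfl

lemma envD_scalar (k : K) : A.envD (algebraMap K _ k) = 0 := by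
  change A.envMatrix _ 0 1 = _
  simp [Matrix.algebraMap_matrix_apply]

lemma envD_idem (a : Λ) : A.envD (A.idem a) = 0 := (A.envD_tau _).trans (A.delta_idem a)

lemma envScale_envD (t : Kˣ) (r : Env A) :
    A.envScale t (A.envD r) = ((t⁻¹ : Kˣ) : K) • A.envD (A.envScale t r) := by
  induction r using Env.induction with
  | scalar k => simp only [AlgHom.commutes, envD_scalar, map_zero, smul_zero]
  | tau c =>
    have h1 := map_insertSum (s := A.barSgn) (b := A.bar) (A.envScale t).toLinearMap (A.tau _ _) c
    have h2 := map_insertSum (s := A.barSgn) (b := A.bar)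
      (((t⁻¹ : Kˣ) : K) • (LinearMap.id : Env A →ₗ[K] Env A))
      (fun l => A.tau _ _ (l.map fun a b => (A.Hom a b).barScale t)) c
    simp only [AlgHom.toLinearMap_apply, envScale_tau, LinearMap.smul_apply, LinearMap.id_apply]
      at h1 h2
    rw [envScale_tau, map_smul, envD_tau, envD_tau, delta, delta, map_add, h1, ← h2, map_sumSplits,
      A.insertSum_map_barScale t (A.slotLinear_tau _ _), sumSplits_map, smul_add, smul_add,
      smul_smul _ (t : K), Units.inv_mul, one_smul, smul_sumSplits, smul_sumSplits]
    congr 2; funext e p q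
    rw [map_mul, envScale_tau, envScale_tau, smul_mul_smul_comm, smul_smul, AInfCat.chain_map_map,
      AInfCat.chain_map_map, map_congr fun a b x => A.barScale_comm t (-1) x]
  | mul r s hr hs =>
    rw [envD_mul, map_mul, envD_mul, map_add, map_mul, map_mul, hr, hs, smul_add,
      ← A.envScale_comm t (-1), smul_mul_assoc, mul_smul_comm]
  | add r s hr hs => simp only [map_add, hr, hs, smul_add]

lemma envSgn_envD (r : Env A) : A.envSgn (A.envD r) = -A.envD (A.envSgn r) := by simp [envScale_envD]

lemma envD_envD (r : Env A) : A.envD (A.envD r) = 0 := by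
  induction r using Env.induction with
  | scalar k => rw [envD_scalar, map_zero]
  | tau c =>
    have h1 : ∀ {a b} (p : χ[A] a b),
        ι[A] (A.tau a b) (p.map σ[A]) =
        -ι[A] (fun l => A.tau a b (l.map σ[A])) p := by
      intro a b p
      rw [A.insertSum_map_barScale (-1) (A.slotLinear_tau a b)]; simp
    have h2 : ∀ {a b} (p : χ[A] a b) (y : Env A),
        ι[A] (fun l => A.tau a b (l.map σ[A]) * y) p =
        ι[A] (fun l => A.tau a b (l.map σ[A])) p * y :=
      fun p y => (map_insertSum (LinearMap.mulRight K y) _ p).symm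
    have h3 : ∀ {a b} (p : χ[A] a b) (y : Env A),
        ι[A] (fun l => y * A.tau a b l) p =
        y * ι[A] (A.tau a b) p :=
      fun p y => (map_insertSum (LinearMap.mulLeft K y) _ p).symm
    have h4 : ∀ {a b} (p : χ[A] a b), ι[A] (A.delta a b) p =
        p.sumSplits fun _ p q =>
          ι[A] (fun l => A.tau _ _ (l.map σ[A])) p *
            A.tau _ _ q + A.tau _ _ p * ι[A] (A.tau _ _) q := by
      intro a b p
      have e1 : ι[A] (A.delta a b) p =
          ι[A] (ι[A] (A.tau a b)) p +
          ι[A] (fun c => c.sumSplits fun _ p q =>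
            A.tau _ _ (p.map σ[A]) * A.tau _ _ q) p := by
        unfold delta
        conv_lhs => unfold insertSum
        simp only [sumSplits_add]
        rfl
      rw [e1, insertSum_insertSum A.barSgn_barSgn A.bar_barSgn A.insertSum_bar (A.slotLinear_tau a b),
        zero_add, insertSum_sumSplits]
      simp only [h2, h3, map_barSgn_barSgn]
    rw [envD_tau]
    conv_lhs => rw [delta]
    rw [map_add, map_insertSum]
    simp only [envD_tau, h4]
    rw [map_sumSplits, ← sumSplits_add]
    simp only [envD_mul, envD_tau, envSgn_tau, map_barSgn_barSgn]
    have e2 : ∀ {a b : Λ} e (p : χ[A] a e) (q : χ[A] e b),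
        (ι[A] (fun l => A.tau a e (l.map σ[A])) p *
            A.tau e b q + A.tau a e p * ι[A] (A.tau e b) q) +
          (A.delta a e (p.map σ[A]) * A.tau e b q +
            -A.tau a e p * A.delta e b q) =
        (p.sumSplits fun f p1 p2 => A.tau a f p1 * A.tau f e (p2.map σ[A]) *
          A.tau e b q) + -(q.sumSplits fun f q1 q2 =>
            A.tau a e p * A.tau e f (q1.map σ[A]) * A.tau f b q2) := by
      intro a b e p q
      have e3 := map_sumSplits (LinearMap.mulRight K (A.tau e b q)) p fun f p1 p2 =>
        A.tau a f p1 * A.tau f e (p2.map σ[A])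
      have e4 := map_sumSplits (LinearMap.mulLeft K (A.tau a e p)) q fun f q1 q2 =>
        A.tau e f (q1.map σ[A]) * A.tau f b q2
      simp only [LinearMap.mulRight_apply, LinearMap.mulLeft_apply, ← mul_assoc] at e3 e4
      rw [← e3, ← e4, delta, delta, h1, sumSplits_map]
      simp only [map_barSgn_barSgn]
      noncomm_ring
    simp only [e2]
    rw [sumSplits_add, ← neg_sumSplits, add_neg_eq_zero]
    exact (sumSplits_assoc _ fun _ _ p q t =>
      A.tau _ _ p * A.tau _ _ (q.map σ[A]) * A.tau _ _ t).symm
  | mul r s hr hs =>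
    rw [envD_mul, map_add, envD_mul, envD_mul, hr, hs, envSgn_envSgn, envSgn_envD]
    simp
  | add r s hr hs => simp only [map_add, hr, hs, add_zero]

end AInfCat

namespace Cx

lemma mem_grade_of_scale [CharZero K] (V : Cx.{u,w} K) {n : ℤ} {x : V.X}
    (h : ∀ t : Kˣ, V.scale t x = ((t ^ n : Kˣ) : K) • x) : x ∈ V.grade n := by
  let t : Kˣ := Units.mk0 2 two_ne_zero
  have inj : Function.Injective fun n : ℤ => ((t ^ n : Kˣ) : K) := by
    intro a b hab
    have hab' : (2 : K) ^ a = 2 ^ b := by simpa [t] using hab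
    have : (((2 : ℚ) ^ a : ℚ) : K) = (((2 : ℚ) ^ b : ℚ) : K) := by push_cast; exact hab'
    exact zpow_right_injective₀ (by norm_num) (by norm_num) (Rat.cast_injective this)
  have ind := (Module.End.eigenspaces_iSupIndep (V.scale t)).comp inj
  have le : ∀ n, V.grade n ≤ Module.End.eigenspace (V.scale t) ((t ^ n : Kˣ) : K) := fun n x hx =>
    Module.End.mem_eigenspace_iff.2 (V.scale_of_mem t hx)
  have hx : x ∈ V.grade n ⊔ ⨆ (m) (_ : m ≠ n), V.grade m := by
    have : (⊤ : Submodule K V.X) ≤ V.grade n ⊔ ⨆ (m) (_ : m ≠ n), V.grade m := by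
      rw [← V.internal.submodule_iSup_eq_top]
      refine iSup_le fun m => ?_
      by_cases hm : m = n
      · subst hm; exact le_sup_left
      · exact le_trans (le_iSup₂_of_le m hm le_rfl) le_sup_right
    exact this trivial
  obtain ⟨y, hy, z, hz, rfl⟩ := Submodule.mem_sup.1 hx
  have hz' : z ∈ Module.End.eigenspace (V.scale t) ((t ^ n : Kˣ) : K) := by
    have h1 := Submodule.sub_mem _ (Module.End.mem_eigenspace_iff.2 (h t)) (le n hy)
    simpa using h1
  have h0 : z = 0 := by
    have := Submodule.disjoint_def.1 (ind n) z hz'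
    refine this ?_
    exact (iSup₂_mono fun m _ => le m) hz
  rw [h0, add_zero]; exact hy

lemma Hom.map_barScale {V W : Cx.{u,w} K} (f : Hom V W) (t : Kˣ) (x : V.X) :
    f.f (V.barScale t x) = W.barScale t (f.f x) := by
  simp [barScale, f.map_scale]

end Cx

lemma insertSum_map {H H' : Λ → Λ → Type w}
    [∀ a b, AddCommGroup (H a b)] [∀ a b, Module K (H a b)] [∀ a b, AddCommGroup (H' a b)]
    [∀ a b, Module K (H' a b)] {N : Type*} [AddCommGroup N] [Module K N]
    {s : ∀ a b, H a b →ₗ[K] H a b} {s' : ∀ a b, H' a b →ₗ[K] H' a b}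
    {β : ∀ a b : Λ, Chain H a b → H a b} {β' : ∀ a b : Λ, Chain H' a b → H' a b}
    (f : ∀ a b, H a b → H' a b) (hs : ∀ a b x, s' a b (f a b x) = f a b (s a b x))
    (hβ : ∀ a b c, β' a b (c.map f) = f a b (β a b c)) (Ψ : Chain H' a b → N)
    (c : Chain H a b) :
    insertSum s' β' Ψ (c.map f) = insertSum s β (fun l => Ψ (l.map f)) c := by
  unfold insertSum
  simp only [Chain.sumSplits_map, hβ]
  congr 1; funext e p w; congr 1; funext e' q t
  rw [Chain.map_append, Chain.map, AInfCat.chain_map_map, AInfCat.chain_map_map,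
    Chain.map_congr hs]

namespace AInfCat

open Chain

section Env

variable (A : AInfCat.{u,v,w} K Λ)

/-- The elements of degree `n` of the enveloping algebra. -/
def envGrade (n : ℤ) : Submodule K (Env A) where
  carrier := {r | ∀ t : Kˣ, A.envScale t r = ((t ^ n : Kˣ) : K) • r}
  add_mem' hx hy t := by rw [map_add, hx t, hy t, smul_add]
  zero_mem' t := by simp
  smul_mem' k x hx t := by rw [map_smul, hx t, smul_comm]

lemma tau_mem (c : χ[A] a b) {n : ℤ} (h : c.Homogeneous n) :
    A.tau a b c ∈ A.envGrade (n + c.length - 1) := fun t => by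
  rw [envScale_tau, (A.slotLinear_tau a b).map_barScale t h, smul_smul, ← Units.val_mul,
    ← zpow_neg_one, ← zpow_add]
  congr 3; ring

lemma mul_mem_envGrade {r s : Env A} {n m : ℤ} (hr : r ∈ A.envGrade n) (hs : s ∈ A.envGrade m) :
    r * s ∈ A.envGrade (n + m) := fun t => by
  rw [map_mul, hr t, hs t, smul_mul_smul_comm, ← Units.val_mul, ← zpow_add]

lemma algebraMap_mem (k : K) : algebraMap K (Env A) k ∈ A.envGrade 0 := fun t => by
  simp

lemma idem_mem (a : Λ) : A.idem a ∈ A.envGrade 0 := fun t => by simp [envScale_idem]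

lemma iSup_envGrade : ⨆ n, A.envGrade n = ⊤ := by
  refine eq_top_iff.2 fun r hr => ?_
  clear hr
  induction r using Env.induction with
  | scalar k => exact Submodule.mem_iSup_of_mem 0 (A.algebraMap_mem k)
  | @tau a b c =>
    rw [← Submodule.Quotient.mk_eq_zero]
    refine SlotLinear.ext_homogeneous
      ((A.slotLinear_tau a b).comp (Submodule.mkQ (⨆ n, A.envGrade n))) SlotLinear.zero
      (fun l n h => ?_) c
    exact (Submodule.Quotient.mk_eq_zero _).2 (Submodule.mem_iSup_of_mem _ (A.tau_mem l h))
  | mul r s hr hs =>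
    induction hr using Submodule.iSup_induction' with
    | mem n x hx =>
      induction hs using Submodule.iSup_induction' with
      | mem m y hy => exact Submodule.mem_iSup_of_mem _ (A.mul_mem_envGrade hx hy)
      | zero => rw [mul_zero]; exact Submodule.zero_mem _
      | add y z _ _ hy hz => rw [mul_add]; exact Submodule.add_mem _ hy hz
    | zero => rw [zero_mul]; exact Submodule.zero_mem _
    | add y z _ _ hy hz => rw [add_mul]; exact Submodule.add_mem _ hy hz
  | add r s hr hs => exact Submodule.add_mem _ hr hs

/-- The elements from `a` to `b` of the enveloping algebra. -/
def corner (a b : Λ) : Submodule K (Env A) where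
  carrier := {r | A.idem a * r = r ∧ r * A.idem b = r}
  add_mem' hx hy := ⟨by rw [mul_add, hx.1, hy.1], by rw [add_mul, hx.2, hy.2]⟩
  zero_mem' := ⟨mul_zero _, zero_mul _⟩
  smul_mem' k x hx := ⟨by rw [mul_smul_comm, hx.1], by rw [smul_mul_assoc, hx.2]⟩

def toCorner (a b : Λ) : Env A →ₗ[K] A.corner a b :=
  (LinearMap.mulLeft K (A.idem a) ∘ₗ LinearMap.mulRight K (A.idem b)).codRestrict _ fun r => by
    constructor
    · simp [← mul_assoc, idem_mul_idem]
    · simp [mul_assoc, idem_mul_idem]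

lemma coe_toCorner (r : Env A) :
    (A.toCorner a b r : Env A) = A.idem a * (r * A.idem b) := rfl

lemma toCorner_coe (r : A.corner a b) : A.toCorner a b r = r := by grind [coe_toCorner, r.2.2, r.2.1]

variable [CharZero K]

/-- The morphism complexes of the enveloping dg category. -/
def envCx (a b : Λ) : Cx.{u, max u v w} K where
  X := A.corner a b
  grade n := (A.envGrade n).comap (A.corner a b).subtype
  internal := by
    refine isInternal_of_eigenspaces _ ((A.toCorner a b) ∘ₗ
      (A.envScale (Units.mk0 2 two_ne_zero)).toLinearMap ∘ₗ (A.corner a b).subtype)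
      (fun n x hx => ?_) ?_
    · have h1 : A.envScale (Units.mk0 2 two_ne_zero) (x : Env A) = _ := hx (Units.mk0 2 two_ne_zero)
      simp only [LinearMap.comp_apply, AlgHom.toLinearMap_apply, Submodule.subtype_apply]
      rw [h1, map_smul, Submodule.subtype_apply, toCorner_coe]
      simp
    · refine eq_top_iff.2 fun x _ => ?_
      rw [← A.toCorner_coe x]
      have hx : (x : Env A) ∈ ⨆ n, A.envGrade n := by rw [A.iSup_envGrade]; trivial
      generalize (x : Env A) = x at hx
      induction hx using Submodule.iSup_induction' with
      | mem n x hx =>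
        refine Submodule.mem_iSup_of_mem n ?_
        have := A.mul_mem_envGrade (A.idem_mem a) (A.mul_mem_envGrade hx (A.idem_mem b))
        rw [add_zero, zero_add] at this
        exact this
      | zero => rw [map_zero]; exact Submodule.zero_mem _
      | add y z _ _ hy hz => rw [map_add]; exact Submodule.add_mem _ hy hz
  d := (A.envD ∘ₗ (A.corner a b).subtype).codRestrict _ fun r => by
    constructor
    · conv_rhs => rw [LinearMap.comp_apply, Submodule.subtype_apply, ← r.2.1, envD_mul, envD_idem,
        zero_mul, zero_add, envScale_idem]
      rfl
    · conv_rhs => rw [LinearMap.comp_apply, Submodule.subtype_apply, ← r.2.2, envD_mul, envD_idem,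
        mul_zero, add_zero]
      rfl
  d_mem {n x} hx t := by
    have h1 : A.envScale t (x : Env A) = _ := hx t
    change A.envScale t (A.envD x) = _ • A.envD x
    rw [envScale_envD, h1, map_smul, smul_smul, ← Units.val_mul, ← zpow_neg_one, ← zpow_add]
    congr 3; ring
  d_d x := Subtype.ext (A.envD_envD x)

def envVal (a b : Λ) : (A.envCx a b).X →ₗ[K] Env A := (A.corner a b).subtype

def toEnvCx (a b : Λ) : Env A →ₗ[K] (A.envCx a b).X := A.toCorner a b

variable {A} in
lemma envCx_ext {x y : (A.envCx a b).X} (h : A.envVal a b x = A.envVal a b y) :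
    x = y := Subtype.ext h

lemma envVal_toEnvCx (r : Env A) :
    A.envVal a b (A.toEnvCx a b r) = A.idem a * (r * A.idem b) := rfl

lemma toEnvCx_envVal (x : (A.envCx a b).X) : A.toEnvCx a b (A.envVal a b x) = x :=
  A.toCorner_coe x

lemma idem_mul_envVal (x : (A.envCx a b).X) :
    A.idem a * A.envVal a b x = A.envVal a b x := x.2.1

lemma envVal_mul_idem (x : (A.envCx a b).X) :
    A.envVal a b x * A.idem b = A.envVal a b x := x.2.2

lemma envVal_mem {x : (A.envCx a b).X} {n : ℤ} :
    x ∈ (A.envCx a b).grade n ↔ A.envVal a b x ∈ A.envGrade n := Iff.rfl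

lemma envVal_d (x : (A.envCx a b).X) :
    A.envVal a b ((A.envCx a b).d x) = A.envD (A.envVal a b x) := rfl

lemma d_toEnvCx (r : Env A) :
    (A.envCx a b).d (A.toEnvCx a b r) = A.toEnvCx a b (A.envD r) := by
  apply envCx_ext
  rw [envVal_d, envVal_toEnvCx, envVal_toEnvCx, envD_mul, envD_mul, envD_idem, envD_idem]
  simp [envScale_idem]

lemma envVal_scale (t : Kˣ) (x : (A.envCx a b).X) :
    A.envVal a b ((A.envCx a b).scale t x) = A.envScale t (A.envVal a b x) := by
  induction x using (A.envCx a b).homogeneous_induction with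
  | mem n x hx => rw [Cx.scale_of_mem _ t hx, map_smul]; exact (hx t).symm
  | add x y hx hy => simp only [map_add, hx, hy]

lemma envVal_sgn (x : (A.envCx a b).X) :
    A.envVal a b ((A.envCx a b).sgn x) = A.envSgn (A.envVal a b x) := by
  rw [← Cx.scale_neg_one, envVal_scale]

/-- The enveloping dg category. -/
def envCat : DGCat.{u,v,max u v w} K Λ where
  Hom := A.envCx
  mul {a b c} := LinearMap.mk₂ K (fun (x : A.corner a b) (y : A.corner b c) =>
      (⟨(x : Env A) * y, by rw [← mul_assoc, x.2.1], by rw [mul_assoc, y.2.2]⟩ : A.corner a c))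
    (fun x y z => Subtype.ext (add_mul _ _ _)) (fun k x y => Subtype.ext (smul_mul_assoc _ _ _))
    (fun x y z => Subtype.ext (mul_add _ _ _)) (fun k x y => Subtype.ext (mul_smul_comm _ _ _))
  mul_mem hx hy := A.mul_mem_envGrade hx hy
  d_mul {a b c} x y := Subtype.ext <| (A.envD_mul _ _).trans <| by
    change _ + A.envSgn (A.envVal a b x) * _ = _
    rw [← A.envVal_sgn]; rfl
  mul_assoc x y z := Subtype.ext (_root_.mul_assoc _ _ _)
  one a := ⟨A.idem a, A.idem_mul_idem a, A.idem_mul_idem a⟩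
  one_mem a := A.idem_mem a
  d_one a := Subtype.ext (A.envD_idem a)
  one_mul x := Subtype.ext x.2.1
  mul_one x := Subtype.ext x.2.2

end Env

section EnvMap

variable {A B C : AInfCat.{u,v,w} K Λ}

lemma isTau_map (F : Mor A B) :
    A.IsTau fun a b c => B.tau a b (c.map fun a b => (F.φ a b).f) := by
  refine ⟨fun a b => (B.slotLinear_tau a b).map _, fun a => B.isTau_tau.nil a,
    fun c c' h => B.isTau_tau.mul_eq_zero _ _ h, fun c => ?_, fun c => ?_, fun l l' h => ?_⟩
  · simp only [Chain.map, F.map_one]; exact B.idem_mul_tau _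
  · simp only [Chain.map, F.map_one]; exact B.tau_mul_idem _
  · simp only [map_append, Chain.map, F.map_one]
    exact B.isTau_tau.unit _ _ (by rw [length_map, length_map]; exact h)

def envMap (F : Mor A B) : Env A →ₐ[K] Env B := (isTau_map F).lift

lemma envMap_tau (F : Mor A B) (c : χ[A] a b) :
    envMap F (A.tau a b c) = B.tau a b (c.map fun a b => (F.φ a b).f) := IsTau.lift_tau _ _

lemma envMap_idem (F : Mor A B) (a : Λ) : envMap F (A.idem a) = B.idem a := by simp [idem, envMap_tau, Chain.map, F.map_one]

lemma envMap_envScale (F : Mor A B) (t : Kˣ) (r : Env A) :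
    envMap F (A.envScale t r) = B.envScale t (envMap F r) := by
  refine Env.algHom_ext (f := (envMap F).comp (A.envScale t))
    (g := (B.envScale t).comp (envMap F)) (fun c => ?_) r
  simp only [AlgHom.comp_apply, envScale_tau, map_smul, envMap_tau, chain_map_map,
    Cx.Hom.map_barScale]

lemma envMap_envD (F : Mor A B) (r : Env A) : envMap F (A.envD r) = B.envD (envMap F r) := by
  induction r using Env.induction with
  | scalar k => simp only [envD_scalar, map_zero, AlgHom.commutes]
  | @tau a b c =>
    rw [envMap_tau, envD_tau, envD_tau, delta, delta, map_add,
      insertSum_map (s := A.barSgn) (β := A.bar) _ (fun a b x => ((F.φ a b).map_barScale _ x).symm)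
        fun a b c => (map_bar F c).symm]
    have h1 := map_insertSum (s := A.barSgn) (b := A.bar) (envMap F).toLinearMap (A.tau a b) c
    simp only [AlgHom.toLinearMap_apply, envMap_tau] at h1
    rw [h1, map_sumSplits, sumSplits_map]
    simp only [map_mul, envMap_tau, chain_map_map, Cx.Hom.map_barScale]
  | mul r s hr hs => simp only [envD_mul, map_add, map_mul, hr, hs, envMap_envScale]
  | add r s hr hs => simp only [map_add, hr, hs]

lemma envMap_mem_corner (F : Mor A B) {r : Env A} (h : r ∈ A.corner a b) :
    envMap F r ∈ B.corner a b :=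
  ⟨by rw [← envMap_idem F, ← map_mul, h.1], by rw [← envMap_idem F, ← map_mul, h.2]⟩

variable [CharZero K]

def envCatMap (F : Mor A B) : DGCat.Mor A.envCat B.envCat where
  φ a b :=
    { f := ((envMap F).toLinearMap ∘ₗ (A.corner a b).subtype).codRestrict (B.corner a b) fun r =>
        envMap_mem_corner F r.2
      map_mem := fun {n x} hx t => by
        have h1 : A.envScale t (A.envVal a b x) = _ := hx t
        change B.envScale t (envMap F (A.envVal a b x)) = _ • envMap F (A.envVal a b x)
        rw [← envMap_envScale, h1, map_smul]
        rfl
      map_d := fun x => Subtype.ext (envMap_envD F _) }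
  map_mul x y := Subtype.ext (map_mul (envMap F) _ _)
  map_one a := Subtype.ext (envMap_idem F a)

end EnvMap

def envelope (K : Type u) [Field K] [CharZero K] (Λ : Type v) :
    AInfCat.{u,v,w} K Λ ⥤ DGCat.{u,v,max u v w} K Λ where
  obj A := A.envCat
  map F := envCatMap F
  map_id A := by
    refine DGCat.Mor.ext (funext fun a => funext fun b => Cx.Hom.ext (LinearMap.ext fun x =>
      Subtype.ext ?_))
    refine Env.algHom_ext (f := envMap (𝟙 A : A ⟶ A)) (g := AlgHom.id K _) (fun c => ?_) _
    rw [envMap_tau]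
    exact congrArg _ (chain_map_id c)
  map_comp {A B C} F G := by
    refine DGCat.Mor.ext (funext fun a => funext fun b => Cx.Hom.ext (LinearMap.ext fun x =>
      Subtype.ext ?_))
    refine Env.algHom_ext (f := envMap (F ≫ G : A ⟶ C)) (g := (envMap G).comp (envMap F))
      (fun c => ?_) _
    rw [AlgHom.comp_apply, envMap_tau, envMap_tau, envMap_tau, chain_map_map]
    rfl

end AInfCat

lemma insertSum_append_single {H : Λ → Λ → Type w}
    [∀ a b, AddCommGroup (H a b)] [∀ a b, Module K (H a b)] {N : Type*} [AddCommGroup N]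
    [Module K N] {s : ∀ a b, H a b →ₗ[K] H a b} {β : ∀ a b : Λ, Chain H a b → H a b}
    (hnil : ∀ a, β a a (.nil a) = 0) {Ψ : Chain H a e → N} (h : SlotLinear K Ψ)
    (c : Chain H a b) (y : H b e) :
    insertSum s β Ψ (c.append (.cons y (.nil e))) =
      insertSum s β (fun l => Ψ (l.append (.cons y (.nil e)))) c +
        c.sumSplits fun f p q => Ψ ((p.map fun a b => s a b).append
          (.cons (β f e (q.append (.cons y (.nil e)))) (.nil e))) := by
  unfold insertSum
  rw [Chain.sumSplits_append_cons, ← Chain.sumSplits_add]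
  have h0 : ((Chain.nil e : Chain H e e).sumSplits fun f p q =>
      (q.sumSplits fun f' q' t => Ψ ((((c.append (.cons y p))).map fun a b => s a b).append
        (.cons (β _ _ q') t)))) = 0 := by
    rw [Chain.sumSplits_nil, Chain.sumSplits_nil, hnil]
    exact h.zero_slot _ _
  rw [h0, add_zero]
  congr 1; funext f p w
  rw [Chain.sumSplits_append_cons, Chain.sumSplits_nil]
  congr 1
  simp only [Chain.append_assoc, Chain.append]

namespace AInfCat

open Chain

section Action

variable (A : AInfCat.{u,v,w} K Λ) (b₀ : Λ)

/-- The operation and the generator of the enveloping algebra given by a chain. -/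
def barTau (l : χ[A] a b) : (A.Hom a b).X × Env A :=
  (A.bar a b l, A.tau a b l)

lemma slotLinear_barTau : SlotLinear K (A.barTau (a := a) (b := b)) :=
  ⟨fun _ _ _ _ => Prod.ext ((A.slotLinear_bar _ _).add _ _ _ _) ((A.slotLinear_tau _ _).add _ _ _ _),
    fun _ _ _ _ => Prod.ext ((A.slotLinear_bar _ _).smul _ _ _ _)
      ((A.slotLinear_tau _ _).smul _ _ _ _)⟩

variable {b₀}

/-- The action of a chain on pairs of a morphism to `b₀` and an element of the enveloping algebra. -/
def cellAct {a a' : Λ} (c : χ[A] a a') :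
    ((A.Hom a' b₀).X × Env A) →ₗ[K] ((A.Hom a b₀).X × Env A) where
  toFun m := A.barTau (c.append (.cons m.1 (.nil b₀))) + (0, A.tau a a' c * m.2)
  map_add' m n := by
    rw [Prod.fst_add, A.slotLinear_barTau.add, Prod.snd_add, mul_add]
    refine Prod.ext ?_ ?_
    · simp
    · simp only [Prod.snd_add]; abel
  map_smul' k m := by
    rw [Prod.smul_fst, A.slotLinear_barTau.smul, Prod.smul_snd, mul_smul_comm, RingHom.id_apply,
      smul_add]
    exact congrArg _ (Prod.ext (smul_zero k).symm rfl)

lemma cellAct_fst {a a' : Λ} (c : χ[A] a a') (m : (A.Hom a' b₀).X × Env A) :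
    (A.cellAct c m).1 = A.bar a b₀ (c.append (.cons m.1 (.nil b₀))) := add_zero _

lemma cellAct_snd {a a' : Λ} (c : χ[A] a a') (m : (A.Hom a' b₀).X × Env A) :
    (A.cellAct c m).2 = A.tau a b₀ (c.append (.cons m.1 (.nil b₀))) + A.tau a a' c * m.2 := rfl

lemma slotLinear_cellAct {a a' : Λ} (m : (A.Hom a' b₀).X × Env A) :
    SlotLinear K fun c : χ[A] a a' => A.cellAct c m :=
  (A.slotLinear_barTau.append_right _).add_fun
    ((A.slotLinear_tau a a').comp (LinearMap.inr K (A.Hom a b₀).X (Env A) ∘ₗ LinearMap.mulRight K m.2))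

lemma cellAct_relation {a a' : Λ} (c : χ[A] a a') (m : (A.Hom a' b₀).X × Env A) :
    ι[A] (fun l => A.cellAct l m) c +
      (c.sumSplits fun _ p q => A.cellAct (p.map σ[A]) (A.cellAct q m)) =
    (0, A.envD (A.cellAct c m).2 +
      A.tau a a' (c.map σ[A]) * A.envD m.2) := by
  have h1 := map_insertSum (s := A.barSgn) (b := A.bar)
    (LinearMap.fst K (A.Hom a b₀).X (Env A)) (fun l => A.cellAct l m) c
  have h2 := map_insertSum (s := A.barSgn) (b := A.bar)
    (LinearMap.snd K (A.Hom a b₀).X (Env A)) (fun l => A.cellAct l m) c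
  have h3 := map_sumSplits (LinearMap.fst K (A.Hom a b₀).X (Env A)) c
    (fun _ p q => A.cellAct (p.map σ[A]) (A.cellAct q m))
  have h4 := map_sumSplits (LinearMap.snd K (A.Hom a b₀).X (Env A)) c
    (fun _ p q => A.cellAct (p.map σ[A]) (A.cellAct q m))
  simp only [LinearMap.fst_apply, LinearMap.snd_apply] at h1 h2 h3 h4
  refine Prod.ext ?_ ?_
  · rw [Prod.fst_add, h1, h3]
    simp only [cellAct_fst]
    rw [← insertSum_append_single A.bar_nil (A.slotLinear_bar a b₀)]
    exact A.insertSum_bar _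
  · rw [Prod.snd_add, h2, h4]
    simp only [cellAct_snd, cellAct_fst]
    have h5 : ι[A]
        (fun l => A.tau a b₀ (l.append (cons m.1 (nil b₀))) + A.tau a a' l * m.2) c =
        ι[A] (fun l => A.tau a b₀ (l.append (cons m.1 (nil b₀)))) c +
        ι[A] (A.tau a a') c * m.2 := by
      have := map_insertSum (s := A.barSgn) (b := A.bar) (LinearMap.mulRight K m.2) (A.tau a a') c
      simp only [LinearMap.mulRight_apply] at this
      rw [this]
      simp only [insertSum, sumSplits_add]
    have h6 := insertSum_append_single (s := A.barSgn) A.bar_nil (A.slotLinear_tau a b₀) c m.1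
    have h7 := map_sumSplits (LinearMap.mulRight K m.2) c
      fun _ p q => A.tau _ _ (p.map σ[A]) * A.tau _ _ q
    simp only [LinearMap.mulRight_apply] at h7
    rw [h5, map_add, envD_mul, envD_tau, envD_tau, envSgn_tau, delta, delta, h6,
      sumSplits_append_cons, sumSplits_nil, A.isTau_tau.nil, mul_zero, add_zero, add_mul, h7]
    simp only [mul_add, ← mul_assoc, sumSplits_add]
    noncomm_ring

/-- The differential on pairs of a morphism to `b₀` and an element of the enveloping algebra. -/
def cellD :
    ((A.Hom a b₀).X × Env A) →ₗ[K] ((A.Hom a b₀).X × Env A) :=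
  LinearMap.inr K _ _ ∘ₗ A.envD ∘ₗ LinearMap.snd K _ _ - A.cellAct (nil a)

lemma cellD_apply (m : (A.Hom a b₀).X × Env A) :
    A.cellD m = (0, A.envD m.2) - A.cellAct (nil a) m := rfl

lemma cellD_eq (m : (A.Hom a b₀).X × Env A) :
    A.cellD m = (-(A.Hom a b₀).d m.1, A.envD m.2 - A.tau a b₀ (cons m.1 (nil b₀))) := by
  rw [cellD_apply]
  refine Prod.ext ?_ ?_
  · rw [Prod.fst_sub, cellAct_fst]
    simp [Chain.append, bar_single]
  · rw [Prod.snd_sub, cellAct_snd, A.isTau_tau.nil]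
    simp [Chain.append]

variable (b₀)

/-- The module on which the enveloping algebra acts. -/
abbrev ActMod := ∀ a, (A.Hom a b₀).X × Env A

open Classical in
def chainAct (a a' : Λ) (c : χ[A] a a') : Module.End K (A.ActMod b₀) :=
  if c.length = 0 then 0 else
    LinearMap.single K _ a ∘ₗ A.cellAct c ∘ₗ LinearMap.proj a'

variable {b₀}

lemma chainAct_of_ne {a a' e : Λ} (c : χ[A] a a') (n : A.ActMod b₀) (h : e ≠ a) :
    A.chainAct b₀ a a' c n e = 0 := by
  classical
  unfold chainAct
  split_ifs
  · rfl
  · exact Pi.single_eq_of_ne h _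

lemma chainAct_same {a a' : Λ} (c : χ[A] a a') (n : A.ActMod b₀) :
    A.chainAct b₀ a a' c n a = if c.length = 0 then 0 else A.cellAct c (n a') := by
  unfold chainAct
  split_ifs
  · rfl
  · classical
    exact Pi.single_eq_same (M := fun a => (A.Hom a b₀).X × Env A) a _

lemma chainAct_ext {n n' : A.ActMod b₀} (h : n a = n' a) (h1 : ∀ e, e ≠ a → n e = 0)
    (h2 : ∀ e, e ≠ a → n' e = 0) : n = n' := by
  funext e
  by_cases he : e = a
  · subst he; exact h
  · rw [h1 e he, h2 e he]

lemma chainAct_nil (a : Λ) : A.chainAct b₀ a a (nil a) = 0 := if_pos rfl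

lemma length_append_cons {H : Λ → Λ → Type*} (l : Chain H a b) (x : H b c)
    (l' : Chain H c e) : (l.append (cons x l')).length ≠ 0 := by
  simp only [length_append, length]; omega

lemma slotLinear_chainAct (a a' : Λ) : SlotLinear K (A.chainAct b₀ a a') := by
  refine ⟨fun l x y l' => LinearMap.ext fun n => ?_, fun l k x l' => LinearMap.ext fun n => ?_⟩
  · refine A.chainAct_ext (a := a) ?_ (fun e he => A.chainAct_of_ne _ n he) fun e he => ?_
    · simp only [LinearMap.add_apply, Pi.add_apply, chainAct_same, length_append_cons, if_false]
      exact (A.slotLinear_cellAct (n a')).add _ _ _ _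
    · simp only [LinearMap.add_apply, Pi.add_apply, A.chainAct_of_ne _ n he, add_zero]
  · refine A.chainAct_ext (a := a) ?_ (fun e he => A.chainAct_of_ne _ n he) fun e he => ?_
    · simp only [LinearMap.smul_apply, Pi.smul_apply, chainAct_same, length_append_cons, if_false]
      exact (A.slotLinear_cellAct (n a')).smul _ _ _ _
    · simp only [LinearMap.smul_apply, Pi.smul_apply, A.chainAct_of_ne _ n he, smul_zero]

lemma cellAct_one (m : (A.Hom a b₀).X × Env A) :
    A.cellAct (cons (A.one a) (nil a)) m = (m.1, A.idem a * m.2) := by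
  refine Prod.ext ?_ ?_
  · rw [cellAct_fst]; exact A.bar_one_left _
  · rw [cellAct_snd, Chain.append, Chain.append]
    have := A.isTau_tau.unit (nil a) (cons m.1 (nil b₀)) (by simp [length])
    rw [Chain.append] at this
    rw [this, zero_add]; rfl

lemma isTau_chainAct : A.IsTau (A.chainAct b₀) := by
  have h1 : ∀ {a a'} (c : χ[A] a a') n, A.idem a * (A.chainAct b₀ a a' c n a).2 =
      (A.chainAct b₀ a a' c n a).2 := by
    intro a a' c n
    rw [chainAct_same]
    split_ifs
    · simp
    · rw [cellAct_snd, mul_add, idem_mul_tau, ← mul_assoc, idem_mul_tau]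
  refine ⟨A.slotLinear_chainAct, A.chainAct_nil, fun {a b a' b'} c c' h => LinearMap.ext fun n => ?_,
    fun {a b} c => LinearMap.ext fun n => ?_, fun {a b} c => LinearMap.ext fun n => ?_,
    fun {a b e} l l' h => LinearMap.ext fun n => ?_⟩
  · refine A.chainAct_ext (a := a) ?_ (fun e he => A.chainAct_of_ne _ _ he) fun e he => rfl
    rw [Module.End.mul_apply, chainAct_same, A.chainAct_of_ne c' n h, map_zero, ite_self]
    rfl
  · rw [Module.End.mul_apply]
    refine A.chainAct_ext (a := a) ?_ (fun e he => A.chainAct_of_ne _ _ he)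
      fun e he => A.chainAct_of_ne _ _ he
    rw [chainAct_same, if_neg (by simp [length]), cellAct_one, h1]
  · rw [Module.End.mul_apply]
    refine A.chainAct_ext (a := a) ?_ (fun e he => A.chainAct_of_ne _ _ he)
      fun e he => A.chainAct_of_ne _ _ he
    have h2 : (cons (A.one b) (nil b) : χ[A] b b).length ≠ 0 := by simp [length]
    rw [chainAct_same, chainAct_same, chainAct_same, if_neg h2, cellAct_one]
    congr 1
    refine Prod.ext ?_ ?_
    · simp only [cellAct_fst]
    · rw [cellAct_snd, cellAct_snd, ← _root_.mul_assoc, tau_mul_idem]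
  · refine A.chainAct_ext (a := a) ?_ (fun e he => A.chainAct_of_ne _ _ he) fun e he => rfl
    rw [chainAct_same, if_neg (length_append_cons _ _ _)]
    refine Prod.ext ?_ ?_
    · rw [cellAct_fst, append_assoc, Chain.append, A.bar_one]
      · rfl
      · simp only [length_append, length]; omega
    · rw [cellAct_snd, append_assoc, Chain.append, A.isTau_tau.unit _ _ h, A.isTau_tau.unit]
      · simp
      · simp only [length_append, length]; omega

variable (b₀)

def envAct : Env A →ₐ[K] Module.End K (A.ActMod b₀) := A.isTau_chainAct.lift

variable {b₀}

lemma envAct_tau (c : χ[A] a b) :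
    A.envAct b₀ (A.tau a b c) = A.chainAct b₀ a b c := IsTau.lift_tau _ _

variable (b₀)

def actD : A.ActMod b₀ →ₗ[K] A.ActMod b₀ :=
  LinearMap.pi fun a => A.cellD ∘ₗ LinearMap.proj a

variable {b₀}

lemma actD_envAct (r : Env A) (n : A.ActMod b₀) :
    A.actD b₀ (A.envAct b₀ r n) =
      A.envAct b₀ (A.envD r) n + A.envAct b₀ (A.envSgn r) (A.actD b₀ n) := by
  induction r using Env.induction generalizing n with
  | scalar k =>
    simp only [AlgHom.commutes, envD_scalar, map_zero, LinearMap.zero_apply, zero_add,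
      Module.algebraMap_end_apply, map_smul]
  | @tau a b c =>
    have h1 := map_insertSum (s := A.barSgn) (b := A.bar)
      (LinearMap.applyₗ n ∘ₗ (A.envAct b₀).toLinearMap) (A.tau a b) c
    have h2 := map_sumSplits (LinearMap.applyₗ n ∘ₗ (A.envAct b₀).toLinearMap) c
      fun _ p q => A.tau _ _ (p.map σ[A]) * A.tau _ _ q
    simp only [LinearMap.comp_apply, AlgHom.toLinearMap_apply, LinearMap.applyₗ_apply_apply,
      envAct_tau, map_mul, Module.End.mul_apply] at h1 h2
    rw [envD_tau, envSgn_tau, delta, map_add, LinearMap.add_apply, h1, h2, map_neg, envAct_tau,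
      envAct_tau]
    refine A.chainAct_ext (a := a) ?_ (fun e he => ?_) (fun e he => ?_)
    · have h3 := map_insertSum (s := A.barSgn) (b := A.bar)
        (LinearMap.proj (R := K) (φ := fun a => (A.Hom a b₀).X × Env A) a)
        (fun l => A.chainAct b₀ a b l n) c
      have h4 := map_sumSplits (LinearMap.proj (R := K) (φ := fun a => (A.Hom a b₀).X × Env A) a) c
        fun _ p q => A.chainAct b₀ _ _ (p.map σ[A]) (A.chainAct b₀ _ _ q n)
      simp only [LinearMap.proj_apply, chainAct_same] at h3 h4
      rw [Pi.add_apply, Pi.add_apply, h3, h4, LinearMap.neg_apply, Pi.neg_apply, chainAct_same,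
        length_map]
      change A.cellD (A.chainAct b₀ a b c n a) = _
      rw [chainAct_same]
      cases c with
      | nil =>
        simp [insertSum, length, Chain.append, Chain.map, bar_nil]
        exact (A.slotLinear_cellAct (n a)).zero_slot (nil a) (nil a) |>.symm
      | @cons a a' b x l =>
        have h5 := A.cellAct_relation (cons x l) (n b)
        have h6 : ∀ {e f : Λ} (y : (A.Hom e f).X) {f' : Λ} (l : χ[A] f f'),
            (cons y l).length ≠ 0 := fun y _ l => by simp [length]
        have h7 : (cons x l).length ≠ 0 := h6 x l
        have e1 : ι[A]
            (fun l => if l.length = 0 then 0 else A.cellAct l (n b)) (cons x l) =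
            ι[A] (fun l => A.cellAct l (n b)) (cons x l) := by
          simp only [insertSum, length_append_cons, if_false]
        have e2 : (l.sumSplits fun e p q => A.cellAct ((cons x p).map σ[A])
            (A.cellAct q (n b))) = (l.sumSplits fun e p q =>
              A.cellAct ((cons x p).map σ[A])
                (if q.length = 0 then 0 else A.cellAct q (n b))) +
              A.cellAct ((cons x l).map σ[A]) (A.cellAct (nil b) (n b)) := by
          have := sumSplits_eq_last l (g := fun e p q => if q.length = 0 then
            A.cellAct ((cons x p).map σ[A]) (A.cellAct q (n b)) else 0)
            fun e p q hq => if_neg (by omega)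
          rw [if_pos (by rfl)] at this
          rw [← this, ← sumSplits_add]
          congr 1; funext e p q
          split_ifs
          · rw [map_zero, zero_add]
          · rw [add_zero]
        have e3 : ∀ e (p : χ[A] a' e),
            ((cons x p).map σ[A]).length ≠ 0 := fun e p => by
          rw [length_map]; exact h6 x p
        rw [if_neg h7, if_neg h7, e1, sumSplits_cons, if_pos (by rfl), zero_add]
        rw [sumSplits_cons, e2, Chain.map] at h5
        simp only [e3, if_false]
        change _ = _ + _ + -A.cellAct _ (A.cellD (n b))
        rw [cellD_apply, cellD_apply, map_sub]
        have e4 : A.cellAct ((cons x l).map σ[A])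
            ((0, A.envD (n b).2) : (A.Hom b b₀).X × Env A) =
            (0, A.tau a b ((cons x l).map σ[A]) * A.envD (n b).2) := by
          refine Prod.ext ?_ ?_
          · rw [cellAct_fst]; exact (A.slotLinear_bar _ _).zero_slot _ _
          · rw [cellAct_snd, (A.slotLinear_tau _ _).zero_slot, zero_add]
        have e5 : ((0, A.envD (A.cellAct (cons x l) (n b)).2 +
            A.tau a b ((cons x l).map σ[A]) * A.envD (n b).2) :
            (A.Hom a b₀).X × Env A) = (0, A.envD (A.cellAct (cons x l) (n b)).2) +
            (0, A.tau a b ((cons x l).map σ[A]) * A.envD (n b).2) :=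
          Prod.ext (add_zero _).symm rfl
        rw [e4]
        rw [e5] at h5
        rw [eq_sub_of_add_eq h5.symm]
        abel
    · change A.cellD (A.chainAct b₀ a b c n e) = _
      rw [A.chainAct_of_ne _ _ he, map_zero]
    · have h3 := map_insertSum (s := A.barSgn) (b := A.bar)
        (LinearMap.proj (R := K) (φ := fun a => (A.Hom a b₀).X × Env A) e)
        (fun l => A.chainAct b₀ a b l n) c
      have h4 := map_sumSplits (LinearMap.proj (R := K) (φ := fun a => (A.Hom a b₀).X × Env A) e) c
        fun _ p q => A.chainAct b₀ _ _ (p.map σ[A]) (A.chainAct b₀ _ _ q n)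
      simp only [LinearMap.proj_apply, A.chainAct_of_ne _ _ he, sumSplits_zero] at h3 h4
      rw [Pi.add_apply, Pi.add_apply, h3, h4, LinearMap.neg_apply, Pi.neg_apply,
        A.chainAct_of_ne _ _ he]
      simp [insertSum, sumSplits_zero]
  | mul r s hr hs =>
    rw [map_mul, Module.End.mul_apply, hr, hs, envD_mul, map_add, map_add, map_mul, map_mul,
      map_mul, map_mul]
    simp only [LinearMap.add_apply, Module.End.mul_apply]
    rw [add_assoc]
  | add r s hr hs =>
    simp only [map_add, LinearMap.add_apply, hr, hs]
    abel

end Action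

end AInfCat

namespace AInfCat

open Chain

section Retract

variable (A : AInfCat.{u,v,w} K Λ) (b : Λ)

def actInr : Env A →ₗ[K] A.ActMod b :=
  LinearMap.pi fun a => LinearMap.inr K _ _ ∘ₗ LinearMap.mulLeft K (A.idem a)

lemma actInr_apply (t : Env A) (a : Λ) : A.actInr b t a = (0, A.idem a * t) := rfl

variable {b}

lemma cellAct_inr {a a' : Λ} (c : χ[A] a a') (t : Env A) :
    A.cellAct c ((0, t) : (A.Hom a' b).X × Env A) = (0, A.tau a a' c * t) := by
  refine Prod.ext ?_ ?_
  · rw [cellAct_fst]; exact (A.slotLinear_bar _ _).zero_slot _ _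
  · rw [cellAct_snd, (A.slotLinear_tau _ _).zero_slot, zero_add]

lemma envAct_actInr (r t : Env A) : A.envAct b r (A.actInr b t) = A.actInr b (r * t) := by
  induction r using Env.induction generalizing t with
  | scalar k => simp [Algebra.algebraMap_eq_smul_one]
  | @tau a a' c =>
    rw [envAct_tau]
    refine A.chainAct_ext (a := a) ?_ (fun e he => A.chainAct_of_ne _ _ he) fun e he => ?_
    · rw [chainAct_same, actInr_apply, actInr_apply, cellAct_inr, ← _root_.mul_assoc, tau_mul_idem,
        ← _root_.mul_assoc, idem_mul_tau]
      cases c with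
      | nil => rw [if_pos (by rfl), A.isTau_tau.nil, zero_mul]; rfl
      | cons x l => rw [if_neg (by simp [length])]
    · rw [actInr_apply, ← A.idem_mul_tau, ← _root_.mul_assoc, ← _root_.mul_assoc,
        A.idem_mul_idem_of_ne he, zero_mul, zero_mul]
      rfl
  | mul r s hr hs => rw [map_mul, Module.End.mul_apply, hs, hr, _root_.mul_assoc]
  | add r s hr hs => rw [map_add, LinearMap.add_apply, hr, hs, add_mul, map_add]

variable (b)

open Classical in
def actOne : A.ActMod b := Pi.single b (A.one b, 0)

variable {b}

lemma actOne_same : A.actOne b b = (A.one b, 0) := by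
  classical
  exact Pi.single_eq_same (M := fun a => (A.Hom a b).X × Env A) b _

lemma actOne_of_ne (h : a ≠ b) : A.actOne b a = 0 := by
  classical
  exact Pi.single_eq_of_ne (M := fun a => (A.Hom a b).X × Env A) h _

lemma actD_actOne : A.actD b (A.actOne b) = -A.actInr b (A.idem b) := by
  refine A.chainAct_ext (a := b) ?_ (fun e he => ?_) fun e he => ?_
  · change A.cellD (A.actOne b b) = -(A.actInr b (A.idem b) b)
    rw [actOne_same, cellD_eq, actInr_apply, idem_mul_idem, d_one, map_zero, zero_sub]
    rfl
  · change A.cellD (A.actOne b e) = 0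
    rw [actOne_of_ne A he, map_zero]
  · rw [Pi.neg_apply, actInr_apply, A.idem_mul_idem_of_ne he]; simp

def actScale (t : Kˣ) : A.ActMod b →ₗ[K] A.ActMod b :=
  LinearMap.pi fun a => (LinearMap.prodMap ((A.Hom a b).scale t)
    (((t⁻¹ : Kˣ) : K) • (A.envScale t).toLinearMap)) ∘ₗ LinearMap.proj a

lemma actScale_apply (t : Kˣ) (n : A.ActMod b) (a : Λ) : A.actScale t n a =
    ((A.Hom a b).scale t (n a).1, ((t⁻¹ : Kˣ) : K) • A.envScale t (n a).2) := rfl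

lemma actScale_actOne (t : Kˣ) : A.actScale t (A.actOne b) = A.actOne b := by
  refine A.chainAct_ext (a := b) ?_ (fun e he => ?_) fun e he => A.actOne_of_ne he
  · rw [actScale_apply, actOne_same, map_zero, smul_zero, Cx.scale_of_mem _ t (A.one_mem b)]
    simp
  · rw [actScale_apply, actOne_of_ne A he]; simp

lemma cellAct_actScale (t : Kˣ) {a a' : Λ} (c : χ[A] a a')
    (m : (A.Hom a' b).X × Env A) :
    A.cellAct (c.map fun a b => (A.Hom a b).barScale t)
        ((A.Hom a' b).scale t m.1, ((t⁻¹ : Kˣ) : K) • A.envScale t m.2) =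
      (t : K) • ((A.Hom a b).scale t (A.cellAct c m).1,
        ((t⁻¹ : Kˣ) : K) • A.envScale t (A.cellAct c m).2) := by
  have e : ((c.map fun a b => (A.Hom a b).barScale t).append
      (cons ((A.Hom a' b).scale t m.1) (nil b))) =
      (c.map fun a b => (A.Hom a b).barScale t).append (cons (((t⁻¹ : Kˣ) : K) •
        (A.Hom a' b).barScale t m.1) (nil b)) := by
    rw [Cx.barScale, LinearMap.smul_apply, smul_smul, Units.inv_mul, one_smul]
  have e' : (c.map fun a b => (A.Hom a b).barScale t).append
        (cons ((A.Hom a' b).barScale t m.1) (nil b)) =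
      (c.append (cons m.1 (nil b))).map fun a b => (A.Hom a b).barScale t := by
    rw [map_append]; rfl
  refine Prod.ext ?_ ?_
  · rw [cellAct_fst, Prod.smul_fst]
    dsimp only
    rw [e, (A.slotLinear_bar _ _).smul, e', bar_barScale, cellAct_fst, smul_smul, Units.inv_mul,
      one_smul, Cx.barScale, LinearMap.smul_apply]
  · rw [cellAct_snd, Prod.smul_snd]
    dsimp only
    rw [e, (A.slotLinear_tau _ _).smul, e', cellAct_snd, map_add, map_mul, envScale_tau,
      envScale_tau, smul_add, smul_add, smul_mul_assoc, mul_smul_comm, smul_smul, smul_smul,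
      smul_smul, smul_smul, Units.mul_inv, _root_.one_mul]

lemma envAct_envScale (t : Kˣ) (r : Env A) (n : A.ActMod b) :
    A.envAct b (A.envScale t r) (A.actScale t n) = A.actScale t (A.envAct b r n) := by
  induction r using Env.induction generalizing n with
  | scalar k => simp
  | @tau a a' c =>
    rw [envScale_tau, map_smul, envAct_tau, envAct_tau]
    refine A.chainAct_ext (a := a) ?_ (fun e he => ?_) fun e he => ?_
    · rw [LinearMap.smul_apply, Pi.smul_apply, chainAct_same, actScale_apply, actScale_apply,
        chainAct_same, length_map]
      split_ifs
      · simp only [smul_zero, Prod.fst_zero, Prod.snd_zero, map_zero]; rfl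
      · rw [cellAct_actScale, smul_smul, Units.inv_mul, one_smul]
    · rw [LinearMap.smul_apply, Pi.smul_apply, A.chainAct_of_ne _ _ he, smul_zero]
    · rw [actScale_apply, A.chainAct_of_ne _ _ he]; simp
  | mul r s hr hs =>
    rw [map_mul, map_mul, Module.End.mul_apply, hs, hr, map_mul, Module.End.mul_apply]
  | add r s hr hs =>
    rw [map_add, map_add, LinearMap.add_apply, hr, hs, map_add, LinearMap.add_apply, map_add]

def evalFst (a b : Λ) : Env A →ₗ[K] (A.Hom a b).X :=
  LinearMap.fst K _ _ ∘ₗ LinearMap.proj (φ := fun a => (A.Hom a b).X × Env A) a ∘ₗ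
    LinearMap.applyₗ (A.actOne b) ∘ₗ (A.envAct b).toLinearMap

lemma evalFst_apply (a b : Λ) (r : Env A) :
    A.evalFst a b r = (A.envAct b r (A.actOne b) a).1 := rfl

def evalSnd (a b : Λ) : Env A →ₗ[K] Env A :=
  LinearMap.snd K _ _ ∘ₗ LinearMap.proj (φ := fun a => (A.Hom a b).X × Env A) a ∘ₗ
    LinearMap.applyₗ (A.actOne b) ∘ₗ (A.envAct b).toLinearMap

lemma envAct_of_ne {r : Env A} (h : A.idem a * r = r) (n : A.ActMod b) (he : e ≠ a) :
    A.envAct b r n e = 0 := by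
  rw [← h, map_mul, Module.End.mul_apply, idem, envAct_tau, chainAct_of_ne _ _ _ he]

lemma evalFst_tau (x : (A.Hom a b).X) :
    A.evalFst a b (A.tau a b (cons x (nil b))) = (A.Hom a b).sgn x := by
  rw [evalFst_apply, envAct_tau, chainAct_same, if_neg (by simp [length]), actOne_same, cellAct_fst]
  exact A.bar_one_right x

lemma evalFst_scale (t : Kˣ) (a b : Λ) (r : Env A) :
    A.evalFst a b (A.envScale t r) = (A.Hom a b).scale t (A.evalFst a b r) := by
  rw [evalFst_apply, ← A.actScale_actOne t, envAct_envScale]; rfl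

lemma actD_eval (a b : Λ) (r : Env A) :
    A.cellD (A.envAct b r (A.actOne b) a) = A.envAct b (A.envD r) (A.actOne b) a -
      (0, A.idem a * (A.envSgn r * A.idem b)) := by
  have h := congrFun (A.actD_envAct r (A.actOne b)) a
  rw [actD_actOne, map_neg, envAct_actInr, ← sub_eq_add_neg] at h
  exact h

lemma evalFst_envD (a b : Λ) (r : Env A) :
    A.evalFst a b (A.envD r) = -(A.Hom a b).d (A.evalFst a b r) := by
  have := congrArg Prod.fst (A.actD_eval a b r)
  rw [cellD_eq, Prod.fst_sub, sub_zero] at this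
  exact this.symm

lemma evalSnd_envD (a b : Λ) (r : Env A) :
    A.envD (A.evalSnd a b r) - A.tau a b (cons (A.evalFst a b r) (nil b)) =
      A.evalSnd a b (A.envD r) - A.idem a * (A.envSgn r * A.idem b) := by
  have := congrArg Prod.snd (A.actD_eval a b r)
  rw [cellD_eq, Prod.snd_sub] at this
  exact this

lemma tau_single_mem_corner (x : (A.Hom a b).X) :
    A.tau a b (cons x (nil b)) ∈ A.corner a b := ⟨A.idem_mul_tau _, A.tau_mul_idem _⟩

lemma envD_tau_single (x : (A.Hom a b).X) :
    A.envD (A.tau a b (cons x (nil b))) = A.tau a b (cons ((A.Hom a b).d x) (nil b)) := by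
  have h := (A.slotLinear_tau a b).zero_slot (cons (A.barSgn a b x) (nil b)) (nil b)
  simp only [Chain.append] at h
  simp [envD_tau, delta, insertSum, sumSplits_cons, bar_nil, bar_single,
    (A.slotLinear_tau a b).cons_zero, Chain.map, Chain.append, A.isTau_tau.nil]
  simpa using h

lemma envSgn_tau_single (x : (A.Hom a b).X) :
    A.envSgn (A.tau a b (cons x (nil b))) = A.tau a b (cons ((A.Hom a b).sgn x) (nil b)) := by
  rw [envSgn_tau, Chain.map, Chain.map, barSgn, Cx.barScale_neg_one, LinearMap.neg_apply,
    (A.slotLinear_tau a b).cons_neg, neg_neg]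

end Retract

section Unit

variable [CharZero K] (A : AInfCat.{u,v,max u v w} K Λ)

/-- The inclusion of an A-infinity category into its enveloping dg category. -/
def envUnit (a b : Λ) : Cx.Hom (A.Hom a b) (A.envCx a b) where
  f := LinearMap.codRestrict (A.corner a b)
    { toFun := fun x => A.tau a b (cons x (nil b))
      map_add' := fun x y => (A.slotLinear_tau a b).cons_add x y _
      map_smul' := fun k x => (A.slotLinear_tau a b).cons_smul k x _ } A.tau_single_mem_corner
  map_mem {n x} hx := by
    have := A.tau_mem (cons x (nil b)) (n := n) ⟨n, 0, hx, rfl, (add_zero n).symm⟩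
    simp only [length, zero_add, Nat.cast_one, add_sub_cancel_right] at this
    exact this
  map_d x := A.envCx_ext (A.envD_tau_single x).symm

lemma envVal_envUnit (x : (A.Hom a b).X) :
    A.envVal a b ((A.envUnit a b).f x) = A.tau a b (cons x (nil b)) := rfl

/-- The chain map from the enveloping dg category that is left inverse to the inclusion. -/
def envRetract (a b : Λ) : Cx.Hom (A.envCx a b) (A.Hom a b) where
  f := (A.Hom a b).sgn ∘ₗ A.evalFst a b ∘ₗ A.envVal a b
  map_mem {n x} hx := by
    refine Cx.sgn_mem _ (Cx.mem_grade_of_scale _ fun t => ?_)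
    have h1 : A.envScale t (A.envVal a b x) = _ := hx t
    rw [LinearMap.comp_apply, ← evalFst_scale, h1, map_smul]
    rfl
  map_d x := by
    simp only [LinearMap.comp_apply, envVal_d, evalFst_envD, map_neg, Cx.sgn_d, neg_neg]

lemma envRetract_apply (x : (A.envCx a b).X) :
    (A.envRetract a b).f x = (A.Hom a b).sgn (A.evalFst a b (A.envVal a b x)) := rfl

lemma envRetract_envUnit (x : (A.Hom a b).X) :
    (A.envRetract a b).f ((A.envUnit a b).f x) = x := by
  rw [envRetract_apply, envVal_envUnit, evalFst_tau, Cx.sgn_sgn]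

lemma isQuasiIso_envUnit (a b : Λ) : (A.envUnit a b).IsQuasiIso := by
  refine ⟨fun x _ ⟨r, hr⟩ => ⟨(A.envRetract a b).f r, ?_⟩, fun r hr => ?_⟩
  · rw [← Cx.Hom.map_d, hr, envRetract_envUnit]
  · have h0 : A.envD (A.envVal a b r) = 0 := by rw [← envVal_d, hr, map_zero]
    have h1 := A.evalFst_envD a b (A.envVal a b r)
    have h2 := A.evalSnd_envD a b (A.envVal a b r)
    rw [h0, map_zero, eq_comm, neg_eq_zero] at h1
    rw [h0, map_zero, zero_sub, sub_eq_iff_eq_add, neg_add_eq_sub] at h2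
    refine ⟨(A.Hom a b).sgn (A.evalFst a b (A.envVal a b r)), ?_,
      A.toEnvCx a b (A.envSgn (A.evalSnd a b (A.envVal a b r))), ?_⟩
    · rw [← neg_inj, ← Cx.sgn_d, h1, map_zero, neg_zero]
    · have h3 := congrArg (fun s => A.toEnvCx a b (A.envSgn s)) h2
      simp only [map_sub, envSgn_envD, map_neg, envSgn_tau_single, map_mul, envScale_idem,
        envSgn_envSgn, envVal_mul_idem, idem_mul_envVal, toEnvCx_envVal, ← d_toEnvCx,
        ← envVal_envUnit] at h3
      have h4 : A.toEnvCx a b (A.tau a b (cons ((A.Hom a b).sgn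
          (A.evalFst a b (A.envVal a b r))) (nil b))) =
          (A.envUnit a b).f ((A.Hom a b).sgn (A.evalFst a b (A.envVal a b r))) :=
        A.toEnvCx_envVal ((A.envUnit a b).f _)
      rw [h4] at h3
      linear_combination (norm := module) h3

lemma isQuasiIso_envRetract (a b : Λ) : (A.envRetract a b).IsQuasiIso := by
  have h : (A.envRetract a b).f ∘ₗ (A.envUnit a b).f = LinearMap.id :=
    LinearMap.ext A.envRetract_envUnit
  refine HomologyBijective.of_comp (f := (A.envUnit a b).f)
    (HomologyBijective.of_bijective (fun x => ?_) ?_) (A.isQuasiIso_envUnit a b)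
    (A.envUnit a b).map_d (A.envRetract a b).map_d
  · rw [h]; rfl
  · rw [h]; exact Function.bijective_id

end Unit

section Map

variable {A B : AInfCat.{u,v,w} K Λ} (F : Mor A B)

def actMap : A.ActMod b →ₗ[K] B.ActMod b :=
  LinearMap.pi fun a =>
    (LinearMap.prodMap (F.φ a b).f (envMap F).toLinearMap) ∘ₗ LinearMap.proj a

lemma actMap_apply (n : A.ActMod b) (a : Λ) :
    actMap F n a = ((F.φ a b).f (n a).1, envMap F (n a).2) := rfl

lemma actMap_actOne : actMap F (A.actOne b) = B.actOne b := by
  refine B.chainAct_ext (a := b) ?_ (fun e he => ?_) fun e he => B.actOne_of_ne he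
  · rw [actMap_apply, actOne_same, actOne_same, F.map_one, map_zero]
  · rw [actMap_apply, A.actOne_of_ne he]; simp

lemma envAct_envMap (r : Env A) (n : A.ActMod b) :
    B.envAct b (envMap F r) (actMap F n) = actMap F (A.envAct b r n) := by
  induction r using Env.induction generalizing n with
  | scalar k => simp
  | @tau a a' c =>
    rw [envMap_tau, envAct_tau, envAct_tau]
    refine B.chainAct_ext (a := a) ?_ (fun e he => B.chainAct_of_ne _ _ he) fun e he => ?_
    · rw [chainAct_same, actMap_apply, actMap_apply, chainAct_same, length_map]
      have h : ∀ {e e' f : Λ} (c : χ[A] e e') (y : (A.Hom e' f).X),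
          (c.map fun a b => (F.φ a b).f).append (cons ((F.φ e' f).f y) (nil f)) =
          (c.append (cons y (nil f))).map fun a b => (F.φ a b).f := fun c y => by
        rw [map_append]; rfl
      split_ifs
      · simp only [Prod.fst_zero, Prod.snd_zero, map_zero]; rfl
      · refine Prod.ext ?_ ?_
        · rw [cellAct_fst, cellAct_fst]
          dsimp only
          rw [h, map_bar]
        · rw [cellAct_snd, cellAct_snd]
          dsimp only
          rw [h, map_add, map_mul, envMap_tau, envMap_tau]
    · rw [actMap_apply, A.chainAct_of_ne _ _ he]; simp
  | mul r s hr hs =>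
    simp only [map_mul, Module.End.mul_apply, hr, hs]
  | add r s hr hs => simp only [map_add, LinearMap.add_apply, hr, hs]

lemma map_evalFst (a : Λ) (r : Env A) :
    (F.φ a b).f (A.evalFst a b r) = B.evalFst a b (envMap F r) := by
  rw [evalFst_apply, evalFst_apply, ← actMap_actOne F, envAct_envMap]; rfl

lemma envUnit_natural [CharZero K] {A B : AInfCat.{u,v,max u v w} K Λ} (F : Mor A B)
    (x : (A.Hom a b).X) :
    ((envCatMap F).φ a b).f ((A.envUnit a b).f x) = (B.envUnit a b).f ((F.φ a b).f x) :=
  envCx_ext (envMap_tau F _)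

end Map

end AInfCat

namespace DGCat

open Chain AInfCat

lemma sgn_mul (B : DGCat.{u,v,w} K Λ) (x : (B.Hom a b).X) (y : (B.Hom b c).X) :
    (B.Hom a c).sgn (B.mul x y) = B.mul ((B.Hom a b).sgn x) ((B.Hom b c).sgn y) := by
  induction x using (B.Hom a b).homogeneous_induction with
  | mem n x hx =>
    induction y using (B.Hom b c).homogeneous_induction with
    | mem m y hy =>
      rw [Cx.sgn_of_mem _ hx, Cx.sgn_of_mem _ hy, Cx.sgn_of_mem _ (B.mul_mem hx hy)]
      simp [Int.negOnePow_add, smul_smul, mul_comm]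
    | add y z hy hz => simp only [map_add, hy, hz]
  | add x z hx hz => simp only [map_add, LinearMap.add_apply, hx, hz]

lemma bar_pair (B : DGCat.{u,v,w} K Λ) (x : (B.Hom a b).X) (y : (B.Hom b c).X) :
    B.toAInfCat.bar a c (cons x (cons y (nil c))) = B.mul ((B.Hom a b).sgn x) y := rfl

lemma bar_long (B : DGCat.{u,v,w} K Λ) (l : ChainOf B.toAInfCat.Hom a b)
    (h : 3 ≤ l.length) : B.toAInfCat.bar a b l = 0 :=
  B.op_long _ (h.trans_eq (length_twist l).symm)

def postMul (B : DGCat.{u,v,w} K Λ) (y : (B.Hom b c).X) (a : Λ) :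
    (B.toAInfCat.Hom a b).X →ₗ[K] (B.toAInfCat.Hom a c).X := B.mul.flip y

lemma envAct_mul (B : DGCat.{u,v,w} K Λ) (y : (B.Hom b c).X)
    (r : Env B.toAInfCat) (n : B.toAInfCat.ActMod b) (n' : B.toAInfCat.ActMod c)
    (h : ∀ a, (n' a).1 = B.postMul y a (n a).1) (a : Λ) :
    (B.toAInfCat.envAct c r n' a).1 = B.postMul y a (B.toAInfCat.envAct b r n a).1 := by
  induction r using Env.induction generalizing n n' a with
  | scalar k =>
    simp only [AlgHom.commutes, Module.algebraMap_end_apply, Pi.smul_apply, Prod.smul_fst, h,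
      map_smul]
  | @tau e e' l =>
    rw [envAct_tau, envAct_tau]
    by_cases he : a = e
    · subst he
      rw [chainAct_same, chainAct_same]
      cases l with
      | nil => rw [if_pos (by rfl), if_pos (by rfl), Prod.fst_zero, Prod.fst_zero, map_zero]
      | cons x l =>
        rw [if_neg (by simp [length]), if_neg (by simp [length]), cellAct_fst, cellAct_fst, h]
        cases l with
        | nil => exact (B.bar_pair _ _).trans ((B.mul_assoc _ _ _).symm.trans
            (congrArg (B.postMul y a) (B.bar_pair _ _).symm))
        | cons x' l =>
          rw [bar_long, bar_long, map_zero]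
          all_goals simp only [length_append, length]; omega
    · rw [chainAct_of_ne _ _ _ he, chainAct_of_ne _ _ _ he, Prod.fst_zero, Prod.fst_zero, map_zero]
  | mul r s hr hs =>
    simp only [map_mul, Module.End.mul_apply]
    exact hr _ _ (hs _ _ h) a
  | add r s hr hs =>
    simp only [map_add, LinearMap.add_apply, Pi.add_apply, Prod.fst_add, hr _ _ h, hs _ _ h]

variable [CharZero K]

/-- The enveloping dg category of a dg category is a resolution. -/
def envCounit (B : DGCat.{u,v,max u v w} K Λ) : Mor B.toAInfCat.envCat B where
  φ a b := B.toAInfCat.envRetract a b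
  map_mul {a b c} x y := by
    refine Eq.trans (congrArg (B.Hom a c).sgn ?_) (B.sgn_mul _ _)
    change B.toAInfCat.evalFst a c (B.toAInfCat.envVal a b x * B.toAInfCat.envVal b c y) =
      B.postMul (B.toAInfCat.evalFst b c (B.toAInfCat.envVal b c y)) a
        (B.toAInfCat.evalFst a b (B.toAInfCat.envVal a b x))
    rw [evalFst_apply, map_mul, Module.End.mul_apply]
    refine B.envAct_mul _ _ (B.toAInfCat.actOne b) _ (fun e => ?_) a
    by_cases he : e = b
    · subst he
      rw [actOne_same]
      exact (B.one_mul _).symm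
    · rw [actOne_of_ne _ he, Prod.fst_zero, map_zero]
      exact congrArg Prod.fst
        (B.toAInfCat.envAct_of_ne (B.toAInfCat.idem_mul_envVal (a := b) (b := c) y) _ he)
  map_one a := by
    have := B.toAInfCat.envRetract_envUnit (B.one a)
    exact this

lemma isQuasiIso_envCounit (B : DGCat.{u,v,max u v w} K Λ) (a b : Λ) :
    (B.envCounit.φ a b).IsQuasiIso := B.toAInfCat.isQuasiIso_envRetract a b

/-- The natural quasi-isomorphism from the enveloping dg category of a dg category. -/
def envCounitNat (K : Type u) [Field K] [CharZero K] (Λ : Type v) :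
    inclusion.{u,v,max u v w} K Λ ⋙ envelope.{u,v,max u v w} K Λ ⟶ 𝟭 _ where
  app B := B.envCounit
  naturality B B' F := by
    refine DGCat.Mor.ext (funext fun a => funext fun b => Cx.Hom.ext (LinearMap.ext fun x => ?_))
    have := map_evalFst (b := b) ((inclusion K Λ).map F) a (B.toAInfCat.envVal a b x)
    exact (congrArg (B'.Hom a b).sgn this.symm).trans ((F.φ a b).map_sgn _).symm

end DGCat

lemma isExact_inclusion (K : Type u) [Field K] (Λ : Type v) :
    IsExact (DGCat.quasiIso K Λ) (AInfCat.quasiIso K Λ) (DGCat.inclusion.{u,v,w} K Λ) :=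
  fun _ _ _ h => h

lemma isExact_envelope (K : Type u) [Field K] [CharZero K] (Λ : Type v) :
    IsExact (AInfCat.quasiIso K Λ) (DGCat.quasiIso K Λ)
      (AInfCat.envelope.{u,v,max u v w} K Λ) := by
  intro A B F hF a b
  refine HomologyBijective.of_comp (f := (A.envUnit a b).f) ?_ (A.isQuasiIso_envUnit a b)
    (A.envUnit a b).map_d (((AInfCat.envelope K Λ).map F).φ a b).map_d
  have : (((AInfCat.envelope K Λ).map F).φ a b).f ∘ₗ (A.envUnit a b).f =
      (B.envUnit a b).f ∘ₗ (F.φ a b).f :=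
    LinearMap.ext fun x => AInfCat.envUnit_natural F x
  rw [this]
  exact HomologyBijective.comp (B.isQuasiIso_envUnit a b) (hF a b) (F.φ a b).map_d
    (B.envUnit a b).map_d

lemma HomologyBijective.of_comp_left {L M N : Type*} [AddCommGroup L]
    [Module K L] [AddCommGroup M] [Module K M] [AddCommGroup N] [Module K N]
    {dL : L →ₗ[K] L} {dM : M →ₗ[K] M} {dN : N →ₗ[K] N} {g : M →ₗ[K] N} {f : L →ₗ[K] M}
    (hgf : HomologyBijective dL dN (g ∘ₗ f)) (hg : HomologyBijective dM dN g)
    (h : ∀ x, f (dL x) = dM (f x)) (h' : ∀ x, g (dM x) = dN (g x)) :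
    HomologyBijective dL dM f := by
  refine ⟨fun x hx ⟨y, hy⟩ => hgf.1 x hx ⟨g y, by rw [← h', hy]; rfl⟩, fun y hy => ?_⟩
  obtain ⟨x, hx, z, hz⟩ := hgf.2 (g y) (by rw [← h', hy, map_zero])
  obtain ⟨w, hw⟩ := hg.1 (y - f x) (by rw [map_sub, hy, ← h, hx, map_zero, sub_zero])
    ⟨z, by rw [map_sub, hz]; simp⟩
  exact ⟨x, hx, w, by rw [hw]; abel⟩

lemma SlotLinear.sub_fun {N : Type*} [AddCommGroup N]
    [Module K N] {H : Λ → Λ → Type*} [∀ a b, AddCommGroup (H a b)] [∀ a b, Module K (H a b)]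
    {Ψ Ψ' : Chain H a b → N} (h : SlotLinear K Ψ) (h' : SlotLinear K Ψ') :
    SlotLinear K fun c => Ψ c - Ψ' c := by
  simpa [sub_eq_add_neg] using h.add_fun (h'.const_smul (-1))

lemma Chain.eq_nil_or_append {H : Λ → Λ → Type w} (c : Chain H a b) :
    (∃ h : a = b, c = h ▸ Chain.nil a) ∨
      ∃ (e : Λ) (l : Chain H a e) (x : H e b), c = l.append (Chain.cons x (Chain.nil b)) := by
  induction c with
  | nil => exact Or.inl ⟨rfl, rfl⟩
  | @cons a e b x l ih =>
    rcases ih with ⟨h, h'⟩ | ⟨f, l', y, rfl⟩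
    · subst h; subst h'
      exact Or.inr ⟨a, Chain.nil a, x, rfl⟩
    · exact Or.inr ⟨f, Chain.cons x l', y, rfl⟩

/-- Functions of chains with values in a ring. -/
def Conv (H : Λ → Λ → Type w) (B : Type*) := ∀ a b, Chain H a b → B

namespace Conv

variable {H H' : Λ → Λ → Type w} {B : Type*} [Ring B]

instance : AddCommGroup (Conv H B) := inferInstanceAs (AddCommGroup (∀ a b, Chain H a b → B))

instance : Mul (Conv H B) := ⟨fun f g _ _ c => c.sumSplits fun _ p q => f _ _ p * g _ _ q⟩

lemma mul_apply (f g : Conv H B) (c : Chain H a b) :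
    (f * g) a b c = c.sumSplits fun e p q => f a e p * g e b q := rfl

@[simp] lemma add_apply (f g : Conv H B) (c : Chain H a b) :
    (f + g) a b c = f a b c + g a b c := rfl

@[simp] lemma sub_apply (f g : Conv H B) (c : Chain H a b) :
    (f - g) a b c = f a b c - g a b c := rfl

@[simp] lemma neg_apply (f : Conv H B) (c : Chain H a b) :
    (-f) a b c = -f a b c := rfl

@[simp] lemma zero_apply (c : Chain H a b) : (0 : Conv H B) a b c = 0 := rfl

lemma ext {f g : Conv H B} (h : ∀ a b c, f a b c = g a b c) : f = g :=
  funext fun a => funext fun b => funext fun c => h a b c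

instance : NonUnitalRing (Conv H B) where
  __ := (inferInstance : AddCommGroup (Conv H B))
  left_distrib f g h := ext fun a b c => by
    simp only [mul_apply, add_apply, mul_add, Chain.sumSplits_add]
  right_distrib f g h := ext fun a b c => by
    simp only [mul_apply, add_apply, add_mul, Chain.sumSplits_add]
  zero_mul f := ext fun a b c => by simp only [mul_apply, zero_apply, zero_mul, Chain.sumSplits_zero]
  mul_zero f := ext fun a b c => by simp only [mul_apply, zero_apply, mul_zero, Chain.sumSplits_zero]
  mul_assoc f g h := ext fun a b c => by
    have e1 : ∀ e (p : Chain H a e) (q : Chain H e b), (p.sumSplits fun e' p1 p2 =>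
        f a e' p1 * g e' e p2) * h e b q = p.sumSplits fun e' p1 p2 =>
        f a e' p1 * g e' e p2 * h e b q := fun e p q =>
      Chain.map_sumSplits (AddMonoidHom.mulRight (h e b q)) p _
    have e2 : ∀ e (p : Chain H a e) (q : Chain H e b), f a e p * (q.sumSplits fun e' q1 q2 =>
        g e e' q1 * h e' b q2) = q.sumSplits fun e' q1 q2 =>
        f a e p * g e e' q1 * h e' b q2 := fun e p q =>
      (Chain.map_sumSplits (AddMonoidHom.mulLeft (f a e p)) q _).trans (by
        simp only [AddMonoidHom.coe_mulLeft, mul_assoc])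
    simp only [mul_apply, e1, e2]
    exact (Chain.sumSplits_assoc c fun _ _ p q t => f _ _ p * g _ _ q * h _ _ t).symm

variable [Algebra K B]

def post (L : B →ₗ[K] B) (f : Conv H B) : Conv H B := fun a b c => L (f a b c)

@[simp] lemma post_apply (L : B →ₗ[K] B) (f : Conv H B) (c : Chain H a b) :
    f.post L a b c = L (f a b c) := rfl

lemma post_add (L : B →ₗ[K] B) (f g : Conv H B) : (f + g).post L = f.post L + g.post L :=
  ext fun _ _ _ => map_add _ _ _

lemma post_sub (L : B →ₗ[K] B) (f g : Conv H B) : (f - g).post L = f.post L - g.post L :=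
  ext fun _ _ _ => map_sub _ _ _

lemma post_mul (σ : B →ₐ[K] B) (f g : Conv H B) :
    (f * g).post σ.toLinearMap = f.post σ.toLinearMap * g.post σ.toLinearMap :=
  ext fun a b c => by
    simp only [mul_apply, post_apply, Chain.map_sumSplits, AlgHom.toLinearMap_apply, map_mul]

lemma post_mul_of_derivation (d : B →ₗ[K] B) (σ : B →ₐ[K] B)
    (h : ∀ r s, d (r * s) = d r * s + σ r * d s) (f g : Conv H B) :
    (f * g).post d = f.post d * g + f.post σ.toLinearMap * g.post d :=
  ext fun a b c => by
    simp only [mul_apply, post_apply, add_apply, Chain.map_sumSplits, h, Chain.sumSplits_add,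
      AlgHom.toLinearMap_apply]

/-- Application of a map to the entries of the chain. -/
def pre (s : ∀ a b, H a b → H' a b) (f : Conv H' B) : Conv H B := fun a b c => f a b (c.map s)

lemma pre_mul (s : ∀ a b, H a b → H' a b) (f g : Conv H' B) :
    (f * g).pre s = f.pre s * g.pre s := ext fun a b c => Chain.sumSplits_map _ _ _

variable [∀ a b, AddCommGroup (H a b)] [∀ a b, Module K (H a b)]

/-- The function that applies a linear map to chains of length one and vanishes on all others. -/
def single (f : ∀ a b, H a b →ₗ[K] B) : Conv H B
  | _, _, .cons x (.nil _) => f _ _ x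
  | _, _, .nil _ => 0
  | _, _, .cons _ (.cons _ _) => 0

lemma single_of_length (f : ∀ a b, H a b →ₗ[K] B) (c : Chain H a b)
    (h : c.length ≠ 1) : single f a b c = 0 := by
  match c, h with
  | .nil _, _ => rfl
  | .cons x (.nil _), h => exact absurd rfl h
  | .cons _ (.cons _ _), _ => rfl

lemma slotLinear_single (f : ∀ a b, H a b →ₗ[K] B) (a b : Λ) :
    SlotLinear K (single f a b) := by
  constructor
  · intro c e l x y l'
    by_cases h : l.length = 0 ∧ l'.length = 0
    · cases l with
      | nil =>
        cases l' with
        | nil => exact map_add _ _ _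
        | cons z l' => exact absurd h.2 (by simp [Chain.length])
      | cons z l => exact absurd h.1 (by simp [Chain.length])
    · rw [single_of_length, single_of_length, single_of_length, add_zero]
      all_goals simp only [Chain.length_append, Chain.length]; omega
  · intro c e l k x l'
    by_cases h : l.length = 0 ∧ l'.length = 0
    · cases l with
      | nil =>
        cases l' with
        | nil => exact map_smul _ _ _
        | cons z l' => exact absurd h.2 (by simp [Chain.length])
      | cons z l => exact absurd h.1 (by simp [Chain.length])
    · rw [single_of_length, single_of_length, smul_zero]
      all_goals simp only [Chain.length_append, Chain.length]; omega

lemma slotLinear_mul {f g : Conv H B} (hf : ∀ a b, SlotLinear K (f a b))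
    (hg : ∀ a b, SlotLinear K (g a b)) (a b : Λ) : SlotLinear K ((f * g) a b) :=
  SlotLinear.sumSplits (fun e q => (hf a e).comp (LinearMap.mulRight K (g e b q)))
    fun e p => (hg e b).comp (LinearMap.mulLeft K (f a e p))

variable (s : ∀ a b, H a b →ₗ[K] H a b) (β : ∀ a b : Λ, Chain H a b → H a b)

/-- The coderivation induced by `β`. -/
def ins (f : Conv H B) : Conv H B := fun a b => insertSum s β (f a b)

lemma ins_add (f g : Conv H B) : ins s β (f + g) = ins s β f + ins s β g :=
  ext fun a b c => by simp only [ins, insertSum, add_apply, Chain.sumSplits_add]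

lemma ins_neg (f : Conv H B) : ins s β (-f) = -ins s β f :=
  ext fun a b c => by simp only [ins, insertSum, neg_apply, Chain.neg_sumSplits]

lemma ins_sub (f g : Conv H B) : ins s β (f - g) = ins s β f - ins s β g := by simp [sub_eq_add_neg, ins_add, ins_neg]

lemma ins_post (L : B →ₗ[K] B) (f : Conv H B) : ins s β (f.post L) = (ins s β f).post L :=
  ext fun a b c => (map_insertSum L (f a b) c).symm

lemma ins_mul (f g : Conv H B) :
    ins s β (f * g) = ins s β f * g + f.pre (fun a b => s a b) * ins s β g :=
  ext fun a b c => by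
    have h1 : ∀ {e} (p : Chain H a e) (y : B),
        insertSum s β (fun p' => f a e p' * y) p = insertSum s β (f a e) p * y :=
      fun p y => (map_insertSum (LinearMap.mulRight K y) _ p).symm
    have h2 : ∀ {e} (p : Chain H e b) (y : B),
        insertSum s β (fun p' => y * g e b p') p = y * insertSum s β (g e b) p :=
      fun p y => (map_insertSum (LinearMap.mulLeft K y) _ p).symm
    have := insertSum_sumSplits (s := s) (b := β) c fun e p q => f a e p * g e b q
    simp only [h1, h2, Chain.sumSplits_add] at this
    exact this

lemma ins_single (f : ∀ a b, H a b →ₗ[K] B) :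
    ins s β (single f) = fun a b c => f a b (β a b c) := ext fun a b c => by
  rw [ins, insertSum, Chain.sumSplits_eq_first, Chain.sumSplits_eq_last]
  · rfl
  · intro e p q hq
    refine single_of_length f _ ?_
    simp only [Chain.length_append, Chain.length]; omega
  · intro e p w hp
    refine (Chain.sumSplits_congr w fun e' q t _ => ?_).trans (Chain.sumSplits_zero w)
    refine single_of_length f _ ?_
    simp only [Chain.length_append, Chain.length, Chain.length_map]; omega

end Conv

namespace AInfCat

open Chain

/-- Morphisms in terms of the operations on suspensions. -/
def Mor.ofBar {A B : AInfCat.{u,v,w} K Λ} (φ : ∀ a b, Cx.Hom (A.Hom a b) (B.Hom a b))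
    (h : ∀ {a b : Λ} (c : χ[A] a b),
      (φ a b).f (A.bar a b c) = B.bar a b (c.map fun a b => (φ a b).f))
    (one : ∀ a, (φ a a).f (A.one a) = B.one a) : Mor A B where
  φ := φ
  map_m {a b} l := by
    have := h l.twist
    rw [bar, bar, twist_twist, ← twist_map _ fun a b x => (φ a b).map_sgn x, twist_twist] at this
    exact this
  map_one := one

section Cylinder

variable [CharZero K] (A : AInfCat.{u,v,max u v w} K Λ)

/-- The complex of pairs of a morphism of an A-infinity category and a morphism of its enveloping dg
category, together with a homotopy between them. -/
def cylCx (a b : Λ) : Cx.{u, max u v w} K where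
  X := (A.Hom a b).X × (A.envCx a b).X × (A.envCx a b).X
  grade n := ((A.Hom a b).grade n).prod
    (((A.envCx a b).grade n).prod ((A.envCx a b).grade (n + 1)))
  internal := by
    refine isInternal_of_eigenspaces _ (LinearMap.prodMap
      ((A.Hom a b).scale (Units.mk0 2 two_ne_zero)) (LinearMap.prodMap
        ((A.envCx a b).scale (Units.mk0 2 two_ne_zero))
        ((2⁻¹ : K) • (A.envCx a b).scale (Units.mk0 2 two_ne_zero))))
      (fun n x hx => ?_) (eq_top_iff.2 fun x _ => ?_)
    · obtain ⟨h1, h2, h3⟩ := hx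
      refine Prod.ext ?_ (Prod.ext ?_ ?_)
      · exact (Cx.scale_of_mem _ _ h1).trans (by simp)
      · exact (Cx.scale_of_mem _ _ h2).trans (by simp)
      · refine (congrArg (fun z => (2⁻¹ : K) • z) (Cx.scale_of_mem _ _ h3)).trans ?_
        rw [smul_smul, Units.val_zpow_eq_zpow_val, Units.val_mk0, zpow_add_one₀ two_ne_zero,
          mul_comm, _root_.mul_assoc, mul_inv_cancel₀ two_ne_zero, _root_.mul_one]
        rfl
    · have e : x = (x.1, (0 : (A.envCx a b).X × (A.envCx a b).X)) +
          ((0, (x.2.1, 0)) + (0, (0, x.2.2))) := by ext <;> simp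
      rw [e]
      refine Submodule.add_mem _ ?_ (Submodule.add_mem _ ?_ ?_)
      · induction x.1 using (A.Hom a b).homogeneous_induction with
        | mem n x hx => exact Submodule.mem_iSup_of_mem n ⟨hx, Submodule.zero_mem _⟩
        | add x y hx hy => simpa using Submodule.add_mem _ hx hy
      · induction x.2.1 using (A.envCx a b).homogeneous_induction with
        | mem n x hx =>
          exact Submodule.mem_iSup_of_mem n ⟨Submodule.zero_mem _, hx, Submodule.zero_mem _⟩
        | add x y hx hy => simpa using Submodule.add_mem _ hx hy
      · induction x.2.2 using (A.envCx a b).homogeneous_induction with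
        | mem n x hx =>
          exact Submodule.mem_iSup_of_mem (n - 1) ⟨Submodule.zero_mem _, Submodule.zero_mem _,
            by simpa using hx⟩
        | add x y hx hy => simpa using Submodule.add_mem _ hx hy
  d := ((A.Hom a b).d ∘ₗ LinearMap.fst K _ _).prod
    (((A.envCx a b).d ∘ₗ LinearMap.fst K _ _ ∘ₗ LinearMap.snd K _ _).prod
      ((A.envUnit a b).f ∘ₗ LinearMap.fst K _ _ - LinearMap.fst K _ _ ∘ₗ LinearMap.snd K _ _ -
        (A.envCx a b).d ∘ₗ LinearMap.snd K _ _ ∘ₗ LinearMap.snd K _ _))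
  d_mem {n x} hx := by
    obtain ⟨h1, h2, h3⟩ := hx
    refine ⟨(A.Hom a b).d_mem h1, (A.envCx a b).d_mem h2, ?_⟩
    have h3' := (A.envCx a b).d_mem h3
    rw [add_sub_cancel_right] at h3'
    rw [sub_add_cancel]
    exact Submodule.sub_mem _ (Submodule.sub_mem _ ((A.envUnit a b).map_mem h1) h2) h3'
  d_d x := by
    refine Prod.ext ?_ (Prod.ext ?_ ?_)
    · exact (A.Hom a b).d_d _
    · exact (A.envCx a b).d_d _
    · simp [Cx.d_d, Cx.Hom.map_d]

def cylFst (a b : Λ) : (A.cylCx a b).X →ₗ[K] (A.Hom a b).X := LinearMap.fst K _ _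

def cylSnd (a b : Λ) : (A.cylCx a b).X →ₗ[K] (A.envCx a b).X :=
  LinearMap.fst K _ _ ∘ₗ LinearMap.snd K _ _

def cylThd (a b : Λ) : (A.cylCx a b).X →ₗ[K] (A.envCx a b).X :=
  LinearMap.snd K _ _ ∘ₗ LinearMap.snd K _ _

lemma cyl_scale (t : Kˣ) (x : (A.cylCx a b).X) :
    A.cylFst a b ((A.cylCx a b).scale t x) = (A.Hom a b).scale t (A.cylFst a b x) ∧
      A.cylSnd a b ((A.cylCx a b).scale t x) = (A.envCx a b).scale t (A.cylSnd a b x) ∧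
      (t : K) • A.cylThd a b ((A.cylCx a b).scale t x) =
        (A.envCx a b).scale t (A.cylThd a b x) := by
  induction x using (A.cylCx a b).homogeneous_induction with
  | mem n x hx =>
    rw [Cx.scale_of_mem _ t hx]
    obtain ⟨h1, h2, h3⟩ := hx
    refine ⟨?_, ?_, ?_⟩
    · rw [map_smul]; exact (Cx.scale_of_mem _ t h1).symm
    · rw [map_smul]; exact (Cx.scale_of_mem _ t h2).symm
    · rw [map_smul, smul_smul, ← Units.val_mul, mul_comm t, ← zpow_add_one]
      exact (Cx.scale_of_mem _ t h3).symm
  | add x y hx hy =>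
    simp only [map_add, smul_add]
    exact ⟨congrArg₂ _ hx.1 hy.1, congrArg₂ _ hx.2.1 hy.2.1, congrArg₂ _ hx.2.2 hy.2.2⟩

/-- The generators of the enveloping algebra, as a function on chains. -/
def convTau : Conv (fun a b => (A.Hom a b).X) (Env A) := A.tau

/-- Functions on chains of the cylinder. -/
abbrev CylConv := Conv (fun a b => (A.cylCx a b).X) (Env A)

/-- The twisting function given by the first components. -/
def cylT : CylConv A :=
  A.convTau.pre fun a b => A.cylFst a b

/-- The function given by the second component. -/
def cylU : CylConv A :=
  Conv.single fun a b => A.envVal a b ∘ₗ A.cylSnd a b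

/-- The function given by the third component. -/
def cylZ : CylConv A :=
  Conv.single fun a b => A.envVal a b ∘ₗ A.cylThd a b

def cylY : CylConv A :=
  A.cylU.post A.envD + A.cylU.post A.envSgn.toLinearMap * A.cylU

def cylM : CylConv A :=
  A.cylT + A.cylT * A.cylZ - A.cylZ.post A.envSgn.toLinearMap * A.cylU - A.cylU -
    A.cylZ.post A.envD

def cylBar (a b : Λ) (c : ChainOf A.cylCx a b) : (A.cylCx a b).X :=
  (A.bar a b (c.map fun a b => A.cylFst a b), A.toEnvCx a b (A.cylY a b c),
    A.toEnvCx a b (A.cylM a b c))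

/-- Functions on chains of degree `-k`. -/
def HasWeight (k : ℤ) (f : CylConv A) : Prop :=
  ∀ (t : Kˣ) (a b : Λ) (c : ChainOf A.cylCx a b),
    f a b (c.map fun a b => (A.cylCx a b).barScale t) =
      ((t ^ k : Kˣ) : K) • A.envScale t (f a b c)

variable {A}

lemma HasWeight.add {k : ℤ} {f g : CylConv A}
    (hf : A.HasWeight k f) (hg : A.HasWeight k g) : A.HasWeight k (f + g) := fun t a b c => by
  rw [Conv.add_apply, hf, hg, Conv.add_apply, map_add, smul_add]

lemma HasWeight.sub {k : ℤ} {f g : CylConv A}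
    (hf : A.HasWeight k f) (hg : A.HasWeight k g) : A.HasWeight k (f - g) := fun t a b c => by
  rw [Conv.sub_apply, hf, hg, Conv.sub_apply, map_sub, smul_sub]

lemma HasWeight.mul {k l : ℤ} {f g : CylConv A}
    (hf : A.HasWeight k f) (hg : A.HasWeight l g) : A.HasWeight (k + l) (f * g) :=
  fun t a b c => by
    simp only [Conv.mul_apply, sumSplits_map, hf t, hg t, map_sumSplits, smul_sumSplits, map_mul,
      smul_mul_smul_comm, zpow_add, Units.val_mul]

lemma HasWeight.sgn {k : ℤ} {f : CylConv A}
    (hf : A.HasWeight k f) : A.HasWeight k (f.post A.envSgn.toLinearMap) := fun t a b c => by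
  simp only [Conv.post_apply, hf t, map_smul, AlgHom.toLinearMap_apply]
  rw [A.envScale_comm]

lemma HasWeight.d {k : ℤ} {f : CylConv A}
    (hf : A.HasWeight k f) : A.HasWeight (k + 1) (f.post A.envD) := fun t a b c => by
  simp only [Conv.post_apply, hf t, map_smul, A.envScale_envD, smul_smul]
  rw [zpow_add_one, Units.val_mul, _root_.mul_assoc, Units.mul_inv, _root_.mul_one]

lemma HasWeight.pre_sgn {k : ℤ} {f : CylConv A}
    (hf : A.HasWeight k f) : (f.pre fun a b => (A.cylCx a b).barScale (-1)) =
      f.post ((((-1) ^ k : Kˣ) : K) • A.envSgn.toLinearMap) :=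
  Conv.ext fun a b c => hf (-1) a b c

lemma HasWeight.mem {k : ℤ} {f : CylConv A}
    (hf : A.HasWeight k f) (hl : ∀ a b, SlotLinear K (f a b)) {c : ChainOf A.cylCx a b}
    {n : ℤ} (hc : c.Homogeneous n) : f a b c ∈ A.envGrade (n + c.length - k) := fun t => by
  have h := hf t a b c
  rw [(hl a b).map_barScale t hc] at h
  have h2 := congrArg (fun r => ((t ^ (-k) : Kˣ) : K) • r) h
  simp only [smul_smul, ← Units.val_mul, ← zpow_add, neg_add_cancel, zpow_zero, Units.val_one,
    one_smul] at h2
  rw [← h2, sub_eq_neg_add]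

/-- Functions on chains with values in the corners of the enveloping algebra. -/
def InCorner (f : CylConv A) : Prop :=
  ∀ (a b : Λ) (c : ChainOf A.cylCx a b), f a b c ∈ A.corner a b

lemma InCorner.add {f g : CylConv A}
    (hf : InCorner f) (hg : InCorner g) : InCorner (f + g) := fun a b c =>
  Submodule.add_mem _ (hf a b c) (hg a b c)

lemma InCorner.sub {f g : CylConv A}
    (hf : InCorner f) (hg : InCorner g) : InCorner (f - g) := fun a b c =>
  Submodule.sub_mem _ (hf a b c) (hg a b c)

lemma InCorner.mul {f g : CylConv A}
    (hf : InCorner f) (hg : InCorner g) : InCorner (f * g) := fun a b c => by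
  have h1 := map_sumSplits (LinearMap.mulLeft K (A.idem a)) c fun e p q => f a e p * g e b q
  have h2 := map_sumSplits (LinearMap.mulRight K (A.idem b)) c fun e p q => f a e p * g e b q
  simp only [LinearMap.mulLeft_apply, ← _root_.mul_assoc,
    (hf _ _ _).1] at h1
  simp only [LinearMap.mulRight_apply, _root_.mul_assoc, (hg _ _ _).2] at h2
  exact ⟨h1, h2⟩

lemma InCorner.sgn {f : CylConv A}
    (hf : InCorner f) : InCorner (f.post A.envSgn.toLinearMap) := fun a b c => by
  have h1 := congrArg A.envSgn (hf a b c).1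
  have h2 := congrArg A.envSgn (hf a b c).2
  rw [map_mul, envScale_idem] at h1 h2
  exact ⟨h1, h2⟩

lemma InCorner.d {f : CylConv A}
    (hf : InCorner f) : InCorner (f.post A.envD) := fun a b c =>
  ((A.envCx a b).d ⟨_, hf a b c⟩ : A.corner a b).2

lemma InCorner.envVal_toEnvCx {f : CylConv A}
    (hf : InCorner f) (c : ChainOf A.cylCx a b) :
    A.envVal a b (A.toEnvCx a b (f a b c)) = f a b c := by
  rw [A.envVal_toEnvCx, (hf a b c).2, (hf a b c).1]

lemma inCorner_single (f : ∀ a b, (A.cylCx a b).X →ₗ[K] (A.envCx a b).X) :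
    InCorner (Conv.single fun a b => A.envVal a b ∘ₗ f a b) := fun a b c =>
  match c with
  | .nil a => Submodule.zero_mem _
  | .cons x (.nil _) => (f _ _ x : A.corner _ _).2
  | .cons _ (.cons _ _) => Submodule.zero_mem _

variable (A)

lemma inCorner_cylT : InCorner A.cylT := fun _ _ _ => ⟨A.idem_mul_tau _, A.tau_mul_idem _⟩

lemma inCorner_cylY : InCorner A.cylY :=
  (inCorner_single _).d.add ((inCorner_single _).sgn.mul (inCorner_single _))

lemma inCorner_cylM : InCorner A.cylM :=
  (((A.inCorner_cylT.add (A.inCorner_cylT.mul (inCorner_single _))).sub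
    ((inCorner_single _).sgn.mul (inCorner_single _))).sub (inCorner_single _)).sub
    (inCorner_single _).d

lemma hasWeight_cylT : A.HasWeight 1 A.cylT := fun t a b c => by
  change A.tau a b ((c.map fun a b => (A.cylCx a b).barScale t).map fun a b => A.cylFst a b) =
    ((t ^ (1 : ℤ) : Kˣ) : K) • A.envScale t (A.tau a b (c.map fun a b => A.cylFst a b))
  rw [envScale_tau, smul_smul, zpow_one, Units.mul_inv, one_smul, chain_map_map, chain_map_map]
  congr 1
  refine Chain.map_congr (fun a b x => ?_) c
  simp only [Cx.barScale, LinearMap.smul_apply, map_smul, (A.cyl_scale t x).1]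

lemma hasWeight_single {k : ℤ} (f : ∀ a b, (A.cylCx a b).X →ₗ[K] (A.envCx a b).X)
    (h : ∀ (t : Kˣ) a b (x : (A.cylCx a b).X), f a b ((A.cylCx a b).barScale t x) =
      ((t ^ k : Kˣ) : K) • (A.envCx a b).scale t (f a b x)) :
    A.HasWeight k (Conv.single fun a b => A.envVal a b ∘ₗ f a b) := fun t a b c =>
  match c with
  | .nil a => by simp [Chain.map, Conv.single]
  | .cons x (.nil _) => by
    simp only [Chain.map, Conv.single, LinearMap.comp_apply, h, map_smul, A.envVal_scale]
  | .cons _ (.cons _ _) => by simp [Chain.map, Conv.single]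

lemma hasWeight_cylU : A.HasWeight 1 A.cylU := A.hasWeight_single _ fun t a b x => by
  rw [Cx.barScale, LinearMap.smul_apply, map_smul, (A.cyl_scale t x).2.1, zpow_one]

lemma hasWeight_cylZ : A.HasWeight 0 A.cylZ := A.hasWeight_single _ fun t a b x => by
  rw [Cx.barScale, LinearMap.smul_apply, map_smul, (A.cyl_scale t x).2.2, zpow_zero, Units.val_one,
    one_smul]

lemma hasWeight_cylY : A.HasWeight 2 A.cylY :=
  A.hasWeight_cylU.d.add (A.hasWeight_cylU.sgn.mul A.hasWeight_cylU)

lemma hasWeight_cylM : A.HasWeight 1 A.cylM :=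
  (((A.hasWeight_cylT.add (A.hasWeight_cylT.mul A.hasWeight_cylZ)).sub
    (A.hasWeight_cylZ.sgn.mul A.hasWeight_cylU)).sub A.hasWeight_cylU).sub A.hasWeight_cylZ.d

lemma slotLinear_cylT (a b : Λ) : SlotLinear K (A.cylT a b) := (A.slotLinear_tau a b).map _

lemma slotLinear_cylU (a b : Λ) : SlotLinear K (A.cylU a b) := Conv.slotLinear_single _ a b

lemma slotLinear_cylZ (a b : Λ) : SlotLinear K (A.cylZ a b) := Conv.slotLinear_single _ a b

lemma slotLinear_cylY (a b : Λ) : SlotLinear K (A.cylY a b) :=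
  ((A.slotLinear_cylU a b).comp A.envD).add_fun (Conv.slotLinear_mul
    (fun a b => (A.slotLinear_cylU a b).comp A.envSgn.toLinearMap) A.slotLinear_cylU a b)

lemma slotLinear_cylM (a b : Λ) : SlotLinear K (A.cylM a b) :=
  SlotLinear.sub_fun (SlotLinear.sub_fun (SlotLinear.sub_fun ((A.slotLinear_cylT a b).add_fun
    (Conv.slotLinear_mul A.slotLinear_cylT A.slotLinear_cylZ a b))
    (Conv.slotLinear_mul (fun a b => (A.slotLinear_cylZ a b).comp A.envSgn.toLinearMap)
      A.slotLinear_cylU a b)) (A.slotLinear_cylU a b)) ((A.slotLinear_cylZ a b).comp A.envD)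

lemma slotLinear_cylBar (a b : Λ) : SlotLinear K (A.cylBar a b) :=
  ⟨fun l x y l' => Prod.ext (((A.slotLinear_bar a b).map _).add l x y l')
    (Prod.ext (((A.slotLinear_cylY a b).comp (A.toEnvCx a b)).add l x y l')
      (((A.slotLinear_cylM a b).comp (A.toEnvCx a b)).add l x y l')),
  fun l k x l' => Prod.ext (((A.slotLinear_bar a b).map _).smul l k x l')
    (Prod.ext (((A.slotLinear_cylY a b).comp (A.toEnvCx a b)).smul l k x l')
      (((A.slotLinear_cylM a b).comp (A.toEnvCx a b)).smul l k x l'))⟩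

end Cylinder

end AInfCat

namespace AInfCat

open Chain

section Cylinder

variable [CharZero K] (A : AInfCat.{u,v,max u v w} K Λ)

lemma convTau_d : A.convTau.post A.envD =
    Conv.ins A.barSgn A.bar A.convTau - A.convTau.post A.envSgn.toLinearMap * A.convTau :=
  Conv.ext fun a b c => by
    refine (A.envD_tau c).trans ?_
    rw [delta, Conv.sub_apply, sub_eq_add_neg, Conv.mul_apply, neg_sumSplits]
    refine congrArg _ (sumSplits_congr c fun e p q _ => ?_)
    rw [Conv.post_apply, AlgHom.toLinearMap_apply]
    change _ = -(A.envSgn (A.tau a e p) * A.tau e b q)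
    rw [envSgn_tau, neg_mul, neg_neg]

abbrev cylSgn (a b : Λ) : (A.cylCx a b).X →ₗ[K] (A.cylCx a b).X :=
  (A.cylCx a b).barScale (-1)

lemma insertSum_cylFst {N : Type*} [AddCommGroup N] [Module K N]
    (Ψ : χ[A] a b → N) (c : ChainOf A.cylCx a b) :
    insertSum A.cylSgn A.cylBar (fun l => Ψ (l.map fun a b => A.cylFst a b)) c =
      ι[A] Ψ (c.map fun a b => A.cylFst a b) := by
  refine (insertSum_map (s := A.cylSgn) (β := A.cylBar) (s' := A.barSgn)
      (β' := A.bar) (fun a b x => AInfCat.cylFst.{u,v,w} A a b x) (fun a b x => ?_) ?_ Ψ c).symm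
  · simp only [Cx.barScale, LinearMap.smul_apply, map_smul, (A.cyl_scale (-1) x).1]
  · exact fun a b c => rfl

lemma cylT_apply (c : ChainOf A.cylCx a b) :
    A.cylT a b c = A.tau a b (c.map fun a b => A.cylFst a b) := rfl

lemma ins_cylT : Conv.ins A.cylSgn A.cylBar A.cylT =
    A.cylT.post A.envD + A.cylT.post A.envSgn.toLinearMap * A.cylT := by
  have h : Conv.ins A.cylSgn A.cylBar A.cylT =
      (Conv.ins A.barSgn A.bar A.convTau).pre fun a b => A.cylFst a b :=
    Conv.ext fun a b c => A.insertSum_cylFst (A.tau a b) c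
  rw [h, eq_add_of_sub_eq A.convTau_d.symm]
  exact congrArg (fun z => A.cylT.post A.envD + z) (Conv.pre_mul _ _ _)

lemma ins_cylU : Conv.ins A.cylSgn A.cylBar A.cylU = A.cylY := by
  rw [cylU, Conv.ins_single]
  exact Conv.ext fun a b c => A.inCorner_cylY.envVal_toEnvCx c

lemma ins_cylZ : Conv.ins A.cylSgn A.cylBar A.cylZ = A.cylM := by
  rw [cylZ, Conv.ins_single]
  exact Conv.ext fun a b c => A.inCorner_cylM.envVal_toEnvCx c

variable {A} in
lemma HasWeight.pre_one {f : CylConv A} (hf : A.HasWeight 1 f) :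
    (f.pre fun a b => A.cylSgn a b) = -f.post A.envSgn.toLinearMap := by
  rw [hf.pre_sgn]; exact Conv.ext fun a b c => by simp

variable {A} in
lemma HasWeight.pre_zero {f : CylConv A} (hf : A.HasWeight 0 f) :
    (f.pre fun a b => A.cylSgn a b) = f.post A.envSgn.toLinearMap := by simp [hf.pre_sgn]

lemma post_sgn_sgn (f : CylConv A) :
    (f.post A.envSgn.toLinearMap).post A.envSgn.toLinearMap = f :=
  Conv.ext fun _ _ _ => A.envSgn_envSgn _

lemma post_d_d (f : CylConv A) :
    (f.post A.envD).post A.envD = 0 := Conv.ext fun _ _ _ => A.envD_envD _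

lemma post_d_sgn (f : CylConv A) :
    (f.post A.envD).post A.envSgn.toLinearMap = -(f.post A.envSgn.toLinearMap).post A.envD :=
  Conv.ext fun _ _ _ => A.envSgn_envD _

lemma post_d_mul (f g : CylConv A) :
    (f * g).post A.envD = f.post A.envD * g + f.post A.envSgn.toLinearMap * g.post A.envD :=
  Conv.post_mul_of_derivation _ _ A.envD_mul f g

lemma ins_cylY : Conv.ins A.cylSgn A.cylBar A.cylY = 0 := by
  conv_lhs => rw [cylY]
  rw [Conv.ins_add, Conv.ins_mul, Conv.ins_post, Conv.ins_post, ins_cylU,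
    A.hasWeight_cylU.sgn.pre_one, post_sgn_sgn, cylY]
  simp only [Conv.post_add, Conv.post_mul, post_d_mul, post_sgn_sgn, post_d_d, post_d_sgn]
  noncomm_ring

lemma ins_cylM : Conv.ins A.cylSgn A.cylBar A.cylM = 0 := by
  conv_lhs => rw [cylM]
  simp only [Conv.ins_add, Conv.ins_sub, Conv.ins_mul, Conv.ins_post, ins_cylU, ins_cylZ, ins_cylT,
    A.hasWeight_cylT.pre_one, A.hasWeight_cylZ.sgn.pre_zero, post_sgn_sgn]
  rw [cylM, cylY]
  simp only [Conv.post_add, Conv.post_sub, Conv.post_mul, post_d_mul, post_sgn_sgn, post_d_d,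
    post_d_sgn]
  noncomm_ring

lemma insertSum_cylBar (c : ChainOf A.cylCx a b) :
    insertSum A.cylSgn A.cylBar (A.cylBar a b) c = 0 := by
  have h1 := map_insertSum (s := A.cylSgn) (b := A.cylBar) (A.cylFst a b) (A.cylBar a b) c
  have h2 := map_insertSum (s := A.cylSgn) (b := A.cylBar)
    (A.envVal a b ∘ₗ A.cylSnd a b) (A.cylBar a b) c
  have h3 := map_insertSum (s := A.cylSgn) (b := A.cylBar)
    (A.envVal a b ∘ₗ A.cylThd a b) (A.cylBar a b) c
  refine Prod.ext ?_ (Prod.ext (envCx_ext ?_) (envCx_ext ?_))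
  · exact h1.trans ((A.insertSum_cylFst (A.bar a b) c).trans (A.insertSum_bar _))
  · refine h2.trans (Eq.trans ?_ (congrFun (congrFun (congrFun A.ins_cylY a) b) c))
    exact congrArg (fun f => insertSum A.cylSgn A.cylBar f c)
      (funext fun c => A.inCorner_cylY.envVal_toEnvCx c)
  · refine h3.trans (Eq.trans ?_ (congrFun (congrFun (congrFun A.ins_cylM a) b) c))
    exact congrArg (fun f => insertSum A.cylSgn A.cylBar f c)
      (funext fun c => A.inCorner_cylM.envVal_toEnvCx c)

lemma cylY_single (x : (A.cylCx a b).X) :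
    A.cylY a b (cons x (nil b)) = A.envD (A.envVal a b (A.cylSnd a b x)) := by
  simp [cylY, Conv.mul_apply, sumSplits_cons, cylU, Conv.single]

lemma cylY_pair (x : (A.cylCx a b).X) (y : (A.cylCx b c).X) :
    A.cylY a c (cons x (cons y (nil c))) =
      A.envSgn (A.envVal a b (A.cylSnd a b x)) * A.envVal b c (A.cylSnd b c y) := by
  simp [cylY, Conv.mul_apply, sumSplits_cons, cylU, Conv.single]

lemma cylY_long (c : ChainOf A.cylCx a b) (h : 3 ≤ c.length) : A.cylY a b c = 0 := by
  rw [cylY, Conv.add_apply, Conv.post_apply, cylU, Conv.single_of_length _ _ (by omega), map_zero,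
    zero_add, Conv.mul_apply]
  refine (sumSplits_congr c fun e p q hpq => ?_).trans (sumSplits_zero c)
  by_cases hp : p.length = 1
  · rw [Conv.single_of_length _ q (by omega), mul_zero]
  · rw [Conv.post_apply, Conv.single_of_length _ p hp, map_zero, zero_mul]

lemma cylM_single (x : (A.cylCx a b).X) :
    A.cylM a b (cons x (nil b)) = A.tau a b (cons (A.cylFst a b x) (nil b)) -
      A.envVal a b (A.cylSnd a b x) - A.envD (A.envVal a b (A.cylThd a b x)) := by simp [cylM, Conv.mul_apply, sumSplits_cons, cylU, cylZ, cylT_apply, Conv.single, Chain.map, A.isTau_tau.nil]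

lemma cylM_cons_nil (x : (A.cylCx a b).X) (y : (A.cylCx b c).X) :
    A.cylM a c (cons x (cons y (nil c))) =
      A.tau a c (cons (A.cylFst a b x) (cons (A.cylFst b c y) (nil c))) +
      A.tau a b (cons (A.cylFst a b x) (nil b)) * A.envVal b c (A.cylThd b c y) -
      A.envSgn (A.envVal a b (A.cylThd a b x)) * A.envVal b c (A.cylSnd b c y) := by simp [cylM, Conv.mul_apply, sumSplits_cons, cylU, cylZ, cylT_apply, Conv.single, Chain.map, A.isTau_tau.nil]

lemma cylM_long (c : ChainOf A.cylCx a b) (x : (A.cylCx b e).X) (h : 2 ≤ c.length) :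
    A.cylM a e (c.append (cons x (nil e))) =
      A.tau a e ((c.append (cons x (nil e))).map fun a b => A.cylFst a b) +
      A.tau a b (c.map fun a b => A.cylFst a b) * A.envVal b e (A.cylThd b e x) := by
  have h1 : (c.append (cons x (nil e))).length = c.length + 1 := by simp [length_append, length]
  have h2 : (A.cylT * A.cylZ) a e (c.append (cons x (nil e))) =
      A.cylT a b c * A.envVal b e (A.cylThd b e x) := by
    rw [Conv.mul_apply, sumSplits_append_cons, sumSplits_eq_last, sumSplits_nil, cylZ,
      Conv.single_of_length _ (nil e) (by simp [length]), mul_zero, add_zero]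
    · rfl
    · intro f p q hq
      rw [cylZ, Conv.single_of_length _ _ (by simp [length_append, length]; omega), mul_zero]
  have h3 : (A.cylZ.post A.envSgn.toLinearMap * A.cylU) a e (c.append (cons x (nil e))) = 0 := by
    rw [Conv.mul_apply]
    refine (sumSplits_congr _ fun e p q hpq => ?_).trans (sumSplits_zero _)
    by_cases hp : p.length = 1
    · rw [cylU, Conv.single_of_length _ q (by omega), mul_zero]
    · rw [Conv.post_apply, cylZ, Conv.single_of_length _ p hp, map_zero, zero_mul]
  rw [cylM, Conv.sub_apply, Conv.sub_apply, Conv.sub_apply, Conv.add_apply, h2, h3,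
    Conv.post_apply, cylU, cylZ, Conv.single_of_length _ _ (by omega),
    Conv.single_of_length _ _ (by omega), map_zero, sub_zero, sub_zero, sub_zero]
  rfl

def cylOne (a : Λ) : (A.cylCx a a).X := (A.one a, A.envCat.one a, 0)

lemma cylFst_one (a : Λ) : A.cylFst a a (A.cylOne a) = A.one a := rfl

lemma cylSnd_one (a : Λ) : A.envVal a a (A.cylSnd a a (A.cylOne a)) = A.idem a := rfl

lemma cylThd_one (a : Λ) : A.cylThd a a (A.cylOne a) = 0 := rfl

lemma cylBar_unit (l : ChainOf A.cylCx a b) (l' : ChainOf A.cylCx b c)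
    (h : 2 ≤ l.length + l'.length) :
    A.cylBar a c (l.append (cons (A.cylOne b) l')) = 0 := by
  have hM : A.cylM a c (l.append (cons (A.cylOne b) l')) = 0 := by
    rcases l'.eq_nil_or_append with ⟨e, h'⟩ | ⟨e, l'', x, rfl⟩
    · subst e
      subst h'
      rw [A.cylM_long _ _ (by simpa [length] using h), cylThd_one, map_zero, mul_zero, add_zero,
        map_append, Chain.map, cylFst_one, A.isTau_tau.unit]
      simp only [length_map, length, Chain.map] at *
      omega
    · have e1 : l.append (cons (A.cylOne b) (l''.append (cons x (nil c)))) =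
          (l.append (cons (A.cylOne b) l'')).append (cons x (nil c)) := by
        rw [append_assoc]; rfl
      simp only [length_append, length] at h
      rw [e1, A.cylM_long _ _ (by simp only [length_append, length]; omega), map_append,
        map_append, Chain.map, cylFst_one, append_assoc, A.isTau_tau.unit (l.map _) (l''.map _)
          (by simp only [length_map]; omega), zero_mul, add_zero, Chain.append, A.isTau_tau.unit]
      simp only [length_append, length_map, Chain.map, length]; omega
  refine Prod.ext ?_ (Prod.ext ?_ ?_)
  · change A.bar a c ((l.append (cons (A.cylOne b) l')).map fun a b => A.cylFst a b) = 0
    rw [map_append, Chain.map, cylFst_one]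
    exact A.bar_one _ _ (by rw [length_map, length_map]; exact h)
  · change A.toEnvCx a c (A.cylY a c _) = 0
    rw [A.cylY_long _ (by simp only [length_append, length]; omega), map_zero]
  · change A.toEnvCx a c (A.cylM a c _) = 0
    rw [hM, map_zero]

/-- The cylinder relating an A-infinity category to its enveloping dg category. -/
def cylinder : AInfCat.{u,v,max u v w} K Λ :=
  ofBar A.cylCx A.cylBar A.slotLinear_cylBar
    (fun a => by
      refine Prod.ext ?_ (Prod.ext ?_ ?_)
      · change A.bar a a (nil a) = 0
        exact A.bar_nil a
      · change A.toEnvCx a a (A.cylY a a (nil a)) = 0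
        rw [← map_zero (A.toEnvCx a a)]
        congr 1
        simp [cylY, cylU, Conv.single, Conv.mul_apply]
      · change A.toEnvCx a a (A.cylM a a (nil a)) = 0
        rw [← map_zero (A.toEnvCx a a)]
        congr 1
        simp [cylM, cylU, cylZ, cylT_apply, Conv.single, Conv.mul_apply, Chain.map,
            A.isTau_tau.nil])
    (fun {a e} x => by
      refine Prod.ext (A.bar_single _) (Prod.ext (envCx_ext ?_) (envCx_ext ?_))
      · exact (A.inCorner_cylY.envVal_toEnvCx _).trans (A.cylY_single x)
      · exact (A.inCorner_cylM.envVal_toEnvCx _).trans (A.cylM_single x))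
    (fun {a e} l n h => by
      have h1 : (l.map fun a b => A.cylFst a b).Homogeneous n := by
        clear * - h
        induction l generalizing n with
        | nil => exact h
        | cons x l ih =>
          obtain ⟨p, q, hx, hq, rfl⟩ := h
          exact ⟨p, q, hx.1, ih _ hq, rfl⟩
      have h2 := A.bar_mem _ n h1
      rw [length_map] at h2
      have h3 := A.hasWeight_cylM.mem A.slotLinear_cylM h
      refine ⟨h2, ?_, ?_⟩
      · rw [SetLike.mem_coe, envVal_mem]
        exact (A.inCorner_cylY.envVal_toEnvCx l).symm ▸ A.hasWeight_cylY.mem A.slotLinear_cylY h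
      · rw [show (n + l.length - 1 : ℤ) = n + l.length - 2 + 1 by ring] at h3
        rw [SetLike.mem_coe, envVal_mem]
        exact (A.inCorner_cylM.envVal_toEnvCx l).symm ▸ h3)
    A.insertSum_cylBar A.cylOne
    (fun a => ⟨A.one_mem a, A.envCat.one_mem a, Submodule.zero_mem _⟩)
    (fun a => Prod.ext (A.d_one a) (Prod.ext (A.envCat.d_one a) (by
      change (A.envUnit a a).f (A.one a) - A.cylSnd a a (A.cylOne a) -
        (A.envCx a a).d (A.cylThd a a (A.cylOne a)) = 0
      rw [cylThd_one, map_zero, sub_zero, sub_eq_zero]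
      rfl)))
    (fun {a e} x => by
      refine Prod.ext (A.bar_one_left _) (Prod.ext (envCx_ext ?_) (envCx_ext ?_))
      · refine (A.inCorner_cylY.envVal_toEnvCx _).trans ((A.cylY_pair _ _).trans ?_)
        rw [cylSnd_one, envScale_idem]
        exact A.idem_mul_envVal _
      · refine (A.inCorner_cylM.envVal_toEnvCx _).trans ((A.cylM_cons_nil _ _).trans ?_)
        have := A.isTau_tau.unit (nil a) (cons (A.cylFst a e x) (nil e)) (by simp [length])
        rw [Chain.append] at this
        rw [cylFst_one, cylThd_one, map_zero, map_zero, zero_mul, this, sub_zero, zero_add]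
        exact A.idem_mul_envVal _)
    (fun {a e} x => by
      have h := A.cyl_scale (-1) x
      simp only [Cx.scale_neg_one] at h
      refine Prod.ext ((A.bar_one_right _).trans h.1.symm) (Prod.ext (envCx_ext ?_) (envCx_ext ?_))
      · refine (A.inCorner_cylY.envVal_toEnvCx _).trans ((A.cylY_pair _ _).trans ?_)
        rw [cylSnd_one, ← A.envVal_sgn, A.envVal_mul_idem, ← h.2.1]
        rfl
      · refine (A.inCorner_cylM.envVal_toEnvCx _).trans ((A.cylM_cons_nil _ _).trans ?_)
        have h2 := A.isTau_tau.unit (cons (A.cylFst a e x) (nil e)) (nil e) (by simp [length])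
        rw [Chain.append, Chain.append] at h2
        have h3 := congrArg (A.envVal a e) h.2.2
        rw [map_smul, A.envVal_sgn] at h3
        rw [cylSnd_one, cylThd_one, map_zero, mul_zero, add_zero, cylFst_one, h2, zero_sub, ← h3]
        simp only [Units.val_neg, Units.val_one, neg_smul, one_smul, neg_mul, neg_neg]
        exact A.envVal_mul_idem _)
    A.cylBar_unit

end Cylinder

end AInfCat

namespace AInfCat

variable [CharZero K]

open Chain

section Projections

variable (A : AInfCat.{u,v,max u v w} K Λ)

lemma bar_cylinder (c : ChainOf A.cylCx a b) :
    (cylinder.{u,v,w} A).bar a b c = A.cylBar a b c := congrArg (A.cylBar a b) (twist_twist c)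

def cylHomFst (a b : Λ) : Cx.Hom (A.cylCx a b) (A.Hom a b) :=
  ⟨A.cylFst a b, fun h => h.1, fun _ => rfl⟩

def cylHomSnd (a b : Λ) : Cx.Hom (A.cylCx a b) (A.envCx a b) :=
  ⟨A.cylSnd a b, fun h => h.2.1, fun _ => rfl⟩

def cylProj : Mor (cylinder.{u,v,w} A) A :=
  Mor.ofBar A.cylHomFst (fun c => congrArg (A.cylFst _ _) (A.bar_cylinder c)) fun _ => rfl

lemma cylY_nil (a : Λ) : A.cylY a a (nil a) = 0 := by
  simp [cylY, Conv.mul_apply, cylU, Conv.single]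

lemma cylY_eq_envVal_bar (c : ChainOf A.cylCx a b) :
    A.cylY a b c = A.envVal a b
      (A.envCat.toAInfCat.bar a b (c.map fun a b => (A.cylHomSnd a b).f)) := by
  match c with
  | .nil a => exact (A.cylY_nil a).trans ((congrArg (A.envVal _ _)
      (A.envCat.toAInfCat.bar_nil a)).trans (map_zero _)).symm
  | .cons x (.nil _) =>
    rw [cylY_single]
    exact congrArg (A.envVal _ _) (A.envCat.toAInfCat.bar_single (A.cylSnd _ _ x)).symm
  | .cons x (.cons y (.nil _)) =>
    rw [cylY_pair]
    refine Eq.trans ?_ (congrArg (A.envVal _ _)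
      (A.envCat.bar_pair (A.cylSnd _ _ x) (A.cylSnd _ _ y)).symm)
    rw [← A.envVal_sgn]
    rfl
  | .cons x (.cons y (.cons z l)) =>
    rw [cylY_long _ _ (by simp [length])]
    exact ((congrArg (A.envVal _ _) (A.envCat.bar_long _ (by simp [length, Chain.map]))).trans
      (map_zero _)).symm

def cylProjEnv : Mor (cylinder.{u,v,w} A) A.envCat.toAInfCat :=
  Mor.ofBar A.cylHomSnd (fun {a b} c => by
    refine (congrArg (A.cylSnd _ _) (A.bar_cylinder c)).trans ?_
    exact envCx_ext ((A.inCorner_cylY.envVal_toEnvCx c).trans (A.cylY_eq_envVal_bar c)))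
    fun _ => rfl

lemma isQuasiIso_cylHomFst (a b : Λ) : (A.cylHomFst a b).IsQuasiIso := by
  refine ⟨fun x hx ⟨y, hy⟩ => ?_, fun y hy => ?_⟩
  · have h3 : (A.envUnit a b).f (A.cylFst a b x) - A.cylSnd a b x -
        (A.envCx a b).d (A.cylThd a b x) = 0 := congrArg (A.cylThd a b) hx
    replace hy : (A.Hom a b).d y = A.cylFst a b x := hy
    have e := (A.envUnit a b).map_d y
    rw [hy] at e
    refine ⟨(y, (A.envUnit a b).f y - A.cylThd a b x, 0), Prod.ext hy (Prod.ext ?_ ?_)⟩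
    · change (A.envCx a b).d ((A.envUnit a b).f y - A.cylThd a b x) = A.cylSnd a b x
      rw [map_sub, ← e]
      linear_combination (norm := module) h3
    · change (A.envUnit a b).f y - ((A.envUnit a b).f y - A.cylThd a b x) - (A.envCx a b).d 0 =
        A.cylThd a b x
      rw [map_zero]; abel
  · refine ⟨(y, (A.envUnit a b).f y, 0), Prod.ext hy (Prod.ext ?_ ?_), 0, ?_⟩
    · change (A.envCx a b).d ((A.envUnit a b).f y) = 0
      rw [← Cx.Hom.map_d, hy, map_zero]
    · change (A.envUnit a b).f y - (A.envUnit a b).f y - (A.envCx a b).d 0 = 0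
      rw [map_zero]; abel
    · rw [map_zero, add_zero]; rfl

def cylSection (a b : Λ) : Cx.Hom (A.Hom a b) (A.cylCx a b) where
  f := LinearMap.id.prod ((A.envUnit a b).f.prod 0)
  map_mem h := ⟨h, (A.envUnit a b).map_mem h, Submodule.zero_mem _⟩
  map_d x := by
    refine Prod.ext rfl (Prod.ext ((A.envUnit a b).map_d x) ?_)
    change 0 = (A.envUnit a b).f x - (A.envUnit a b).f x - (A.envCx a b).d 0
    rw [map_zero]; abel

lemma isQuasiIso_cylHomSnd (a b : Λ) : (A.cylHomSnd a b).IsQuasiIso := by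
  have h : (A.cylSection a b).IsQuasiIso := by
    refine HomologyBijective.of_comp_left (g := (A.cylHomFst a b).f)
      (HomologyBijective.of_bijective (fun x => rfl) ?_) (A.isQuasiIso_cylHomFst a b)
      (A.cylSection a b).map_d (A.cylHomFst a b).map_d
    exact Function.bijective_id
  exact HomologyBijective.of_comp (f := (A.cylSection a b).f) (A.isQuasiIso_envUnit a b) h
    (A.cylSection a b).map_d (A.cylHomSnd a b).map_d

end Projections

section Functor

variable {A B : AInfCat.{u,v,max u v w} K Λ} (F : Mor A B)

def envCxMap (a b : Λ) : Cx.Hom (A.envCx a b) (B.envCx a b) := (envCatMap F).φ a b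

def cylCxMap (a b : Λ) : Cx.Hom (A.cylCx a b) (B.cylCx a b) where
  f := ((F.φ a b).f ∘ₗ A.cylFst a b).prod
    (((envCxMap F a b).f ∘ₗ A.cylSnd a b).prod ((envCxMap F a b).f ∘ₗ A.cylThd a b))
  map_mem h := ⟨(F.φ a b).map_mem h.1, (envCxMap F a b).map_mem h.2.1,
    (envCxMap F a b).map_mem h.2.2⟩
  map_d x := by
    refine Prod.ext ((F.φ a b).map_d _) (Prod.ext ((envCxMap F a b).map_d _) ?_)
    change (envCxMap F a b).f ((A.envUnit a b).f (A.cylFst a b x) - A.cylSnd a b x -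
      (A.envCx a b).d (A.cylThd a b x)) = (B.envUnit a b).f ((F.φ a b).f (A.cylFst a b x)) -
        (envCxMap F a b).f (A.cylSnd a b x) -
          (B.envCx a b).d ((envCxMap F a b).f (A.cylThd a b x))
    have h : (envCxMap F a b).f ((A.envUnit a b).f (A.cylFst a b x)) =
        (B.envUnit a b).f ((F.φ a b).f (A.cylFst a b x)) := envUnit_natural F _
    rw [← h, map_sub, map_sub, Cx.Hom.map_d]

/-- Functions on chains that are compatible with a morphism. -/
def ConvNatural (f : CylConv A)
    (g : CylConv B) : Prop :=
  ∀ (a b : Λ) (c : ChainOf A.cylCx a b),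
    envMap F (f a b c) = g a b (c.map fun a b => (cylCxMap F a b).f)

variable {F} {f f' : CylConv A}
  {g g' : CylConv B}

lemma ConvNatural.add (h : ConvNatural F f g) (h' : ConvNatural F f' g') :
    ConvNatural F (f + f') (g + g') := fun a b c => by
  rw [Conv.add_apply, map_add, h, h']; rfl

lemma ConvNatural.sub (h : ConvNatural F f g) (h' : ConvNatural F f' g') :
    ConvNatural F (f - f') (g - g') := fun a b c => by
  rw [Conv.sub_apply, map_sub, h, h']; rfl

lemma ConvNatural.mul (h : ConvNatural F f g) (h' : ConvNatural F f' g') :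
    ConvNatural F (f * f') (g * g') := fun a b c => by
  rw [Conv.mul_apply, Conv.mul_apply, map_sumSplits, sumSplits_map]
  exact sumSplits_congr c fun e p q _ => by rw [map_mul, h, h']

lemma ConvNatural.d (h : ConvNatural F f g) : ConvNatural F (f.post A.envD) (g.post B.envD) :=
  fun a b c => (envMap_envD F _).trans (congrArg B.envD (h a b c))

lemma ConvNatural.sgn (h : ConvNatural F f g) :
    ConvNatural F (f.post A.envSgn.toLinearMap) (g.post B.envSgn.toLinearMap) :=
  fun a b c => (envMap_envScale F (-1) _).trans (congrArg B.envSgn (h a b c))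

variable (F)

lemma convNatural_cylT : ConvNatural F A.cylT B.cylT := fun a b c => by
  rw [cylT_apply, cylT_apply, envMap_tau, chain_map_map, chain_map_map]
  rfl

lemma convNatural_cylU : ConvNatural F A.cylU B.cylU := fun a b c =>
  match c with
  | .nil _ => map_zero _
  | .cons _ (.nil _) => rfl
  | .cons _ (.cons _ _) => map_zero _

lemma convNatural_cylZ : ConvNatural F A.cylZ B.cylZ := fun a b c =>
  match c with
  | .nil _ => map_zero _
  | .cons _ (.nil _) => rfl
  | .cons _ (.cons _ _) => map_zero _

lemma convNatural_cylY : ConvNatural F A.cylY B.cylY :=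
  (convNatural_cylU F).d.add ((convNatural_cylU F).sgn.mul (convNatural_cylU F))

lemma convNatural_cylM : ConvNatural F A.cylM B.cylM :=
  ((((convNatural_cylT F).add ((convNatural_cylT F).mul (convNatural_cylZ F))).sub
    ((convNatural_cylZ F).sgn.mul (convNatural_cylU F))).sub (convNatural_cylU F)).sub
    (convNatural_cylZ F).d

lemma cylCxMap_cylBar (c : ChainOf A.cylCx a b) :
    (cylCxMap F a b).f (A.cylBar a b c) =
      B.cylBar a b (c.map fun a b => (cylCxMap F a b).f) := by
  refine Prod.ext ?_ (Prod.ext (envCx_ext ?_) (envCx_ext ?_))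
  · refine (map_bar F _).trans (congrArg (B.bar a b) ?_)
    rw [chain_map_map, chain_map_map]
    rfl
  · refine Eq.trans ?_ (B.inCorner_cylY.envVal_toEnvCx _).symm
    exact (congrArg (envMap F) (A.inCorner_cylY.envVal_toEnvCx c)).trans
      (convNatural_cylY F a b c)
  · refine Eq.trans ?_ (B.inCorner_cylM.envVal_toEnvCx _).symm
    exact (congrArg (envMap F) (A.inCorner_cylM.envVal_toEnvCx c)).trans
      (convNatural_cylM F a b c)

def cylMap : Mor (cylinder.{u,v,w} A) (cylinder.{u,v,w} B) :=
  Mor.ofBar (cylCxMap F) (fun {a b} c =>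
    (congrArg (cylCxMap F a b).f (A.bar_cylinder c)).trans
      ((cylCxMap_cylBar F c).trans (B.bar_cylinder _).symm))
    fun a => Prod.ext (F.map_one a) (Prod.ext ((envCatMap F).map_one a)
      (map_zero (envCxMap F a a).f))

end Functor

def cylinderFunctor (K : Type u) [Field K] [CharZero K] (Λ : Type v) :
    AInfCat.{u,v,max u v w} K Λ ⥤ AInfCat.{u,v,max u v w} K Λ where
  obj A := cylinder.{u,v,w} A
  map F := cylMap.{u,v,w} F
  map_id A := by
    refine Mor.ext (funext fun a => funext fun b => Cx.Hom.ext (LinearMap.ext fun x => ?_))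
    have h := congrArg (fun G : DGCat.Mor _ _ => (G.φ a b).f)
      ((envelope.{u,v,max u v w} K Λ).map_id A)
    exact Prod.ext rfl (Prod.ext (LinearMap.congr_fun h _) (LinearMap.congr_fun h _))
  map_comp F G := by
    refine Mor.ext (funext fun a => funext fun b => Cx.Hom.ext (LinearMap.ext fun x => ?_))
    have h := congrArg (fun G : DGCat.Mor _ _ => (G.φ a b).f)
      ((envelope.{u,v,max u v w} K Λ).map_comp F G)
    exact Prod.ext rfl (Prod.ext (LinearMap.congr_fun h _) (LinearMap.congr_fun h _))

def cylinderProj (K : Type u) [Field K] [CharZero K] (Λ : Type v) :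
    cylinderFunctor.{u,v,w} K Λ ⟶ 𝟭 _ where
  app A := A.cylProj
  naturality _ _ _ := rfl

def cylinderProjEnv (K : Type u) [Field K] [CharZero K] (Λ : Type v) :
    cylinderFunctor.{u,v,w} K Λ ⟶ envelope.{u,v,max u v w} K Λ ⋙ DGCat.inclusion K Λ where
  app A := A.cylProjEnv
  naturality _ _ _ := rfl

end AInfCat

lemma isExact_id {C : Type*} [Category C] (W : MorphismProperty C) : IsExact W W (𝟭 C) :=
  fun _ _ _ h => h

lemma IsExact.comp {C D E : Type*} [Category C] [Category D] [Category E]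
    {WC : MorphismProperty C} {WD : MorphismProperty D} {WE : MorphismProperty E} {F : C ⥤ D}
    {G : D ⥤ E} (hF : IsExact WC WD F) (hG : IsExact WD WE G) : IsExact WC WE (F ⋙ G) :=
  fun _ _ f h => hG _ (hF f h)

lemma isExact_cylinderFunctor (K : Type u) [Field K] [CharZero K] (Λ : Type v) :
    IsExact (AInfCat.quasiIso K Λ) (AInfCat.quasiIso K Λ)
      (AInfCat.cylinderFunctor.{u,v,w} K Λ) := by
  intro A B F hF a b
  refine HomologyBijective.of_comp_left (g := (B.cylHomFst a b).f) ?_ (B.isQuasiIso_cylHomFst a b)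
    (AInfCat.cylCxMap F a b).map_d (B.cylHomFst a b).map_d
  have h : ((F.φ a b).comp (A.cylHomFst a b)).IsQuasiIso :=
    Cx.Hom.IsQuasiIso.comp (hF a b) (A.isQuasiIso_cylHomFst a b)
  exact h

lemma isQuasiEquivalence_inclusion_envelope (K : Type u) [Field K] [CharZero K] (Λ : Type v) :
    IsQuasiEquivalence (DGCat.quasiIso K Λ) (AInfCat.quasiIso K Λ)
      (DGCat.inclusion.{u,v,max u v w} K Λ) (AInfCat.envelope.{u,v,max u v w} K Λ) := by
  have hI := isExact_inclusion.{u,v,max u v w} K Λ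
  have hR := isExact_envelope.{u,v,w} K Λ
  refine ⟨hI, hR, ?_, ?_⟩
  · refine Relation.EqvGen.trans _ (AInfCat.cylinderFunctor.{u,v,w} K Λ) _
      (Relation.EqvGen.symm _ _ (Relation.EqvGen.rel _ _ ?_)) (Relation.EqvGen.rel _ _ ?_)
    · exact ⟨isExact_cylinderFunctor K Λ, hR.comp hI, AInfCat.cylinderProjEnv K Λ,
        fun A a b => A.isQuasiIso_cylHomSnd a b⟩
    · exact ⟨isExact_cylinderFunctor K Λ, isExact_id _, AInfCat.cylinderProj K Λ,
        fun A a b => A.isQuasiIso_cylHomFst a b⟩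
  · exact Relation.EqvGen.rel _ _ ⟨hI.comp hR, isExact_id _, DGCat.envCounitNat.{u,v,w} K Λ,
      fun B a b => B.isQuasiIso_envCounit a b⟩

section QuasiEquivalences

universe v₁ v₂ v₃ u₁ u₂ u₃

variable {C : Type u₁} [Category.{v₁} C] {D : Type u₂} [Category.{v₂} D]
  {E : Type u₃} [Category.{v₃} E] {WC : MorphismProperty C} {WD : MorphismProperty D}
  {WE : MorphismProperty E}

lemma QuasiIsomorphic.whiskerRight {F G : C ⥤ D} (h : QuasiIsomorphic WC WD F G) {H : D ⥤ E}
    (hH : IsExact WD WE H) : QuasiIsomorphic WC WE (F ⋙ H) (G ⋙ H) := by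
  induction h with
  | rel F G h =>
    obtain ⟨hF, hG, τ, hτ⟩ := h
    exact Relation.EqvGen.rel _ _ ⟨hF.comp hH, hG.comp hH, Functor.whiskerRight τ H,
      fun X => hH _ (hτ X)⟩
  | refl F => exact Relation.EqvGen.refl _
  | symm F G _ ih => exact Relation.EqvGen.symm _ _ ih
  | trans F G H _ _ ih1 ih2 => exact Relation.EqvGen.trans _ _ _ ih1 ih2

lemma QuasiIsomorphic.whiskerLeft {H : C ⥤ D} (hH : IsExact WC WD H) {F G : D ⥤ E}
    (h : QuasiIsomorphic WD WE F G) : QuasiIsomorphic WC WE (H ⋙ F) (H ⋙ G) := by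
  induction h with
  | rel F G h =>
    obtain ⟨hF, hG, τ, hτ⟩ := h
    exact Relation.EqvGen.rel _ _ ⟨hH.comp hF, hH.comp hG, Functor.whiskerLeft H τ,
      fun X => hτ _⟩
  | refl F => exact Relation.EqvGen.refl _
  | symm F G _ ih => exact Relation.EqvGen.symm _ _ ih
  | trans F G H _ _ ih1 ih2 => exact Relation.EqvGen.trans _ _ _ ih1 ih2

lemma QuasiEquivalent.symm (h : QuasiEquivalent WC WD) : QuasiEquivalent WD WC := by
  obtain ⟨F, G, hF, hG, h1, h2⟩ := h
  exact ⟨G, F, hG, hF, h2, h1⟩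

lemma QuasiEquivalent.trans (h : QuasiEquivalent WC WD) (h' : QuasiEquivalent WD WE) :
    QuasiEquivalent WC WE := by
  obtain ⟨F, G, hF, hG, h1, h2⟩ := h
  obtain ⟨F', G', hF', hG', h1', h2'⟩ := h'
  refine ⟨F ⋙ F', G' ⋙ G, hF.comp hF', hG'.comp hG, ?_, ?_⟩
  · exact Relation.EqvGen.trans _ _ _
      (QuasiIsomorphic.whiskerLeft hG' (QuasiIsomorphic.whiskerRight h1 hF')) h1'
  · exact Relation.EqvGen.trans _ _ _
      (QuasiIsomorphic.whiskerLeft hF (QuasiIsomorphic.whiskerRight h2' hG)) h2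

end QuasiEquivalences

/-! ## Sign exponents -/

def zsign (K : Type u) [Field K] (a : ZMod 2) : K := if a = 0 then 1 else -1

section ZSign

variable (K : Type u) [Field K]

@[simp] lemma zsign_zero : zsign K 0 = 1 := rfl

@[simp] lemma zsign_one : zsign K 1 = -1 := rfl

lemma zsign_add (a b : ZMod 2) : zsign K (a + b) = zsign K a * zsign K b := by
  have h : ∀ a : ZMod 2, a = 0 ∨ a = 1 := by decide
  have h2 : (1 : ZMod 2) + 1 = 0 := by decide
  rcases h a with rfl | rfl <;> rcases h b with rfl | rfl <;> simp [h2]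

lemma zsign_natCast (n : ℕ) : zsign K n = (-1) ^ n := by
  induction n <;> simp_all [Nat.cast_succ, zsign_add, pow_succ, zsign_one]

lemma zsign_intCast (n : ℤ) : zsign K n = ((n.negOnePow : ℤ) : K) := by
  rcases Int.even_or_odd n with h | h
  · rw [Int.negOnePow_even n h, (ZMod.intCast_eq_zero_iff_even (n := n)).2 h]; simp
  · rw [Int.negOnePow_odd n h, (ZMod.intCast_eq_one_iff_odd (n := n)).2 h]; simp

lemma zsign_mul_self (a : ZMod 2) : zsign K a * zsign K a = 1 := by
  rw [← zsign_add, CharTwo.add_self_eq_zero, zsign_zero]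

end ZSign

/-- The parities of a family of degrees. -/
notation "π[" ε "]" => fun i => ((ε : ℕ → ℤ) i : ZMod 2)

namespace List

/-- The sum of `φ j k` over all pairs such that `j` precedes `k` in the list. -/
def pairSum (φ : ℕ → ℕ → ZMod 2) : List ℕ → ZMod 2
  | [] => 0
  | j :: l => (l.map (φ j)).sum + pairSum φ l

variable {φ ψ : ℕ → ℕ → ZMod 2}

lemma pairSum_append (l m : List ℕ) : pairSum φ (l ++ m) =
    pairSum φ l + pairSum φ m + (l.map fun j => (m.map (φ j)).sum).sum := by
  induction l <;> grind [pairSum, cons_append, map_append, sum_append, map_cons, sum_cons]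

lemma pairSum_add (l : List ℕ) :
    pairSum (fun j k => φ j k + ψ j k) l = pairSum φ l + pairSum ψ l := by
  induction l <;> grind [pairSum, sum_map_add]

lemma pairSum_congr {l : List ℕ} (h : l.Pairwise fun j k => φ j k = ψ j k) :
    pairSum φ l = pairSum ψ l := by
  induction h <;> grind [pairSum, map_congr_left]

lemma pairSum_perm (h : ∀ j k, φ j k = φ k j) {l m : List ℕ} (hl : l.Perm m) :
    pairSum φ l = pairSum φ m := by
  induction hl with
  | nil => rfl
  | cons j hl ih => rw [pairSum, pairSum, ih, (hl.map (φ j)).sum_eq]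
  | swap j k l => simp only [pairSum, map_cons, sum_cons, h j k]; ring
  | trans _ _ ih1 ih2 => exact ih1.trans ih2

lemma sum_map_flatMap (T : ℕ → List ℕ) (f : ℕ → ZMod 2) (l : List ℕ) :
    ((l.flatMap T).map f).sum = (l.map fun j => ((T j).map f).sum).sum := by
  induction l <;> grind

lemma pairSum_flatMap (T : ℕ → List ℕ) (l : List ℕ) :
    pairSum φ (l.flatMap T) = (l.map fun j => pairSum φ (T j)).sum +
      pairSum (fun j k => ((T j).map fun x => ((T k).map (φ x)).sum).sum) l := by
  induction l with
  | nil => simp [pairSum]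
  | cons j l ih =>
    rw [flatMap_cons, pairSum_append, ih, pairSum, map_cons, sum_cons]
    have : ((T j).map fun x => ((l.flatMap T).map (φ x)).sum).sum =
        (l.map fun k => ((T j).map fun x => ((T k).map (φ x)).sum).sum).sum := by
      generalize T j = m
      induction m with
      | nil => simp
      | cons x m ih =>
        rw [map_cons, sum_cons, ih, sum_map_flatMap, ← sum_map_add]
        simp only [map_cons, sum_cons]
    rw [this]; ring

lemma pairSum_eq_add_inversions {l : List ℕ} {n : ℕ} (hl : l.Perm (range n)) :
    pairSum φ l =
      pairSum φ (range n) + pairSum (fun j k => if k < j then φ j k + φ k j else 0) l := by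
  have hnd : l.Nodup := hl.nodup_iff.2 nodup_range
  let χ : ℕ → ℕ → ZMod 2 := fun j k => if j < k then φ j k else if k < j then φ k j else 0
  have h1 : pairSum φ l = pairSum χ l + pairSum (fun j k => if k < j then φ j k + φ k j else 0) l
      := by
    rw [← pairSum_add]
    refine pairSum_congr (hnd.imp fun {j k} hjk => ?_)
    rcases lt_or_gt_of_ne hjk with h | h
    · simp [χ, h, not_lt.2 h.le]
    · simp only [χ, h, not_lt.2 h.le, if_true, if_false]
      linear_combination (-φ k j) * (CharTwo.two_eq_zero (R := ZMod 2))
  have h2 : pairSum χ l = pairSum χ (range n) := by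
    refine pairSum_perm (fun j k => ?_) hl
    rcases lt_trichotomy j k with h | rfl | h
    · simp [χ, h, not_lt.2 h.le]
    · simp [χ]
    · simp [χ, h, not_lt.2 h.le]
  have h3 : pairSum χ (range n) = pairSum φ (range n) :=
    pairSum_congr (pairwise_lt_range.imp fun {j k} h => by simp [χ, h])
  rw [h1, h2, h3]

end List

namespace Forest

open List

def leafSum (δ : ℕ → ZMod 2) (F : Forest) : ZMod 2 := (F.leaves.map δ).sum

/-- The parity of `Forest.shuffle`. -/
def shuf (δ : ℕ → ZMod 2) : Forest → ZMod 2
  | nil => 0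
  | leaf j r => δ j * r.deg + r.shuf δ
  | node c r => c.leafSum δ * r.deg + c.shuf δ + r.shuf δ

/-- The parity of `Forest.invSign`. -/
def inv (δ : ℕ → ZMod 2) : List ℕ → ZMod 2 :=
  pairSum fun j k => if k < j then δ j * δ k else 0

/-- The sign exponent of the action of a cell. -/
def sg (δ : ℕ → ZMod 2) (F : Forest) : ZMod 2 := F.shuf δ + inv δ F.leaves

lemma sum_natCast (δ : ℕ → ℕ) (l : List ℕ) :
    (((l.map δ).sum : ℕ) : ZMod 2) = (l.map fun j => (δ j : ZMod 2)).sum := by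
  rw [Nat.cast_list_sum, map_map]; rfl

lemma shuffle_natCast (δ : ℕ → ℕ) (F : Forest) :
    (F.shuffle δ : ZMod 2) = F.shuf fun j => (δ j : ZMod 2) := by
  induction F with
  | nil => simp [shuffle, shuf]
  | leaf j r ih => simp [shuffle, shuf, ih]
  | node c r ihc ih => simp only [shuffle, shuf, Nat.cast_add, Nat.cast_mul, ihc, ih, leafSum,
      sum_natCast]

lemma invSign_natCast (δ : ℕ → ℕ) (l : List ℕ) :
    (invSign δ l : ZMod 2) = inv (fun j => (δ j : ZMod 2)) l := by
  induction l with
  | nil => simp [invSign, inv, pairSum]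
  | cons j l ih =>
    simp only [invSign, inv, pairSum, Nat.cast_add, Nat.cast_mul, sum_natCast]
    congr 1
    clear ih
    induction l with
    | nil => simp
    | cons k l ih =>
      by_cases h : k < j <;> simp [h, mul_add, ih]

lemma deg_append (F G : Forest) : (F.append G).deg = F.deg + G.deg := by
  induction F <;> grind [append, deg]

lemma leafSum_leaf (δ : ℕ → ZMod 2) (j : ℕ) (r : Forest) :
    (leaf j r).leafSum δ = δ j + r.leafSum δ := by
  simp [leafSum, leaves]

lemma leafSum_node (δ : ℕ → ZMod 2) (c r : Forest) :
    (node c r).leafSum δ = c.leafSum δ + r.leafSum δ := by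
  simp [leafSum, leaves]

lemma shuf_append (δ : ℕ → ZMod 2) (F G : Forest) :
    (F.append G).shuf δ = F.shuf δ + G.shuf δ + F.leafSum δ * G.deg := by
  induction F with
  | nil => simp [append, shuf, leafSum, leaves]
  | leaf i r ih => simp only [append, shuf, ih, deg_append, leafSum_leaf]; push_cast; ring
  | node c r _ ih => simp only [append, shuf, ih, deg_append, leafSum_node]; push_cast; ring

lemma append_assoc (F G H : Forest) : (F.append G).append H = F.append (G.append H) := by
  induction F <;> grind [append]

lemma append_nil (F : Forest) : F.append nil = F := by
  induction F <;> grind [append]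

lemma width_eq_one {F : Forest} (h : F.width = 1) :
    (∃ j, F = leaf j nil) ∨ ∃ c, F = node c nil := by
  match F, h with
  | leaf j nil, _ => exact Or.inl ⟨j, rfl⟩
  | node c nil, _ => exact Or.inr ⟨c, rfl⟩
  | leaf _ (leaf _ _), h => simp [width] at h
  | leaf _ (node _ _), h => simp [width] at h
  | node _ (leaf _ _), h => simp [width] at h
  | node _ (node _ _), h => simp [width] at h

lemma roots_append_of_width {T : Forest} (h : T.width = 1) (r : Forest) :
    (T.append r).roots = T :: r.roots := by
  rcases width_eq_one h with ⟨j, rfl⟩ | ⟨c, rfl⟩ <;> rfl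

lemma width_join {c n : Forest} (h : c.join = some n) : n.width = 1 := by
  unfold join at h
  split_ifs at h with hu
  · split at h <;> first | (obtain rfl := Option.some.inj h; rfl) | cases h
  · obtain rfl := Option.some.inj h
    rfl

lemma deg_join {c n : Forest} (h : c.join = some n) : n.deg = (c.width - 2) + c.deg := by
  unfold join at h
  split_ifs at h with hu
  · split at h <;> first | (obtain rfl := Option.some.inj h; simp [deg, width]) | cases h
  · obtain rfl := Option.some.inj h
    simp [deg]

lemma leaves_join {c n : Forest} (h : c.join = some n) : n.leaves = c.leaves := by
  have := (join_spec c n h).1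
  rw [← flatten_legs, this]; simp

lemma shuf_join (δ : ℕ → ZMod 2) {c n : Forest} (h : c.join = some n) :
    n.shuf δ = c.shuf δ := by
  unfold join at h
  split_ifs at h with hu
  · split at h <;>
      first | (obtain rfl := Option.some.inj h; simp [deg, shuf, leafSum, leaves, width]) | cases h
  · obtain rfl := Option.some.inj h
    simp [shuf, deg]

section Subst

variable {S : ℕ → Forest}

lemma leaves_subst {G : Forest} : ∀ {H : Forest}, G.subst S = some H →
    H.leaves = G.leaves.flatMap fun j => (S j).leaves := by
  induction G with
  | nil => intro H h; obtain rfl := Option.some.inj h; rfl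
  | leaf j r ih =>
    intro H h
    simp only [subst, Option.map_eq_some_iff] at h
    obtain ⟨r', hr, rfl⟩ := h
    simp [leaves_append, leaves, ih hr]
  | node c r ihc ihr =>
    intro H h
    simp only [subst, Option.bind_eq_some_iff, Option.map_eq_some_iff] at h
    obtain ⟨c', hc, n, hn, r', hr, rfl⟩ := h
    simp [leaves_append, leaves, leaves_join hn, ihc hc, ihr hr]

lemma width_subst {G : Forest} : ∀ {H : Forest}, G.subst S = some H →
    (∀ j ∈ G.leaves, (S j).width = 1) → H.width = G.width := by
  induction G with
  | nil => intro H h _; obtain rfl := Option.some.inj h; rfl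
  | leaf j r ih =>
    intro H h hS
    simp only [subst, Option.map_eq_some_iff] at h
    obtain ⟨r', hr, rfl⟩ := h
    rw [width_append, hS j (by simp [leaves]), ih hr fun k hk => hS k (by simp [leaves, hk]),
      width, Nat.add_comm]
  | node c r ihc ihr =>
    intro H h hS
    simp only [subst, Option.bind_eq_some_iff, Option.map_eq_some_iff] at h
    obtain ⟨c', hc, n, hn, r', hr, rfl⟩ := h
    rw [width_append, width_join hn, ihr hr fun k hk => hS k (by simp [leaves, hk]), width,
      Nat.add_comm]

lemma deg_subst {G : Forest} : ∀ {H : Forest}, G.subst S = some H →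
    (∀ j ∈ G.leaves, (S j).width = 1) →
      H.deg = G.deg + (G.leaves.map fun j => (S j).deg).sum := by
  induction G with
  | nil => intro H h _; obtain rfl := Option.some.inj h; rfl
  | leaf j r ih =>
    intro H h hS
    simp only [subst, Option.map_eq_some_iff] at h
    obtain ⟨r', hr, rfl⟩ := h
    rw [deg_append, ih hr fun k hk => hS k (by simp [leaves, hk])]
    simp [deg, leaves]; omega
  | node c r ihc ihr =>
    intro H h hS
    simp only [subst, Option.bind_eq_some_iff, Option.map_eq_some_iff] at h
    obtain ⟨c', hc, n, hn, r', hr, rfl⟩ := h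
    have hSc : ∀ j ∈ c.leaves, (S j).width = 1 := fun k hk => hS k (by simp [leaves, hk])
    rw [deg_append, deg_join hn, ihr hr fun k hk => hS k (by simp [leaves, hk]), ihc hc hSc,
      width_subst hc hSc]
    simp [deg, leaves]; omega

lemma leafSum_subst (δ : ℕ → ZMod 2) {G H : Forest} (h : G.subst S = some H) :
    H.leafSum δ = G.leafSum fun j => (S j).leafSum δ := by
  simp only [leafSum, leaves_subst h, sum_map_flatMap]

lemma shuf_subst (δ : ℕ → ZMod 2) {G : Forest} : ∀ {H : Forest}, G.subst S = some H →
    (∀ j ∈ G.leaves, (S j).width = 1) →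
      H.shuf δ = (G.leaves.map fun j => (S j).shuf δ).sum + G.shuf (fun j => (S j).leafSum δ) +
        pairSum (fun j k => (S j).leafSum δ * (S k).deg) G.leaves := by
  induction G with
  | nil => intro H h _; obtain rfl := Option.some.inj h; simp [shuf, leaves, pairSum]
  | leaf j r ih =>
    intro H h hS
    simp only [subst, Option.map_eq_some_iff] at h
    obtain ⟨r', hr, rfl⟩ := h
    have hSr : ∀ j ∈ r.leaves, (S j).width = 1 := fun k hk => hS k (by simp [leaves, hk])
    rw [shuf_append, ih hr hSr, deg_subst hr hSr]
    simp only [shuf, leaves, map_cons, sum_cons, pairSum, sum_map_mul_left, Nat.cast_add,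
      sum_natCast]
    ring
  | node c r ihc ihr =>
    intro H h hS
    have h' := h
    simp only [subst, Option.bind_eq_some_iff, Option.map_eq_some_iff] at h
    obtain ⟨c', hc, n, hn, r', hr, rfl⟩ := h
    have hSr : ∀ j ∈ r.leaves, (S j).width = 1 := fun k hk => hS k (by simp [leaves, hk])
    have hSc : ∀ j ∈ c.leaves, (S j).width = 1 := fun k hk => hS k (by simp [leaves, hk])
    have hl : n.leafSum δ = c.leafSum fun j => (S j).leafSum δ := by
      rw [← leafSum_subst δ hc, leafSum, leafSum, leaves_join hn]
    rw [shuf_append, shuf_join δ hn, ihr hr hSr, ihc hc hSc, deg_subst hr hSr, hl]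
    simp only [shuf, leaves, map_append, sum_append, pairSum_append, sum_map_mul_left,
      sum_map_mul_right, Nat.cast_add, sum_natCast, leafSum]
    ring

end Subst

lemma subst_ofLabels {S : ℕ → Forest} (l : List ℕ) :
    (ofLabels l).subst S = some ((l.map S).foldr append nil) := by
  induction l <;> grind [ofLabels, subst]

lemma foldr_roots (F : Forest) : F.roots.foldr append nil = F := by
  induction F <;> grind [roots, append]

lemma length_roots (F : Forest) : F.roots.length = F.width := by
  rw [← length_legs, legs, length_map]

lemma map_tree_range (F : Forest) : (range F.width).map F.tree = F.roots := by
  refine ext_getElem (by simp [length_roots]) fun i h1 h2 => ?_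
  simp [tree, getD_eq_getElem?_getD, getElem?_eq_getElem h2]

lemma ofLabels_subst_tree (F : Forest) : (ofLabels (range F.width)).subst F.tree = some F := by
  rw [subst_ofLabels, map_tree_range, foldr_roots]

lemma width_tree (F : Forest) {j : ℕ} (hj : j < F.width) : (F.tree j).width = 1 := by
  induction F generalizing j with
  | nil => simp [width] at hj
  | leaf i r ih =>
    cases j with
    | zero => rfl
    | succ j => exact ih (by simpa [width] using hj)
  | node c r _ ih =>
    cases j with
    | zero => rfl
    | succ j => exact ih (by simpa [width] using hj)

lemma deg_ofLabels (l : List ℕ) : (ofLabels l).deg = 0 := by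
  induction l with
  | nil => rfl
  | cons j l ih => exact ih

lemma width_ofLabels (l : List ℕ) : (ofLabels l).width = l.length := by
  induction l <;> grind [ofLabels, width]

lemma shuf_ofLabels (δ : ℕ → ZMod 2) (l : List ℕ) : (ofLabels l).shuf δ = 0 := by
  induction l <;> simp_all [ofLabels, shuf, deg_ofLabels]

lemma shuf_add (δ ε : ℕ → ZMod 2) (F : Forest) :
    F.shuf (fun j => δ j + ε j) = F.shuf δ + F.shuf ε := by
  induction F <;> grind [shuf, leafSum, sum_map_add]

/-- The signs of the actions of two cells and of their composite. -/
lemma sg_subst (δ : ℕ → ZMod 2) {F G H : Forest} {n : ℕ} (hF : F.leaves.Perm (range n))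
    (hG : G.leaves.Perm (range F.width)) (h : G.subst F.tree = some H) :
    (G.gluingSign F : ZMod 2) + H.sg δ =
      F.sg δ + G.sg fun j => ((F.tree j).deg : ZMod 2) + (F.tree j).leafSum δ := by
  have hR : ∀ j ∈ (ofLabels (range F.width)).leaves, (F.tree j).width = 1 := fun j hj =>
    F.width_tree (by simpa [leaves_ofLabels] using hj)
  have hS : ∀ j ∈ G.leaves, (F.tree j).width = 1 := fun j hj =>
    F.width_tree (by simpa using hG.subset hj)
  have eH := shuf_subst δ h hS
  have eF := shuf_subst δ F.ofLabels_subst_tree hR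
  have lH := leaves_subst h
  have lF := leaves_subst F.ofLabels_subst_tree
  rw [leaves_ofLabels] at eF lF
  rw [shuf_ofLabels] at eF
  set d : ℕ → ZMod 2 := fun j => (F.tree j).leafSum δ with hd
  set t : ℕ → ZMod 2 := fun j => ((F.tree j).deg : ZMod 2) with ht
  set τ : ℕ → ℕ → ZMod 2 := fun x y => if y < x then δ x * δ y else 0 with hτ
  set τ' : ℕ → ℕ → ZMod 2 := fun j k =>
    ((F.tree j).leaves.map fun x => ((F.tree k).leaves.map (τ x)).sum).sum with hτ'
  have iH : inv δ H.leaves = (G.leaves.map fun j => pairSum τ (F.tree j).leaves).sum +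
      pairSum τ' G.leaves := by rw [inv, lH, pairSum_flatMap]
  have iF : inv δ F.leaves = ((range F.width).map fun j => pairSum τ (F.tree j).leaves).sum +
      pairSum τ' (range F.width) := by rw [inv, lF, pairSum_flatMap]
  have s1 := (hG.map fun j => pairSum τ (F.tree j).leaves).sum_eq
  have s2 := (hG.map fun j => (F.tree j).shuf δ).sum_eq
  have p1 := pairSum_eq_add_inversions (φ := τ') hG
  have p2 := pairSum_eq_add_inversions (φ := fun j k => d j * t k) hG
  have hnd : G.leaves.Nodup := hG.nodup_iff.2 nodup_range
  have hFnd : F.leaves.Nodup := hF.nodup_iff.2 nodup_range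
  have p3 : pairSum (fun j k => if k < j then τ' j k + τ' k j else 0) G.leaves =
      inv d G.leaves := by
    refine pairSum_congr (hnd.pairwise_of_forall_ne fun j hj k hk hjk => ?_)
    split_ifs
    · have hdis : List.Disjoint (F.tree j).leaves (F.tree k).leaves := by
        rw [lF] at hFnd
        have hp := (nodup_flatMap.1 hFnd).2
        have : Std.Symm (Function.onFun List.Disjoint fun j => (F.tree j).leaves) :=
          ⟨fun a b h => h.symm⟩
        exact hp.forall (hG.subset hj) (hG.subset hk) hjk
      have key : ∀ l m : List ℕ, l.Disjoint m →
          (l.map fun x => (m.map (τ x)).sum).sum + (m.map fun x => (l.map (τ x)).sum).sum =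
            (l.map δ).sum * (m.map δ).sum := by
        intro l m hlm
        have e1 : ∀ y, ∀ m : List ℕ, y ∉ m →
            (m.map (τ y)).sum + (m.map fun x => τ x y).sum = δ y * (m.map δ).sum := by
          intro y m hy
          induction m with
          | nil => simp
          | cons x m ih =>
            simp only [mem_cons, not_or] at hy
            have := ih hy.2
            simp only [map_cons, sum_cons]
            have h0 : τ y x + τ x y = δ y * δ x := by
              rcases lt_or_gt_of_ne hy.1 with h | h
              · simp [hτ, h, not_lt.2 h.le, mul_comm]
              · simp [hτ, h, not_lt.2 h.le]
            linear_combination this + h0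
        induction l with
        | nil => simp
        | cons y l ih =>
          rw [disjoint_cons_left] at hlm
          have h1 := ih hlm.2
          have h2 := e1 y m hlm.1
          simp only [map_cons, sum_cons, sum_map_add]
          linear_combination h1 + h2
      exact key _ _ hdis
    · rfl
  have p4 : inv (fun j => t j + d j) G.leaves = inv t G.leaves + inv d G.leaves +
      pairSum (fun j k => if k < j then d j * t k + d k * t j else 0) G.leaves := by
    simp only [inv, ← pairSum_add]
    refine pairSum_congr (hnd.imp fun {j k} _ => ?_)
    split_ifs <;> ring
  have hg : (G.gluingSign F : ZMod 2) = G.shuf t + inv t G.leaves := by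
    rw [gluingSign, Nat.cast_add, shuffle_natCast, invSign_natCast]
  rw [hg, sg, sg, sg, eH, eF, iH, iF, shuf_add, p4, s1, s2, p1, p2, p3]
  ring

end Forest

/-! ## Evaluation of forests -/

namespace AInfCat

open Chain Forest

/-- Labelled inputs: elements of morphism complexes. -/
abbrev Inputs (A : AInfCat.{u,v,w} K Λ) := ℕ → Option (Σ a b : Λ, (A.Hom a b).X)

variable (A : AInfCat.{u,v,w} K Λ)

/-- The operations, extended to empty sequences by the units. -/
def mu : ∀ {a b : Λ}, χ[A] a b → (A.Hom a b).X
  | _, _, .nil a => A.one a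
  | _, _, .cons x l => A.m (cons x l)

variable {A}

/-- An input that starts at `a`. -/
def look {M : Type*} [Zero M] (a : Λ) (Ψ : ∀ b, (A.Hom a b).X → M) :
    Option (Σ a b : Λ, (A.Hom a b).X) → M
  | none => 0
  | some s => open Classical in if e : s.1 = a then Ψ s.2.1 (e ▸ s.2.2) else 0

@[simp] lemma look_some {M : Type*} [Zero M] (Ψ : ∀ b, (A.Hom a b).X → M)
    (x : (A.Hom a b).X) : look a Ψ (some ⟨a, b, x⟩) = Ψ b x := by simp [look]

/-- The evaluation of a forest that starts at `a`, followed by a function of the sequence of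
results. -/
def eval {M : Type*} [Zero M] (η : A.Inputs) :
    Forest → ∀ a, (∀ b, χ[A] a b → M) → M
  | .nil, a, Ψ => Ψ a (nil a)
  | .leaf i r, a, Ψ => look a (fun c x => eval η r c fun b l => Ψ b (cons x l)) (η i)
  | .node c r, a, Ψ =>
      eval η c a fun e k => eval η r e fun b l => Ψ b (cons (A.mu k) l)

/-- The inputs with the given labels form a sequence from `a` to `b`. -/
def PathIn (η : A.Inputs) : List ℕ → Λ → Λ → Prop
  | [], a, b => a = b
  | i :: l, a, b => ∃ c x, η i = some ⟨a, c, x⟩ ∧ PathIn η l c b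

lemma pathIn_append {η : A.Inputs} {l l' : List ℕ} :
    PathIn η (l ++ l') a b ↔ ∃ e, PathIn η l a e ∧ PathIn η l' e b := by
  induction l generalizing a <;> grind [PathIn, List.cons_append]

/-- The input with label `i` has degree `ε i`. -/
def HasDeg (η : A.Inputs) (ε : ℕ → ℤ) : Prop :=
  ∀ i a b x, η i = some ⟨a, b, x⟩ → x ∈ (A.Hom a b).grade (ε i)

lemma mu_of_length (k : χ[A] a b) (h : 1 ≤ k.length) : A.mu k = A.m k := by
  cases k with
  | nil => simp [length] at h
  | cons => rfl

lemma mu_mem {k : χ[A] a b} {n : ℤ} (hk : k.Homogeneous n)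
    (h : k.length ≠ 1) : A.mu k ∈ (A.Hom a b).grade ((k.length - 2 : ℕ) + n) := by
  cases k with
  | nil => obtain rfl : n = 0 := hk; exact A.one_mem _
  | cons x l =>
    have := A.m_mem _ n hk
    have e : n + ((cons x l).length : ℤ) - 2 = (((cons x l).length - 2 : ℕ) : ℤ) + n := by
      simp only [length] at h ⊢
      omega
    rw [e] at this
    exact this

lemma slotLinear_mu (a b : Λ) : SlotLinear K (A.mu (a := a) (b := b)) := by
  refine ⟨fun l x y l' => ?_, fun l k x l' => ?_⟩
  · rw [mu_of_length _ (by simp [length_append, length]; omega), mu_of_length _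
      (by simp [length_append, length]; omega), mu_of_length _
      (by simp [length_append, length]; omega), A.m_add]
  · rw [mu_of_length _ (by simp [length_append, length]; omega), mu_of_length _
      (by simp [length_append, length]; omega), A.m_smul]

section Eval

variable {M N : Type*} {η : A.Inputs}

lemma look_congr [Zero M] {Ψ Ψ' : ∀ b, (A.Hom a b).X → M} (h : ∀ b x, Ψ b x = Ψ' b x)
    (s) : look a Ψ s = look a Ψ' s := by
  rw [show Ψ = Ψ' from funext fun b => funext fun x => h b x]

lemma map_look [Zero M] [Zero N] (f : M → N) (hf : f 0 = 0)
    (Ψ : ∀ b, (A.Hom a b).X → M) (s) : f (look a Ψ s) = look a (fun b x => f (Ψ b x)) s := by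
  match s with
  | none => exact hf
  | some s => simp only [look]; split_ifs <;> simp [hf]

lemma look_add [AddZeroClass M] (Ψ Ψ' : ∀ b, (A.Hom a b).X → M) (s) :
    look a (fun b x => Ψ b x + Ψ' b x) s = look a Ψ s + look a Ψ' s := by
  match s with
  | none => simp [look]
  | some s => simp only [look]; split_ifs <;> simp

lemma map_eval [Zero M] [Zero N] (f : M → N) (hf : f 0 = 0) (F : Forest) (a : Λ)
    (Ψ : ∀ b, χ[A] a b → M) :
    f (eval η F a Ψ) = eval η F a fun b k => f (Ψ b k) := by
  induction F generalizing a <;> simp_all [eval, map_look]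

lemma eval_zero [Zero M] (F : Forest) (a : Λ) : eval η F a (fun _ _ => (0 : M)) = 0 :=
  (map_eval (fun _ : M => (0 : M)) rfl F a fun _ _ => 0).symm

lemma eval_add [AddZeroClass M] (F : Forest) (a : Λ) (Ψ Ψ' : ∀ b, χ[A] a b → M) :
    eval η F a (fun b k => Ψ b k + Ψ' b k) = eval η F a Ψ + eval η F a Ψ' := by
  induction F generalizing a <;> simp_all [eval, look_add]

lemma eval_smul [AddCommGroup M] [Module K M] (z : K) (F : Forest) (a : Λ)
    (Ψ : ∀ b, χ[A] a b → M) :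
    eval η F a (fun b k => z • Ψ b k) = z • eval η F a Ψ :=
  (map_eval (fun x : M => z • x) (smul_zero z) F a Ψ).symm

lemma eval_append [Zero M] (F G : Forest) (a : Λ) (Ψ : ∀ b, χ[A] a b → M) :
    eval η (F.append G) a Ψ =
      eval η F a fun e k => eval η G e fun b l => Ψ b (k.append l) := by
  induction F generalizing a with
  | nil => rfl
  | leaf i r ih => simp only [Forest.append, eval, ih]; rfl
  | node c r _ ih => simp only [Forest.append, eval, ih]; rfl

lemma eval_splits [AddCommMonoid M] (F : Forest) (a : Λ)
    (g : ∀ b e, χ[A] a e → χ[A] e b → M) :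
    (F.splits.map fun s => eval η s.1 a fun e p => eval η s.2 e fun b q => g b e p q).sum =
      eval η F a fun b k => k.sumSplits (g b) := by
  induction F generalizing a with
  | nil => simp [Forest.splits, eval, sumSplits]
  | leaf i r ih =>
    simp only [Forest.splits, List.map_cons, List.sum_cons, List.map_map, eval, sumSplits_cons,
      eval_add, look_add, ← ih]
    congr 1
    have : ∀ L : List (Forest × Forest), (L.map fun s => look a (fun c x => eval η s.1 c fun e p =>
        eval η s.2 e fun b q => g b e (cons x p) q) (η i)).sum =
        look a (fun c x => (L.map fun s => eval η s.1 c fun e p =>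
          eval η s.2 e fun b q => g b e (cons x p) q).sum) (η i) := by
      intro L
      induction L with
      | nil => exact (map_look (fun _ : M => (0 : M)) rfl (A := A) (a := a) (fun _ _ => 0) _)
      | cons s L ih => simp only [List.map_cons, List.sum_cons, ih, look_add]
    exact this _
  | node c r ihc ih =>
    simp only [Forest.splits, List.map_cons, List.sum_cons, List.map_map, eval, sumSplits_cons,
      eval_add, ← ih]
    congr 1
    have : ∀ L : List (Forest × Forest), (L.map fun s => eval η c a fun f k =>
        eval η s.1 f fun e p => eval η s.2 e fun b q => g b e (cons (A.mu k) p) q).sum =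
        eval η c a fun f k => (L.map fun s => eval η s.1 f fun e p =>
          eval η s.2 e fun b q => g b e (cons (A.mu k) p) q).sum := by
      intro L
      induction L with
      | nil => exact (eval_zero _ _).symm
      | cons s L ih => simp only [List.map_cons, List.sum_cons, ih, eval_add]
    exact this _

lemma eval_congr_inputs [Zero M] {η' : A.Inputs} {F : Forest} (h : ∀ i ∈ F.leaves, η i = η' i)
    (a : Λ) (Ψ : ∀ b, χ[A] a b → M) : eval η F a Ψ = eval η' F a Ψ := by
  induction F generalizing a <;> grind [eval, leaves]

lemma eval_relabel [Zero M] (f : ℕ → ℕ) (F : Forest) (a : Λ)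
    (Ψ : ∀ b, χ[A] a b → M) :
    eval η (F.relabel f) a Ψ = eval (fun i => η (f i)) F a Ψ := by
  induction F generalizing a <;> grind [relabel, eval]

lemma exists_chain {ε : ℕ → ℤ} (hη : HasDeg η ε) {F : Forest} (hF : F.Stable)
    (h : PathIn η F.leaves a b) : ∃ k : χ[A] a b, k.length = F.width ∧
      k.Homogeneous (F.deg + (F.leaves.map ε).sum) ∧
        ∀ {M : Type w} [Zero M] (Ψ : ∀ b, χ[A] a b → M), eval η F a Ψ = Ψ b k := by
  induction F generalizing a b with
  | nil => obtain rfl : a = b := h; exact ⟨.nil a, rfl, by simp [Homogeneous, deg, leaves],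
      fun Ψ => rfl⟩
  | leaf i r ih =>
    obtain ⟨c, x, hx, h⟩ := h
    obtain ⟨l, h1, h2, h3⟩ := ih hF h
    refine ⟨cons x l, by simp [length, width, h1], ⟨ε i, _, hη _ _ _ _ hx, h2, ?_⟩, fun Ψ => ?_⟩
    · simp only [deg, leaves, List.map_cons, List.sum_cons]; ring
    · rw [eval, hx, look_some, h3]
  | node c r ihc ih =>
    obtain ⟨e, hc, hr⟩ := pathIn_append.1 h
    obtain ⟨k, k1, k2, k3⟩ := ihc (hF.1.elim (fun h => h ▸ trivial) fun h => h.2.stable) hc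
    obtain ⟨l, l1, l2, l3⟩ := ih hF.2 hr
    refine ⟨cons (A.mu k) l, by simp [length, width, l1], ⟨_, _, mu_mem k2 ?_, l2, ?_⟩,
      fun Ψ => ?_⟩
    · rw [k1]; rcases hF.1 with rfl | h
      · simp [width]
      · omega
    · simp only [deg, leaves, List.map_append, List.sum_append, k1]; push_cast; ring
    · rw [eval, k3, l3]

end Eval

end AInfCat

section ZSign

lemma Cx.sgn_eq_zsign (V : Cx.{u,w} K) {n : ℤ} {x : V.X} (hx : x ∈ V.grade n) :
    V.sgn x = zsign K n • x := by
  rw [V.sgn_of_mem hx, zsign_intCast]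

lemma Cx.sgn_pow_eq_zsign (V : Cx.{u,w} K) {n : ℤ} {x : V.X} (hx : x ∈ V.grade n) (s : ℕ) :
    (V.sgn ^ s) x = zsign K (s * n) • x := by
  induction s with
  | zero => simp
  | succ s ih =>
    rw [pow_succ', Module.End.mul_apply, ih, map_smul, V.sgn_eq_zsign hx, smul_smul, ← zsign_add]
    congr 2; push_cast; ring

lemma SlotLinear.map_sgn_pow {M : Λ → Λ → Cx.{u,w} K} {N : Type*} [AddCommGroup N]
    [Module K N] {Ψ : ChainOf M a b → N} (h : SlotLinear K Ψ) {k : ChainOf M a b} {n : ℤ}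
    (hk : k.Homogeneous n) (s : ℕ) :
    Ψ (k.map fun a b => (M a b).sgn ^ s) = zsign K (s * n) • Ψ k := by
  induction k generalizing n with
  | nil => obtain rfl : n = 0 := hk; simp [Chain.map]
  | cons x l ih =>
    obtain ⟨p, q, hx, hq, rfl⟩ := hk
    rw [Chain.map, Cx.sgn_pow_eq_zsign _ hx, h.cons_smul, ih (h.cons x) hq, smul_smul, ← zsign_add]
    congr 2; push_cast; ring

end ZSign

namespace AInfCat

open Chain Forest

variable {A : AInfCat.{u,v,w} K Λ}

section ChainSums

variable {M : Type*} [AddCommGroup M] [Module K M] {V : Λ → Λ → Cx.{u,w} K}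

/-- The extension of the differential to sequences. -/
def dSum : ∀ {a b : Λ}, ChainOf V a b → (ChainOf V a b → M) → M
  | _, _, .nil _, _ => 0
  | _, _, .cons x l, Ψ => Ψ (cons ((V _ _).d x) l) +
      dSum l fun l => Ψ (cons ((V _ _).sgn x) l)

/-- The sum over all ways of applying an operation of at least two and fewer than `n` arguments to
some of the entries of a sequence. -/
def midSum (m : ∀ {a b : Λ}, ChainOf V a b → (V a b).X) (n : ℕ)
    (k : ChainOf V a b) (Ψ : ChainOf V a b → M) : M :=
  k.sumSplits fun _ p w => w.sumSplits fun _ q t => if 2 ≤ q.length ∧ q.length < n then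
    zsign K (1 + p.length + q.length * t.length) •
      Ψ ((p.map fun a b => (V a b).sgn ^ q.length).append (cons (m q) t)) else 0

lemma dSum_smul (z : K) (k : ChainOf V a b) (Ψ : ChainOf V a b → M) :
    dSum k (fun l => z • Ψ l) = z • dSum k Ψ := by
  induction k <;> simp_all [dSum, smul_add]

lemma dSum_congr {k : ChainOf V a b} {Ψ Ψ' : ChainOf V a b → M}
    (h : ∀ l, l.length = k.length → Ψ l = Ψ' l) : dSum k Ψ = dSum k Ψ' := by
  induction k with
  | nil => rfl
  | cons x l ih => exact congrArg₂ (· + ·) (h _ rfl) (ih fun l' hl => h _ (congrArg (· + 1) hl))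

lemma sumSplits_single {m : ∀ {a b : Λ}, ChainOf V a b → (V a b).X}
    (hm : ∀ {a b : Λ} (x : (V a b).X), m (cons x (nil b)) = (V a b).d x)
    (k : ChainOf V a b) (Ψ : ChainOf V a b → M) :
    (k.sumSplits fun _ p w => w.sumSplits fun _ q t => if q.length = 1 then
      Ψ ((p.map fun a b => (V a b).sgn).append (cons (m q) t)) else 0) = dSum k Ψ := by
  induction k with
  | nil => simp [dSum, length]
  | cons x l ih =>
    rw [sumSplits_cons, dSum, ← ih]
    congr 1
    rw [sumSplits_cons, if_neg (by simp [length]), zero_add, sumSplits_eq_first]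
    · simp [length, Chain.map, Chain.append, hm]
    · intro e p q hp
      rw [if_neg (by simp [length]; omega)]

lemma sumSplits_all (k : ChainOf V a b)
    (g : ∀ e f, ChainOf V a e → ChainOf V e f → ChainOf V f b → M) :
    (k.sumSplits fun e p w => w.sumSplits fun f q t =>
      if q.length = k.length then g e f p q t else 0) = g a b (nil a) k (nil b) := by
  rw [show (k.sumSplits fun e p w => w.sumSplits fun f q t =>
      if q.length = k.length then g e f p q t else 0) = k.sumSplits fun e p w =>
        if 1 ≤ p.length then 0 else w.sumSplits fun f q t =>
          if q.length = k.length then g e f p q t else 0 from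
    sumSplits_congr k fun e p w h => by
      split_ifs with hp
      · rw [sumSplits_congr w (g' := fun _ _ _ => 0) fun f q t h' => if_neg (by omega),
          sumSplits_zero]
      · rfl]
  rw [sumSplits_eq_first _ fun e p q hp => by simp [hp], if_neg (by simp [length])]
  rw [show (k.sumSplits fun f q t => if q.length = k.length then g a f (nil a) q t else 0) =
      k.sumSplits fun f q t => if 1 ≤ t.length then 0 else g a f (nil a) q t from
    sumSplits_congr k fun f q t h => by
      by_cases ht : 1 ≤ t.length
      · rw [if_pos ht, if_neg (by omega)]
      · rw [if_neg ht, if_pos (by omega)]]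
  rw [sumSplits_eq_last _ fun e p q hp => by simp [hp], if_neg (by simp [length])]

lemma stasheffSum_eq {m : ∀ {a b : Λ}, ChainOf V a b → (V a b).X}
    (hm : ∀ {a b : Λ} (x : (V a b).X), m (cons x (nil b)) = (V a b).d x)
    {k : ChainOf V a b} (hk : 2 ≤ k.length) : stasheffSum V m k =
      (V a b).d (m k) - midSum m k.length k m - zsign K k.length • dSum k m := by
  have e : stasheffSum V m k = (k.sumSplits fun e p w => w.sumSplits fun f q t =>
        (if q.length = k.length then
          zsign K (p.length + q.length * t.length) •
            m ((p.map fun a b => (V a b).sgn ^ q.length).append (cons (m q) t)) else 0) +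
        (if q.length = 1 then zsign K (k.length - 1) •
          m ((p.map fun a b => (V a b).sgn).append (cons (m q) t)) else 0) +
        -(if 2 ≤ q.length ∧ q.length < k.length then zsign K (1 + p.length + q.length * t.length) •
          m ((p.map fun a b => (V a b).sgn ^ q.length).append (cons (m q) t))
            else 0)) := by
    rw [stasheffSum, sum_splits]
    simp only [sum_splits]
    refine sumSplits_congr k fun e p w hpw => sumSplits_congr w fun f q t hqt => ?_
    rw [← zsign_natCast]
    push_cast
    rcases (by omega : q.length = 0 ∨ q.length = 1 ∨ q.length = k.length ∧ 2 ≤ q.length ∨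
      (2 ≤ q.length ∧ q.length < k.length)) with h0 | h0 | h0 | h0
    · rw [if_pos h0, if_neg (by omega), if_neg (by omega), if_neg (by omega)]; simp
    · rw [if_neg (by omega), if_neg (by omega), if_pos h0, if_neg (by omega), h0]
      have : (k.length : ZMod 2) = p.length + 1 + t.length := by
        rw [← hpw, ← hqt, h0]; push_cast; ring
      simp [this]; congr 2; ring
    · rw [if_neg (by omega), if_pos h0.1, if_neg (by omega), if_neg (by omega)]; simp
    · rw [if_neg (by omega), if_neg (by omega), if_neg (by omega), if_pos h0, add_assoc 1,
        zsign_add K 1, zsign_one]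
      simp
  rw [e]
  simp only [sumSplits_add, ← neg_sumSplits]
  rw [sumSplits_all k fun e f p q t => zsign K (p.length + q.length * t.length) •
      m ((p.map fun a b => (V a b).sgn ^ q.length).append (cons (m q) t)),
    sumSplits_single hm k fun l => zsign K (k.length - 1) • m l, dSum_smul]
  have h2 : zsign K ((k.length : ZMod 2) - 1) = - zsign K k.length := by
    rw [sub_eq_add_neg, zsign_add, show (-1 : ZMod 2) = 1 by decide, zsign_one, mul_neg_one]
  simp only [Chain.map, Chain.append, length, hm, h2, Nat.cast_zero, mul_zero, add_zero, zsign_zero,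
    one_smul, midSum]
  module

lemma d_mu (k : χ[A] a b) (h : k.length ≠ 1) :
    (A.Hom a b).d (A.mu k) = midSum A.mu k.length k A.mu + zsign K k.length • dSum k A.mu := by
  by_cases hk : k.length = 0
  · cases k with
    | nil => simp [mu, A.d_one, midSum, dSum, length]
    | cons => simp [length] at hk
  have := stasheffSum_eq (m := A.m) A.m_single (k := k) (by omega)
  rw [A.stasheff, sub_sub, eq_comm, sub_eq_zero] at this
  rw [mu_of_length k (by omega), this, dSum_congr fun l hl => mu_of_length l (by omega)]
  congr 1
  refine sumSplits_congr k fun e p w hpw => sumSplits_congr w fun f q t hqt => ?_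
  split_ifs with hq
  · beta_reduce
    rw [mu_of_length q (by omega), mu_of_length _ (by simp [length_append, length]; omega)]
  · rfl

end ChainSums

lemma list_sum_map_flatMap {α β M : Type*} [AddCommMonoid M] (l : List α) (f : α → List β)
    (g : β → M) : ((l.flatMap f).map g).sum = (l.map fun x => ((f x).map g).sum).sum := by
  induction l <;> grind

lemma list_sum_map_filterMap {α β M : Type*} [AddCommMonoid M] (l : List α) (f : α → Option β)
    (g : β → M) : ((l.filterMap f).map g).sum = (l.map fun x => (f x).elim 0 g).sum := by
  induction l <;> grind [List.filterMap_cons]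

lemma list_smul_sum_map {α M : Type*} [AddCommGroup M] [Module K M] (z : K) (l : List α)
    (g : α → M) : z • (l.map g).sum = (l.map fun x => z • g x).sum := by
  rw [List.smul_sum, List.map_map]; rfl

lemma sum_leaves_intCast (ε : ℕ → ℤ) (F : Forest) :
    (((F.leaves.map ε).sum : ℤ) : ZMod 2) = F.leafSum π[ε] := by
  rw [leafSum, Int.cast_list_sum, List.map_map]; rfl

section Boundary

variable {M : Type w} [AddCommGroup M] [Module K M] {η : A.Inputs} {ε : ℕ → ℤ}

lemma eval_expand (hη : HasDeg η ε) {c : Forest} (hc : c.Reduced)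
    (hp : PathIn η c.leaves a b) {Ψ : ∀ b, χ[A] a b → M}
    (hΨ : ∀ b, SlotLinear K (Ψ b)) :
    (c.expand.map fun t => zsign K (t.1 + t.2.shuf π[ε]) •
      eval η t.2 a Ψ).sum = zsign K (c.shuf π[ε]) •
        eval η c a fun b k => midSum A.mu c.width k (Ψ b) := by
  set δ : ℕ → ZMod 2 := π[ε] with hδ
  simp only [expand, midSum, list_sum_map_flatMap, list_sum_map_filterMap]
  rw [← eval_splits, list_smul_sum_map]
  refine congrArg List.sum (List.map_congr_left fun x hx => ?_)
  have hcx := splits_spec _ x hx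
  have hrx := hc
  rw [← hcx, reduced_append_iff] at hrx
  have hpx := hp
  rw [← hcx, leaves_append, pathIn_append] at hpx
  obtain ⟨e, hp1, hp2⟩ := hpx
  obtain ⟨p, lp, dp, Ep⟩ := exists_chain hη hrx.1.stable hp1
  rw [Ep, ← eval_splits, list_smul_sum_map]
  refine congrArg List.sum (List.map_congr_left fun y hy => ?_)
  have hcy := splits_spec _ y hy
  have hry := hrx.2
  rw [← hcy, reduced_append_iff] at hry
  rw [← hcy, leaves_append, pathIn_append] at hp2
  obtain ⟨f, hp2, hp3⟩ := hp2
  obtain ⟨q, lq, dq, Eq⟩ := exists_chain hη hry.1.stable hp2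
  obtain ⟨t, lt, dt, Et⟩ := exists_chain hη hry.2.stable hp3
  rw [Eq, Et, lq]
  split_ifs with hw
  · simp only [Option.elim, eval_append, eval]
    rw [Ep, Eq, Et, lp, lt]
    rw [((hΨ b).append_right (cons (A.mu q) t)).map_sgn_pow dp, smul_smul, smul_smul, ← zsign_add,
      ← zsign_add]
    congr 2
    rw [← hcx, ← hcy]
    simp only [shuf_append, shuf, deg_append, deg]
    have h2 : ((y.1.width - 2 : ℕ) : ZMod 2) = y.1.width := by
      rw [Nat.cast_sub hw.1]; simp [show (2 : ZMod 2) = 0 from rfl]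
    rw [Int.cast_add, sum_leaves_intCast]
    push_cast
    rw [h2]
    ring
  · simp

/-- The inputs with the differential applied to the `j`-th one. -/
def dAt (η : A.Inputs) (j : ℕ) : A.Inputs := fun i =>
  if i = j then (η i).map fun s => ⟨s.1, s.2.1, (A.Hom _ _).d s.2.2⟩ else η i

lemma eval_dAt_of_not_mem {F : Forest} {j : ℕ} (hj : j ∉ F.leaves) (a : Λ)
    (Ψ : ∀ b, χ[A] a b → M) : eval (dAt η j) F a Ψ = eval η F a Ψ :=
  eval_congr_inputs (fun i hi => if_neg (by rintro rfl; exact hj hi)) a Ψ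

/-- A signed sum over the entries of a list, the sign being the one for moving an odd element to
an entry. -/
def posSum (δ : ℕ → ZMod 2) : List ℕ → (ℕ → M) → M
  | [], _ => 0
  | j :: l, g => g j + zsign K (δ j) • posSum δ l g

lemma posSum_append (δ : ℕ → ZMod 2) (l m : List ℕ) (g : ℕ → M) :
    posSum (K := K) δ (l ++ m) g =
      posSum (K := K) δ l g + zsign K (l.map δ).sum • posSum (K := K) δ m g := by
  induction l with
  | nil => simp [posSum]
  | cons j l ih =>
    simp only [List.cons_append, posSum, ih, List.map_cons, List.sum_cons, zsign_add]
    module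

lemma smul_posSum (δ : ℕ → ZMod 2) (z : K) (l : List ℕ) (g : ℕ → M) :
    z • posSum (K := K) δ l g = posSum (K := K) δ l fun j => z • g j := by
  induction l with
  | nil => simp [posSum]
  | cons j l ih => simp only [posSum, ← ih]; module

lemma posSum_congr (δ : ℕ → ZMod 2) {l : List ℕ} {g g' : ℕ → M} (h : ∀ j ∈ l, g j = g' j) :
    posSum (K := K) δ l g = posSum (K := K) δ l g' := by
  induction l <;> grind [posSum]

lemma map_dSum {M' : Type*} [AddCommGroup M'] [Module K M'] (f : M →ₗ[K] M')
    (k : χ[A] a b) (Ψ : χ[A] a b → M) :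
    f (dSum k Ψ) = dSum k fun l => f (Ψ l) := by
  induction k <;> grind [dSum, map_add]

lemma map_midSum {M' : Type*} [AddCommGroup M'] [Module K M'] (f : M →ₗ[K] M') (n : ℕ)
    (k : χ[A] a b) (Ψ : χ[A] a b → M) :
    f (midSum A.mu n k Ψ) = midSum A.mu n k fun l => f (Ψ l) := by simp [midSum, map_sumSplits, apply_ite, map_smul, map_zero]

end Boundary

end AInfCat

namespace Forest

lemma deg_expand {c : Forest} {t : ℕ × Forest} (ht : t ∈ c.expand) :
    (t.2.width - 2) + t.2.deg + 1 = (c.width - 2) + c.deg := by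
  simp only [expand, List.mem_flatMap, List.mem_filterMap] at ht
  obtain ⟨x, hx, y, hy, h⟩ := ht
  split_ifs at h with hw
  obtain rfl := Option.some.inj h
  have h1 := splits_spec _ x hx
  have h2 := splits_spec _ y hy
  have hc : c = x.1.append (y.1.append y.2) := by rw [h2, h1]
  have hwid : c.width = x.1.width + (y.1.width + y.2.width) := by
    rw [hc, width_append, width_append]
  have hdeg : c.deg = x.1.deg + (y.1.deg + y.2.deg) := by
    rw [hc, deg_append, deg_append]
  simp only [width_append, deg_append, width, deg]
  omega

lemma deg_bdry {F : Forest} {t : ℕ × Forest} (ht : t ∈ F.bdry) : t.2.deg + 1 = F.deg := by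
  induction F generalizing t with
  | nil => simp [bdry] at ht
  | leaf i r ih =>
    simp only [bdry, List.mem_map] at ht
    obtain ⟨s, hs, rfl⟩ := ht
    exact ih (t := s) hs
  | node c r ihc ih =>
    simp only [bdry, List.mem_append, List.mem_map] at ht
    rcases ht with (⟨s, hs, rfl⟩ | ⟨s, hs, rfl⟩) | ⟨s, hs, rfl⟩
    · have := deg_expand hs
      simp only [deg]; omega
    · have := ihc hs
      have hw : s.2.width = c.width := by
        rw [← length_legs, (c.bdry_spec s hs).1, length_legs]
      simp only [deg, hw]; omega
    · have := ih hs
      simp only [deg]; omega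

lemma leaves_bdry {F : Forest} {t : ℕ × Forest} (ht : t ∈ F.bdry) : t.2.leaves = F.leaves := by
  rw [← flatten_legs, (F.bdry_spec t ht).1, flatten_legs]

/-- The indicator function of a label. -/
def single (j : ℕ) : ℕ → ZMod 2 := fun i => if i = j then 1 else 0

lemma leafSum_single_of_not_mem {F : Forest} {j : ℕ} (h : j ∉ F.leaves) :
    F.leafSum (single j) = 0 := by
  rw [leafSum]
  exact List.sum_eq_zero fun x hx => by
    obtain ⟨i, hi, rfl⟩ := List.mem_map.1 hx
    exact if_neg (by rintro rfl; exact h hi)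

lemma sum_map_single {l : List ℕ} {j : ℕ} (h : j ∈ l) (hl : l.Nodup) :
    (l.map (single j)).sum = 1 := by
  induction l with
  | nil => simp at h
  | cons i l ih =>
    rw [List.nodup_cons] at hl
    rw [List.map_cons, List.sum_cons]
    rcases List.mem_cons.1 h with rfl | h'
    · rw [List.sum_eq_zero fun x hx => by
        obtain ⟨i, hi, rfl⟩ := List.mem_map.1 hx
        exact if_neg (by rintro rfl; exact hl.1 hi)]
      simp [single]
    · rw [ih h' hl.2, single, if_neg (by rintro rfl; exact hl.1 h'), zero_add]

lemma shuf_single_of_not_mem {F : Forest} {j : ℕ} (h : j ∉ F.leaves) :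
    F.shuf (single j) = 0 := by
  induction F <;> simp_all [leaves, List.mem_cons, not_or, shuf, single, Ne.symm, List.mem_append, leafSum_single_of_not_mem]

end Forest

lemma zsign_smul_congr {M : Type*} [AddCommGroup M] [Module K M] {a b : ZMod 2} (h : a = b)
    (x : M) : zsign K a • x = zsign K b • x := h ▸ rfl

namespace AInfCat

open Chain Forest

variable {A : AInfCat.{u,v,w} K Λ} {M : Type w}
  [AddCommGroup M] [Module K M] {η : A.Inputs} {ε : ℕ → ℤ}

lemma eval_bdry (hη : HasDeg η ε) {F : Forest} (hF : F.Stable) (hnd : F.leaves.Nodup)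
    (hp : PathIn η F.leaves a b) {Ψ : ∀ b, χ[A] a b → M}
    (hΨ : ∀ b, SlotLinear K (Ψ b)) :
    (F.bdry.map fun t => zsign K (t.1 + t.2.shuf π[ε]) •
      eval η t.2 a Ψ).sum =
      zsign K (F.shuf π[ε]) • eval η F a (fun b k => dSum k (Ψ b)) -
        zsign K F.deg • posSum (K := K) π[ε] F.leaves fun j =>
          zsign K ((F.shuf π[ε]) + F.shuf (single j)) •
            eval (dAt η j) F a Ψ := by
  set δ : ℕ → ZMod 2 := π[ε] with hδ
  induction F generalizing a b with
  | nil => simp [bdry, eval, dSum, posSum, leaves]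
  | leaf i r ih =>
    obtain ⟨c, x, hx, hp⟩ := hp
    simp only [leaves, List.nodup_cons] at hnd
    have IH := ih hF hnd.2 hp (fun b => (hΨ b).cons x)
    obtain ⟨l, ll, dl, El⟩ := exists_chain (F := r) hη hF hp
    have L : (List.map (fun t : ℕ × Forest => zsign K (t.1 + t.2.shuf δ) • eval η t.2 a Ψ)
        (leaf i r).bdry).sum = zsign K (δ i * (r.deg + 1)) •
        (List.map (fun t : ℕ × Forest => zsign K (t.1 + t.2.shuf δ) •
          eval η t.2 c fun b l => Ψ b (cons x l)) r.bdry).sum := by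
      rw [bdry, List.map_map, list_smul_sum_map]
      refine congrArg List.sum (List.map_congr_left fun t ht => ?_)
      simp only [Function.comp, shuf, eval, hx, look_some]
      rw [smul_smul, ← zsign_add, ← deg_bdry ht]
      congr 2; grind
    have hdi : dAt η i i = some ⟨a, c, (A.Hom a c).d x⟩ := by simp [dAt, hx]
    have hr : ∀ j ∈ r.leaves, dAt η j i = some ⟨a, c, x⟩ := fun j hj => by
      rw [dAt, if_neg (by rintro rfl; exact hnd.1 hj), hx]
    rw [L, IH, leaves, posSum]
    simp only [eval, hx, hdi, look_some]
    rw [eval_dAt_of_not_mem hnd.1]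
    simp only [El, dSum, shuf, deg, shuf_single_of_not_mem hnd.1]
    have hs : (A.Hom a c).sgn x = zsign K (δ i) • x := Cx.sgn_eq_zsign _ (hη _ _ _ _ hx)
    have hΨ' : (fun l : χ[A] c b => Ψ b (cons ((A.Hom a c).sgn x) l)) =
        fun l => zsign K (δ i) • Ψ b (cons x l) := by
      funext l; rw [hs, (hΨ b).cons_smul]
    rw [hΨ', dSum_smul]
    have hpos : (posSum (K := K) δ r.leaves fun j =>
        zsign K (δ i * r.deg + r.shuf δ + (single j i * r.deg + r.shuf (single j))) •
          look a (fun c x => eval (dAt η j) r c fun b l => Ψ b (cons x l)) (dAt η j i)) =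
        zsign K (δ i * r.deg) • posSum (K := K) δ r.leaves fun j =>
          zsign K (r.shuf δ + r.shuf (single j)) • eval (dAt η j) r c fun b l => Ψ b (cons x l) := by
      rw [smul_posSum]
      refine posSum_congr δ fun j hj => ?_
      rw [hr j hj, look_some, smul_smul, ← zsign_add, single,
        if_neg (by rintro rfl; exact hnd.1 hj)]
      congr 2; ring
    rw [hpos]
    have h1 : zsign K (δ i * (r.deg + 1)) = zsign K (δ i * r.deg) * zsign K (δ i) := by
      rw [← zsign_add]; congr 1; ring
    have h2 : zsign K (δ i * r.deg + r.shuf δ + (single i i * r.deg + 0)) =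
        zsign K (δ i * r.deg) * zsign K (r.shuf δ) * zsign K r.deg := by
      rw [← zsign_add, ← zsign_add]; congr 1; simp [single]
    have h3 : zsign K r.deg • zsign K r.deg • Ψ b (cons ((A.Hom a c).d x) l) =
        Ψ b (cons ((A.Hom a c).d x) l) := by rw [smul_smul, zsign_mul_self, one_smul]
    rw [h1, h2, zsign_add]
    linear_combination (norm := module) (zsign K (δ i * r.deg) * zsign K (r.shuf δ)) • h3
  | node c r ihc ih =>
    obtain ⟨e, hpc, hpr⟩ := pathIn_append.1 hp
    have hFc : c.Stable := hF.1.elim (fun h => h ▸ trivial) fun h => h.2.stable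
    have hcr : c.Reduced := hF.1.elim (fun h => h ▸ trivial) fun h => h.2
    simp only [leaves] at hnd
    have hdis := List.disjoint_of_nodup_append hnd
    obtain ⟨k, lk, dk, Ek⟩ := exists_chain hη hFc hpc
    obtain ⟨l, ll, dl, El⟩ := exists_chain hη hF.2 hpr
    have hw : k.length ≠ 1 := by
      rw [lk]; rcases hF.1 with rfl | h
      · simp [width]
      · omega
    have hww : ((c.width - 2 : ℕ) : ZMod 2) = c.width := by
      rcases hF.1 with rfl | h
      · rfl
      · rw [Nat.cast_sub h.1]; simp [show (2 : ZMod 2) = 0 from rfl]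
    have hsl : ∀ f, SlotLinear K fun k : χ[A] a f =>
        eval η r f fun b l => Ψ b (cons (A.mu k) l) := fun f =>
      ⟨fun p x y q => by
        rw [← eval_add]; congr 1; funext b l
        rw [(slotLinear_mu _ _).add, (hΨ b).cons_add],
      fun p z x q => by
        rw [← eval_smul]; congr 1; funext b l
        rw [(slotLinear_mu _ _).smul, (hΨ b).cons_smul]⟩
    let Φ : (A.Hom a e).X →ₗ[K] M :=
      { toFun := fun y => Ψ b (cons y l)
        map_add' := fun x y => (hΨ b).cons_add x y l
        map_smul' := fun z x => (hΨ b).cons_smul z x l }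
    have hsgn : (A.Hom a e).sgn (A.mu k) =
        zsign K (c.width + c.deg + c.leafSum δ) • A.mu k := by
      rw [Cx.sgn_eq_zsign _ (mu_mem dk hw)]
      congr 2
      rw [Int.cast_add, Int.cast_add, sum_leaves_intCast, lk, Int.cast_natCast, hww]
      push_cast; ring
    have S1 : (c.expand.map fun t => zsign K (t.1 + (node t.2 r).shuf δ) •
        eval η (node t.2 r) a Ψ).sum =
        zsign K ((node c r).shuf δ) • Φ (midSum A.mu c.width k A.mu) := by
      have h := eval_expand hη hcr hpc hsl
      rw [Ek, show (fun k : χ[A] a e => eval η r e fun b l => Ψ b (cons (A.mu k) l)) =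
        fun k => Φ (A.mu k) from funext fun k => El _, ← map_midSum] at h
      rw [shuf, show c.leafSum δ * r.deg + c.shuf δ + r.shuf δ =
        (c.leafSum δ * r.deg + r.shuf δ) + c.shuf δ by ring, zsign_add, mul_smul, ← h,
        list_smul_sum_map]
      refine congrArg List.sum (List.map_congr_left fun t ht => ?_)
      have hl : t.2.leafSum δ = c.leafSum δ := by rw [leafSum, leafSum, (c.expand_spec t ht).1]
      rw [smul_smul, ← zsign_add, shuf, hl]
      exact zsign_smul_congr (by ring) _
    have S2 : (c.bdry.map fun t => zsign K ((c.width + t.1 : ℕ) + (node t.2 r).shuf δ) •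
        eval η (node t.2 r) a Ψ).sum =
        zsign K ((node c r).shuf δ + c.width) • dSum k (fun k => Φ (A.mu k)) -
        zsign K (node c r).deg • posSum (K := K) δ c.leaves fun j =>
          zsign K ((node c r).shuf δ + (node c r).shuf (single j)) •
            eval (dAt η j) (node c r) a Ψ := by
      have h := ihc hFc hnd.of_append_left hpc hsl
      rw [Ek, show (fun k : χ[A] a e => eval η r e fun b l => Ψ b (cons (A.mu k) l)) =
        fun k => Φ (A.mu k) from funext fun k => El _] at h
      have h' := congrArg (fun z => zsign K (c.leafSum δ * r.deg + r.shuf δ + c.width) • z) h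
      rw [list_smul_sum_map, smul_sub, smul_smul, smul_smul, ← zsign_add, ← zsign_add,
        smul_posSum] at h'
      rw [smul_posSum]
      refine Eq.trans (congrArg List.sum (List.map_congr_left fun t ht => ?_)) (h'.trans ?_)
      · have hl : t.2.leafSum δ = c.leafSum δ := by rw [leafSum, leafSum, leaves_bdry ht]
        rw [smul_smul, ← zsign_add, shuf, hl]
        exact zsign_smul_congr (by push_cast; ring) _
      · congr 1
        · congr 2; rw [shuf]; ring
        · refine posSum_congr δ fun j hj => ?_
          have hjr : j ∉ r.leaves := fun h => hdis hj h
          rw [smul_smul, smul_smul, ← zsign_add, ← zsign_add]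
          congr 1
          · congr 1
            rw [shuf, shuf, deg, shuf_single_of_not_mem hjr, leafSum, leafSum,
              sum_map_single hj hnd.of_append_left]
            grind
          · rw [eval]
            congr 1; funext f k
            exact (eval_dAt_of_not_mem hjr _ _).symm
    have S3 : (r.bdry.map fun t => zsign K ((c.width + c.deg + t.1 : ℕ) + (node c t.2).shuf δ) •
        eval η (node c t.2) a Ψ).sum =
        zsign K ((node c r).shuf δ) •
          dSum l (fun l => Ψ b (cons ((A.Hom a e).sgn (A.mu k)) l)) -
        zsign K (node c r).deg • zsign K (c.leafSum δ) • posSum (K := K) δ r.leaves fun j =>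
          zsign K ((node c r).shuf δ + (node c r).shuf (single j)) •
            eval (dAt η j) (node c r) a Ψ := by
      have h := ih hF.2 hnd.of_append_right hpr fun b => (hΨ b).cons (A.mu k)
      rw [El] at h
      have h' := congrArg (fun z => zsign K (c.width + c.deg + c.leafSum δ * (r.deg + 1) +
        c.shuf δ) • z) h
      rw [list_smul_sum_map, smul_sub, smul_smul, smul_smul, ← zsign_add, ← zsign_add,
        smul_posSum] at h'
      rw [smul_smul, ← zsign_add, smul_posSum]
      refine Eq.trans (congrArg List.sum (List.map_congr_left fun t ht => ?_)) (h'.trans ?_)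
      · rw [smul_smul, ← zsign_add, shuf, eval, Ek, ← deg_bdry ht]
        congr 2; grind
      · congr 1
        · rw [hsgn, show (fun l : χ[A] e b => Ψ b (cons (zsign K (c.width + c.deg +
            c.leafSum δ) • A.mu k) l)) = fun l => zsign K (c.width + c.deg + c.leafSum δ) •
              Ψ b (cons (A.mu k) l) from funext fun l => (hΨ b).cons_smul _ _ _, dSum_smul,
            smul_smul, ← zsign_add]
          congr 2; rw [shuf]; ring
        · refine posSum_congr δ fun j hj => ?_
          have hjc : j ∉ c.leaves := fun h => hdis h hj
          rw [smul_smul, smul_smul, ← zsign_add, ← zsign_add]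
          congr 1
          · congr 1
            rw [shuf, shuf, deg, shuf_single_of_not_mem hjc, leafSum_single_of_not_mem hjc]
            grind
          · rw [eval, eval_dAt_of_not_mem hjc, Ek]
    rw [bdry, List.map_append, List.map_append, List.map_map, List.map_map, List.map_map,
      List.sum_append, List.sum_append]
    refine (congrArg₂ (· + ·) (congrArg₂ (· + ·) S1 S2) S3).trans ?_
    rw [eval, Ek, El, dSum, leaves, posSum_append, ← leafSum]
    have hd : Ψ b (cons ((A.Hom a e).d (A.mu k)) l) = Φ (midSum A.mu c.width k A.mu) +
        zsign K c.width • dSum k (fun k => Φ (A.mu k)) := by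
      rw [← map_dSum, ← map_smul, ← map_add, ← lk, ← d_mu k hw]; rfl
    rw [hd, zsign_add K _ (c.width : ZMod 2)]
    module

end AInfCat

namespace AInfCat

open Chain Forest

variable {A : AInfCat.{u,v,w} K Λ}

section Join

variable {M : Type*} [Zero M] {η : A.Inputs}

lemma look_zero (s) : look (A := A) a (fun _ _ => (0 : M)) s = 0 :=
  (map_look (fun _ : M => (0 : M)) rfl (A := A) (a := a) (fun _ _ => 0) s).symm

lemma eval_congr_of_length (F : Forest) (a : Λ) {Ψ Ψ' : ∀ b, χ[A] a b → M}
    (h : ∀ b k, k.length = F.width → Ψ b k = Ψ' b k) : eval η F a Ψ = eval η F a Ψ' := by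
  induction F generalizing a <;> grind [length, width, eval]

lemma eval_of_hasUnit {F : Forest} (hF : F.HasUnit) (a : Λ) {Ψ : ∀ b, χ[A] a b → M}
    (h : ∀ b f (l : χ[A] a f) (l' : χ[A] f b),
      (l.append (cons (A.one f) l')).length = F.width → Ψ b (l.append (cons (A.one f) l')) = 0) :
    eval η F a Ψ = 0 := by
  induction F generalizing a with
  | nil => exact hF.elim
  | leaf i r ih =>
    refine (look_congr (fun c x => ih hF c (Ψ := fun b l => Ψ b (cons x l)) fun b f l l' hl => ?_)
      _).trans (look_zero _)
    exact h b f (cons x l) l' (by simpa [length, width, Chain.append] using hl)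
  | node c r _ ih =>
    rw [eval]
    rcases hF with rfl | hF
    · rw [eval]
      refine (eval_congr_of_length r a fun b l hl => ?_).trans (eval_zero (A := A) r a)
      exact h b a (nil a) l (by simp [length, width, Chain.append, hl])
    · refine Eq.trans ?_ (eval_zero (η := η) c a)
      congr 1; funext e k
      exact ih hF e fun b f l l' hl =>
        h b f (cons (A.mu k) l) l' (by simpa [length, width, Chain.append] using hl)

lemma eval_join {c n : Forest} (h : c.join = some n) (a : Λ)
    (Ψ : ∀ b, χ[A] a b → M) :
    eval η n a Ψ = eval η c a fun e k => Ψ e (cons (A.mu k) (nil e)) := by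
  unfold join at h
  split_ifs at h with hu
  · have h1 : ∀ {a b : Λ} (x : (A.Hom a b).X), A.mu (cons (A.one a) (cons x (nil b))) = x :=
      A.one_mul
    have h2 : ∀ {a b : Λ} (x : (A.Hom a b).X), A.mu (cons x (cons (A.one b) (nil b))) = x :=
      A.mul_one
    split at h <;> first
      | (obtain rfl := Option.some.inj h
         simp only [eval, mu]
         first | exact look_congr (fun c x => congrArg (fun y => Ψ c (cons y _)) (h1 x).symm) _
               | exact look_congr (fun c x => congrArg (fun y => Ψ c (cons y _)) (h2 x).symm) _
               | (congr 1; funext e k; congr 2; exact (h1 _).symm)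
               | (congr 1; funext e k; congr 2; exact (h2 _).symm))
      | cases h
  · obtain rfl := Option.some.inj h
    rfl

lemma eval_of_join_eq_none {c : Forest} (h : c.join = none) (hc : c.width ≠ 1) (a : Λ)
    {Ψ : ∀ b, (A.Hom a b).X → M} (hΨ : ∀ b, Ψ b 0 = 0) :
    eval η c a (fun e k => Ψ e (A.mu k)) = 0 := by
  unfold join at h
  split_ifs at h with hu
  have hw : 3 ≤ c.width := by
    match c, hu, h, hc with
    | .leaf _ .nil, _, _, hc => simp [width] at hc
    | .node _ .nil, _, _, hc => simp [width] at hc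
    | .leaf _ (.leaf _ .nil), hu, _, _ => simp [HasUnit] at hu
    | .leaf _ (.node .nil .nil), _, h, _ => simp at h
    | .leaf _ (.node (.leaf _ _) .nil), hu, _, _ => simp [HasUnit] at hu
    | .leaf _ (.node (.node _ _) .nil), hu, _, _ => simp [HasUnit] at hu
    | .node .nil (.leaf _ .nil), _, h, _ => simp at h
    | .node .nil (.node _ .nil), _, h, _ => simp at h
    | .node (.leaf _ _) (.leaf _ .nil), hu, _, _ => simp [HasUnit] at hu
    | .node (.node _ _) (.leaf _ .nil), hu, _, _ => simp [HasUnit] at hu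
    | .node (.leaf _ _) (.node .nil .nil), _, h, _ => simp at h
    | .node (.node _ _) (.node .nil .nil), _, h, _ => simp at h
    | .node (.leaf _ _) (.node (.leaf _ _) .nil), hu, _, _ => simp [HasUnit] at hu
    | .node (.leaf _ _) (.node (.node _ _) .nil), hu, _, _ => simp [HasUnit] at hu
    | .node (.node _ _) (.node (.leaf _ _) .nil), hu, _, _ => simp [HasUnit] at hu
    | .node (.node _ _) (.node (.node _ _) .nil), hu, _, _ => simp [HasUnit] at hu
    | .leaf _ (.leaf _ (.leaf _ _)), _, _, _ => simp [width]
    | .leaf _ (.leaf _ (.node _ _)), _, _, _ => simp [width]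
    | .leaf _ (.node _ (.leaf _ _)), _, _, _ => simp [width]
    | .leaf _ (.node _ (.node _ _)), _, _, _ => simp [width]
    | .node _ (.leaf _ (.leaf _ _)), _, _, _ => simp [width]
    | .node _ (.leaf _ (.node _ _)), _, _, _ => simp [width]
    | .node _ (.node _ (.leaf _ _)), _, _, _ => simp [width]
    | .node _ (.node _ (.node _ _)), _, _, _ => simp [width]
  refine eval_of_hasUnit hu a fun b f l l' hl => ?_
  rw [mu_of_length _ (by omega), A.m_one _ _ (by omega), hΨ]

end Join

section Subst

variable {η η' : A.Inputs} {ε : ℕ → ℤ}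
  {S : ℕ → Forest}

lemma slotLinear_eval_mu {M : Type*} [AddCommGroup M] [Module K M] (r : Forest) {a f : Λ} {Ψ : ∀ b, χ[A] a b → M}
    (hΨ : ∀ b, SlotLinear K (Ψ b)) : SlotLinear K fun k : χ[A] a f =>
      eval η r f fun b l => Ψ b (cons (A.mu k) l) :=
  ⟨fun p x y q => by
    rw [← eval_add]; congr 1; funext b l
    rw [(slotLinear_mu _ _).add, (hΨ b).cons_add],
  fun p z x q => by
    rw [← eval_smul]; congr 1; funext b l
    rw [(slotLinear_mu _ _).smul, (hΨ b).cons_smul]⟩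

/-- The trees `S j` evaluate to the inputs `η'`. -/
def EvalTo (η η' : A.Inputs) (S : ℕ → Forest) (l : List ℕ) : Prop :=
  ∀ j ∈ l, ∀ a c x, η' j = some ⟨a, c, x⟩ → ∀ {M : Type w} [Zero M]
    (Ψ : ∀ b, χ[A] a b → M), eval η (S j) a Ψ = Ψ c (cons x (nil c))

lemma eval_subst (hη : HasDeg η' ε) {G : Forest} (hG : G.Stable)
    (hS : EvalTo η η' S G.leaves) (hp : PathIn η' G.leaves a b) {H : Forest}
    (h : G.subst S = some H) {M : Type w} [Zero M] (Ψ : ∀ b, χ[A] a b → M) :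
    eval η H a Ψ = eval η' G a Ψ := by
  induction G generalizing a b H M with
  | nil => obtain rfl := Option.some.inj h; rfl
  | leaf j r ih =>
    simp only [subst, Option.map_eq_some_iff] at h
    obtain ⟨r', hr, rfl⟩ := h
    obtain ⟨c, x, hx, hp⟩ := hp
    rw [eval_append, hS j (by simp [leaves]) _ _ _ hx, eval, hx, look_some]
    exact ih hG (fun k hk => hS k (by simp [leaves, hk])) hp hr _
  | node c r ihc ih =>
    simp only [subst, Option.bind_eq_some_iff, Option.map_eq_some_iff] at h
    obtain ⟨c', hc, n, hn, r', hr, rfl⟩ := h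
    obtain ⟨e, hpc, hpr⟩ := pathIn_append.1 hp
    have hGc : c.Stable := hG.1.elim (fun h => h ▸ trivial) fun h => h.2.stable
    obtain ⟨k, -, -, Ek⟩ := exists_chain hη hGc hpc
    rw [eval_append, eval_join hn, ihc hGc (fun k hk => hS k (by simp [leaves, hk])) hpc hc, Ek,
      eval, Ek]
    exact ih hG.2 (fun k hk => hS k (by simp [leaves, hk])) hpr hr _

lemma eval_of_subst_eq_none {M : Type w} [AddCommGroup M] [Module K M] (hη : HasDeg η' ε) {G : Forest} (hG : G.Stable)
    (hS : EvalTo η η' S G.leaves) (hw : ∀ j ∈ G.leaves, (S j).width = 1)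
    (hp : PathIn η' G.leaves a b) (h : G.subst S = none) {Ψ : ∀ b, χ[A] a b → M}
    (hΨ : ∀ b, SlotLinear K (Ψ b)) : eval η' G a Ψ = 0 := by
  induction G generalizing a b with
  | nil => cases h
  | leaf j r ih =>
    simp only [subst, Option.map_eq_none_iff] at h
    obtain ⟨c, x, hx, hp⟩ := hp
    rw [eval, hx, look_some]
    exact ih hG (fun k hk => hS k (by simp [leaves, hk])) (fun k hk => hw k (by simp [leaves, hk]))
      hp h fun b => (hΨ b).cons x
  | node c r ihc ih =>
    obtain ⟨e, hpc, hpr⟩ := pathIn_append.1 hp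
    have hGc : c.Stable := hG.1.elim (fun h => h ▸ trivial) fun h => h.2.stable
    have hSc : EvalTo η η' S c.leaves := fun k hk => hS k (by simp [leaves, hk])
    have hwc : ∀ j ∈ c.leaves, (S j).width = 1 := fun k hk => hw k (by simp [leaves, hk])
    rw [eval]
    cases hc : c.subst S with
    | none => exact ihc hGc hSc hwc hpc hc fun f => slotLinear_eval_mu r hΨ
    | some c' =>
      cases hn : c'.join with
      | none =>
        rw [← eval_subst hη hGc hSc hpc hc]
        refine eval_of_join_eq_none hn ?_ a (Ψ := fun e y => eval η' r e fun b l => Ψ b (cons y l))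
          fun f => ?_
        · rw [width_subst hc hwc]
          rcases hG.1 with rfl | h
          · simp [width]
          · omega
        · refine Eq.trans ?_ (eval_zero (η := η') r f)
          congr 1; funext b l
          exact (hΨ b).cons_zero l
      | some n =>
        simp only [subst, hc, hn, Option.bind_some, Option.map_eq_none_iff] at h
        obtain ⟨k, -, -, Ek⟩ := exists_chain hη hGc hpc
        rw [Ek]
        exact ih hG.2 (fun k hk => hS k (by simp [leaves, hk]))
          (fun k hk => hw k (by simp [leaves, hk])) hpr h fun b => (hΨ b).cons _

end Subst

section Linear

variable {M : Type*} [AddCommGroup M] [Module K M]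

/-- Linearity in the `j`-th input. -/
structure LinAt (j : ℕ) (g : A.Inputs → M) : Prop where
  add : ∀ (η : A.Inputs) (a b : Λ) (x y : (A.Hom a b).X),
    g (Function.update η j (some ⟨a, b, x + y⟩)) =
      g (Function.update η j (some ⟨a, b, x⟩)) + g (Function.update η j (some ⟨a, b, y⟩))
  smul : ∀ (η : A.Inputs) (a b : Λ) (z : K) (x : (A.Hom a b).X),
    g (Function.update η j (some ⟨a, b, z • x⟩)) =
      z • g (Function.update η j (some ⟨a, b, x⟩))

lemma eval_update_of_not_mem (η : A.Inputs) {F : Forest} {j : ℕ} (hj : j ∉ F.leaves) (s)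
    (Ψ : ∀ b, χ[A] a b → M) :
    eval (Function.update η j s) F a Ψ = eval η F a Ψ :=
  eval_congr_inputs (fun i hi => Function.update_of_ne (fun h : i = j => hj (h ▸ hi)) _ _) a Ψ

lemma look_smul (z : K) (Ψ : ∀ b, (A.Hom a b).X → M) (s) :
    look a (fun b x => z • Ψ b x) s = z • look a Ψ s :=
  (map_look (fun x : M => z • x) (smul_zero z) Ψ s).symm

lemma look_linear (Ψ : ∀ b, (A.Hom a b).X → M) (hadd : ∀ b x y, Ψ b (x + y) = Ψ b x + Ψ b y)
    (hsmul : ∀ b (z : K) x, Ψ b (z • x) = z • Ψ b x) (a' b : Λ) :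
    (∀ x y : (A.Hom a' b).X, look a Ψ (some ⟨a', b, x + y⟩) =
      look a Ψ (some ⟨a', b, x⟩) + look a Ψ (some ⟨a', b, y⟩)) ∧
    ∀ (z : K) (x : (A.Hom a' b).X), look a Ψ (some ⟨a', b, z • x⟩) =
      z • look a Ψ (some ⟨a', b, x⟩) := by
  by_cases h : a' = a
  · subst h; simp [hadd, hsmul]
  · simp [look, h]

lemma linAt_eval {F : Forest} (hF : F.leaves.Nodup) {j : ℕ} (hj : j ∈ F.leaves)
    {Ψ : ∀ b, χ[A] a b → M} (hΨ : ∀ b, SlotLinear K (Ψ b)) :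
    LinAt j fun η => eval η F a Ψ := by
  induction F generalizing a with
  | nil => simp [leaves] at hj
  | leaf i r ih =>
    simp only [leaves, List.nodup_cons] at hF
    by_cases hij : j = i
    · subst hij
      have h : ∀ (η : A.Inputs) s, eval (Function.update η j s) (.leaf j r) a Ψ =
          look a (fun c x => eval η r c fun b l => Ψ b (cons x l)) s := fun η s => by
        rw [eval, Function.update_self]
        exact look_congr (fun c x => eval_update_of_not_mem η hF.1 _ _) _
      have h' := fun η : A.Inputs => look_linear (A := A) (a := a)
        (fun c x => eval η r c fun b l => Ψ b (cons x l))
        (fun c x y => by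
          rw [← eval_add]; congr 1; funext b l; exact (hΨ b).cons_add x y l)
        (fun c z x => by
          rw [← eval_smul]; congr 1; funext b l; exact (hΨ b).cons_smul z x l)
      exact ⟨fun η a' b x y => by rw [h, h, h]; exact (h' η a' b).1 x y,
        fun η a' b z x => by rw [h, h]; exact (h' η a' b).2 z x⟩
    · have hjr : j ∈ r.leaves := by simpa [leaves, hij] using hj
      have IH := fun c (x : (A.Hom a c).X) => ih hF.2 hjr fun b => (hΨ b).cons x
      refine ⟨fun η a' b x y => ?_, fun η a' b z x => ?_⟩
      · simp only [eval, Function.update_of_ne (Ne.symm hij)]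
        rw [← look_add]
        exact look_congr (fun c u => (IH c u).add η a' b x y) _
      · simp only [eval, Function.update_of_ne (Ne.symm hij)]
        rw [← look_smul]
        exact look_congr (fun c u => (IH c u).smul η a' b z x) _
  | node c r ihc ih =>
    have hdis := List.disjoint_of_nodup_append hF
    simp only [leaves, List.mem_append] at hj
    by_cases hjc : j ∈ c.leaves
    · have h : ∀ (η : A.Inputs) s, eval (Function.update η j s) (.node c r) a Ψ =
          eval (Function.update η j s) c a fun e k => eval η r e fun b l =>
            Ψ b (cons (A.mu k) l) := fun η s => by
        rw [eval]; congr 1; funext e k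
        exact eval_update_of_not_mem η (fun h => hdis hjc h) _ _
      have IH := fun η : A.Inputs => ihc hF.of_append_left hjc
        fun f => slotLinear_eval_mu (η := η) r (f := f) hΨ
      exact ⟨fun η a' b x y => by rw [h, h, h]; exact (IH η).add η a' b x y,
        fun η a' b z x => by rw [h, h]; exact (IH η).smul η a' b z x⟩
    · have hjr : j ∈ r.leaves := hj.resolve_left hjc
      have IH := fun e (y : (A.Hom a e).X) => ih hF.of_append_right hjr fun b => (hΨ b).cons y
      refine ⟨fun η a' b x y => ?_, fun η a' b z x => ?_⟩
      · simp only [eval, eval_update_of_not_mem η hjc]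
        rw [← eval_add]
        congr 1; funext e k
        exact (IH e _).add η a' b x y
      · simp only [eval, eval_update_of_not_mem η hjc]
        rw [← eval_smul]
        congr 1; funext e k
        exact (IH e _).smul η a' b z x

end Linear

end AInfCat

/-! ## Iterated tensor products -/

inductive Tup (M : Λ → Λ → Cx.{u,w} K) :
    DPlus.Obj Λ → Type (max v w)
  | nil : Tup M []
  | cons {p : Λ × Λ} {α : DPlus.Obj Λ} (x : (M p.1 p.2).X) (l : Tup M α) : Tup M (p :: α)

namespace Tup

variable {M M' : Λ → Λ → Cx.{u,w} K} {α β : DPlus.Obj Λ}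

def append : ∀ {α : DPlus.Obj Λ}, Tup M α → Tup M β → Tup M (α ++ β)
  | _, nil, m => m
  | _, cons x l, m => cons x (l.append m)

/-- The entry at `i` is homogeneous of degree `ε i`. -/
def HasDeg : ∀ {α : DPlus.Obj Λ}, Tup M α → (ℕ → ℤ) → Prop
  | _, nil, _ => True
  | _, @cons _ _ _ _ p _ x l, ε => x ∈ (M p.1 p.2).grade (ε 0) ∧ l.HasDeg fun i => ε (i + 1)

def dAt : ∀ {α : DPlus.Obj Λ}, ℕ → Tup M α → Tup M α
  | _, _, nil => nil
  | _, 0, cons x l => cons ((M _ _).d x) l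
  | _, j + 1, cons x l => cons x (l.dAt j)

/-- The tuple given by a function of the index and the pair of objects. -/
def ofFun (f : ℕ → ∀ p : Λ × Λ, (M p.1 p.2).X) : ∀ α : DPlus.Obj Λ, Tup M α
  | [] => nil
  | p :: α => cons (f 0 p) (ofFun (fun j => f (j + 1)) α)

def entries : ∀ {α : DPlus.Obj Λ}, Tup M α → ℕ → Option (Σ a b : Λ, (M a b).X)
  | _, nil, _ => none
  | _, @cons _ _ _ _ p _ x _, 0 => some ⟨p.1, p.2, x⟩
  | _, cons _ l, i + 1 => l.entries i

/-- Multilinear functions of tuples. -/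
def IsML {N : Type*} [AddCommGroup N] [Module K N] :
    ∀ {α : DPlus.Obj Λ}, (Tup M α → N) → Prop
  | [], _ => True
  | p :: _, f => (∀ (x y : (M p.1 p.2).X) l, f (cons (x + y) l) = f (cons x l) + f (cons y l)) ∧
      (∀ (z : K) (x : (M p.1 p.2).X) l, f (cons (z • x) l) = z • f (cons x l)) ∧
        ∀ x, IsML fun l => f (cons x l)

lemma HasDeg.congr : ∀ {α : DPlus.Obj Λ} {l : Tup M α} {ε ε' : ℕ → ℤ}, l.HasDeg ε →
    (∀ i < α.length, ε i = ε' i) → l.HasDeg ε'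
  | _, nil, _, _, _, _ => trivial
  | _, cons _ _, _, _, h, h' =>
    ⟨h' 0 (by simp) ▸ h.1, HasDeg.congr h.2 fun i hi => h' (i + 1) (by simpa using hi)⟩

lemma HasDeg.dAt : ∀ {α : DPlus.Obj Λ} {l : Tup M α} {ε : ℕ → ℤ} (_ : l.HasDeg ε)
    (j : ℕ), (l.dAt j).HasDeg fun i => if i = j then ε i - 1 else ε i
  | _, nil, _, _, j => by cases j <;> trivial
  | _, cons x l, _, h, 0 => ⟨(M _ _).d_mem h.1, h.2⟩
  | _, cons x l, _, h, j + 1 => ⟨h.1, (HasDeg.dAt h.2 j).congr fun i _ => by simp⟩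

lemma HasDeg.append : ∀ {α : DPlus.Obj Λ} {l : Tup M α} {m : Tup M β} {ε ε' : ℕ → ℤ}
    (_ : l.HasDeg ε) (_ : m.HasDeg ε'),
      (l.append m).HasDeg fun i => if i < α.length then ε i else ε' (i - α.length)
  | _, nil, _, _, _, _, h' => h'
  | _, cons x l, m, ε, ε', h, h' => ⟨by simpa using h.1, by
      refine (HasDeg.append h.2 h').congr fun i _ => ?_
      simp⟩

lemma entries_append : ∀ {α : DPlus.Obj Λ} (l : Tup M α) (m : Tup M β) (i : ℕ),
    (l.append m).entries i = if i < α.length then l.entries i else m.entries (i - α.length)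
  | _, nil, _, _ => by simp [append]
  | _, cons x l, m, 0 => by simp [append, entries]
  | _, cons x l, m, i + 1 => by simpa [append, entries] using entries_append l m i

lemma entries_of_getElem? : ∀ {α : DPlus.Obj Λ} (l : Tup M α) {i : ℕ} {p : Λ × Λ},
    α[i]? = some p → ∃ x, l.entries i = some ⟨p.1, p.2, x⟩
  | _, cons x l, 0, p, h => by
    simp only [List.getElem?_cons_zero, Option.some.injEq] at h
    subst h; exact ⟨x, rfl⟩
  | _, cons x l, i + 1, p, h => entries_of_getElem? l (by simpa using h)

lemma entries_of_le : ∀ {α : DPlus.Obj Λ} (l : Tup M α) {i : ℕ}, α.length ≤ i →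
    l.entries i = none
  | _, nil, _, _ => rfl
  | _, cons x l, i + 1, h => entries_of_le l (by simpa using h)

lemma entries_ofFun : ∀ (f : ℕ → ∀ p : Λ × Λ, (M p.1 p.2).X) (α : DPlus.Obj Λ) (i : ℕ),
    (ofFun f α).entries i = (α[i]?).map fun p => ⟨p.1, p.2, f i p⟩
  | _, [], _ => rfl
  | f, p :: α, 0 => rfl
  | f, p :: α, i + 1 => by
    simpa [ofFun, entries] using entries_ofFun (fun j => f (j + 1)) α i

lemma ext_entries : ∀ {α : DPlus.Obj Λ} {l m : Tup M α}, (∀ i, l.entries i = m.entries i) → l = m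
  | _, nil, nil, _ => rfl
  | _, cons x l, cons y m, h => by
    have h0 := h 0
    simp only [entries, Option.some.injEq, Sigma.mk.injEq, heq_eq_eq, true_and] at h0
    rw [h0, ext_entries fun i => h (i + 1)]

lemma HasDeg.entries : ∀ {α : DPlus.Obj Λ} {l : Tup M α} {ε : ℕ → ℤ} (_ : l.HasDeg ε) (i : ℕ)
    (a b : Λ) (x : (M a b).X), l.entries i = some ⟨a, b, x⟩ → x ∈ (M a b).grade (ε i)
  | _, nil, _, _, _, _, _, _, h => by cases h
  | _, cons x l, _, h, 0, a, b, y, h' => by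
    simp only [Tup.entries, Option.some.injEq] at h'
    cases h'; exact h.1
  | _, cons x l, _, h, i + 1, a, b, y, h' => HasDeg.entries h.2 i a b y h'

lemma hasDeg_ofFun (f : ℕ → ∀ p : Λ × Λ, (M p.1 p.2).X) (α : DPlus.Obj Λ) {ε : ℕ → ℤ}
    (h : ∀ i p, α[i]? = some p → f i p ∈ (M p.1 p.2).grade (ε i)) : (ofFun f α).HasDeg ε := by
  induction α generalizing f ε with
  | nil => trivial
  | cons p α ih => exact ⟨h 0 p (by simp), ih _ fun i p hp => h (i + 1) p (by simpa using hp)⟩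

lemma entries_dAt : ∀ {α : DPlus.Obj Λ} (l : Tup M α) (j i : ℕ), (l.dAt j).entries i =
    if i = j then (l.entries i).map fun s => ⟨s.1, s.2.1, (M _ _).d s.2.2⟩ else l.entries i
  | _, nil, 0, _ => by simp [dAt, entries]
  | _, nil, j + 1, _ => by simp [dAt, entries]
  | _, cons x l, 0, 0 => rfl
  | _, cons x l, 0, i + 1 => rfl
  | _, cons x l, j + 1, 0 => rfl
  | _, cons x l, j + 1, i + 1 => by simpa [dAt, entries] using entries_dAt l j i

end Tup

section Tens

variable [CharZero K]

def tens (M : Λ → Λ → Cx.{u,max u w} K) : DPlus.Obj Λ → Cx.{u,max u w} K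
  | [] => Cx.unitCx.{u,w} K
  | p :: α => (M p.1 p.2).tensor (tens M α)

variable {M M' : Λ → Λ → Cx.{u,max u w} K} {p : Λ × Λ} {α β γ : DPlus.Obj Λ} {N : Type*}
  [AddCommGroup N] [Module K N]

def tunit : (tens.{u,v,w} M []).X := ULift.up.{w} (1 : K)

def tcons :
    (M p.1 p.2).X →ₗ[K] (tens.{u,v,w} M α).X →ₗ[K] (tens.{u,v,w} M (p :: α)).X :=
  TensorProduct.mk K (M p.1 p.2).X (tens.{u,v,w} M α).X

def nlift (n : N) : (tens.{u,v,w} M []).X →ₗ[K] N :=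
  LinearMap.toSpanSingleton K N n ∘ₗ (ULift.moduleEquiv.{u, u, w} (R := K) (M := K)).toLinearMap

def tlift (f : (M p.1 p.2).X →ₗ[K] (tens.{u,v,w} M α).X →ₗ[K] N) :
    (tens.{u,v,w} M (p :: α)).X →ₗ[K] N := TensorProduct.lift f

@[simp] lemma nlift_tunit (n : N) : nlift (M := M) n tunit = n := one_smul K n

@[simp] lemma tlift_tcons (f : (M p.1 p.2).X →ₗ[K] (tens.{u,v,w} M α).X →ₗ[K] N) (x t) :
    tlift f (tcons x t) = f x t := TensorProduct.lift.tmul x t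

lemma tens_nil (z : (tens.{u,v,w} M []).X) :
    z = (ULift.down (show ULift.{w} K from z)) • tunit :=
  ULift.ext _ _ (mul_one (ULift.down (show ULift.{w} K from z))).symm

lemma tens_induction {P : (tens.{u,v,w} M (p :: α)).X → Prop} (h : ∀ x t, P (tcons x t))
    (hadd : ∀ x y, P x → P y → P (x + y)) (z) : P z :=
  TensorProduct.induction_on (motive := P) z
    (by have := h 0 0; rwa [map_zero] at this) h fun x y hx hy => hadd x y hx hy

lemma tens_nil_ext {f g : (tens.{u,v,w} M []).X →ₗ[K] N} (h : f tunit = g tunit) : f = g :=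
  LinearMap.ext fun z => by rw [tens_nil z, map_smul, map_smul, h]

lemma tens_cons_ext {f g : (tens.{u,v,w} M (p :: α)).X →ₗ[K] N}
    (h : ∀ x t, f (tcons x t) = g (tcons x t)) : f = g :=
  LinearMap.ext fun z => tens_induction (P := fun z => f z = g z) h
    (fun x y hx hy => by rw [map_add, map_add, hx, hy]) z

lemma d_tunit : (tens.{u,v,w} M []).d tunit = 0 := rfl

lemma tunit_mem : (tunit : (tens.{u,v,w} M []).X) ∈ (tens.{u,v,w} M []).grade 0 := by
  change (ULift.up.{w} (1 : K)) ∈ (if (0 : ℤ) = 0 then (⊤ : Submodule K (ULift.{w} K)) else ⊥)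
  rw [if_pos rfl]; trivial

lemma d_tcons (x : (M p.1 p.2).X) (t : (tens.{u,v,w} M α).X) :
    (tens M (p :: α)).d (tcons x t) =
      tcons ((M p.1 p.2).d x) t + tcons ((M p.1 p.2).sgn x) ((tens M α).d t) := rfl

lemma sgn_tcons (x : (M p.1 p.2).X) (t : (tens.{u,v,w} M α).X) :
    (tens M (p :: α)).sgn (tcons x t) = tcons ((M p.1 p.2).sgn x) ((tens M α).sgn t) :=
  Cx.sgn_tensor_tmul _ _ x t

lemma tcons_mem {i j : ℤ} {x : (M p.1 p.2).X} {t : (tens.{u,v,w} M α).X}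
    (hx : x ∈ (M p.1 p.2).grade i) (ht : t ∈ (tens M α).grade j) :
    tcons x t ∈ (tens M (p :: α)).grade (i + j) := Cx.tmul_mem_tensorGrade hx ht

/-- The tensor product of the entries of a tuple. -/
def Tup.prod : ∀ {α : DPlus.Obj Λ}, Tup M α → (tens.{u,v,w} M α).X
  | _, nil => tunit
  | _, cons x l => tcons x l.prod

lemma tens_hom_ext {α : DPlus.Obj Λ} {f g : (tens.{u,v,w} M α).X →ₗ[K] N}
    (h : ∀ (l : Tup M α) ε, l.HasDeg ε → f l.prod = g l.prod) : f = g := by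
  induction α with
  | nil => exact tens_nil_ext (h .nil (fun _ => 0) trivial)
  | cons p α ih =>
    refine tens_cons_ext fun x t => ?_
    induction x using (M p.1 p.2).homogeneous_induction with
    | mem n x hx =>
      exact LinearMap.congr_fun (ih (f := f ∘ₗ tcons x) (g := g ∘ₗ tcons x) fun l ε hl =>
        h (.cons x l) (fun i => Nat.casesOn i n ε) ⟨hx, hl⟩) t
    | add x y hx hy => simp only [map_add, LinearMap.add_apply, hx, hy]

lemma sum_map_range_succ {R : Type*} [AddCommMonoid R] (f : ℕ → R) (n : ℕ) :
    ((List.range (n + 1)).map f).sum = f 0 + ((List.range n).map fun i => f (i + 1)).sum := by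
  rw [List.range_succ_eq_map, List.map_cons, List.sum_cons, List.map_map]; rfl

lemma Tup.prod_mem {α : DPlus.Obj Λ} {l : Tup M α} {ε : ℕ → ℤ} (h : l.HasDeg ε) :
    l.prod ∈ (tens.{u,v,w} M α).grade ((List.range α.length).map ε).sum := by
  induction l generalizing ε with
  | nil => exact tunit_mem
  | cons x l ih =>
    rw [List.length_cons, sum_map_range_succ]
    exact tcons_mem h.1 (ih h.2)

lemma tens_grade_le {α : DPlus.Obj Λ} {n : ℤ} {S : Submodule K (tens.{u,v,w} M α).X}
    (h : ∀ (l : Tup M α) ε, l.HasDeg ε → ((List.range α.length).map ε).sum = n → l.prod ∈ S) :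
    (tens M α).grade n ≤ S := by
  induction α generalizing n with
  | nil =>
    intro z (hz : z ∈ if n = 0 then (⊤ : Submodule K (ULift.{w} K)) else ⊥)
    by_cases hn : n = 0
    · rw [tens_nil z]
      exact S.smul_mem _ (h .nil (fun _ => 0) trivial hn.symm)
    · rw [if_neg hn] at hz
      have : z = 0 := (Submodule.mem_bot (M := ULift.{w} K) K).1 hz
      rw [this]; exact S.zero_mem
  | cons p α ih =>
    refine Cx.tensorGrade_le fun i j hij x hx t ht => ?_
    refine ih (S := S.comap (tcons x)) (fun l ε hl hε => ?_) ht
    refine h (.cons x l) (fun k => Nat.casesOn k i ε) ⟨hx, hl⟩ ?_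
    rw [List.length_cons, sum_map_range_succ, ← hij, ← hε]; rfl

lemma AInfCat.posSum_map (δ : ℕ → ZMod 2) (f : ℕ → ℕ) (l : List ℕ)
    (g : ℕ → N) : AInfCat.posSum (K := K) δ (l.map f) g =
      AInfCat.posSum (K := K) (fun i => δ (f i)) l fun i => g (f i) := by
  induction l <;> grind [List.map_cons, AInfCat.posSum]

lemma Tup.d_prod {α : DPlus.Obj Λ} {l : Tup M α} {ε : ℕ → ℤ} (h : l.HasDeg ε) :
    (tens.{u,v,w} M α).d l.prod = AInfCat.posSum (K := K) π[ε]
      (List.range α.length) fun j => (l.dAt j).prod := by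
  induction l generalizing ε with
  | nil => rfl
  | cons x l ih =>
    rw [List.length_cons, List.range_succ_eq_map, AInfCat.posSum, AInfCat.posSum_map, prod, d_tcons,
      Cx.sgn_eq_zsign _ h.1, ih h.2, map_smul, LinearMap.smul_apply]
    congr 2
    generalize List.range _ = L
    induction L with
    | nil => exact map_zero _
    | cons j L ih' =>
      rw [AInfCat.posSum, AInfCat.posSum, map_add, map_smul, ih']; rfl

def tmulAux : ∀ α β : DPlus.Obj Λ, (tens.{u,v,w} M α).X →ₗ[K]
    (tens.{u,v,w} M β).X →ₗ[K] (tens.{u,v,w} M (α ++ β)).X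
  | [], _ => nlift LinearMap.id
  | p :: α, β => tlift (LinearMap.mk₂ K (fun x t => (tcons (α := α ++ β) x).comp (tmulAux α β t))
      (fun x y t => by ext; simp) (fun z x t => by ext; simp)
      (fun x t s => by ext; simp) (fun z x t => by ext; simp))

abbrev tmul : (tens.{u,v,w} M α).X →ₗ[K] (tens.{u,v,w} M β).X →ₗ[K]
    (tens.{u,v,w} M (α ++ β)).X := tmulAux α β

lemma tmul_tunit (t : (tens.{u,v,w} M β).X) : tmul tunit t = t := by
  exact LinearMap.congr_fun (nlift_tunit (M := M) LinearMap.id) t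

lemma tmul_tcons (x : (M p.1 p.2).X) (s : (tens.{u,v,w} M α).X) (t : (tens.{u,v,w} M β).X) :
    tmul (tcons x s) t = tcons x (tmul s t) := rfl

lemma Tup.prod_append (l : Tup M α) (m : Tup M β) :
    (l.append m).prod = tmul l.prod (m.prod : (tens.{u,v,w} M β).X) := by
  induction l with
  | nil => exact (tmul_tunit _).symm
  | cons x l ih => rw [append, prod, ih, prod, tmul_tcons]

lemma tmul_mem {i j : ℤ} {s : (tens.{u,v,w} M α).X} {t : (tens.{u,v,w} M β).X}
    (hs : s ∈ (tens M α).grade i) (ht : t ∈ (tens M β).grade j) :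
    tmul s t ∈ (tens M (α ++ β)).grade (i + j) := by
  induction α generalizing i with
  | nil =>
    have : (tens.{u,v,w} M []).grade i ≤
        ((tens M β).grade (i + j)).comap ((tmulAux [] β).flip t) := by
      refine tens_grade_le fun l ε _ h => ?_
      cases l
      obtain rfl : 0 = i := h
      have : tmul tunit t ∈ (tens M β).grade (0 + j) := by rwa [tmul_tunit, zero_add]
      exact this
    exact this hs
  | cons p α ih =>
    have : (tens.{u,v,w} M (p :: α)).grade i ≤
        ((tens M (p :: (α ++ β))).grade (i + j)).comap ((tmulAux (p :: α) β).flip t) := by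
      refine Cx.tensorGrade_le fun i' k hik x hx s hs => ?_
      have : tmul (tcons x s) t ∈ (tens M (p :: (α ++ β))).grade (i + j) := by
        rw [tmul_tcons, ← hik, add_assoc]
        exact tcons_mem hx (ih hs)
      exact this
    exact this hs

lemma d_tmul (s : (tens.{u,v,w} M α).X) (t : (tens.{u,v,w} M β).X) :
    (tens M (α ++ β)).d (tmul s t) =
      tmul ((tens M α).d s) t + tmul ((tens M α).sgn s) ((tens M β).d t) := by
  induction α with
  | nil =>
    rw [tens_nil s]
    have h : (tens.{u,v,w} M []).sgn tunit = tunit := by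
      rw [Cx.sgn_eq_zsign _ tunit_mem]; simp
    simp only [map_smul, LinearMap.smul_apply, d_tunit, h, map_zero, LinearMap.zero_apply,
      smul_zero, zero_add]
    congr 1
    exact (congrArg _ (tmul_tunit t)).trans (tmul_tunit _).symm
  | cons p α ih =>
    induction s using tens_induction with
    | h x s =>
      rw [tmul_tcons, d_tcons, sgn_tcons, tmul_tcons, map_add, LinearMap.add_apply, tmul_tcons,
        tmul_tcons, add_assoc, ← map_add, ← ih]
      exact d_tcons _ _
    | hadd x y hx hy =>
      simp only [map_add, LinearMap.add_apply]
      exact ((congrArg₂ (· + ·) hx hy).trans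
        (add_add_add_comm _ _ _ _))

lemma heq_add (h : α = β) {x y : (tens.{u,v,w} M α).X} {x' y' : (tens.{u,v,w} M β).X}
    (hx : HEq x x') (hy : HEq y y') : HEq (x + y) (x' + y') := by
  subst h; rw [eq_of_heq hx, eq_of_heq hy]

lemma heq_tcons (h : α = β) (x : (M p.1 p.2).X) {s : (tens.{u,v,w} M α).X}
    {t : (tens.{u,v,w} M β).X} (hs : HEq s t) : HEq (tcons x s) (tcons x t) := by
  subst h; rw [eq_of_heq hs]

lemma tmul_assoc (r : (tens.{u,v,w} M α).X) (s : (tens.{u,v,w} M β).X)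
    (t : (tens.{u,v,w} M γ).X) : HEq (tmul (tmul r s) t) (tmul r (tmul s t)) := by
  induction α with
  | nil =>
    rw [tens_nil r]
    simp only [map_smul, LinearMap.smul_apply]
    refine heq_of_eq (congrArg _ ?_)
    exact (congrArg (fun s => tmul s t) (tmul_tunit s)).trans (tmul_tunit (tmul s t)).symm
  | cons p α ih =>
    induction r using tens_induction with
    | h x r =>
      rw [tmul_tcons, tmul_tcons]
      refine HEq.trans (heq_of_eq (tmul_tcons _ _ _)) ?_
      exact heq_tcons (List.append_assoc α β γ) x (ih r)
    | hadd x y hx hy =>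
      simp only [map_add, LinearMap.add_apply]
      exact heq_add (List.append_assoc (p :: α) β γ) hx hy

lemma tmul_tunit_right (s : (tens.{u,v,w} M α).X) :
    HEq (tmul s (tunit : (tens.{u,v,w} M []).X)) s := by
  induction α with
  | nil =>
    rw [tens_nil s]
    simp only [map_smul, LinearMap.smul_apply]
    exact heq_of_eq (congrArg _ (tmul_tunit _))
  | cons p α ih =>
    induction s using tens_induction with
    | h x s =>
      rw [tmul_tcons]
      exact heq_tcons (List.append_nil α) x (ih s)
    | hadd x y hx hy =>
      simp only [map_add, LinearMap.add_apply]
      exact heq_add (List.append_nil (p :: α)) hx hy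

lemma bijective_lift_tmul (α β : DPlus.Obj Λ) :
    Function.Bijective (TensorProduct.lift (tmul (M := M) (α := α) (β := β))) := by
  induction α with
  | nil =>
    let e : (tens.{u,v,w} M []).X ⊗[K] (tens.{u,v,w} M β).X ≃ₗ[K] (tens.{u,v,w} M β).X :=
      (TensorProduct.congr (ULift.moduleEquiv.{u, u, w} (R := K) (M := K))
        (LinearEquiv.refl K _)).trans (TensorProduct.lid K _)
    have h : TensorProduct.lift (tmul (M := M) (α := []) (β := β)) = e.toLinearMap := by
      refine TensorProduct.ext' fun s t => ?_
      rw [tens_nil s]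
      rfl
    rw [h]
    exact e.bijective
  | cons p α ih =>
    let e := (TensorProduct.assoc K (M p.1 p.2).X (tens.{u,v,w} M α).X
      (tens.{u,v,w} M β).X).trans
        (LinearEquiv.lTensor (M p.1 p.2).X (LinearEquiv.ofBijective _ ih))
    have h : ∀ z, TensorProduct.lift (tmul (M := M) (α := p :: α) (β := β)) z = e z := by
      intro z
      induction z with
      | zero => exact (map_zero (TensorProduct.lift tmul)).trans (map_zero e).symm
      | tmul s t =>
        induction s using tens_induction with
        | h x s => exact tmul_tcons x s t
        | hadd x y hx hy =>
          rw [TensorProduct.add_tmul, map_add]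
          exact (congrArg₂ (· + ·) hx hy).trans (map_add e _ _).symm
      | add x y hx hy => rw [map_add, hx, hy]; exact (map_add e x y).symm
    exact (funext h : _ = ⇑e) ▸ e.bijective

end Tens

namespace Forest

lemma tree_append_zero {T : Forest} (h : T.width = 1) (r : Forest) : (T.append r).tree 0 = T := by grind [tree, roots_append_of_width]

lemma tree_append_succ {T : Forest} (h : T.width = 1) (r : Forest) (j : ℕ) :
    (T.append r).tree (j + 1) = r.tree j := by grind [tree, roots_append_of_width]

lemma tree_induction {P : Forest → Prop} (nil : P .nil)
    (append : ∀ T r : Forest, T.width = 1 → P r → P (T.append r)) (F : Forest) : P F := by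
  induction F with
  | nil => exact nil
  | leaf i r ih => exact append (leaf i .nil) r rfl ih
  | node c r _ ih => exact append (node c .nil) r rfl ih

lemma stable_induction {P : Forest → Prop} (nil : P .nil)
    (append : ∀ T r : Forest, T.width = 1 → T.Stable → r.Stable → P r → P (T.append r))
    (F : Forest) (hF : F.Stable) : P F := by
  induction F with
  | nil => exact nil
  | leaf i r ih => exact append (leaf i .nil) r rfl trivial hF (ih hF)
  | node c r _ ih => exact append (node c .nil) r rfl ⟨hF.1, trivial⟩ hF.2 (ih hF.2)

lemma shuf_congr {δ δ' : ℕ → ZMod 2} {F : Forest} (h : ∀ j ∈ F.leaves, δ j = δ' j) :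
    F.shuf δ = F.shuf δ' := by
  induction F with
  | nil => rfl
  | leaf j r ih =>
    rw [shuf, shuf, h j (by simp [leaves]), ih fun k hk => h k (by simp [leaves, hk])]
  | node c r ihc ih =>
    have hc : ∀ k ∈ c.leaves, δ k = δ' k := fun k hk => h k (by simp [leaves, hk])
    rw [shuf, shuf, ihc hc, ih fun k hk => h k (by simp [leaves, hk]), leafSum, leafSum,
      List.map_congr_left hc]

lemma sg_congr {δ δ' : ℕ → ZMod 2} {F : Forest} (h : ∀ j ∈ F.leaves, δ j = δ' j) :
    F.sg δ = F.sg δ' := by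
  have hi : ∀ l : List ℕ, (∀ j ∈ l, δ j = δ' j) → inv δ l = inv δ' l := fun l => by
    induction l with
    | nil => exact fun _ => rfl
    | cons j l ih =>
      intro h
      simp only [List.mem_cons, forall_eq_or_imp] at h
      rw [inv, inv, List.pairSum, List.pairSum, h.1]
      congr 1
      · refine congrArg _ (List.map_congr_left fun k hk => ?_)
        rw [h.2 k hk]
      · exact ih h.2
  rw [sg, sg, shuf_congr h, hi _ h]

end Forest

section Parity

variable [CharZero K]

/-- The projection to the even or to the odd part. -/
def Cx.parity (V : Cx.{u,w} K) (e : ZMod 2) : V.X →ₗ[K] V.X :=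
  (2⁻¹ : K) • (LinearMap.id + zsign K e • V.sgn)

lemma Cx.parity_of_mem (V : Cx.{u,w} K) (e : ZMod 2) {n : ℤ} {x : V.X} (hx : x ∈ V.grade n) :
    V.parity e x = if (n : ZMod 2) = e then x else 0 := by
  have : V.parity e x = (2⁻¹ * (1 + zsign K (e + n)) : K) • x := by
    simp only [parity, LinearMap.smul_apply, LinearMap.add_apply, LinearMap.id_apply,
      V.sgn_eq_zsign hx, zsign_add]
    module
  rw [this]
  generalize (n : ZMod 2) = m
  split_ifs with h
  · rw [h, CharTwo.add_self_eq_zero, zsign_zero, one_add_one_eq_two,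
      inv_mul_cancel₀ two_ne_zero, one_smul]
  · have : ∀ e m : ZMod 2, ¬m = e → e + m = 1 := by decide
    rw [this e m h, zsign_one]; simp

variable {M : Λ → Λ → Cx.{u,max u w} K} {N : Type*} [AddCommGroup N] [Module K N]

/-- A family of multilinear functions depending on the parities of the entries gives a linear map. -/
lemma exists_linear_of_parity {α : DPlus.Obj Λ} (g : (ℕ → ZMod 2) → Tup M α → N)
    (hg : ∀ δ, Tup.IsML (g δ))
    (hc : ∀ δ δ' l, (∀ i < α.length, δ i = δ' i) → g δ l = g δ' l) :
    ∃ f : (tens.{u,v,w} M α).X →ₗ[K] N, ∀ l ε, l.HasDeg ε →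
      f l.prod = g π[ε] l := by
  induction α with
  | nil =>
    refine ⟨nlift (g 0 .nil), fun l ε _ => ?_⟩
    cases l
    exact (nlift_tunit _).trans (hc _ _ _ fun i hi => absurd hi (by simp))
  | cons p α ih =>
    have h : ∀ (e : ZMod 2) (x : (M p.1 p.2).X), ∃ f : (tens.{u,v,w} M α).X →ₗ[K] N,
        ∀ l ε, l.HasDeg ε →
          f l.prod = g (fun i => Nat.casesOn i e π[ε]) (.cons x l) := by
      intro e x
      refine ih (fun δ l => g (fun i => Nat.casesOn i e δ) (.cons x l))
        (fun δ => (hg _).2.2 x) fun δ δ' l h => hc _ _ _ fun i hi => ?_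
      cases i with
      | zero => rfl
      | succ i => exact h i (by simpa using hi)
    choose f hf using h
    let L : ZMod 2 → (M p.1 p.2).X →ₗ[K] (tens.{u,v,w} M α).X →ₗ[K] N := fun e =>
      { toFun := f e
        map_add' := fun x y => tens_hom_ext fun l ε hl => by
          rw [LinearMap.add_apply, hf e _ l ε hl, hf e _ l ε hl, hf e _ l ε hl, (hg _).1]
        map_smul' := fun z x => tens_hom_ext fun l ε hl => by
          rw [RingHom.id_apply, LinearMap.smul_apply, hf e _ l ε hl, hf e _ l ε hl, (hg _).2.1] }
    refine ⟨tlift (∑ e : ZMod 2, L e ∘ₗ (M p.1 p.2).parity e), fun l ε hl => ?_⟩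
    cases l with
    | cons x l =>
      rw [Tup.prod, tlift_tcons, LinearMap.sum_apply, LinearMap.sum_apply,
        Finset.sum_eq_single (ε 0 : ZMod 2)]
      · rw [LinearMap.comp_apply, Cx.parity_of_mem _ _ hl.1, if_pos rfl]
        refine (hf _ x l _ hl.2).trans (hc _ _ _ fun i _ => ?_)
        cases i <;> rfl
      · intro e _ he
        rw [LinearMap.comp_apply, Cx.parity_of_mem _ _ hl.1, if_neg he.symm, map_zero]; rfl
      · simp

end Parity

namespace AInfCat

open Chain Forest

section Trees

variable {A : AInfCat.{u,v,w} K Λ} {η η' : A.Inputs} {ε : ℕ → ℤ} {F : Forest}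
  {α β : DPlus.Obj Λ} {a q : Λ}

/-- The entry of a sequence of length one that ends at `q`. -/
def extract (q : Λ) : ∀ b, χ[A] a b → (A.Hom a q).X
  | b, .cons x (.nil _) => open Classical in if h : b = q then h ▸ x else 0
  | _, .nil _ => 0
  | _, .cons _ (.cons _ _) => 0

lemma extract_single (x : (A.Hom a q).X) : extract q q (cons x (nil q)) = x := by
  simp [extract]

lemma slotLinear_extract (b : Λ) : SlotLinear K (extract (A := A) (a := a) q b) := by
  refine ⟨fun l x y l' => ?_, fun l k x l' => ?_⟩
  all_goals
    rcases l with _ | ⟨y, _ | ⟨z, l⟩⟩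
    · rcases l' with _ | ⟨y, l'⟩
      · by_cases h : b = q
        · subst h; simp [Chain.append, extract]
        · simp [Chain.append, extract, h]
      · simp [Chain.append, extract]
    all_goals simp [Chain.append, extract]

def treeEval (η : A.Inputs) (T : Forest) (p : Λ × Λ) : (A.Hom p.1 p.2).X :=
  eval η T p.1 (extract p.2)

lemma treeEval_spec (hη : HasDeg η ε) {T : Forest} (hw : T.width = 1) (hT : T.Stable)
    {p : Λ × Λ} (hp : PathIn η T.leaves p.1 p.2) :
    treeEval η T p ∈ (A.Hom p.1 p.2).grade (T.deg + (T.leaves.map ε).sum) ∧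
      ∀ {M : Type w} [Zero M] (Ψ : ∀ b, χ[A] p.1 b → M),
        eval η T p.1 Ψ = Ψ p.2 (cons (treeEval η T p) (nil p.2)) := by
  obtain ⟨k, hk, hd, he⟩ := exists_chain hη hT hp
  have : ∀ {a b : Λ} (k : χ[A] a b), k.length = 1 → ∃ x, k = cons x (nil b) := by
    rintro a b (_ | ⟨x, _ | ⟨y, l⟩⟩) h
    · simp [length] at h
    · exact ⟨x, rfl⟩
    · simp [length] at h
  obtain ⟨x, rfl⟩ := this k (hk.trans hw)
  have hx : treeEval η T p = x := by rw [treeEval, he, extract_single]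
  obtain ⟨m, n, h1, h2, h3⟩ := hd
  obtain rfl : n = 0 := h2
  rw [hx, h3, add_zero]
  exact ⟨h1, fun Ψ => he Ψ⟩

/-- The morphisms to which the trees of a forest evaluate. -/
def evTup (η : A.Inputs) (F : Forest) (β : DPlus.Obj Λ) : Tup A.Hom β :=
  Tup.ofFun (fun j p => treeEval η (F.tree j) p) β

lemma evTup_append {T : Forest} (h : T.width = 1) (r : Forest) (p : Λ × Λ) :
    evTup η (T.append r) (p :: β) = .cons (treeEval η T p) (evTup η r β) := by grind [evTup, Tup.ofFun, tree_append_zero, tree_append_succ]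

lemma evTup_congr (h : ∀ i ∈ F.leaves, η i = η' i) : evTup η F β = evTup η' F β := by
  refine tree_induction (P := fun F => ∀ β, (∀ i ∈ F.leaves, η i = η' i) →
    evTup η F β = evTup η' F β) (fun β _ => rfl) (fun T r hT ih β h => ?_) F β h
  rw [leaves_append] at h
  obtain _ | ⟨p, β⟩ := β
  · rfl
  · rw [evTup_append hT, evTup_append hT, ih β fun i hi => h i (List.mem_append_right _ hi),
      treeEval, eval_congr_inputs fun i hi => h i (List.mem_append_left _ hi), treeEval]

/-- The inputs for the trees of the forest form paths between the pairs in `β`. -/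
def Fits (η : A.Inputs) (F : Forest) (β : DPlus.Obj Λ) : Prop :=
  List.Forall₂ (fun l p => PathIn η l p.1 p.2) F.legs β

lemma Fits.width (h : Fits η F β) : F.width = β.length := by
  rw [← length_legs, h.length_eq]

lemma Fits.path (h : Fits η F β) {j : ℕ} {p : Λ × Λ} (hp : β[j]? = some p) :
    PathIn η (F.tree j).leaves p.1 p.2 := by
  obtain ⟨hj, rfl⟩ := List.getElem?_eq_some_iff.1 hp
  have hj' : j < F.legs.length := by rw [h.length_eq]; exact hj
  rw [leaves_tree, List.getD_eq_getElem?_getD, List.getElem?_eq_getElem hj']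
  exact (List.forall₂_iff_get.1 h).2 j hj' hj

lemma fits_induction {P : Forest → DPlus.Obj Λ → Prop} (nil : P .nil [])
    (append : ∀ (T r : Forest) (p : Λ × Λ) (β : DPlus.Obj Λ), T.width = 1 → T.Stable →
      PathIn η T.leaves p.1 p.2 → r.Stable → Fits η r β → P r β → P (T.append r) (p :: β))
    (hF : F.Stable) (h : Fits η F β) : P F β := by
  refine stable_induction (P := fun F => ∀ β, Fits η F β → P F β) (fun β h => ?_)
    (fun T r hw hT hr ih β h => ?_) F hF β h
  · cases h; exact nil
  · rw [Fits, legs_append, show T.legs = [T.leaves] by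
      obtain ⟨j, rfl⟩ | ⟨c, rfl⟩ := width_eq_one hw <;> simp [leaves]] at h
    cases h with
    | cons h1 h2 => exact append T r _ _ hw hT h1 hr h2 (ih _ h2)

/-- The degrees of the evaluations of the trees of a forest. -/
def outDeg (ε : ℕ → ℤ) (F : Forest) (j : ℕ) : ℤ := (F.tree j).deg + ((F.tree j).leaves.map ε).sum

lemma outDeg_cast (ε : ℕ → ℤ) (F : Forest) (j : ℕ) : (outDeg ε F j : ZMod 2) =
    (F.tree j).deg + (F.tree j).leafSum π[ε] := by
  rw [outDeg, ← sum_leaves_intCast, Int.cast_add, Int.cast_natCast]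

lemma hasDeg_evTup (hη : HasDeg η ε) (hF : F.Stable) (h : Fits η F β) :
    (evTup η F β).HasDeg (outDeg ε F) :=
  Tup.hasDeg_ofFun _ _ fun j p hp => by
    have := F.tree_spec hF j (by rw [h.width]; exact (List.getElem?_eq_some_iff.1 hp).1)
    exact (treeEval_spec hη this.1 this.2 (h.path hp)).1

lemma sum_outDeg (ε : ℕ → ℤ) (hF : F.Stable) :
    ((List.range F.width).map (outDeg ε F)).sum = F.deg + (F.leaves.map ε).sum := by
  refine stable_induction (P := fun F => ((List.range F.width).map (outDeg ε F)).sum =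
    F.deg + (F.leaves.map ε).sum) (by simp [Forest.width, deg, leaves])
    (fun T r hw _ _ ih => ?_) F hF
  rw [width_append, hw, add_comm 1, sum_map_range_succ, outDeg, tree_append_zero hw, deg_append,
    leaves_append, List.map_append, List.sum_append]
  have : (fun i => outDeg ε (T.append r) (i + 1)) = outDeg ε r := by
    funext i; rw [outDeg, tree_append_succ hw]; rfl
  rw [this, ih]; push_cast; ring

lemma _root_.Tup.hasDeg_entries {l : Tup A.Hom α} (h : l.HasDeg ε) : HasDeg l.entries ε :=
  fun i a b x hx => h.entries i a b x hx

lemma pathIn_entries (l : Tup A.Hom α) {k : List ℕ} (h : DPlus.IsPath α k a b) :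
    PathIn l.entries k a b := by
  induction k generalizing a with
  | nil => exact h
  | cons i k ih =>
    obtain ⟨c, h1, h2⟩ := h
    obtain ⟨x, hx⟩ := l.entries_of_getElem? h1
    exact ⟨c, x, hx, ih h2⟩

lemma fits_entries (l : Tup A.Hom α) (h : DPlus.IsCell α β F) : Fits l.entries F β :=
  h.2.1.imp fun _ _ hp => pathIn_entries l hp

end Trees

section Linearity

variable {N : Type w} [AddCommGroup N] [Module K N] {A : AInfCat.{u,v,w} K Λ}

def consInputs (s : Option (Σ a b : Λ, (A.Hom a b).X)) (η : A.Inputs) : A.Inputs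
  | 0 => s
  | i + 1 => η i

lemma consInputs_update (s t) (η : A.Inputs) (j : ℕ) :
    consInputs s (Function.update η j t) = Function.update (consInputs s η) (j + 1) t := by
  funext i
  cases i with
  | zero => simp [consInputs]
  | succ i => simp [consInputs, Function.update_apply]

lemma consInputs_eq_update (s t) (η : A.Inputs) :
    consInputs s η = Function.update (consInputs t η) 0 s := by
  funext i; cases i <;> simp [consInputs]

lemma isML_of_linAt {α : DPlus.Obj Λ} {g : A.Inputs → N} (h : ∀ j < α.length, LinAt j g) :
    Tup.IsML fun l : Tup A.Hom α => g l.entries := by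
  induction α generalizing g with
  | nil => trivial
  | cons p α ih =>
    have e : ∀ (x : (A.Hom p.1 p.2).X) (l : Tup A.Hom α),
        (Tup.cons x l).entries = consInputs (some ⟨p.1, p.2, x⟩) l.entries := fun x l => by
      funext i; cases i <;> rfl
    have h0 := h 0 (by simp)
    refine ⟨fun x y l => ?_, fun z x l => ?_, fun x => ?_⟩
    · simp only [e]
      rw [consInputs_eq_update _ none, consInputs_eq_update (some ⟨p.1, p.2, x⟩) none,
        consInputs_eq_update (some ⟨p.1, p.2, y⟩) none]
      exact h0.add _ _ _ _ _
    · simp only [e]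
      rw [consInputs_eq_update _ none, consInputs_eq_update (some ⟨p.1, p.2, x⟩) none]
      exact h0.smul _ _ _ _ _
    · simp only [e]
      refine ih (g := fun η => g (consInputs _ η)) fun j hj => ?_
      have hj := h (j + 1) (by simpa using hj)
      refine ⟨fun η a b x y => ?_, fun η a b z x => ?_⟩ <;> simp only [consInputs_update]
      · exact hj.add _ _ _ _ _
      · exact hj.smul _ _ _ _ _

lemma LinAt.comp {N' : Type w} [AddCommGroup N'] [Module K N'] {j : ℕ} {g : A.Inputs → N}
    (h : LinAt j g) (f : N →ₗ[K] N') : LinAt j fun η => f (g η) :=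
  ⟨fun η a b x y => by rw [h.add, map_add], fun η a b z x => by rw [h.smul, map_smul]⟩

end Linearity

variable [CharZero K] {A : AInfCat.{u,v,max u w} K Λ} {α β γ : DPlus.Obj Λ}

lemma linAt_evTup {F : Forest} (hF : F.leaves.Nodup) (hw : F.width = β.length) {j : ℕ}
    (hj : j ∈ F.leaves) :
    LinAt j fun η : A.Inputs => ((evTup η F β).prod : (tens.{u,v,w} A.Hom β).X) := by
  refine tree_induction (P := fun F => ∀ β : DPlus.Obj Λ, F.leaves.Nodup → F.width = β.length →
    j ∈ F.leaves → LinAt j fun η : A.Inputs => ((evTup η F β).prod : (tens.{u,v,w} A.Hom β).X))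
    (fun β _ _ hj => by simp [leaves] at hj) (fun T r hT ih β hn hw hj => ?_) F β hF hw hj
  obtain _ | ⟨p, β⟩ := β
  · rw [width_append, hT] at hw; simp at hw
  rw [leaves_append] at hn hj
  obtain ⟨hnT, hnr, hd⟩ := List.nodup_append.1 hn
  simp only [evTup_append hT, Tup.prod]
  by_cases hjT : j ∈ T.leaves
  · have hjr : j ∉ r.leaves := fun h => hd _ hjT _ h rfl
    have hr : ∀ (η : A.Inputs) s, evTup (Function.update η j s) r β = evTup η r β := fun η s =>
      evTup_congr fun i hi => by rw [Function.update_of_ne (by rintro rfl; exact hjr hi)]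
    have hT := linAt_eval (M := (A.Hom p.1 p.2).X) hnT hjT fun b => slotLinear_extract (A := A) b
    refine ⟨fun η a b x y => ?_, fun η a b z x => ?_⟩ <;> simp only [hr, treeEval]
    · rw [hT.add, map_add, LinearMap.add_apply]
    · rw [hT.smul, map_smul, LinearMap.smul_apply]
  · have hr := ih β hnr (by rw [width_append, hT] at hw; simpa [add_comm] using hw)
      ((List.mem_append.1 hj).resolve_left hjT)
    refine ⟨fun η a b x y => ?_, fun η a b z x => ?_⟩ <;>
      simp only [treeEval, eval_update_of_not_mem _ hjT]
    · rw [hr.add, map_add]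
    · rw [hr.smul, map_smul]

end AInfCat

namespace Forest

lemma sum_bdry_append {N : Type*} [AddCommMonoid N] {T : Forest} (hw : T.width = 1)
    (hT : T.Stable) (r : Forest) (f : ZMod 2 → Forest → N) :
    ((T.append r).bdry.map fun t => f t.1 t.2).sum = (T.bdry.map fun t => f t.1 (t.2.append r)).sum +
      (r.bdry.map fun t => f (T.deg + t.1) (T.append t.2)).sum := by
  obtain ⟨j, rfl⟩ | ⟨c, rfl⟩ := width_eq_one hw
  · simp [append, bdry, deg, Function.comp_def]
  · have : ((c.width : ℕ) : ZMod 2) = ((c.width - 2 : ℕ) : ZMod 2) := by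
      rcases hT.1 with rfl | h
      · rfl
      · rw [Nat.cast_sub h.1, show ((2 : ℕ) : ZMod 2) = 0 by decide, sub_zero]
    simp [append, bdry, deg, Function.comp_def, this, add_assoc]

end Forest

namespace AInfCat

open Chain Forest

lemma map_posSum {M M' : Type w} [AddCommGroup M] [Module K M] [AddCommGroup M'] [Module K M']
    (f : M →ₗ[K] M') (δ : ℕ → ZMod 2) (l : List ℕ) (g : ℕ → M) :
    f (posSum (K := K) δ l g) = posSum (K := K) δ l fun j => f (g j) := by
  induction l with
  | nil => exact map_zero f
  | cons j l ih => rw [posSum, posSum, map_add, map_smul, ih]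

lemma posSum_eq_sum {M : Type w} [AddCommGroup M] [Module K M] (δ : ℕ → ZMod 2) {l : List ℕ}
    (hl : l.Nodup) (g : ℕ → M) : posSum (K := K) δ l g =
      (l.map fun j => zsign K (l.pairSum fun i k => δ i * single j k) • g j).sum := by
  induction l with
  | nil => rfl
  | cons i l ih =>
    rw [List.nodup_cons] at hl
    rw [posSum, ih hl.2, list_smul_sum_map, List.map_cons, List.sum_cons]
    have h0 : ∀ l : List ℕ, i ∉ l → l.pairSum (fun i' k => δ i' * single i k) = 0 := fun l h => by
      induction l with
      | nil => rfl
      | cons k l ih =>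
        simp only [List.mem_cons, not_or] at h
        rw [List.pairSum, ih h.2, List.sum_eq_zero, add_zero]
        intro x hx
        obtain ⟨k', hk', rfl⟩ := List.mem_map.1 hx
        rw [single, if_neg (by rintro rfl; exact h.2 hk'), mul_zero]
    congr 1
    · rw [List.pairSum, h0 l hl.1, List.sum_eq_zero, add_zero, zsign_zero, one_smul]
      intro x hx
      obtain ⟨k', hk', rfl⟩ := List.mem_map.1 hx
      rw [single, if_neg (by rintro rfl; exact hl.1 hk'), mul_zero]
    · refine congrArg _ (List.map_congr_left fun j hj => ?_)
      rw [List.pairSum, List.sum_map_mul_left, sum_map_single hj hl.2, _root_.mul_one, zsign_add, mul_smul]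

/-- Reordering a signed sum of the terms in which a derivation is applied to one of the leaves. -/
lemma posSum_range {M : Type w} [AddCommGroup M] [Module K M] (δ : ℕ → ZMod 2) {F : Forest}
    {n : ℕ} (hF : F.leaves.Perm (List.range n)) (g : ℕ → M) :
    posSum (K := K) δ (List.range n) (fun j => zsign K (F.sg fun i => δ i + single j i) • g j) =
      zsign K (Forest.inv δ F.leaves) •
        posSum (K := K) δ F.leaves fun j => zsign K (F.shuf δ + F.shuf (single j)) • g j := by
  rw [posSum_eq_sum δ List.nodup_range, posSum_eq_sum δ (hF.nodup_iff.2 List.nodup_range),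
    ← (hF.map _).sum_eq, list_smul_sum_map]
  refine congrArg _ (List.map_congr_left fun j hj => ?_)
  rw [smul_smul, smul_smul, smul_smul, ← zsign_add, ← zsign_add, ← zsign_add, sg, shuf_add,
    List.pairSum_eq_add_inversions hF]
  have : Forest.inv (fun i => δ i + single j i) F.leaves = Forest.inv δ F.leaves +
      F.leaves.pairSum fun i k => if k < i then δ i * single j k + δ k * single j i else 0 := by
    rw [Forest.inv, Forest.inv, ← List.pairSum_add]
    refine congrArg (fun φ => List.pairSum φ F.leaves) (funext fun i => funext fun k => ?_)
    split_ifs with h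
    · have : single j i * single j k = 0 := by
        rw [single, single]; split_ifs with h1 h2
        · omega
        all_goals simp
      linear_combination this
    · simp
  rw [this]
  congr 2
  ring

variable [CharZero K] {A : AInfCat.{u,v,max u w} K Λ} {α β γ : DPlus.Obj Λ} {η : A.Inputs}
  {ε : ℕ → ℤ} {F : Forest}

lemma treeEval_dAt_of_not_mem {T : Forest} {j : ℕ} (h : j ∉ T.leaves) (p : Λ × Λ) :
    treeEval (dAt η j) T p = treeEval η T p := eval_dAt_of_not_mem h _ _

lemma evTup_bdry (hη : HasDeg η ε) (hF : F.Stable) (hnd : F.leaves.Nodup) (hfit : Fits η F β) :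
    (F.bdry.map fun t => zsign K (t.1 + t.2.shuf π[ε]) •
      (evTup η t.2 β).prod).sum =
      zsign K (F.shuf π[ε]) •
        (tens.{u,v,w} A.Hom β).d (evTup η F β).prod -
        zsign K F.deg • posSum (K := K) π[ε] F.leaves fun j =>
          zsign K ((F.shuf π[ε]) + F.shuf (single j)) •
            (evTup (dAt η j) F β).prod := by
  set δ : ℕ → ZMod 2 := π[ε] with hδ
  refine fits_induction (P := fun F β => F.leaves.Nodup →
    (F.bdry.map fun t => zsign K (t.1 + t.2.shuf δ) • (evTup η t.2 β).prod).sum =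
      zsign K (F.shuf δ) • (tens.{u,v,w} A.Hom β).d (evTup η F β).prod -
        zsign K F.deg • posSum (K := K) δ F.leaves fun j =>
          zsign K (F.shuf δ + F.shuf (single j)) • (evTup (dAt η j) F β).prod)
    (fun _ => ?_) (fun T r p β hw hT hp hr hfr ih hn => ?_) hF hfit hnd
  · simp only [bdry, leaves, posSum, List.map_nil, List.sum_nil, smul_zero, sub_zero]
    exact (smul_zero _).symm
  rw [leaves_append] at hn
  obtain ⟨hnT, hnr, hdis⟩ := List.nodup_append.1 hn
  obtain ⟨hXm, hX⟩ := treeEval_spec hη hw hT hp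
  set X := treeEval η T p with hXd
  set R := ((evTup η r β).prod : (tens.{u,v,w} A.Hom β).X)
  have hsgn : (A.Hom p.1 p.2).sgn X = zsign K (T.deg + T.leafSum δ) • X := by
    rw [Cx.sgn_eq_zsign _ hXm, Int.cast_add, sum_leaves_intCast, Int.cast_natCast]
  have hT' := eval_bdry hη hT hnT hp (slotLinear_extract (A := A) (q := p.2))
  rw [hX, dSum, dSum, add_zero, extract_single, ← hδ] at hT'
  have h1 := congrArg (fun z => zsign K (r.shuf δ + T.leafSum δ * r.deg) • tcons.flip R z) hT'
  have h2 := congrArg (fun z => zsign K (T.deg + T.shuf δ + T.leafSum δ * (r.deg + 1)) • tcons X z)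
    (ih hnr)
  rw [map_list_sum, list_smul_sum_map, List.map_map, map_sub, map_smul, map_smul, map_posSum] at h1
  rw [map_list_sum, list_smul_sum_map, List.map_map, map_sub, map_smul, map_smul, map_posSum] at h2
  rw [sum_bdry_append hw hT r fun e t => zsign K (e + t.shuf δ) • (evTup η t (p :: β)).prod]
  have e1 : (T.bdry.map fun t => zsign K (t.1 + (t.2.append r).shuf δ) •
      ((evTup η (t.2.append r) (p :: β)).prod : (tens.{u,v,w} A.Hom (p :: β)).X)) =
        T.bdry.map ((fun x => zsign K (r.shuf δ + T.leafSum δ * r.deg) • x) ∘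
          (⇑(tcons.flip R) ∘ fun t => zsign K (t.1 + t.2.shuf δ) • treeEval η t.2 p)) :=
    List.map_congr_left fun t ht => by
      have hl := leaves_bdry ht
      have hw' : t.2.width = 1 := by
        rw [← length_legs, (T.bdry_spec t ht).1, length_legs, hw]
      rw [evTup_append hw', shuf_append, leafSum, hl, ← leafSum, Function.comp_apply,
        Function.comp_apply, map_smul, smul_smul, ← zsign_add]
      exact zsign_smul_congr (by ring) _
  have e2 : (r.bdry.map fun t => zsign K (T.deg + t.1 + (T.append t.2).shuf δ) •
      ((evTup η (T.append t.2) (p :: β)).prod : (tens.{u,v,w} A.Hom (p :: β)).X)) =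
        r.bdry.map ((fun x => zsign K (T.deg + T.shuf δ + T.leafSum δ * (r.deg + 1)) • x) ∘
          (⇑(tcons X) ∘ fun t => zsign K (t.1 + t.2.shuf δ) • (evTup η t.2 β).prod)) :=
    List.map_congr_left fun t ht => by
      rw [evTup_append hw, shuf_append, ← deg_bdry ht, Function.comp_apply,
        Function.comp_apply, map_smul, smul_smul, ← zsign_add]
      exact zsign_smul_congr (by grind) _
  refine (congrArg₂ (· + ·) ((congrArg List.sum e1).trans h1)
    ((congrArg List.sum e2).trans h2)).trans ?_
  rw [evTup_append hw, Tup.prod, d_tcons, hsgn, leaves_append, posSum_append, shuf_append, deg_append]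
  have p1 : (posSum (K := K) δ T.leaves fun j => zsign K (T.shuf δ + r.shuf δ +
      T.leafSum δ * r.deg + (T.append r).shuf (single j)) •
        ((evTup (dAt η j) (T.append r) (p :: β)).prod : (tens.{u,v,w} A.Hom (p :: β)).X)) =
      zsign K (r.shuf δ + T.leafSum δ * r.deg + r.deg) • posSum (K := K) δ T.leaves fun j =>
        tcons.flip R (zsign K (T.shuf δ + T.shuf (single j)) • treeEval (dAt η j) T p) := by
    rw [smul_posSum]
    refine posSum_congr δ fun j hj => ?_
    have hjr : j ∉ r.leaves := fun h => hdis _ hj _ h rfl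
    rw [evTup_append hw, evTup_congr (η := dAt η j) (η' := η) fun i hi => if_neg
      (by rintro rfl; exact hjr hi), map_smul, smul_smul, ← zsign_add, shuf_append,
      shuf_single_of_not_mem hjr, show T.leafSum (single j) = 1 from sum_map_single hj hnT]
    exact zsign_smul_congr (by ring) _
  have p2 : (posSum (K := K) δ r.leaves fun j => zsign K (T.shuf δ + r.shuf δ +
      T.leafSum δ * r.deg + (T.append r).shuf (single j)) •
        ((evTup (dAt η j) (T.append r) (p :: β)).prod : (tens.{u,v,w} A.Hom (p :: β)).X)) =
      zsign K (T.shuf δ + T.leafSum δ * r.deg) • posSum (K := K) δ r.leaves fun j =>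
        tcons X (zsign K (r.shuf δ + r.shuf (single j)) • (evTup (dAt η j) r β).prod) := by
    rw [smul_posSum]
    refine posSum_congr δ fun j hj => ?_
    have hjT : j ∉ T.leaves := fun h => hdis _ h _ hj rfl
    rw [evTup_append hw, treeEval_dAt_of_not_mem hjT, map_smul, smul_smul, ← zsign_add, shuf_append,
      shuf_single_of_not_mem hjT, leafSum_single_of_not_mem hjT]
    exact zsign_smul_congr (by ring) _
  rw [p1, p2, ← leafSum, map_smul, LinearMap.smul_apply]
  simp only [smul_sub, smul_add, smul_smul, ← zsign_add, Nat.cast_add]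
  have c : ∀ a b L d e : ZMod 2, e + a + L * (d + 1) + b = a + b + L * d + (e + L) ∧
      b + L * d + e = e + d + (b + L * d + d) ∧
      e + a + L * (d + 1) + d = e + d + (L + (a + L * d)) ∧
      b + L * d + a = a + b + L * d := by decide
  obtain ⟨c1, c2, c3, c4⟩ := c (T.shuf δ) (r.shuf δ) (T.leafSum δ) r.deg T.deg
  rw [c1, c2, c3, c4]
  exact (add_sub_add_comm (α := (tens.{u,v,w} A.Hom (p :: β)).X) _ _ _ _).symm

lemma exists_forestAct (A : AInfCat.{u,v,max u w} K Λ) (h : DPlus.IsCell α β F) :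
    ∃ f : (tens.{u,v,w} A.Hom α).X →ₗ[K] (tens.{u,v,w} A.Hom β).X, ∀ (l : Tup A.Hom α) ε, l.HasDeg ε →
      f l.prod = zsign K (F.sg π[ε]) • (evTup l.entries F β).prod := by
  have hn := h.1.nodup_iff.2 List.nodup_range
  refine exists_linear_of_parity (fun δ l => zsign K (F.sg δ) • (evTup l.entries F β).prod)
    (fun δ => isML_of_linAt (g := fun η => zsign K (F.sg δ) •
      ((evTup η F β).prod : (tens.{u,v,w} A.Hom β).X)) fun j hj => ?_) fun δ δ' l h' => ?_
  · exact (linAt_evTup hn (by rw [← length_legs, h.2.1.length_eq])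
      (h.1.mem_iff.2 (List.mem_range.2 hj))).comp (zsign K (F.sg δ) •
        (LinearMap.id : (tens.{u,v,w} A.Hom β).X →ₗ[K] _))
  · rw [sg_congr fun j hj => h' j (List.mem_range.1 (h.1.mem_iff.1 hj))]

def forestAct (A : AInfCat.{u,v,max u w} K Λ) (x : DPlus.Cell α β) :
    (tens.{u,v,w} A.Hom α).X →ₗ[K] (tens.{u,v,w} A.Hom β).X := (exists_forestAct A x.2).choose

lemma forestAct_prod (x : DPlus.Cell α β) {l : Tup A.Hom α} (hl : l.HasDeg ε) :
    forestAct.{u,v,w} A x l.prod =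
      zsign K (x.1.sg π[ε]) • (evTup l.entries x.1 β).prod :=
  (exists_forestAct A x.2).choose_spec l ε hl

def tensAct (A : AInfCat.{u,v,max u w} K Λ) : DPlus.Hom K α β →ₗ[K]
    (tens.{u,v,w} A.Hom α).X →ₗ[K] (tens.{u,v,w} A.Hom β).X :=
  Finsupp.linearCombination K (forestAct A)

lemma tensAct_of (x : DPlus.Cell α β) : tensAct.{u,v,w} A (DPlus.of K x) = forestAct A x := by
  rw [tensAct, DPlus.of, Finsupp.linearCombination_single, one_smul]

lemma forestAct_mem (x : DPlus.Cell α β) {n : ℤ} {v : (tens.{u,v,w} A.Hom α).X}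
    (hv : v ∈ (tens A.Hom α).grade n) : forestAct A x v ∈ (tens A.Hom β).grade (x.deg + n) := by
  refine tens_grade_le (S := ((tens A.Hom β).grade (x.deg + n)).comap (forestAct A x))
    (fun l ε hl hn => ?_) hv
  rw [Submodule.mem_comap, forestAct_prod x hl]
  refine Submodule.smul_mem _ _ ?_
  have hf := fits_entries l x.2
  have := Tup.prod_mem (hasDeg_evTup (Tup.hasDeg_entries hl) x.2.2.2 hf)
  rwa [← hf.width, sum_outDeg ε x.2.2.2, (x.2.1.map ε).sum_eq, hn] at this

lemma entries_dAt (l : Tup A.Hom α) (j : ℕ) : (l.dAt j).entries = dAt l.entries j :=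
  funext fun i => l.entries_dAt j i

lemma tensAct_d (x : DPlus.Cell α β) (v : (tens.{u,v,w} A.Hom α).X) :
    tensAct A (DPlus.d K (DPlus.of K x)) v = (tens A.Hom β).d (tensAct A (DPlus.of K x) v) -
      (-1 : K) ^ x.deg • tensAct A (DPlus.of K x) ((tens A.Hom α).d v) := by
  have h : tensAct A (DPlus.d K (DPlus.of K x)) = (tens A.Hom β).d ∘ₗ forestAct A x -
      (-1 : K) ^ x.deg • forestAct A x ∘ₗ (tens A.Hom α).d := by
    refine tens_hom_ext fun l ε hl => ?_
    have hη := Tup.hasDeg_entries hl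
    have hf := fits_entries l x.2
    have hn := x.2.1.nodup_iff.2 List.nodup_range
    have hL : tensAct A (DPlus.d K (DPlus.of K x)) l.prod =
        (x.1.bdry.map fun t => zsign K (t.1 + t.2.sg π[ε]) •
          (evTup l.entries t.2 β).prod).sum := by
      rw [DPlus.d, DPlus.of, Finsupp.linearCombination_single, one_smul]
      refine (map_list_sum ((tensAct A).flip l.prod) _).trans ?_
      rw [List.map_map, ← List.attach_map_val (l := x.1.bdry)]
      refine congrArg _ (List.map_congr_left fun t _ => ?_)
      simp only [Function.comp_apply, map_smul, LinearMap.flip_apply]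
      refine (congrArg (fun f => (-1 : K) ^ t.1.1 • f l.prod) (tensAct_of _)).trans ?_
      refine (congrArg _ (forestAct_prod _ hl)).trans ?_
      rw [smul_smul, ← zsign_natCast, ← zsign_add]
    have hsg : ∀ t ∈ x.1.bdry, zsign K (t.1 + t.2.sg π[ε]) •
        ((evTup l.entries t.2 β).prod : (tens.{u,v,w} A.Hom β).X) =
        zsign K (Forest.inv π[ε] x.1.leaves) •
          zsign K (t.1 + t.2.shuf π[ε]) • (evTup l.entries t.2 β).prod :=
      fun t ht => by
        rw [sg, leaves_bdry ht, smul_smul, ← zsign_add]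
        congr 2; ring
    rw [hL, List.map_congr_left hsg, ← list_smul_sum_map, evTup_bdry hη x.2.2.2 hn hf, smul_sub,
      LinearMap.sub_apply, LinearMap.comp_apply, LinearMap.smul_apply, LinearMap.comp_apply,
      Tup.d_prod hl, map_posSum, forestAct_prod x hl, map_smul, ← zsign_natCast, smul_comm]
    congr 1
    · rw [smul_smul, ← zsign_add, sg, add_comm]
    · rw [smul_comm, ← posSum_range _ x.2.1]
      refine congrArg _ (posSum_congr _ fun j _ => ?_)
      rw [forestAct_prod x (hl.dAt j), entries_dAt]
      refine congrArg₂ (· • ·) (congrArg _ (sg_congr fun i _ => ?_)) rfl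
      rw [single]
      split_ifs with h
      · rw [Int.cast_sub, Int.cast_one, sub_eq_add_neg, show (-1 : ZMod 2) = 1 by decide]
      · simp
  rw [tensAct_of]
  exact LinearMap.congr_fun h v

end AInfCat

namespace Forest

lemma inv_of_pairwise {δ : ℕ → ZMod 2} {l : List ℕ} (h : l.Pairwise (· < ·)) : inv δ l = 0 := by
  have : ∀ l : List ℕ, l.pairSum (fun _ _ => 0) = 0 := fun l => by
    induction l with
    | nil => rfl
    | cons j l ih => rw [List.pairSum, ih]; simp
  exact (List.pairSum_congr (h.imp fun hjk => if_neg (by omega))).trans (this l)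

lemma tree_ofLabels : ∀ {k : List ℕ} {i j : ℕ}, k[i]? = some j → (ofLabels k).tree i = leaf j nil
  | a :: k, 0, j, h => by simp at h; subst h; rfl
  | a :: k, i + 1, j, h => tree_ofLabels (k := k) (by simpa using h)

lemma relabel_append (f : ℕ → ℕ) (F G : Forest) :
    (F.append G).relabel f = (F.relabel f).append (G.relabel f) := by
  induction F with
  | nil => rfl
  | leaf i r ih => simp [append, relabel, ih]
  | node c r _ ih => simp [append, relabel, ih]

lemma deg_relabel (f : ℕ → ℕ) (F : Forest) : (F.relabel f).deg = F.deg := by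
  induction F with
  | nil => rfl
  | leaf i r ih => exact ih
  | node c r ihc ih => simp only [relabel, deg, ihc, ih, width_relabel]

lemma shuf_relabel (δ : ℕ → ZMod 2) (f : ℕ → ℕ) (F : Forest) :
    (F.relabel f).shuf δ = F.shuf fun i => δ (f i) := by
  induction F with
  | nil => rfl
  | leaf i r ih => simp only [relabel, shuf, ih, deg_relabel]
  | node c r ihc ih =>
    simp only [relabel, shuf, ihc, ih, deg_relabel, leafSum, leaves_relabel, List.map_map,
      Function.comp_def]

lemma inv_append (δ : ℕ → ZMod 2) (l m : List ℕ) : inv δ (l ++ m) = inv δ l + inv δ m +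
    (l.map fun j => (m.map fun k => if k < j then δ j * δ k else 0).sum).sum :=
  List.pairSum_append l m

lemma inv_map_add (δ : ℕ → ZMod 2) (n : ℕ) (l : List ℕ) :
    inv δ (l.map (n + ·)) = inv (fun i => δ (n + i)) l := by
  induction l with
  | nil => rfl
  | cons j l ih =>
    simp only [List.map_cons, inv, List.pairSum, List.map_map] at ih ⊢
    rw [ih]
    simp [Function.comp_def]

lemma sg_append {δ : ℕ → ZMod 2} {F G : Forest} {n : ℕ} (h : ∀ i ∈ F.leaves, i < n) :
    (F.append (G.relabel (n + ·))).sg δ =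
      F.sg δ + (G.sg fun i => δ (n + i)) + F.leafSum δ * G.deg := by
  rw [sg, shuf_append, shuf_relabel, deg_relabel, leaves_append, leaves_relabel, inv_append,
    inv_map_add, List.sum_eq_zero (l := F.leaves.map _), sg, sg]
  · ring
  · intro x hx
    obtain ⟨j, hj, rfl⟩ := List.mem_map.1 hx
    refine List.sum_eq_zero fun y hy => ?_
    simp only [List.mem_map] at hy
    obtain ⟨_, ⟨k, _, rfl⟩, rfl⟩ := hy
    exact if_neg (by have := h j hj; omega)

end Forest

namespace AInfCat

open Chain Forest

variable [CharZero K] {A : AInfCat.{u,v,max u w} K Λ}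
  {α α' β β' γ : DPlus.Obj Λ} {η η' : A.Inputs} {ε ε' : ℕ → ℤ} {F G H : Forest}

lemma evalTo_evTup (hη : HasDeg η ε) (hF : F.Stable) (hf : Fits η F β) (l : List ℕ) :
    EvalTo η (evTup η F β).entries F.tree l := by
  intro j _ a c x hx M _ Ψ
  rw [evTup, Tup.entries_ofFun, Option.map_eq_some_iff] at hx
  obtain ⟨p, hp, h⟩ := hx
  cases h
  have hj := F.tree_spec hF j (by rw [hf.width]; exact (List.getElem?_eq_some_iff.1 hp).1)
  exact (treeEval_spec hη hj.1 hj.2 (hf.path hp)).2 Ψ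

lemma evTup_subst {S : ℕ → Forest} (hη : HasDeg η' ε') (hG : G.Stable)
    (hS : EvalTo η η' S G.leaves) (hw : ∀ j ∈ G.leaves, (S j).width = 1) (hf : Fits η' G γ) :
    (∀ H, G.subst S = some H → evTup η H γ = evTup η' G γ) ∧
      (G.subst S = none → ((evTup η' G γ).prod : (tens.{u,v,w} A.Hom γ).X) = 0) := by
  refine fits_induction (P := fun G γ => EvalTo η η' S G.leaves → (∀ j ∈ G.leaves, (S j).width = 1) →
    (∀ H, G.subst S = some H → evTup η H γ = evTup η' G γ) ∧
      (G.subst S = none → ((evTup η' G γ).prod : (tens.{u,v,w} A.Hom γ).X) = 0))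
    (fun _ _ => ⟨fun H h => rfl, fun h => by cases h⟩)
    (fun T r p γ hT hTs hp hr hfr ih hS hw => ?_) hG hf hS hw
  have hsub : (T.append r).subst S = (T.subst S).bind fun T' => (r.subst S).map T'.append := by
    obtain ⟨j, rfl⟩ | ⟨c, rfl⟩ := width_eq_one hT
    · simp [Forest.append, subst, Forest.append_nil]
    · simp only [Forest.append, subst, Option.bind_assoc, Option.bind_some,
        Option.map_eq_bind, Function.comp_def, Forest.append_nil]
  rw [leaves_append] at hS hw
  have hST : EvalTo η η' S T.leaves := fun j hj => hS j (List.mem_append_left _ hj)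
  obtain ⟨ih1, ih2⟩ := ih (fun j hj => hS j (List.mem_append_right _ hj))
    fun j hj => hw j (List.mem_append_right _ hj)
  have hwT : ∀ j ∈ T.leaves, (S j).width = 1 := fun j hj => hw j (List.mem_append_left _ hj)
  rw [hsub, evTup_append hT]
  rcases hT' : T.subst S with _ | T'
  · refine ⟨fun H h => (by cases h), fun _ => ?_⟩
    rw [Tup.prod, treeEval, eval_of_subst_eq_none hη hTs hST hwT hp hT' slotLinear_extract, map_zero,
      LinearMap.zero_apply]
  · rcases hr' : r.subst S with _ | r'
    · refine ⟨fun H h => (by cases h), fun _ => ?_⟩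
      rw [Tup.prod, ih2 hr', map_zero]
    · refine ⟨fun H h => ?_, fun h => by cases h⟩
      obtain rfl := Option.some.inj h
      rw [evTup_append ((width_subst hT' hwT).trans hT), ih1 _ hr', treeEval,
        eval_subst hη hTs hST hp hT', treeEval]

lemma tensAct_prod (h : DPlus.IsCell α β F) {l : Tup A.Hom α} (hl : l.HasDeg ε) :
    tensAct.{u,v,w} A (DPlus.of K ⟨F, h⟩) l.prod =
      zsign K (F.sg π[ε]) • (evTup l.entries F β).prod := by
  refine (LinearMap.congr_fun (tensAct_of _) _).trans ?_
  exact forestAct_prod _ hl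

lemma tensAct_comp (g : DPlus.Hom K β γ) (f : DPlus.Hom K α β) (v : (tens.{u,v,w} A.Hom α).X) :
    tensAct A (DPlus.comp K g f) v = tensAct A g (tensAct A f v) := by
  have key : ∀ (y : DPlus.Cell β γ) (x : DPlus.Cell α β),
      tensAct A (DPlus.compCell K y x) = forestAct A y ∘ₗ forestAct A x := by
    intro y x
    refine tens_hom_ext fun l ε hl => ?_
    have hη := Tup.hasDeg_entries hl
    have hf := fits_entries l x.2
    have hd := hasDeg_evTup hη x.2.2.2 hf
    have hF : x.1.width = β.length := hf.width
    obtain ⟨h1, h2⟩ := evTup_subst (Tup.hasDeg_entries hd) y.2.2.2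
      (evalTo_evTup hη x.2.2.2 hf y.1.leaves) (fun j hj => x.1.width_tree (by
        rw [hF]; exact List.mem_range.1 (y.2.1.subset hj))) (fits_entries _ y.2)
    rw [LinearMap.comp_apply, forestAct_prod x hl, map_smul, forestAct_prod y hd]
    unfold DPlus.compCell
    split
    · next h => rw [h2 h, map_zero, smul_zero, smul_zero]; rfl
    · next z h =>
      rw [map_smul, LinearMap.smul_apply]
      refine (congrArg _ (tensAct_prod _ hl)).trans ?_
      rw [smul_smul, smul_smul, ← zsign_natCast, ← zsign_add, ← zsign_add, ← h1 z h]
      refine congrArg₂ (· • ·) (congrArg _ ?_) rfl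
      rw [sg_subst _ x.2.1 (hF ▸ y.2.1) h]
      simp only [outDeg_cast]
  induction g using Finsupp.induction_linear with
  | zero => simp
  | add g g' h h' => simp only [map_add, LinearMap.add_apply, h, h']
  | single y a =>
    induction f using Finsupp.induction_linear with
    | zero => simp
    | add f f' h h' => simp only [map_add, LinearMap.add_apply, h, h']
    | single x b =>
      simp only [DPlus.comp, tensAct, Finsupp.linearCombination_single, map_smul,
        LinearMap.smul_apply]
      rw [smul_comm b a]
      exact congrArg (a • b • ·) (LinearMap.congr_fun (key y x) v)

lemma evTup_ofLabels {m : Tup A.Hom β} {k : List ℕ}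
    (h : ∀ i < β.length, ∃ j, k[i]? = some j ∧ η j = m.entries i) :
    evTup η (ofLabels k) β = m := by
  refine Tup.ext_entries fun i => ?_
  rw [evTup, Tup.entries_ofFun]
  rcases lt_or_ge i β.length with hi | hi
  · obtain ⟨j, hj, hm⟩ := h i hi
    obtain ⟨x, hx⟩ := m.entries_of_getElem? (List.getElem?_eq_getElem hi)
    rw [List.getElem?_eq_getElem hi, Option.map_some, hx, tree_ofLabels hj, treeEval, eval, hm, hx, look_some, eval,
      extract_single]
  · rw [List.getElem?_eq_none hi, m.entries_of_le hi, Option.map_none]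

lemma tensAct_id (v : (tens.{u,v,w} A.Hom α).X) : tensAct A (DPlus.id K α) v = v := by
  have h : tensAct A (DPlus.id K α) = (LinearMap.id : (tens.{u,v,w} A.Hom α).X →ₗ[K] _) :=
    tens_hom_ext fun l ε hl => by
      rw [DPlus.id, tensAct_prod _ hl, evTup_ofLabels (m := l) fun i hi => ⟨i, by simp [hi], rfl⟩, sg,
        shuf_ofLabels, leaves_ofLabels, inv_of_pairwise List.pairwise_lt_range, add_zero, zsign_zero,
        one_smul]
      rfl
  rw [h]; rfl

lemma evTup_append_append (hw : F.width = β.length) (G : Forest) (β' : DPlus.Obj Λ) :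
    evTup η (F.append G) (β ++ β') = (evTup η F β).append (evTup η G β') := by
  refine tree_induction (P := fun F => ∀ β : DPlus.Obj Λ, F.width = β.length →
    evTup η (F.append G) (β ++ β') = (evTup η F β).append (evTup η G β')) (fun β h => ?_)
    (fun T r hT ih β h => ?_) F β hw
  · rw [List.length_eq_zero_iff.1 h.symm]; rfl
  · obtain _ | ⟨p, β⟩ := β
    · rw [width_append, hT] at h; simp at h
    · rw [Forest.append_assoc, evTup_append hT]
      refine (evTup_append hT (r.append G) p).trans ?_
      exact congrArg (Tup.cons _)
        (ih β (by rw [width_append, hT] at h; simpa [add_comm] using h))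

lemma evTup_relabel (f : ℕ → ℕ) (F : Forest) (β : DPlus.Obj Λ) :
    evTup η (F.relabel f) β = evTup (fun i => η (f i)) F β := by
  refine tree_induction (P := fun F => ∀ β, evTup η (F.relabel f) β = evTup (fun i => η (f i)) F β)
    (fun β => rfl) (fun T r hT ih β => ?_) F β
  obtain _ | ⟨p, β⟩ := β
  · rfl
  · rw [relabel_append, evTup_append ((width_relabel f T).trans hT), evTup_append hT, ih, treeEval,
      eval_relabel, treeEval]

lemma tens_hom_ext₂ {N : Type*} [AddCommGroup N] [Module K N] {M : Λ → Λ → Cx.{u,max u w} K}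
    {f g : (tens.{u,v,w} M α).X →ₗ[K] (tens.{u,v,w} M β).X →ₗ[K] N}
    (h : ∀ (l : Tup M α) (m : Tup M β) ε ε', l.HasDeg ε → m.HasDeg ε' →
      f l.prod m.prod = g l.prod m.prod) : f = g :=
  tens_hom_ext fun l ε hl => tens_hom_ext fun m ε' hm => h l m ε ε' hl hm

lemma tensAct_tensor (x : DPlus.Cell α β) (y : DPlus.Cell α' β')
    (v : (tens.{u,v,w} A.Hom α).X) (v' : (tens.{u,v,w} A.Hom α').X) :
    tensAct A (DPlus.tensor K (DPlus.of K x) (DPlus.of K y)) (tmul v v') =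
      tmul (tensAct A (DPlus.of K x) (((tens A.Hom α).sgn ^ y.deg) v))
        (tensAct A (DPlus.of K y) v') := by
  have e : DPlus.tensor K (DPlus.of K x) (DPlus.of K y) =
      DPlus.of K ⟨_, DPlus.isCell_append x.2 y.2⟩ := by
    simp [DPlus.tensor, DPlus.of, Finsupp.linearCombination_single]
  have h : (tmulAux α α').compr₂ (tensAct A (DPlus.of K ⟨_, DPlus.isCell_append x.2 y.2⟩)) =
      (tmulAux β β').compl₁₂ (tensAct A (DPlus.of K x) ∘ₗ ((tens A.Hom α).sgn ^ y.deg))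
        (tensAct A (DPlus.of K y)) := by
    refine tens_hom_ext₂ fun l m ε ε' hl hm => ?_
    have hw : x.1.width = β.length := (fits_entries l x.2).width
    have hlt : ∀ i ∈ x.1.leaves, i < α.length := fun i hi => List.mem_range.1 (x.2.1.subset hi)
    simp only [LinearMap.compr₂_apply, LinearMap.compl₁₂_apply, LinearMap.comp_apply]
    rw [← Tup.prod_append, tensAct_prod _ (hl.append hm), Cx.sgn_pow_eq_zsign _ (Tup.prod_mem hl),
      map_smul]
    have h1 := tensAct_prod (A := A) x.2 hl
    have h2 := tensAct_prod (A := A) y.2 hm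
    refine Eq.trans ?_ (congrArg₂ (fun s t => tmulAux β β' (_ • s) t) h1 h2).symm
    rw [evTup_append_append hw, evTup_relabel, Tup.prod_append, map_smul, map_smul, map_smul,
      LinearMap.smul_apply, LinearMap.smul_apply, smul_smul, smul_smul, ← zsign_add, ← zsign_add,
      sg_append hlt]
    have hL : evTup (l.append m).entries x.1 β = evTup l.entries x.1 β :=
      evTup_congr fun i hi => by rw [Tup.entries_append, if_pos (hlt i hi)]
    have hR : (fun i => (l.append m).entries (α.length + i)) = m.entries := by
      funext i; rw [Tup.entries_append, if_neg (by omega), Nat.add_sub_cancel_left]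
    have hs : ((List.range α.length).map ε).sum = (x.1.leaves.map ε).sum :=
      (x.2.1.map ε).sum_eq.symm
    rw [hL, hR, hs, sum_leaves_intCast, sg_congr (F := x.1) (δ' := π[ε])
      fun i hi => by rw [if_pos (hlt i hi)], leafSum, leafSum, List.map_congr_left (l := x.1.leaves)
      (g := π[ε]) fun i hi => by rw [if_pos (hlt i hi)]]
    simp only [add_lt_iff_neg_left, not_lt_zero, if_false, Nat.add_sub_cancel_left]
    refine congrArg₂ (· • ·) (congrArg _ ?_) rfl
    change _ = _ + (y.1.deg : ZMod 2) * _ + _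
    ring
  rw [e]
  exact LinearMap.congr_fun (LinearMap.congr_fun h v) v'

lemma tensAct_symm {p q : ℤ} {v : (tens.{u,v,w} A.Hom α).X} {v' : (tens.{u,v,w} A.Hom β).X}
    (hv : v ∈ (tens A.Hom α).grade p) (hv' : v' ∈ (tens A.Hom β).grade q) :
    tensAct A (DPlus.symm K α β) (tmul v v') = (((p * q).negOnePow : ℤ) : K) • tmul v' v := by
  have h : ∀ (l : Tup A.Hom α) (m : Tup A.Hom β) ε ε', l.HasDeg ε → m.HasDeg ε' →
      ((List.range α.length).map ε).sum = p → ((List.range β.length).map ε').sum = q →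
      tensAct A (DPlus.symm K α β) (tmul l.prod m.prod) =
        zsign K ((p * q : ℤ) : ZMod 2) • tmul (m.prod : (tens.{u,v,w} A.Hom β).X) l.prod := by
    intro l m ε ε' hl hm hp hq
    rw [← Tup.prod_append, DPlus.symm, tensAct_prod _ (hl.append hm), ← Tup.prod_append,
      evTup_ofLabels (m := m.append l), sg, shuf_ofLabels, leaves_ofLabels, inv_append, inv_map_add,
      inv_of_pairwise List.pairwise_lt_range, inv_of_pairwise List.pairwise_lt_range, ← hp, ← hq]
    · refine congrArg₂ (· • ·) (congrArg _ ?_) rfl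
      rw [List.map_map, add_zero, zero_add, zero_add, Int.cast_mul, mul_comm, Int.cast_list_sum,
        Int.cast_list_sum, ← List.sum_map_mul_right, List.map_map]
      refine congrArg _ (List.map_congr_left fun i _ => ?_)
      simp only [Function.comp_apply, List.map_map]
      rw [← List.sum_map_mul_left]
      refine congrArg _ (List.map_congr_left fun k hk => ?_)
      have hk := List.mem_range.1 hk
      rw [if_pos (by omega), if_neg (by omega), if_pos hk, Nat.add_sub_cancel_left]; rfl
    · intro i hi
      rw [List.length_append] at hi
      by_cases h : i < β.length
      · exact ⟨α.length + i, by rw [List.getElem?_append_left (by simpa using h)]; simp [h],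
          by simp [Tup.entries_append, h]⟩
      · refine ⟨i - β.length, ?_, ?_⟩
        · rw [List.getElem?_append_right (by rw [List.length_map, List.length_range]; omega), List.length_map, List.length_range,
            List.getElem?_range (by omega)]
        · rw [Tup.entries_append, Tup.entries_append, if_neg h, if_pos (by omega)]
  rw [← zsign_intCast]
  have h2 : ∀ (l : Tup A.Hom α) ε, l.HasDeg ε → ((List.range α.length).map ε).sum = p →
      tensAct A (DPlus.symm K α β) (tmul l.prod v') =
        zsign K ((p * q : ℤ) : ZMod 2) • tmul v' l.prod := fun l ε hl hp =>
    tens_grade_le (S := LinearMap.eqLocus (tensAct A (DPlus.symm K α β) ∘ₗ tmulAux α β l.prod)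
      (zsign K ((p * q : ℤ) : ZMod 2) • (tmulAux β α).flip l.prod))
      (fun m ε' hm hq => h l m ε ε' hl hm hp hq) hv'
  exact tens_grade_le (S := LinearMap.eqLocus (tensAct A (DPlus.symm K α β) ∘ₗ
    (tmulAux α β).flip v') (zsign K ((p * q : ℤ) : ZMod 2) • tmulAux β α v'))
    (fun l ε hl hp => h2 l ε hl hp) hv

/-- The unital extended A-infinity category of iterated tensor products of morphism complexes. -/
def toExt (A : AInfCat.{u,v,max u w} K Λ) : ExtAInfCat.{u,v,max u w} K Λ where
  obj := tens.{u,v,w} A.Hom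
  act := tensAct A
  act_mem x _ _ hv := by rw [tensAct_of]; exact forestAct_mem x hv
  act_d := tensAct_d
  act_id _ := tensAct_id
  act_comp := tensAct_comp
  mul := tmul
  mul_mem := tmul_mem
  d_mul := d_tmul
  act_tensor := tensAct_tensor
  mul_assoc := tmul_assoc
  mul_symm := tensAct_symm
  unit := tunit
  unit_mem := tunit_mem
  d_unit := d_tunit
  unit_mul := tmul_tunit
  mul_unit := tmul_tunit_right
  hsplit_mul α β := HomologyBijective.of_bijective (fun z => by
    induction z with
    | zero => simp only [map_zero]
    | add x y hx hy => simp only [map_add, hx, hy]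
    | tmul s t => exact (d_tmul s t).symm) (bijective_lift_tmul α β)
  hsplit_unit := HomologyBijective.of_bijective (fun z => by
    rw [LinearMap.toSpanSingleton_apply, LinearMap.toSpanSingleton_apply, map_smul, d_tunit]
    simp) (by
    refine ⟨fun x y h => ?_, fun z => ⟨_, (tens_nil z).symm⟩⟩
    have := congrArg (nlift (M := A.Hom) (1 : K)) h
    simpa using this)

end AInfCat

namespace Forest

/-- The irreducible disc with `n` incoming points. -/
def cor (n : ℕ) : Forest := node (ofLabels (List.range n)) nil

lemma deg_cor (n : ℕ) : (cor n).deg = n - 2 := by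
  simp [cor, deg, width_ofLabels, deg_ofLabels]

lemma gluingSign_cor (n : ℕ) (F : Forest) : ((cor n).gluingSign F : ZMod 2) = 0 := by
  rw [gluingSign, Nat.cast_add, shuffle_natCast, invSign_natCast, cor, leaves, leaves_ofLabels]
  simp only [leaves, List.append_nil]
  rw [inv_of_pairwise List.pairwise_lt_range, shuf, shuf_ofLabels]
  simp [deg, shuf]

lemma cor_subst (F : Forest) : (cor F.width).subst F.tree = F.join := by
  simp [cor, subst, ofLabels_subst_tree, append_nil]

lemma stable_cor {n : ℕ} (h : n ≠ 1) : (cor n).Stable := by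
  refine ⟨?_, trivial⟩
  rcases Nat.eq_zero_or_pos n with rfl | hn
  · exact Or.inl rfl
  · refine Or.inr ⟨by rw [width_ofLabels, List.length_range]; omega, ?_⟩
    generalize List.range n = l
    induction l with
    | nil => trivial
    | cons i l ih => exact ih

end Forest

lemma DPlus.isCell_cor {γ : DPlus.Obj Λ} {p : Λ × Λ}
    (hγ : IsPath γ (List.range γ.length) p.1 p.2) (h : γ.length ≠ 1) :
    IsCell γ [p] (Forest.cor γ.length) := by
  refine ⟨by simp [Forest.cor, Forest.leaves, Forest.leaves_ofLabels], ?_, Forest.stable_cor h⟩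
  rw [Forest.cor, Forest.legs_node, Forest.legs_nil, Forest.leaves_ofLabels]
  exact .cons hγ .nil

namespace ExtAInfCat

open Chain Forest AInfCat

variable (Φ : ExtAInfCat.{u,v,w} K Λ)

/-- The morphism complexes of a unital extended A-infinity category. -/
abbrev hom (a b : Λ) : Cx.{u,w} K := Φ.obj [(a, b)]

/-- Elements of the complexes of all objects. -/
abbrev Elt := Σ α : DPlus.Obj Λ, (Φ.obj α).X

variable {Φ}

def emul (s t : Φ.Elt) : Φ.Elt := ⟨s.1 ++ t.1, Φ.mul s.2 t.2⟩

lemma emul_assoc (r s t : Φ.Elt) : emul (emul r s) t = emul r (emul s t) :=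
  Sigma.ext (List.append_assoc _ _ _) (Φ.mul_assoc _ _ _)

lemma emul_unit (s : Φ.Elt) : emul s ⟨[], Φ.unit⟩ = s :=
  Sigma.ext (List.append_nil _) (Φ.mul_unit _)

lemma unit_emul (s : Φ.Elt) : emul ⟨[], Φ.unit⟩ s = s :=
  Sigma.ext rfl (heq_of_eq (Φ.unit_mul _))

/-- The product of the entries of a sequence. -/
def celt : ∀ {a b : Λ}, ChainOf Φ.hom a b → Φ.Elt
  | _, _, .nil _ => ⟨[], Φ.unit⟩
  | _, _, @Chain.cons _ _ a b _ x l => emul ⟨[(a, b)], x⟩ (celt l)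

lemma celt_append (k : ChainOf Φ.hom a b) (l : ChainOf Φ.hom b c) :
    celt (k.append l) = emul (celt k) (celt l) := by
  induction k with
  | nil => exact (unit_emul _).symm
  | cons x k ih => rw [Chain.append, celt, ih, celt, emul_assoc]

lemma length_celt (k : ChainOf Φ.hom a b) : (celt k).1.length = k.length := by
  induction k <;> grind [celt, emul, List.length_append, length, add_comm]

lemma isPath_celt (k : ChainOf Φ.hom a b) :
    DPlus.IsPath (celt k).1 (List.range k.length) a b := by
  induction k with
  | nil => rfl
  | @cons a c b x k ih =>
    rw [length, List.range_succ_eq_map]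
    refine ⟨c, rfl, ?_⟩
    rw [show Nat.succ = fun x => [(a, c)].length + x from funext fun x => add_comm x 1]
    exact ih.right [(a, c)]

lemma isCell_cor {k : ChainOf Φ.hom a b} {n : ℕ} (hk : k.length = n) (h : n ≠ 1) :
    DPlus.IsCell (celt k).1 [(a, b)] (cor n) := by
  have hl := (length_celt k).trans hk
  subst hk
  rw [← hl] at h ⊢
  exact DPlus.isCell_cor (hl ▸ isPath_celt k) h

variable (Φ) in
/-- The action of a forest, zero if it is not a cell. -/
def cact (F : Forest) (α β : DPlus.Obj Λ) : (Φ.obj α).X →ₗ[K] (Φ.obj β).X :=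
  open Classical in if h : DPlus.IsCell α β F then Φ.act (DPlus.of K ⟨F, h⟩) else 0

abbrev eact (F : Forest) (β : DPlus.Obj Λ) (s : Φ.Elt) : (Φ.obj β).X :=
  Φ.cact F s.1 β s.2

lemma cact_eq {α β : DPlus.Obj Λ} (x : DPlus.Cell α β) :
    Φ.cact x.1 α β = Φ.act (DPlus.of K x) := dif_pos x.2

lemma cact_d {F : Forest} {α β : DPlus.Obj Λ} (h : DPlus.IsCell α β F) (x : (Φ.obj α).X) :
    (F.bdry.map fun t => zsign K t.1 • Φ.cact t.2 α β x).sum =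
      (Φ.obj β).d (Φ.cact F α β x) - zsign K F.deg • Φ.cact F α β ((Φ.obj α).d x) := by
  obtain ⟨y, rfl⟩ : ∃ y : DPlus.Cell α β, y.1 = F := ⟨⟨F, h⟩, rfl⟩
  rw [cact_eq y, zsign_natCast]
  refine Eq.trans ?_ (Φ.act_d y x)
  rw [DPlus.d, DPlus.of, Finsupp.linearCombination_single, one_smul]
  refine Eq.trans ?_ (map_list_sum (Φ.act.flip x) _).symm
  rw [List.map_map, ← List.attach_map_val (l := y.1.bdry)]
  refine congrArg _ (List.map_congr_left fun t _ => ?_)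
  simp only [Function.comp_apply, map_smul, LinearMap.flip_apply]
  rw [zsign_natCast]
  exact congrArg (fun f : (Φ.obj α).X →ₗ[K] _ => (-1 : K) ^ t.1.1 • f x)
    (cact_eq ⟨_, DPlus.isCell_bdry y.2 t.1 t.2⟩)

lemma comp_of {α β γ : DPlus.Obj Λ} (y : DPlus.Cell β γ) (x : DPlus.Cell α β) :
    DPlus.comp K (DPlus.of K y) (DPlus.of K x) = DPlus.compCell K y x := by
  simp [DPlus.comp, DPlus.of, Finsupp.linearCombination_single]

lemma tensor_of {α α' β β' : DPlus.Obj Λ} (x : DPlus.Cell α β) (x' : DPlus.Cell α' β') :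
    DPlus.tensor K (DPlus.of K x) (DPlus.of K x') =
      DPlus.of K ⟨_, DPlus.isCell_append x.2 x'.2⟩ := by
  simp [DPlus.tensor, DPlus.of, Finsupp.linearCombination_single]

lemma cact_comp {F G : Forest} {α β γ : DPlus.Obj Λ} (hF : DPlus.IsCell α β F)
    (hG : DPlus.IsCell β γ G) (x : (Φ.obj α).X) :
    Φ.cact G β γ (Φ.cact F α β x) = zsign K (G.gluingSign F : ℕ) •
      (G.subst F.tree).elim 0 fun H => Φ.cact H α γ x := by
  obtain ⟨z, rfl⟩ : ∃ z : DPlus.Cell α β, z.1 = F := ⟨⟨F, hF⟩, rfl⟩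
  obtain ⟨y, rfl⟩ : ∃ y : DPlus.Cell β γ, y.1 = G := ⟨⟨G, hG⟩, rfl⟩
  rw [cact_eq y, cact_eq z, ← Φ.act_comp, comp_of]
  unfold DPlus.compCell
  split
  · next h =>
    rw [h, map_zero]; exact (smul_zero _).symm
  · next H h =>
    refine Eq.trans ?_ (congrArg (fun o : Option Forest => zsign K (y.1.gluingSign z.1 : ℕ) •
      o.elim 0 fun H => Φ.cact H α γ x) h).symm
    rw [← zsign_natCast, map_smul]
    exact congrArg (fun f : (Φ.obj α).X →ₗ[K] _ => zsign K (y.1.gluingSign z.1 : ℕ) • f x)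
      (cact_eq ⟨_, DPlus.isCell_subst hG hF h⟩).symm

lemma eact_emul {F F' : Forest} {s t : Φ.Elt} {β β' : DPlus.Obj Λ} (hF : DPlus.IsCell s.1 β F)
    (hF' : DPlus.IsCell t.1 β' F') :
    eact (F.append (F'.relabel (s.1.length + ·))) (β ++ β') (emul s t) =
      Φ.mul (Φ.cact F s.1 β (((Φ.obj s.1).sgn ^ F'.deg) s.2)) (eact F' β' t) := by
  obtain ⟨z, rfl⟩ : ∃ z : DPlus.Cell s.1 β, z.1 = F := ⟨⟨F, hF⟩, rfl⟩
  obtain ⟨y, rfl⟩ : ∃ y : DPlus.Cell t.1 β', y.1 = F' := ⟨⟨F', hF'⟩, rfl⟩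
  have h := Φ.act_tensor z y s.2 t.2
  rw [tensor_of, ← cact_eq, ← cact_eq] at h
  exact (congrArg (fun f : (Φ.obj _).X →ₗ[K] _ => f (Φ.mul s.2 t.2))
    (cact_eq ⟨_, DPlus.isCell_append z.2 y.2⟩)).trans h

lemma eact_id (s : Φ.Elt) : eact (ofLabels (List.range s.1.length)) s.1 s = s.2 :=
  (congrArg (fun f : (Φ.obj s.1).X →ₗ[K] _ => f s.2) (cact_eq ⟨_, DPlus.isCell_id _⟩)).trans
    (Φ.act_id _ _)

lemma sgn_mul {α β : DPlus.Obj Λ} (x : (Φ.obj α).X) (y : (Φ.obj β).X) :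
    (Φ.obj (α ++ β)).sgn (Φ.mul x y) = Φ.mul ((Φ.obj α).sgn x) ((Φ.obj β).sgn y) := by
  induction x using (Φ.obj α).homogeneous_induction with
  | add x x' h h' => simp only [map_add, LinearMap.add_apply, h, h']
  | mem m x hx =>
    induction y using (Φ.obj β).homogeneous_induction with
    | add y y' h h' => simp only [map_add, h, h']
    | mem n y hy =>
      rw [Cx.sgn_eq_zsign _ hx, Cx.sgn_eq_zsign _ hy, Cx.sgn_eq_zsign _ (Φ.mul_mem hx hy),
        Int.cast_add, zsign_add, map_smul, map_smul, LinearMap.smul_apply, smul_smul, mul_comm]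

/-- The parity involution on elements. -/
def esgn (n : ℕ) (s : Φ.Elt) : Φ.Elt := ⟨s.1, ((Φ.obj s.1).sgn ^ n) s.2⟩

lemma celt_map_sgn (n : ℕ) (k : ChainOf Φ.hom a b) :
    celt (k.map fun a b => (Φ.hom a b).sgn ^ n) = esgn n (celt k) := by
  have h : ∀ {α β : DPlus.Obj Λ} (x : (Φ.obj α).X) (y : (Φ.obj β).X),
      ((Φ.obj (α ++ β)).sgn ^ n) (Φ.mul x y) =
        Φ.mul (((Φ.obj α).sgn ^ n) x) (((Φ.obj β).sgn ^ n) y) := by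
    intro α β x y
    induction n with
    | zero => rfl
    | succ n ih => simp only [pow_succ', Module.End.mul_apply, ih, sgn_mul]
  induction k with
  | nil =>
    rw [Chain.map, celt, esgn, Cx.sgn_pow_eq_zsign _ Φ.unit_mem, Int.cast_zero, mul_zero, zsign_zero,
      one_smul]
  | cons x k ih =>
    rw [Chain.map, celt, ih, celt]
    exact Sigma.ext rfl (heq_of_eq (h _ _).symm)

/-- An operation applied to a sequence into which the value of a tree is inserted. -/
lemma cact_cor_insert {T : Forest} {s : Φ.Elt} {a e f b : Λ} (hT : DPlus.IsCell s.1 [(e, f)] T)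
    (p : ChainOf Φ.hom a e) (t : ChainOf Φ.hom f b) (h : p.length + (t.length + 1) ≠ 1) :
    eact (cor (p.length + (t.length + 1))) [(a, b)]
      (celt ((p.map fun a b => (Φ.hom a b).sgn ^ T.deg).append (cons (eact T [(e, f)] s) t))) =
      ((ofLabels (List.range p.length)).append ((T.append
        ((ofLabels (List.range t.length)).relabel (s.1.length + ·))).relabel (p.length + ·))).join.elim
        0 fun H => eact H [(a, b)] (emul (celt p) (emul s (celt t))) := by
  set F := (ofLabels (List.range p.length)).append ((T.append
        ((ofLabels (List.range t.length)).relabel (s.1.length + ·))).relabel (p.length + ·)) with hF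
  set k := (p.map fun a b => (Φ.hom a b).sgn ^ T.deg).append (cons (eact T [(e, f)] s) t)
  have hk : k.length = p.length + (t.length + 1) := by
    rw [length_append, length_map, length]
  have hTt := DPlus.isCell_append hT (DPlus.isCell_id (celt t).1)
  have hc := DPlus.isCell_append (DPlus.isCell_id (celt p).1) hTt
  have hFe : (ofLabels (List.range (celt p).1.length)).append ((T.append
      ((ofLabels (List.range (celt t).1.length)).relabel (s.1.length + ·))).relabel
        ((celt p).1.length + ·)) = F := by rw [length_celt, length_celt]
  have hct : celt k = ⟨(celt p).1 ++ ([(e, f)] ++ (celt t).1),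
      eact F _ (emul (celt p) (emul s (celt t)))⟩ := by
    have h1 := eact_emul (Φ := Φ) (s := celt p) (t := emul s (celt t)) (DPlus.isCell_id _) hTt
    have h2 := eact_emul hT (DPlus.isCell_id (celt t).1)
    rw [deg_append, deg_relabel, deg_ofLabels, add_zero, h2, deg_ofLabels, pow_zero] at h1
    rw [celt_append, celt_map_sgn, celt]
    refine Sigma.ext rfl (heq_of_eq ?_)
    rw [← hFe, h1]
    exact congrArg₂ (fun x y => Φ.mul x (Φ.mul _ y)) (eact_id (esgn T.deg (celt p))).symm
      (eact_id (celt t)).symm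
  have hG : DPlus.IsCell (celt k).1 [(a, b)] (cor (p.length + (t.length + 1))) := isCell_cor hk h
  rw [hct] at hG ⊢
  refine (cact_comp (hFe ▸ hc) hG _).trans ?_
  have hw : F.width = p.length + (t.length + 1) := by
    rw [hF, width_append, width_ofLabels, width_relabel, width_append, width_relabel,
      width_ofLabels, ← length_legs T, hT.2.1.length_eq, List.length_range, List.length_range]
    simp [add_comm]
  rw [gluingSign_cor, zsign_zero, one_smul, ← hw, cor_subst]

end ExtAInfCat

lemma Chain.sumSplits_congr_append {H : Λ → Λ → Type w} {N : Type*} [AddCommMonoid N]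
    (c : Chain H a b) {g g' : ∀ e, Chain H a e → Chain H e b → N}
    (h : ∀ e p q, p.append q = c → g e p q = g' e p q) : c.sumSplits g = c.sumSplits g' := by
  induction c with
  | nil => exact h _ _ _ rfl
  | cons x l ih =>
    rw [sumSplits_cons, sumSplits_cons, h _ _ _ rfl, ih fun e p q hl => h _ (cons x p) q (by rw [append, hl])]

namespace Forest

lemma relabel_ofLabels_range (o s n : ℕ) :
    (ofLabels (List.range' s n)).relabel (o + ·) = ofLabels (List.range' (o + s) n) := by
  induction n generalizing s <;> grind [List.range'_succ, ofLabels, relabel, add_assoc]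

lemma sum_splits_ofLabels {H : Λ → Λ → Type w} {N : Type*} [AddCommMonoid N]
    (k : Chain H a b) (o : ℕ) (g : Forest → Forest → N) :
    ((ofLabels (List.range' o k.length)).splits.map fun s => g s.1 s.2).sum =
      k.sumSplits fun _ p w => g (ofLabels (List.range' o p.length))
        (ofLabels (List.range' (o + p.length) w.length)) := by
  induction k generalizing o g with
  | nil => simp [ofLabels, splits, Chain.length]
  | cons x l ih =>
    simp only [Chain.length, List.range'_succ, ofLabels, splits, List.map_cons, List.sum_cons,
      List.map_map, Function.comp_def, Chain.sumSplits_cons, List.range'_zero, add_zero,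
      ih (o + 1) fun s t => g (leaf o s) t, add_assoc, add_comm 1]

lemma hasUnit_append (F G : Forest) : (F.append G).HasUnit ↔ F.HasUnit ∨ G.HasUnit := by
  induction F <;> simp_all [append, HasUnit, or_assoc]

lemma not_hasUnit_ofLabels (l : List ℕ) : ¬ (ofLabels l).HasUnit := by
  induction l with
  | nil => exact id
  | cons i l ih => exact ih

lemma join_eq_none {c : Forest} (hu : c.HasUnit) (hw : 3 ≤ c.width) : c.join = none := by
  unfold join
  rw [if_pos hu]
  split <;> first | rfl | simp [width] at hw

lemma join_eq_some {c : Forest} (hu : ¬ c.HasUnit) : c.join = some (node c nil) := by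
  unfold join
  rw [if_neg hu]

end Forest

namespace ExtAInfCat

open Chain Forest AInfCat

variable {Φ : ExtAInfCat.{u,v,w} K Λ}

lemma dSum_celt {M : Type*} [AddCommGroup M] [Module K M] (k : ChainOf Φ.hom a b)
    (g : ∀ α, (Φ.obj α).X →ₗ[K] M) :
    dSum k (fun l => g _ (celt l).2) = g _ ((Φ.obj _).d (celt k).2) := by
  induction k generalizing g with
  | nil => exact ((congrArg _ Φ.d_unit).trans (map_zero _)).symm
  | cons x l ih =>
    refine Eq.trans ?_ (congrArg (g _) (Φ.d_mul x (celt l).2)).symm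
    rw [dSum, map_add]
    exact congrArg _ (ih fun α => g (_ :: α) ∘ₗ Φ.mul (α := [_]) ((Φ.hom _ _).sgn x))

lemma cact_mem {F : Forest} {α β : DPlus.Obj Λ} (h : DPlus.IsCell α β F) {n : ℤ} {x : (Φ.obj α).X}
    (hx : x ∈ (Φ.obj α).grade n) : Φ.cact F α β x ∈ (Φ.obj β).grade (F.deg + n) := by
  obtain ⟨y, rfl⟩ : ∃ y : DPlus.Cell α β, y.1 = F := ⟨⟨F, h⟩, rfl⟩
  rw [cact_eq y]
  exact Φ.act_mem y hx

lemma celt_mem {k : ChainOf Φ.hom a b} {n : ℤ} (h : k.Homogeneous n) :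
    (celt k).2 ∈ (Φ.obj (celt k).1).grade n := by
  induction k generalizing n with
  | nil => obtain rfl : n = 0 := h; exact Φ.unit_mem
  | cons x l ih =>
    obtain ⟨p, q, hx, hq, rfl⟩ := h
    exact Φ.mul_mem hx (ih hq)

lemma slotLinear_cact (F : Forest) (β : DPlus.Obj Λ) :
    SlotLinear K fun k : ChainOf Φ.hom a b => eact F β (celt k) := by
  have h : ∀ {c e : Λ} (l : ChainOf Φ.hom a c) (l' : ChainOf Φ.hom e b) (x : (Φ.hom c e).X),
      eact F β (celt (l.append (cons x l'))) =
        (Φ.cact F _ β ∘ₗ Φ.mul (celt l).2 ∘ₗ (Φ.mul (α := [(c, e)])).flip (celt l').2) x :=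
    fun l l' x => by rw [celt_append]; rfl
  exact ⟨fun l x y l' => by rw [h, h, h, map_add], fun l z x l' => by rw [h, h, map_smul]⟩

def op : ∀ {a b : Λ}, ChainOf Φ.hom a b → (Φ.hom a b).X
  | _, _, .nil _ => 0
  | _, _, .cons x (.nil _) => (Φ.hom _ _).d x
  | a, b, .cons x (.cons y l) => eact (cor (l.length + 2)) [(a, b)] (celt (cons x (cons y l)))

lemma op_eq {k : ChainOf Φ.hom a b} {n : ℕ} (hk : k.length = n) (hn : 2 ≤ n) :
    op k = eact (cor n) [(a, b)] (celt k) := by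
  subst hk
  match k, hn with
  | .nil _, h => simp [length] at h
  | .cons _ (.nil _), h => simp [length] at h
  | .cons _ (.cons _ _), _ => rfl

lemma zsign_sub_two {n : ℕ} (h : 2 ≤ n) : ((n - 2 : ℕ) : ZMod 2) = n := by grind [Nat.cast_sub, sub_zero]

lemma midSum_op {k : ChainOf Φ.hom a b} (hk : 2 ≤ k.length) :
    midSum op k.length k op =
      ((cor k.length).bdry.map fun t => zsign K t.1 • eact t.2 [(a, b)] (celt k)).sum := by
  have hb : ∀ l : List ℕ, (ofLabels l).bdry = [] := fun l => by
    induction l with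
    | nil => rfl
    | cons i l ih => rw [ofLabels, bdry, ih]; rfl
  let g : Forest → Forest → Forest → (Φ.hom a b).X := fun x y y' =>
    if 2 ≤ y.width ∧ y.width < k.length then
      zsign K (1 + x.width + y.width * y'.width + y.width * x.deg) •
        eact (node (x.append (node y y')) nil) [(a, b)] (celt k) else 0
  have e : ((cor k.length).bdry.map fun t => zsign K t.1 • eact t.2 [(a, b)] (celt k)).sum =
      ((ofLabels (List.range' 0 k.length)).splits.map fun x =>
        (x.2.splits.map fun y => g x.1 y.1 y.2).sum).sum := by
    rw [cor, bdry, hb, bdry, List.map_nil, List.append_nil, List.map_nil, List.append_nil,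
      List.map_map, expand, list_sum_map_flatMap, List.range_eq_range']
    simp only [list_sum_map_filterMap, width_ofLabels, List.length_range']
    refine congrArg _ (List.map_congr_left fun x _ => congrArg _ (List.map_congr_left fun y _ => ?_))
    simp only [g]
    split_ifs
    · simp
    · rfl
  rw [e, sum_splits_ofLabels k 0 fun x w => (w.splits.map fun y => g x y.1 y.2).sum, midSum]
  refine sumSplits_congr_append k fun e p w hpw => ?_
  rw [sum_splits_ofLabels w _ (g _)]
  refine sumSplits_congr_append w fun f q t hqt => ?_
  subst hqt hpw
  simp only [g, width_ofLabels, List.length_range', deg_ofLabels, Nat.cast_zero, mul_zero, add_zero,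
    zero_add]
  split_ifs with hq
  · have hl : p.length + (t.length + 1) ≠ 1 := by
      have := hq.2
      rw [length_append, length_append] at this
      omega
    have hd : ∀ (V : Cx.{u,w} K) (x : V.X), (V.sgn ^ q.length) x = (V.sgn ^ (cor q.length).deg) x := by
      intro V x
      obtain ⟨m, hm⟩ : ∃ m, q.length = m + 2 := ⟨q.length - 2, by omega⟩
      rw [deg_cor, hm, Nat.add_sub_cancel, pow_add, pow_two, Module.End.mul_apply,
        Module.End.mul_apply, V.sgn_sgn]
    have hT := isCell_cor (k := q) rfl (by omega)
    rw [map_congr fun a b x => hd (Φ.hom a b) x, op_eq rfl hq.1,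
      op_eq (n := p.length + (t.length + 1)) (by rw [length_append, length_map, length]) (by omega),
      cact_cor_insert hT p t hl, cor, relabel_append, relabel, length_celt, List.range_eq_range',
      List.range_eq_range', List.range_eq_range', relabel_ofLabels_range, relabel_ofLabels_range,
      relabel_ofLabels_range, join_eq_some, Option.elim_some, celt_append,
      celt_append]
    · rfl
    · rw [hasUnit_append]
      rintro (h | h | h)
      · exact not_hasUnit_ofLabels _ h
      · have := congrArg width h
        rw [width_ofLabels, List.length_range'] at this
        exact absurd hq.1 (by rw [this]; decide)
      · exact not_hasUnit_ofLabels _ h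
  · rfl

lemma stasheffSum_op (k : ChainOf Φ.hom a b) : stasheffSum Φ.hom op k = 0 := by
  by_cases hk : 2 ≤ k.length
  · have hd := cact_d (Φ := Φ) (isCell_cor (k := k) rfl (by omega)) (celt k).2
    rw [← midSum_op hk, deg_cor, zsign_sub_two hk, ← dSum_celt k fun α => Φ.cact (cor k.length) α _] at hd
    rw [stasheffSum_eq (fun _ => rfl) hk, hd, dSum_congr fun l hl => op_eq hl hk, op_eq rfl hk]
    abel
  · match k, hk with
    | .nil _, _ => simp [stasheffSum, Chain.splits, length]
    | .cons x (.nil _), _ => simp [stasheffSum, Chain.splits, length, Chain.append, Chain.map, op, Cx.d_d]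
    | .cons _ (.cons _ _), h => simp [length] at h

lemma slotLinear_op (a b : Λ) : SlotLinear K (op (Φ := Φ) (a := a) (b := b)) := by
  refine ⟨fun l x y l' => ?_, fun l z x l' => ?_⟩
  all_goals
    by_cases h : 2 ≤ l.length + (l'.length + 1)
    · have h' := fun z => op_eq (k := l.append (cons z l')) (length_append _ _) h
      simp only [h']
      first | exact (slotLinear_cact _ _).add l x y l' | exact (slotLinear_cact _ _).smul l z x l'
    · cases l with
      | cons _ l => simp [length] at h; omega
      | nil =>
        cases l' with
        | cons _ l' => simp [length] at h
        | nil => first | exact map_add _ _ _ | exact map_smul _ _ _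

variable (Φ) in
def one (a : Λ) : (Φ.hom a a).X := eact (cor 0) [(a, a)] ⟨[], Φ.unit⟩

lemma isCell_one (a : Λ) : DPlus.IsCell [] [(a, a)] (cor 0) :=
  ⟨.refl _, .cons rfl .nil, Or.inl rfl, trivial⟩

lemma op_one {l : ChainOf Φ.hom a b} {l' : ChainOf Φ.hom b c}
    (h : 2 ≤ (l.append (cons (Φ.one b) l')).length) :
    op (l.append (cons (Φ.one b) l')) =
      ((ofLabels (List.range' 0 l.length)).append
        (node nil (ofLabels (List.range' l.length l'.length)))).join.elim 0 fun H =>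
          eact H [(a, c)] (emul (celt l) (celt l')) := by
  rw [op_eq rfl h]
  rw [length_append, length] at h ⊢
  have := cact_cor_insert (s := ⟨[], Φ.unit⟩) (isCell_one b) l l' (by omega)
  simp only [unit_emul, deg_cor] at this
  rw [Chain.map_id' (f := fun a b => ⇑((Φ.hom a b).sgn ^ (0 - 2))) (fun _ _ _ => rfl)] at this
  refine this.trans ?_
  rw [cor, relabel_append, relabel]
  simp only [List.range_eq_range', relabel_ofLabels_range, add_zero]
  rfl

/-- The unital A-infinity category underlying a unital extended A-infinity category. -/
def toAInf (Φ : ExtAInfCat.{u,v,w} K Λ) : AInfCat.{u,v,w} K Λ where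
  Hom := Φ.hom
  m := op
  m_nil _ := rfl
  m_single _ := rfl
  m_add := (slotLinear_op _ _).add
  m_smul := (slotLinear_op _ _).smul
  m_mem l n h := by
    match l, h with
    | .nil _, _ => exact Submodule.zero_mem _
    | .cons x (.nil _), h =>
      obtain ⟨p, q, hx, hq, rfl⟩ := h
      obtain rfl : q = 0 := hq
      have e : p + 0 + ((cons x (.nil _) : ChainOf Φ.hom _ _).length : ℤ) - 2 = p - 1 := by
        simp [length]; ring
      rw [e]
      exact (Φ.hom _ _).d_mem hx
    | .cons x (.cons y l), h =>
      have h2 : 2 ≤ (cons x (cons y l)).length := by simp [length]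
      rw [op_eq rfl h2]
      have := cact_mem (isCell_cor (k := cons x (cons y l)) rfl (by omega)) (celt_mem h)
      rw [deg_cor, Nat.cast_sub h2] at this
      exact (by ring : n + ((cons x (cons y l)).length : ℤ) - 2 =
        (((cons x (cons y l)).length : ℤ) - (2 : ℕ)) + n) ▸ this
  stasheff := stasheffSum_op
  one := Φ.one
  one_mem a := cact_mem (isCell_one a) Φ.unit_mem
  d_one a := by
    have := cact_d (isCell_one a) Φ.unit
    rw [Φ.d_unit, map_zero] at this
    simpa [cor, ofLabels, bdry, expand, Forest.splits, width, one] using this.symm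
  one_mul {a b} x := by
    refine (op_one (l := .nil a) (l' := cons x (.nil b)) (by simp [Chain.append, length])).trans ?_
    have : (node nil (leaf 0 nil)).join = some (leaf 0 nil) := by
      unfold join; exact if_pos (Or.inl rfl)
    refine (congrArg (fun o : Option Forest => o.elim 0 fun H => eact H [(a, b)]
      (emul ⟨[], Φ.unit⟩ (emul ⟨[(a, b)], x⟩ ⟨[], Φ.unit⟩))) this).trans ?_
    rw [unit_emul, emul_unit]
    exact eact_id ⟨[(a, b)], x⟩
  mul_one {a b} x := by
    refine (op_one (l := cons x (.nil b)) (l' := .nil b) (by simp [Chain.append, length])).trans ?_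
    have : (leaf 0 (node nil nil)).join = some (leaf 0 nil) := by
      unfold join; exact if_pos (Or.inl rfl)
    refine (congrArg (fun o : Option Forest => o.elim 0 fun H => eact H [(a, b)]
      (emul (emul ⟨[(a, b)], x⟩ ⟨[], Φ.unit⟩) ⟨[], Φ.unit⟩)) this).trans ?_
    rw [emul_unit, emul_unit]
    exact eact_id ⟨[(a, b)], x⟩
  m_one l l' h := by
    rw [op_one (by omega), join_eq_none]
    · rfl
    · rw [hasUnit_append]; exact Or.inr (Or.inl rfl)
    · rw [length_append, length] at h
      rw [width_append, width_ofLabels, width, width_ofLabels, List.length_range', List.length_range']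
      exact h

end ExtAInfCat

namespace Forest

lemma relabel_relabel (f g : ℕ → ℕ) (F : Forest) :
    (F.relabel f).relabel g = F.relabel fun i => g (f i) := by
  induction F <;> grind [relabel]

lemma relabel_congr {f g : ℕ → ℕ} {F : Forest} (h : ∀ i ∈ F.leaves, f i = g i) :
    F.relabel f = F.relabel g := by
  induction F <;> grind [relabel, leaves]

lemma relabel_id (F : Forest) : (F.relabel fun i => i) = F := by
  induction F <;> grind [relabel]

lemma relabel_ofLabels (f : ℕ → ℕ) (l : List ℕ) :
    (ofLabels l).relabel f = ofLabels (l.map f) := by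
  induction l <;> grind [ofLabels, relabel]

lemma Reduced.not_hasUnit {F : Forest} (h : F.Reduced) : ¬ F.HasUnit := by
  induction F with
  | nil => exact id
  | leaf i r ih => exact ih h
  | node c r _ ih =>
    rintro (rfl | h')
    · exact absurd h.1 (by decide)
    · exact ih h.2.2 h'

lemma not_hasUnit_of_stable {c : Forest} (h : (node c nil).Stable) : ¬ c.HasUnit := by
  rcases h.1 with rfl | h
  · exact id
  · exact h.2.not_hasUnit

lemma subst_leaf {S : ℕ → Forest} {g : ℕ → ℕ} {F : Forest} (hF : F.Stable)
    (hS : ∀ j ∈ F.leaves, S j = leaf (g j) nil) : F.subst S = some (F.relabel g) := by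
  induction F with
  | nil => rfl
  | leaf i r ih =>
    rw [subst, hS i (by simp [leaves]), ih hF fun j hj => hS j (by simp [leaves, hj])]; rfl
  | node c r ihc ih =>
    have hc : (node c nil).Stable := ⟨hF.1, trivial⟩
    have hcs : c.Stable := by
      rcases hF.1 with rfl | h
      · trivial
      · exact h.2.stable
    rw [subst, ihc hcs fun j hj => hS j (by simp [leaves, hj]),
      ih hF.2 fun j hj => hS j (by simp [leaves, hj]), Option.bind_some,
      join_eq_some (not_hasUnit_of_stable (hc.relabel g))]
    rfl

end Forest

lemma DPlus.IsPath.map {α α' : Obj Λ} {f : ℕ → ℕ} {l : List ℕ} (h : IsPath α l a b)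
    (hf : ∀ i ∈ l, α'[f i]? = α[i]?) : IsPath α' (l.map f) a b := by
  induction l generalizing a with
  | nil => exact h
  | cons i l ih =>
    obtain ⟨c, h1, h2⟩ := h
    exact ⟨c, (hf i (by simp)).trans h1, ih h2 fun j hj => hf j (by simp [hj])⟩

lemma DPlus.IsPath.exists_forall₂ {α : Obj Λ} {L : List (List ℕ)}
    (h : IsPath α L.flatten a b) : ∃ γ : Obj Λ, List.Forall₂ (fun l p => IsPath α l p.1 p.2) L γ ∧
      IsPath γ (List.range γ.length) a b := by
  have happ : ∀ (l l' : List ℕ) (a : Λ), IsPath α (l ++ l') a b →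
      ∃ c, IsPath α l a c ∧ IsPath α l' c b := fun l l' => by
    induction l with
    | nil => exact fun a h => ⟨a, rfl, h⟩
    | cons i l ih =>
      rintro a ⟨c, h1, h2⟩
      obtain ⟨e, h3, h4⟩ := ih c h2
      exact ⟨e, ⟨c, h1, h3⟩, h4⟩
  induction L generalizing a with
  | nil => exact ⟨[], .nil, h⟩
  | cons l L ih =>
    obtain ⟨c, h1, h2⟩ := happ _ _ _ h
    obtain ⟨γ, h3, h4⟩ := ih h2
    refine ⟨(a, c) :: γ, .cons h1 h3, ?_⟩
    rw [List.length_cons, List.range_succ_eq_map]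
    exact ⟨c, rfl, h4.map fun i _ => rfl⟩

lemma List.Nodup.map_idxOf_self {l : List ℕ} (h : l.Nodup) : l.map l.idxOf = List.range l.length := by
  refine List.ext_getElem (by simp) fun i h1 h2 => ?_
  rw [List.getElem_map, List.getElem_range, h.idxOf_getElem]

namespace ExtAInfCat

open Chain Forest AInfCat

variable {X Y : ExtAInfCat.{u,v,w} K Λ}
  {ψ : ∀ α, Cx.Hom (X.obj α) (Y.obj α)} {α α' β β' γ : DPlus.Obj Λ} {F F' G H : Forest}

/-- The forest is a cell, and the maps commute with its actions. -/
def Compat (ψ : ∀ α, Cx.Hom (X.obj α) (Y.obj α)) (α β : DPlus.Obj Λ) (F : Forest) : Prop :=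
  DPlus.IsCell α β F ∧ ∀ x, (ψ β).f (X.cact F α β x) = Y.cact F α β ((ψ α).f x)

lemma compat_id (ψ : ∀ α, Cx.Hom (X.obj α) (Y.obj α)) (α : DPlus.Obj Λ) :
    Compat ψ α α (ofLabels (List.range α.length)) :=
  ⟨DPlus.isCell_id α, fun x => (congrArg (ψ α).f (eact_id ⟨α, x⟩)).trans
    (eact_id ⟨α, (ψ α).f x⟩).symm⟩

lemma Compat.subst (hF : Compat ψ α β F) (hG : Compat ψ β γ G) (h : G.subst F.tree = some H) :
    Compat ψ α γ H := by
  refine ⟨DPlus.isCell_subst hG.1 hF.1 h, fun x => ?_⟩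
  have h1 := cact_comp hF.1 hG.1 x
  have h2 := cact_comp hF.1 hG.1 ((ψ α).f x)
  rw [h] at h1 h2
  rw [← hF.2, ← hG.2, h1, map_smul] at h2
  have := congrArg (zsign K (G.gluingSign F : ℕ) • ·) h2
  simpa only [smul_smul, zsign_mul_self, one_smul, Option.elim_some] using this

/-- The maps are compatible with products, and products span. -/
structure IsMul (ψ : ∀ α, Cx.Hom (X.obj α) (Y.obj α)) : Prop where
  map_mul : ∀ {α β} (x : (X.obj α).X) (y : (X.obj β).X),
    (ψ (α ++ β)).f (X.mul x y) = Y.mul ((ψ α).f x) ((ψ β).f y)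
  span : ∀ α β, Function.Surjective (TensorProduct.lift (X.mul (α := α) (β := β)))

lemma IsMul.ext (hψ : IsMul ψ) {N : Type*} [AddCommGroup N] [Module K N]
    {f g : (X.obj (α ++ β)).X →ₗ[K] N} (h : ∀ (i j : ℤ), ∀ x ∈ (X.obj α).grade i,
      ∀ y ∈ (X.obj β).grade j, f (X.mul x y) = g (X.mul x y)) (z) : f z = g z := by
  obtain ⟨t, rfl⟩ := hψ.span α β z
  induction t with
  | zero => simp only [map_zero]
  | add s t hs ht => simp only [map_add, hs, ht]
  | tmul x y =>
    rw [TensorProduct.lift.tmul]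
    induction x using (X.obj α).homogeneous_induction with
    | add x x' h h' => simp only [map_add, LinearMap.add_apply, h, h']
    | mem m x hx =>
      induction y using (X.obj β).homogeneous_induction with
      | add y y' h h' => simp only [map_add, h, h']
      | mem n y hy => exact h m n x hx y hy

lemma Compat.append (hψ : IsMul ψ) (hF : Compat ψ α β F) (hF' : Compat ψ α' β' F') :
    Compat ψ (α ++ α') (β ++ β') (F.append (F'.relabel (α.length + ·))) := by
  refine ⟨DPlus.isCell_append hF.1 hF'.1, hψ.ext (f := (ψ _).f ∘ₗ X.cact _ _ _)
    (g := Y.cact _ _ _ ∘ₗ (ψ _).f) fun m n x hx y _ => ?_⟩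
  have h1 := eact_emul (s := ⟨α, x⟩) (t := ⟨α', y⟩) hF.1 hF'.1
  have h2 := eact_emul (s := ⟨α, (ψ α).f x⟩) (t := ⟨α', (ψ α').f y⟩) hF.1 hF'.1
  simp only [eact, emul] at h1 h2
  refine (congrArg (ψ _).f h1).trans (Eq.trans ?_ (h2.symm.trans (congrArg (Y.cact _ _ _)
    (hψ.map_mul x y).symm)))
  rw [hψ.map_mul, hF.2, hF'.2, Cx.sgn_pow_eq_zsign _ hx, Cx.sgn_pow_eq_zsign _ ((ψ α).map_mem hx), map_smul]

lemma compat_symm (hψ : IsMul ψ) (α β : DPlus.Obj Λ) : Compat ψ (α ++ β) (β ++ α)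
    (ofLabels ((List.range β.length).map (α.length + ·) ++ List.range α.length)) := by
  refine ⟨DPlus.isCell_symm α β, hψ.ext (f := (ψ _).f ∘ₗ X.cact _ _ _)
    (g := Y.cact _ _ _ ∘ₗ (ψ _).f) fun m n x hx y hy => ?_⟩
  have h1 := X.mul_symm hx hy
  have h2 := Y.mul_symm ((ψ α).map_mem hx) ((ψ β).map_mem hy)
  have e := fun Z : ExtAInfCat.{u,v,w} K Λ => cact_eq (Φ := Z) ⟨_, DPlus.isCell_symm α β⟩
  refine (congrArg (ψ _).f ((LinearMap.congr_fun (e X) _).trans h1)).trans (Eq.trans ?_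
    ((congrArg (Y.cact _ _ _) (hψ.map_mul x y)).trans ((LinearMap.congr_fun (e Y) _).trans h2)).symm)
  rw [map_smul, hψ.map_mul]

lemma compat_perm (hψ : IsMul ψ) (κ : ℕ → Λ × Λ) {l l' : List ℕ} (h : l.Perm l') (hn : l.Nodup) :
    Compat ψ (l.map κ) (l'.map κ) (ofLabels (l'.map fun i => l.idxOf i)) := by
  induction h with
  | nil => exact compat_id ψ []
  | @cons x l l' h ih =>
    rw [List.nodup_cons] at hn
    have := (compat_id ψ [κ x]).append hψ (ih hn.2)
    rw [relabel_ofLabels, List.map_map] at this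
    have e : (x :: l').map (fun i => (x :: l).idxOf i) =
        0 :: l'.map ((fun i => [κ x].length + i) ∘ fun i => l.idxOf i) := by
      rw [List.map_cons, List.idxOf_cons_self]
      refine congrArg _ (List.map_congr_left fun z hz => ?_)
      rw [List.idxOf_cons_ne _ (by rintro rfl; exact hn.1 (h.mem_iff.2 hz))]
      exact add_comm _ 1
    rw [e]
    exact this
  | swap x y l =>
    simp only [List.nodup_cons, List.mem_cons, not_or] at hn
    have := (compat_symm hψ [κ y] [κ x]).append hψ (compat_id ψ (l.map κ))
    rw [relabel_ofLabels] at this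
    have e : (x :: y :: l).map (fun i => (y :: x :: l).idxOf i) =
        1 :: 0 :: (List.range (l.map κ).length).map (([κ y] ++ [κ x]).length + ·) := by
      rw [List.map_cons, List.map_cons, List.idxOf_cons_self, List.idxOf_cons_ne _ hn.1.1,
        List.idxOf_cons_self, List.length_map, ← hn.2.2.map_idxOf_self, List.map_map]
      refine congrArg _ (congrArg _ (List.map_congr_left fun z hz => ?_))
      rw [List.idxOf_cons_ne _ (by rintro rfl; exact hn.1.2 hz),
        List.idxOf_cons_ne _ (by rintro rfl; exact hn.2.1 hz)]
      exact add_comm _ 2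
    rw [e]
    exact this
  | @trans l₁ l₂ l₃ h h' ih ih' =>
    refine (ih hn).subst (ih' (h.nodup_iff.1 hn)) ?_
    have hg : ∀ z ∈ l₃, l₂[l₂.idxOf z]? = some z := fun z hz => by
      have := List.idxOf_lt_length_of_mem (h'.mem_iff.2 hz)
      rw [List.getElem?_eq_getElem this, List.getElem_idxOf]
    rw [subst_leaf (g := fun j => l₁.idxOf (l₂.getD j 0)) (stable_ofLabels _) fun j hj => ?_,
      relabel_ofLabels, List.map_map, List.map_congr_left fun z hz => ?_]
    · rw [Function.comp_apply, List.getD_eq_getElem?_getD, hg z hz]; rfl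
    · rw [leaves_ofLabels, List.mem_map] at hj
      obtain ⟨z, hz, rfl⟩ := hj
      exact tree_ofLabels (by rw [List.getElem?_map, List.getD_eq_getElem?_getD, hg z hz]; rfl)

lemma forall₂_relabel {f : ℕ → ℕ} (h : ∀ i ∈ F.leaves, α'[f i]? = α[i]?)
    (hF : List.Forall₂ (fun l p => DPlus.IsPath α l p.1 p.2) F.legs β) :
    List.Forall₂ (fun l p => DPlus.IsPath α' l p.1 p.2) (F.relabel f).legs β := by
  rw [legs_relabel, List.forall₂_map_left_iff]
  refine ((List.forall₂_and_left _ _).2 ⟨fun l hl => hl, hF⟩).imp fun l p hp => hp.2.map fun i hi => ?_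
  exact h i (by rw [← flatten_legs]; exact List.mem_flatten.2 ⟨l, hp.1, hi⟩)

lemma compat_tree_append (hψ : IsMul ψ) {T r : Forest} {p : Λ × Λ} {f : ℕ → ℕ} (hw : T.width = 1)
    (hl : (T.append (r.relabel f)).leaves = List.range α.length)
    (hF : DPlus.IsCell α (p :: β) (T.append (r.relabel f)))
    (hT : ∀ α, T.leaves = List.range α.length → DPlus.IsCell α [p] T → Compat ψ α [p] T)
    (hr : ∀ f α, (r.relabel f).leaves = List.range α.length → DPlus.IsCell α β (r.relabel f) →
      Compat ψ α β (r.relabel f)) : Compat ψ α (p :: β) (T.append (r.relabel f)) := by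
  obtain ⟨-, h2, h3⟩ := hF
  have hT' : T.legs = [T.leaves] ∧ T.Stable ∧ (r.relabel f).Stable := by
    obtain ⟨j, rfl⟩ | ⟨c, rfl⟩ := width_eq_one hw
    · exact ⟨by simp [leaves], trivial, h3⟩
    · exact ⟨by simp [leaves], ⟨h3.1, trivial⟩, h3.2⟩
  rw [legs_append, hT'.1] at h2
  have hn := congrArg List.length hl
  rw [leaves_append, List.length_append, List.length_range] at hn
  obtain ⟨α₁, α₂, rfl, h1⟩ : ∃ α₁ α₂ : DPlus.Obj Λ, α = α₁ ++ α₂ ∧ α₁.length = T.leaves.length :=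
    ⟨_, _, (List.take_append_drop T.leaves.length α).symm, by simp; omega⟩
  rw [leaves_append, List.length_append, List.range_add] at hl
  obtain ⟨e1, e2⟩ := List.append_inj hl (by simp [h1])
  have hg : r.relabel f = (r.relabel fun i => f i - α₁.length).relabel (α₁.length + ·) := by
    rw [relabel_relabel]
    refine relabel_congr fun i hi => ?_
    have : f i ∈ (r.relabel f).leaves := by rw [leaves_relabel]; exact List.mem_map_of_mem hi
    rw [e2] at this
    obtain ⟨j, -, hj⟩ := List.mem_map.1 this
    omega
  have e3 : (r.relabel fun i => f i - α₁.length).leaves = List.range α₂.length := by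
    refine List.map_injective_iff.2 (add_right_injective α₁.length) ?_
    rw [← leaves_relabel, ← hg, e2]
  cases h2 with
  | cons hp h2 =>
    rw [hg]
    refine (hT α₁ e1 ⟨by rw [e1], hT'.1 ▸ .cons ?_ .nil, hT'.2.1⟩).append hψ (hr _ α₂ e3
      ⟨by rw [e3], ?_, ?_⟩)
    · rw [← List.map_id T.leaves]
      refine hp.map fun i hi => ?_
      rw [e1, List.mem_range] at hi
      exact (List.getElem?_append_left hi).symm
    · rw [← relabel_relabel f (· - α₁.length)]
      refine forall₂_relabel (fun i hi => ?_) h2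
      rw [e2] at hi
      obtain ⟨j, -, rfl⟩ := List.mem_map.1 hi
      rw [List.getElem?_append_right (Nat.le_add_right _ _)]
    · rw [← relabel_relabel f (· - α₁.length)]
      exact hT'.2.2.relabel _

/-- Compatibility for planar forests follows from compatibility for irreducible discs. -/
lemma compat_planar (hψ : IsMul ψ) (hc : ∀ (γ : DPlus.Obj Λ) (p : Λ × Λ),
      DPlus.IsCell γ [p] (cor γ.length) → Compat ψ γ [p] (cor γ.length)) (F : Forest) (f : ℕ → ℕ)
    {α β : DPlus.Obj Λ} (hl : (F.relabel f).leaves = List.range α.length)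
    (hF : DPlus.IsCell α β (F.relabel f)) : Compat ψ α β (F.relabel f) := by
  induction F generalizing f α β with
  | nil =>
    obtain rfl := List.length_eq_zero_iff.1 (List.range_eq_nil.1 hl.symm)
    cases hF.2.1
    exact compat_id ψ []
  | leaf i r ih =>
    obtain _ | ⟨p, β⟩ := β
    · cases hF.2.1
    refine compat_tree_append hψ (T := leaf (f i) nil) rfl hl hF (fun α hα hT => ?_)
      fun f α h h' => ih f h h'
    obtain ⟨q, rfl⟩ := List.length_eq_one_iff.1 (by simpa [leaves] using congrArg List.length hα.symm : α.length = 1)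
    have h0 : f i = 0 := by simpa [leaves] using hα
    have hp := hT.2.1
    rw [h0, legs_leaf] at hp
    cases hp with
    | cons hp _ =>
      obtain ⟨c, h1, h2⟩ := hp
      obtain rfl : c = p.2 := h2
      obtain rfl : q = p := Option.some.inj h1
      rw [h0]
      exact compat_id ψ [q]
  | node c r ihc ih =>
    obtain _ | ⟨p, β⟩ := β
    · cases hF.2.1
    refine compat_tree_append hψ (T := node (c.relabel f) nil) rfl hl hF (fun α hα hT => ?_)
      fun f α h h' => ih f h h'
    have hS := hT.2.2
    have hp := hT.2.1
    rw [legs_node, ← flatten_legs] at hp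
    cases hp with
    | cons hp _ =>
    obtain ⟨γ, hγ, hpγ⟩ := hp.exists_forall₂
    have hw : (c.relabel f).width = γ.length := by rw [← length_legs, hγ.length_eq]
    have hα' : (c.relabel f).leaves = List.range α.length := by simpa [leaves] using hα
    have hu := not_hasUnit_of_stable hS
    have hcS : (c.relabel f).Stable := hS.1.elim (fun h => h ▸ trivial) fun h => h.2.stable
    refine (ihc f hα' ⟨by rw [hα'], hγ, hcS⟩).subst (hc γ p (DPlus.isCell_cor hpγ ?_)) ?_
    · rw [← hw]
      rcases hS.1 with h | h
      · rw [h]; decide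
      · omega
    · rw [← hw, cor_subst, join_eq_some hu]

lemma compat_of_cor (hψ : IsMul ψ) (hc : ∀ (γ : DPlus.Obj Λ) (p : Λ × Λ),
      DPlus.IsCell γ [p] (cor γ.length) → Compat ψ γ [p] (cor γ.length))
    (hF : DPlus.IsCell α β F) : Compat ψ α β F := by
  have hn := hF.1.nodup_iff.2 List.nodup_range
  have hlen := hF.1.length_eq
  rw [List.length_range] at hlen
  have hg : ∀ z ∈ F.leaves, F.leaves[F.leaves.idxOf z]? = some z := fun z hz => by
    have := List.idxOf_lt_length_of_mem hz
    rw [List.getElem?_eq_getElem this, List.getElem_idxOf]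
  obtain _ | ⟨p₀, α⟩ := α
  · rw [List.length_nil, List.length_eq_zero_iff] at hlen
    have := compat_planar hψ hc F (fun i => i) (α := []) (β := β)
    rw [relabel_id] at this
    exact this hlen hF
  let κ : ℕ → Λ × Λ := fun i => (p₀ :: α).getD i p₀
  have h1 := compat_perm hψ κ hF.1.symm List.nodup_range
  have e : (List.range (p₀ :: α).length).map κ = p₀ :: α := by
    refine List.ext_getElem (by simp) fun i h1 h2 => ?_
    rw [List.getElem_map, List.getElem_range]
    exact List.getD_eq_getElem _ _ h2
  rw [e] at h1
  have hl : (F.relabel F.leaves.idxOf).leaves = List.range (F.leaves.map κ).length := by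
    rw [leaves_relabel, hn.map_idxOf_self, List.length_map]
  refine h1.subst (compat_planar hψ hc F F.leaves.idxOf hl ⟨by rw [hl], forall₂_relabel (fun i hi => ?_) hF.2.1, hF.2.2.relabel _⟩) ?_
  · have h' : i < (p₀ :: α).length := List.mem_range.1 (hF.1.subset hi)
    rw [List.getElem?_map, hg i hi, List.getElem?_eq_getElem h']
    exact congrArg some (List.getD_eq_getElem _ _ h')
  · rw [subst_leaf (g := fun j => F.leaves.getD j 0) (hF.2.2.relabel _) fun j hj => ?_,
      relabel_relabel, relabel_congr (g := fun i => i) fun i hi => ?_, relabel_id]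
    · rw [List.getD_eq_getElem?_getD, hg i hi]; rfl
    · rw [leaves_relabel, List.mem_map] at hj
      obtain ⟨z, hz, rfl⟩ := hj
      refine tree_ofLabels ?_
      have h' : z < (List.range (p₀ :: α).length).length := by
        rw [List.length_range]; exact List.mem_range.1 (hF.1.subset hz)
      have := List.nodup_range.idxOf_getElem z h'
      rw [List.getElem_range] at this
      rw [List.getElem?_map, List.getD_eq_getElem?_getD, hg z hz]
      exact congrArg some this

end ExtAInfCat

namespace ExtAInfCat

open Chain Forest AInfCat

lemma mu_toAInf {Φ : ExtAInfCat.{u,v,w} K Λ} {k : ChainOf Φ.hom a b} {n : ℕ}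
    (hk : k.length = n) (h : n ≠ 1) : Φ.toAInf.mu k = eact (cor n) [(a, b)] (celt k) := by
  subst hk
  cases k with
  | nil => rfl
  | cons x l => exact op_eq rfl (by rw [length] at h ⊢; omega)

lemma map_celt {X Y : ExtAInfCat.{u,v,w} K Λ} {ψ : ∀ α, Cx.Hom (X.obj α) (Y.obj α)}
    (hψ : ∀ {α β} (v : (X.obj α).X) (w : (X.obj β).X),
      (ψ (α ++ β)).f (X.mul v w) = Y.mul ((ψ α).f v) ((ψ β).f w))
    (h1 : (ψ []).f X.unit = Y.unit) (k : ChainOf X.hom a b) :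
    celt (k.map fun a b => (ψ [(a, b)]).f) = ⟨(celt k).1, (ψ _).f (celt k).2⟩ := by
  induction k with
  | nil => exact Sigma.ext rfl (heq_of_eq h1.symm)
  | cons x k ih =>
    rw [Chain.map, celt, ih]
    exact Sigma.ext rfl (heq_of_eq (hψ _ _).symm)

variable (Φ : ExtAInfCat.{u,v,w} K Λ)

def mulHom [CharZero K] (α β : DPlus.Obj Λ) :
    Cx.Hom ((Φ.obj α).tensor (Φ.obj β)) (Φ.obj (α ++ β)) where
  f := TensorProduct.lift Φ.mul
  map_mem {n _} hx := Cx.tensorGrade_le (S := ((Φ.obj (α ++ β)).grade n).comap (TensorProduct.lift Φ.mul))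
    (fun i j hij x hx t ht => by
      rw [Submodule.mem_comap, TensorProduct.lift.tmul, ← hij]; exact Φ.mul_mem hx ht) hx
  map_d := LinearMap.congr_fun (f := TensorProduct.lift Φ.mul ∘ₗ ((Φ.obj α).tensor (Φ.obj β)).d)
    (g := (Φ.obj (α ++ β)).d ∘ₗ TensorProduct.lift Φ.mul)
    (TensorProduct.ext' fun x y => (Φ.d_mul x y).symm)

end ExtAInfCat

namespace AInfCat

open Chain Forest ExtAInfCat

variable [CharZero K]

section Lift

variable {M : Λ → Λ → Cx.{u,max u w} K} {Φ : ExtAInfCat.{u,v,max u w} K Λ}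

/-- The extension of maps on morphism complexes to iterated tensor products. -/
def liftHom (f : ∀ a b, Cx.Hom (M a b) (Φ.hom a b)) :
    ∀ α, Cx.Hom (tens.{u,v,w} M α) (Φ.obj α)
  | [] => ⟨nlift Φ.unit, fun hx => tens_grade_le (S := (((Φ.obj []).grade _).comap (nlift Φ.unit)))
      (fun l ε _ h => by
        cases l
        obtain rfl : 0 = _ := h
        rw [Submodule.mem_comap, Tup.prod, nlift_tunit]; exact Φ.unit_mem) hx,
      fun x => by rw [tens_nil x, map_smul, map_smul, map_smul, map_smul, nlift_tunit, Φ.d_unit, d_tunit, map_zero]⟩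
  | p :: α => (Φ.mulHom [p] α).comp ((f p.1 p.2).tensor (liftHom f α))

lemma liftHom_tcons (f : ∀ a b, Cx.Hom (M a b) (Φ.hom a b)) {p : Λ × Λ} {α : DPlus.Obj Λ} (x t) :
    (liftHom f (p :: α)).f (tcons x t) =
      Φ.mul (α := [p]) ((f p.1 p.2).f x) ((liftHom f α).f t) := rfl

lemma isQuasiIso_liftHom {f : ∀ a b, Cx.Hom (M a b) (Φ.hom a b)}
    (hf : ∀ a b, (f a b).IsQuasiIso) (α : DPlus.Obj Λ) : (liftHom.{u,v,w} f α).IsQuasiIso := by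
  induction α with
  | nil =>
    exact HomologyBijective.comp Φ.hsplit_unit (HomologyBijective.of_bijective (f :=
      (ULift.moduleEquiv.{u, u, w} (R := K) (M := K)).toLinearMap) (fun _ => rfl) (ULift.moduleEquiv.{u, u, w} (R := K) (M := K)).bijective) (fun _ => rfl) fun x => by
        simp [Φ.d_unit]
  | cons p α ih => exact Cx.Hom.IsQuasiIso.comp (g := Φ.mulHom [p] α) (Φ.hsplit_mul [p] α) ((hf p.1 p.2).tensor ih)

lemma liftHom_tmul (f : ∀ a b, Cx.Hom (M a b) (Φ.hom a b)) {α β : DPlus.Obj Λ}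
    (x : (tens.{u,v,w} M α).X) (y : (tens.{u,v,w} M β).X) : (liftHom f (α ++ β)).f (tmul x y) =
      Φ.mul ((liftHom f α).f x) ((liftHom f β).f y) := by
  induction α with
  | nil =>
    have : LinearMap.comp (liftHom f ([] ++ β)).f (tmul.flip y) =
        (Φ.mul.flip ((liftHom f β).f y)).comp (liftHom.{u,v,w} f []).f := by
      refine tens_nil_ext ?_
      refine (congrArg _ (tmul_tunit y)).trans ((Φ.unit_mul _).symm.trans
        (congrArg (fun z => Φ.mul z _) (nlift_tunit Φ.unit).symm))
    exact LinearMap.congr_fun this x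
  | cons p α ih =>
    refine tens_induction (P := fun x => (liftHom f (p :: α ++ β)).f (tmul x y) =
      Φ.mul ((liftHom f (p :: α)).f x) ((liftHom f β).f y)) (fun x t => ?_)
      (fun x x' h h' => ?_) x
    · rw [tmul_tcons]
      refine (liftHom_tcons f x (tmul t y)).trans ?_
      rw [ih, liftHom_tcons]
      exact (eq_of_heq (Φ.mul_assoc (α := [p]) (β := α) _ _ _)).symm
    · simp only [map_add, LinearMap.add_apply, h, h']

end Lift

variable {A : AInfCat.{u,v,max u w} K Λ} {Φ : ExtAInfCat.{u,v,max u w} K Λ}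

lemma isMul_liftHom (f : ∀ a b, Cx.Hom (A.Hom a b) (Φ.hom a b)) :
    IsMul (X := toExt.{u,v,w} A) (liftHom f) where
  span α β := (bijective_lift_tmul α β).2
  map_mul := liftHom_tmul f

def incl (A : AInfCat.{u,v,max u w} K Λ) (a b : Λ) :
    Cx.Hom (A.Hom a b) (tens.{u,v,w} A.Hom [(a, b)]) where
  f := (tcons (p := (a, b))).flip tunit
  map_mem {n x} hx := by
    have := tcons_mem (p := (a, b)) hx tunit_mem
    rwa [add_zero] at this
  map_d x := by
    have := d_tcons (p := (a, b)) x (tunit : (tens.{u,v,w} A.Hom []).X)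
    rw [d_tunit, map_zero, add_zero] at this
    exact this.symm

lemma isQuasiIso_incl (a b : Λ) : (incl.{u,v,w} A a b).IsQuasiIso :=
  HomologyBijective.of_bijective (incl A a b).map_d
    ⟨Function.LeftInverse.injective (g := tlift (p := (a, b)) (LinearMap.mk₂ K
      (fun x (t : ULift.{w} K) => t.down • x) (fun _ _ _ => smul_add _ _ _)
      (fun _ _ _ => smul_comm _ _ _) (fun _ _ _ => add_smul _ _ _) fun _ _ _ => mul_smul _ _ _))
      fun x => by
        refine (tlift_tcons (p := (a, b)) _ x tunit).trans ?_
        exact one_smul K x, fun z =>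
    tens_induction (P := fun z => ∃ x, (incl A a b).f x = z)
      (fun x t => ⟨t.down • x, (map_smul _ _ _).trans
        ((map_smul (tcons x) t.down tunit).symm.trans (congrArg _ (tens_nil t).symm))⟩)
      (fun x x' ⟨y, h⟩ ⟨y', h'⟩ => ⟨y + y', by rw [map_add, h, h']⟩) z⟩

end AInfCat

namespace AInfCat

open Chain Forest ExtAInfCat

section Path

variable {A : AInfCat.{u,v,w} K Λ}

/-- The pairs of objects of the entries of a sequence. -/
def path : ∀ {a b : Λ}, χ[A] a b → DPlus.Obj Λ
  | _, _, .nil _ => []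
  | _, _, @Chain.cons _ _ a b _ _ k => (a, b) :: path k

def tup : ∀ {a b : Λ} (k : χ[A] a b), Tup A.Hom (path k)
  | _, _, .nil _ => .nil
  | _, _, @Chain.cons _ _ a b _ x k => .cons (p := (a, b)) x (tup k)

lemma length_path (k : χ[A] a b) : (path k).length = k.length := by
  induction k <;> grind [path, List.length_cons, length, add_comm]

lemma hasDeg_tup {k : χ[A] a b} {n : ℤ} (hk : k.Homogeneous n) :
    ∃ ε, (tup k).HasDeg ε := by
  induction k generalizing n with
  | nil => exact ⟨0, trivial⟩
  | cons x k ih =>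
    obtain ⟨p, q, hx, hk, -⟩ := hk
    obtain ⟨ε, h⟩ := ih hk
    exact ⟨fun i => Nat.casesOn i p ε, hx, h⟩

lemma eval_tup {M : Type*} [Zero M] (k : χ[A] a b) {η : A.Inputs} {o : ℕ}
    (h : ∀ i, η (o + i) = (tup k).entries i) (Ψ : ∀ b, χ[A] a b → M) :
    eval η (ofLabels (List.range' o k.length)) a Ψ = Ψ b k := by
  induction k generalizing o with
  | nil => rfl
  | cons x k ih =>
    rw [length, List.range'_succ, ofLabels, eval, show η o = _ from h 0]
    refine (look_some _ _).trans (ih (fun i => ?_) _)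
    rw [add_assoc, add_comm 1 i]
    exact h (i + 1)

lemma isPath_shift {p : Λ × Λ} {α : DPlus.Obj Λ} {l : List ℕ}
    (h : DPlus.IsPath (p :: α) (l.map Nat.succ) a b) : DPlus.IsPath α l a b := by
  induction l generalizing a with
  | nil => exact h
  | cons i l ih => obtain ⟨c, h1, h2⟩ := h; exact ⟨c, h1, ih h2⟩

lemma exists_tup {α : DPlus.Obj Λ} (l : Tup A.Hom α)
    (h : DPlus.IsPath α (List.range α.length) a b) :
    ∃ k : χ[A] a b, (⟨path k, tup k⟩ : Σ α, Tup A.Hom α) = ⟨α, l⟩ := by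
  induction l generalizing a with
  | nil => obtain rfl : a = b := h; exact ⟨nil a, rfl⟩
  | @cons p α x l ih =>
    rw [List.length_cons, List.range_succ_eq_map] at h
    obtain ⟨c, h1, h2⟩ := h
    obtain rfl : p = (a, c) := Option.some.inj h1
    obtain ⟨k, hk⟩ := ih (isPath_shift h2)
    refine ⟨cons x k, ?_⟩
    exact congrArg (fun s : Σ α, Tup A.Hom α => (⟨(a, c) :: s.1, .cons (p := (a, c)) x s.2⟩ : Σ α, Tup A.Hom α)) hk

end Path

variable [CharZero K] {A B : AInfCat.{u,v,max u w} K Λ} {Φ : ExtAInfCat.{u,v,max u w} K Λ}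

def inclChain (k : χ[A] a b) : ChainOf (toExt.{u,v,w} A).hom a b :=
  k.map fun a b => (incl A a b).f

lemma length_inclChain (k : χ[A] a b) :
    (inclChain.{u,v,w} k).length = k.length := length_map _ k

lemma celt_incl (k : χ[A] a b) :
    celt (inclChain k) =
      ⟨path k, ((tup k).prod : (tens.{u,v,w} A.Hom _).X)⟩ := by
  induction k with
  | nil => rfl
  | @cons a c b x k ih =>
    refine (congrArg (emul _) ih).trans (Sigma.ext rfl (heq_of_eq ?_))
    exact (tmul_tcons (p := (a, c)) x tunit _).trans (congrArg _ (tmul_tunit _))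

lemma mu_incl (k : χ[A] a b) :
    (toExt.{u,v,w} A).toAInf.mu (inclChain k) = (incl A a b).f (A.mu k) := by
  refine SlotLinear.ext_homogeneous
    (Ψ := fun k => (toExt.{u,v,w} A).toAInf.mu (inclChain k))
    ((slotLinear_mu a b).map _) ((slotLinear_mu a b).comp _) (fun k n hk => ?_) k
  by_cases h : k.length = 1
  · match k, h with
    | .cons x (.nil _), _ =>
      refine ((toExt A).toAInf.m_single _).trans ?_
      exact ((incl A _ _).map_d x).symm.trans (congrArg _ (A.m_single x).symm)
    | .cons _ (.cons _ _), h => simp [length] at h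
  · refine (mu_toAInf (length_inclChain k) h).trans ?_
    have hc := isCell_cor (length_inclChain.{u,v,w} k) h
    rw [celt_incl] at hc ⊢
    obtain ⟨ε, hε⟩ := hasDeg_tup hk
    refine (congrArg (fun f : (tens.{u,v,w} A.Hom _).X →ₗ[K] (tens.{u,v,w} A.Hom _).X =>
      f (tup k).prod) (dif_pos hc)).trans ((tensAct_prod hc hε).trans ?_)
    have hsg : (cor k.length).sg π[ε] = 0 := by
      rw [sg, cor, shuf, deg, Nat.cast_zero, mul_zero, shuf_ofLabels, shuf, leaves, leaves_ofLabels,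
        leaves, List.append_nil, inv_of_pairwise List.pairwise_lt_range]
      rfl
    rw [hsg, zsign_zero, one_smul]
    have hev : treeEval (tup k).entries (cor k.length) (a, b) = A.mu k := by
      rw [treeEval, cor, eval, List.range_eq_range',
        eval_tup k (η := (tup k).entries) fun i => congrArg _ (Nat.zero_add i)]
      exact extract_single (A.mu k)
    refine (congrArg (Tup.prod (M := A.Hom)) (evTup_append (T := cor k.length) rfl .nil (a, b))).trans ?_
    rw [hev]
    rfl

variable (A) in
/-- The inclusion into the extended A-infinity category. -/
def unitMor : A ⟶ (toExt.{u,v,w} A).toAInf where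
  φ := incl A
  map_m k := by
    cases k with
    | nil =>
      refine (congrArg _ (A.m_nil _)).trans ?_
      rw [map_zero]
      exact ((toExt.{u,v,w} A).toAInf.m_nil _).symm
    | cons x k => exact (mu_incl (cons x k)).symm
  map_one a := (mu_incl (nil a)).symm

lemma map_mu {A B : AInfCat.{u,v,w} K Λ} (f : Mor A B) (k : χ[A] a b) :
    (f.φ a b).f (A.mu k) = B.mu (k.map fun a b => (f.φ a b).f) := by
  cases k with
  | nil => exact f.map_one _
  | cons x k => exact f.map_m _

lemma liftHom_incl (f : ∀ a b, Cx.Hom (A.Hom a b) (Φ.hom a b)) (x : (A.Hom a b).X) :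
    (liftHom f [(a, b)]).f ((incl A a b).f x) = (f a b).f x :=
  (congrArg (Φ.mul (α := [(a, b)]) _) (nlift_tunit Φ.unit)).trans
    (eq_of_heq (Φ.mul_unit (α := [(a, b)]) _))

lemma compat_liftHom (f : Mor A Φ.toAInf) {γ : DPlus.Obj Λ} {p : Λ × Λ}
    (hc : DPlus.IsCell γ [p] (cor γ.length)) :
    Compat (X := toExt.{u,v,w} A) (liftHom f.φ) γ [p] (cor γ.length) := by
  refine ⟨hc, LinearMap.congr_fun (f := (liftHom f.φ [p]).f ∘ₗ (toExt.{u,v,w} A).cact _ γ [p])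
    (g := Φ.cact (cor γ.length) γ [p] ∘ₗ (liftHom.{u,v,w} f.φ γ).f)
    (tens_hom_ext fun l ε _ => ?_)⟩
  obtain ⟨a, b⟩ := p
  have hp : DPlus.IsPath γ (List.range γ.length) a b := by
    have := hc.2.1
    rw [cor, legs, roots, List.map_cons, leaves, leaves_ofLabels, leaves, List.append_nil] at this
    exact (List.forall₂_cons.1 this).1
  have hl : γ.length ≠ 1 := fun h => by
    have := hc.2.2.1
    rw [h] at this
    rcases this with h | h
    · cases h
    · exact absurd h.1 (by decide)
  obtain ⟨k, hk⟩ := exists_tup l hp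
  cases hk
  have hn := (length_path k).symm
  have h1 := (mu_toAInf ((length_inclChain.{u,v,w} k).trans hn) hl).symm.trans (mu_incl k)
  rw [celt_incl] at h1
  have h2 := (map_mu f k).trans (mu_toAInf ((length_map _ k).trans hn) hl)
  have h3 := map_celt (ψ := liftHom f.φ) (liftHom_tmul f.φ) (nlift_tunit Φ.unit) (inclChain k)
  rw [celt_incl] at h3
  have h4 : (inclChain k).map (fun a b => (liftHom f.φ [(a, b)]).f) = k.map fun a b => (f.φ a b).f :=
    (chain_map_map _ _ k).trans (congrArg (fun g => Chain.map g k)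
      (funext fun a => funext fun b => funext fun x => liftHom_incl f.φ x))
  refine (congrArg _ h1).trans ((liftHom_incl f.φ _).trans (h2.trans ?_))
  exact congrArg (eact (cor (path k).length) [(a, b)]) ((congrArg celt h4).symm.trans h3)

variable (Φ) in
/-- The extension of a morphism to iterated tensor products. -/
def lift (f : A ⟶ Φ.toAInf) : toExt.{u,v,w} A ⟶ Φ where
  φ := liftHom (Mor.φ f)
  map_act {α β} g v := by
    induction g using Finsupp.induction_linear with
    | zero => rw [map_zero, map_zero]; exact map_zero _
    | add g g' h h' => simp only [map_add, LinearMap.add_apply, h, h']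
    | single x z =>
      have := (compat_of_cor (isMul_liftHom (Mor.φ f)) (fun _ _ => compat_liftHom f) x.2).2 v
      rw [cact_eq, cact_eq] at this
      rw [show (Finsupp.single x z : DPlus.Hom K α β) = z • DPlus.of K x by simp [DPlus.of]]
      simp only [map_smul, LinearMap.smul_apply, this]
  map_mul := liftHom_tmul _
  map_unit := nlift_tunit _

end AInfCat

open Chain Forest ExtAInfCat AInfCat

/-- The A-infinity category of an extended A-infinity category, as a functor. -/
def ExtAInfCat.toAInfFunctor (K : Type u) [Field K] (Λ : Type v) :
    ExtAInfCat.{u,v,w} K Λ ⥤ AInfCat.{u,v,w} K Λ where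
  obj := toAInf
  map {X Y} g :=
    have h {a b : Λ} (k : ChainOf X.hom a b) {n : ℕ} (hk : k.length = n) (hn : n ≠ 1) :
        (g.φ [(a, b)]).f (X.toAInf.mu k) =
          Y.toAInf.mu (k.map fun a b => (g.φ [(a, b)]).f) := by
      have hc := isCell_cor hk hn
      refine (congrArg _ (mu_toAInf hk hn)).trans
        (Eq.trans ?_ (mu_toAInf ((length_map _ k).trans hk) hn).symm)
      refine Eq.trans ?_ (congrArg (eact (cor n) [(a, b)]) (map_celt g.map_mul g.map_unit k)).symm
      obtain ⟨x, hx⟩ : ∃ x : DPlus.Cell (celt k).1 [(a, b)], x.1 = cor n := ⟨⟨_, hc⟩, rfl⟩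
      have h1 := g.map_act (DPlus.of K x) (celt k).2
      rw [← cact_eq, ← cact_eq, hx] at h1
      exact h1
    { φ := fun a b => g.φ [(a, b)]
      map_m := fun k => by
        match k with
        | .nil _ => exact (congrArg _ (X.toAInf.m_nil _)).trans ((map_zero _).trans (Y.toAInf.m_nil _).symm)
        | .cons x (.nil _) => exact (g.φ _).map_d x
        | .cons x (.cons y k) => exact h (.cons x (.cons y k)) rfl (by simp [length])
      map_one := fun a => h (.nil a) rfl (by simp [length]) }
  map_id _ := rfl
  map_comp _ _ := rfl

variable [CharZero K]

lemma AInfCat.unitMor_lift {A : AInfCat.{u,v,max u w} K Λ} {Φ : ExtAInfCat.{u,v,max u w} K Λ}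
    (f : A ⟶ Φ.toAInf) : unitMor.{u,v,w} A ≫ (toAInfFunctor K Λ).map (lift Φ f) = f :=
  Mor.ext (funext fun _ => funext fun _ => Cx.Hom.ext (LinearMap.ext fun x => liftHom_incl (Mor.φ f) x))

lemma AInfCat.hom_ext_toExt {A : AInfCat.{u,v,max u w} K Λ} {Φ : ExtAInfCat.{u,v,max u w} K Λ}
    {g h : toExt.{u,v,w} A ⟶ Φ}
    (H : unitMor.{u,v,w} A ≫ (toAInfFunctor K Λ).map g = unitMor A ≫ (toAInfFunctor K Λ).map h) :
    g = h := by
  refine ExtAInfCat.Mor.ext (funext fun α => Cx.Hom.ext ?_)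
  induction α with
  | nil => exact tens_nil_ext (M := A.Hom) ((ExtAInfCat.Mor.map_unit g).trans (ExtAInfCat.Mor.map_unit h).symm)
  | cons p α ih =>
    refine tens_cons_ext fun x t => ?_
    have e : (tcons x t : (tens.{u,v,w} A.Hom (p :: α)).X) = tmul (tcons x tunit) t :=
      ((tmul_tcons x tunit t).trans (congrArg _ (tmul_tunit t))).symm
    rw [e]
    refine (ExtAInfCat.Mor.map_mul g (α := [p]) (β := α) _ _).trans
      (Eq.trans ?_ (ExtAInfCat.Mor.map_mul h (α := [p]) (β := α) _ _).symm)
    refine congrArg₂ (fun y z => Φ.mul (α := [p]) y z) ?_ (LinearMap.congr_fun ih t)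
    exact congrArg (fun F : AInfCat.Mor A Φ.toAInf => (F.φ p.1 p.2).f x) H

variable (K Λ)

def AInfCat.toExtFunctor :
    AInfCat.{u,v,max u v w} K Λ ⥤ ExtAInfCat.{u,v,max u v w} K Λ :=
  Adjunction.leftAdjointOfEquiv (G := toAInfFunctor K Λ) (F_obj := toExt.{u,v,max v w})
    (fun A Φ => ⟨fun g => unitMor.{u,v,max v w} A ≫ (toAInfFunctor K Λ).map g, lift Φ,
      fun _ => hom_ext_toExt (unitMor_lift _), unitMor_lift⟩)
    (fun _ _ _ _ _ => rfl)

/-- Iterated tensor products are left adjoint to the restriction to morphism complexes. -/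
def extAdjunction :
    toExtFunctor.{u,v,w} K Λ ⊣ toAInfFunctor.{u,v,max u v w} K Λ :=
  Adjunction.adjunctionOfEquivLeft _ _

lemma quasiEquivalent_ext_aInf :
    QuasiEquivalent (ExtAInfCat.quasiIso.{u,v,max u v w} K Λ)
      (AInfCat.quasiIso.{u,v,max u v w} K Λ) := by
  have hG : IsExact (ExtAInfCat.quasiIso.{u,v,max u v w} K Λ)
    (AInfCat.quasiIso.{u,v,max u v w} K Λ) (toAInfFunctor K Λ) := fun X Y g hg a b => hg [(a, b)]
  have hF : IsExact (AInfCat.quasiIso.{u,v,max u v w} K Λ)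
      (ExtAInfCat.quasiIso.{u,v,max u v w} K Λ) (toExtFunctor.{u,v,w} K Λ) := fun A B f hf α =>
    isQuasiIso_liftHom.{u,v,max v w} (M := A.Hom) (Φ := toExt.{u,v,max v w} B)
      (f := fun a b => (incl.{u,v,max v w} B a b).comp (AInfCat.Mor.φ f a b))
      (fun a b => (isQuasiIso_incl.{u,v,max v w} a b).comp (hf a b)) α
  refine ⟨toAInfFunctor K Λ, toExtFunctor.{u,v,w} K Λ, hG, hF, ?_, ?_⟩
  · exact .symm _ _ (.rel _ _ ⟨isExact_id _, hF.comp hG, (extAdjunction.{u,v,w} K Λ).unit,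
      fun A a b => isQuasiIso_incl.{u,v,max v w} a b⟩)
  · exact .rel _ _ ⟨hG.comp hF, isExact_id _, (extAdjunction.{u,v,w} K Λ).counit,
      fun Φ α => isQuasiIso_liftHom.{u,v,max v w} (f := fun a b => Cx.Hom.id (Φ.hom a b))
        (fun a b => HomologyBijective.of_bijective (fun _ => rfl) Function.bijective_id) α⟩

theorem mainTheorem8 (K : Type u) [Field K] [CharZero K] (Λ : Type v) :
    QuasiEquivalent (ExtAInfCat.quasiIso.{u,v,max u v w} K Λ)
        (AInfCat.quasiIso.{u,v,max u v w} K Λ) ∧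
      QuasiEquivalent (AInfCat.quasiIso.{u,v,max u v w} K Λ)
        (DGCat.quasiIso.{u,v,max u v w} K Λ) ∧
      QuasiEquivalent (ExtAInfCat.quasiIso.{u,v,max u v w} K Λ)
        (DGCat.quasiIso.{u,v,max u v w} K Λ) ∧
      ∃ R : AInfCat.{u,v,max u v w} K Λ ⥤ DGCat.{u,v,max u v w} K Λ,
        IsQuasiEquivalence (DGCat.quasiIso K Λ) (AInfCat.quasiIso K Λ)
          (DGCat.inclusion K Λ) R := by
  have h1 := quasiEquivalent_ext_aInf.{u,v,w} K Λ
  have h2 := isQuasiEquivalence_inclusion_envelope.{u,v,w} K Λ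
  have h3 : QuasiEquivalent (AInfCat.quasiIso.{u,v,max u v w} K Λ)
      (DGCat.quasiIso.{u,v,max u v w} K Λ) := QuasiEquivalent.symm ⟨_, _, h2⟩
  exact ⟨h1, h3, h1.trans h3, _, h2⟩
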